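/- **Setting.** Let $y_1\neq y_2$ be points of $\mathbb R^3$, $r_A=|x-y_A|$, $r_{12}=|y_1-y_2|$, $\alpha_1,\alpha_2>0$. Put $g=\ln(r_1+r_2+r_{12})$ and let $s_{ij}$ be the symmetric trace-free part of $\partial^2 g/\partial y_1^i\partial y_2^j$. For the conformal metric $\tilde\gamma_{ij}=\delta_{ij}+\beta s_{ij}$, consider the solution of the time-symmetric vacuum constraint $\tilde\Delta\Psi=\frac18\tilde R\,\Psi$ as a power series in $\beta$, $\Psi=\sigma_{(0)}+\beta\sigma_{(1)}+\beta^2\sigma_{(2)}+\cdots$, where $\sigma_{(0)}=1+\alpha_1/r_1+\alpha_2/r_2$ is the Brill–Lindquist factor and, for $n=1,2$, $\sigma_{(n)}$ is smooth off $y_1,y_2$, locally integrable, tends to $0$ at infinity and satisfies $\Delta\sigma_{(n)}=\Sigma_{(n)}$ in the sense of distributions on $\mathbb R^3$. Here $\Sigma_{(n)}$ is minus the coefficient of $\beta^n$ in $(\tilde\Delta-\frac18\tilde R)\sum_{k<n}\beta^k\sigma_{(k)}$, taken as a distribution by the Hadamard finite part at $y_1,y_2$. Let $\gamma_{ij}=\Psi^4\tilde\gamma_{ij}$.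 *Masses.* The ADM mass is $$M=\frac{c^2}{16\pi G}\lim_{r\to\infty}\int dS^i\,(\partial_j\gamma_{ij}-\partial_i\gamma_{jj}),$$ computed coefficient by coefficient in $\beta$ up to and including $\beta^2$. For each hole $A$, let $\zeta_A(\mathbf n)=\lim_{r_A\to0}r_A\Psi(y_A+r_A\mathbf n)$ and use the inverted coordinates $\rho\,\mathbf n\mapsto y_A+\frac{\zeta_A(\mathbf n)^2}{\rho}\mathbf n$; with $\Gamma_{ij}$ the metric in these coordinates, the mass $m_A$ is the same surface integral with $\Gamma_{ij}$ in place of $\gamma_{ij}$, in the limit $\rho\to\infty$, computed coefficient by coefficient in $\beta$ up to and including $\beta^1$ (higher orders in $\beta$ are discarded). **Theorem 3.** (a) All these limits exist and are finite: $M$ up to and including order $\beta^2$, and $m_1,m_2$ up to and including order $\beta$. (b) Fix $G>0$, masses $m_1,m_2>0$ and points $Y_1\ne Y_2$ of $\mathbb R^3$, with $R=|Y_1-Y_2|$. For large $c$, let $\beta=-8G^2m_1m_2/c^4$; let $y_A=y_A(c)\to Y_A$ be the positions whose images in harmonic coordinates are $Y_A$, that is $y_A+\xi(y_A)=Y_A+O(c^{-6})$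 as $c\to\infty$, where $$\xi^i(x)=\frac{G^2m_1^2}{4c^4}\frac{x^i-y_1^i}{r_1^2}+\frac{G^2m_2^2}{4c^4}\frac{x^i-y_2^i}{r_2^2}$$ and $\xi(y_A)$ denotes its Hadamard finite part at $y_A$; and let $\alpha_A=\alpha_A(c)>0$ be such that the individual masses, computed as above to linear order in $\beta$, are $m_1$ and $m_2$. Then, with $M$ computed as above to second order in $\beta$, the energy $E=c^2(M-m_1-m_2)$ satisfies, as $c\to\infty$, $$E=-\frac{Gm_1m_2}{R}+\frac{G^2m_1m_2(m_1+m_2)}{2R^2c^2}-\frac{G^3m_1m_2(2m_1^2+19m_1m_2+2m_2^2)}{4R^3c^4}+O(c^{-6}),$$ which is the known second post-Newtonian energy of two bodies at rest, in harmonic coordinates. -/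

import Mathlib

open Filter Topology MeasureTheory Asymptotics Metric

noncomputable section

namespace Geometrostatics

/-- Euclidean three-space with its Cartesian coordinates. -/
abbrev E3 : Type := EuclideanSpace ℝ (Fin 3)

/-- A field of symmetric 2-tensors (a metric, say), by its components in Cartesian coordinates. -/
abbrev TensorField : Type := E3 → Matrix (Fin 3) (Fin 3) ℝ

/-- The partial derivative `∂ᵢ f` at `x`. -/
def pd (i : Fin 3) (f : E3 → ℝ) (x : E3) : ℝ :=
  fderiv ℝ f x (EuclideanSpace.single i 1)

/-- The coefficient of `β ^ n` in the Taylor expansion of `f` at `β = 0`. -/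
def betaCoeff (n : ℕ) (f : ℝ → ℝ) : ℝ :=
  iteratedDeriv n f 0 / (n.factorial : ℝ)

/-- The partial sum `∑_{k ≤ N} β ^ k u_k` of a power series in `β`. -/
def partialSum (N : ℕ) (β : ℝ) (u : ℕ → ℝ) : ℝ :=
  ∑ k ∈ Finset.range (N + 1), β ^ k * u k

/-! ### Riemannian geometry in coordinates -/

/-- Christoffel symbols `Γᵏᵢⱼ` of the metric `h`. -/
def christoffel (h : TensorField) (k i j : Fin 3) (x : E3) : ℝ :=
  (1 / 2) * ∑ l, (h x)⁻¹ k l *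
    (pd i (fun z => h z j l) x + pd j (fun z => h z i l) x - pd l (fun z => h z i j) x)

/-- Ricci tensor of the metric `h`. -/
def ricci (h : TensorField) (i j : Fin 3) (x : E3) : ℝ :=
  ∑ k, (pd k (christoffel h k i j) x - pd j (christoffel h k i k) x
    + ∑ l, (christoffel h k k l x * christoffel h l i j x
      - christoffel h k j l x * christoffel h l i k x))

/-- Scalar curvature of the metric `h`. -/
def scalarCurvature (h : TensorField) (x : E3) : ℝ :=
  ∑ i, ∑ j, (h x)⁻¹ i j * ricci h i j x

/-- Laplace–Beltrami operator of the metric `h`. -/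
def laplaceBeltrami (h : TensorField) (u : E3 → ℝ) (x : E3) : ℝ :=
  ∑ i, ∑ j, (h x)⁻¹ i j * (pd i (pd j u) x - ∑ k, christoffel h k i j x * pd k u x)

/-- The time-symmetric constraint operator; `constraintOp h Ψ = 0` is the vacuum Hamiltonian
constraint for the metric `Ψ⁴ h`. -/
def constraintOp (h : TensorField) (u : E3 → ℝ) (x : E3) : ℝ :=
  laplaceBeltrami h u x - u x / 8 * scalarCurvature h x

/-! ### The conformal metric and the perturbation of the Brill–Lindquist conformal factor -/

/-- The kernel `g = ln (r₁ + r₂ + r₁₂)`. -/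
def kernel (x a b : E3) : ℝ := Real.log (dist x a + dist x b + dist a b)

/-- `∂² g / ∂y₁ⁱ ∂y₂ʲ`. -/
def kernelHess (y₁ y₂ x : E3) (i j : Fin 3) : ℝ :=
  pd i (fun a => pd j (fun b => kernel x a b) y₂) y₁

/-- The seed `s_{ij}`: the symmetric trace-free part of `∂² g / ∂y₁ⁱ ∂y₂ʲ`. -/
def seed (y₁ y₂ : E3) : TensorField := fun x => Matrix.of fun i j =>
  (kernelHess y₁ y₂ x i j + kernelHess y₁ y₂ x j i) / 2
    - (if i = j then (∑ k, kernelHess y₁ y₂ x k k) / 3 else 0)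

/-- The conformal metric `δ_{ij} + β s_{ij}`. -/
def conformalMetric (y₁ y₂ : E3) (β : ℝ) : TensorField := fun x => 1 + β • seed y₁ y₂ x

/-- The Brill–Lindquist conformal factor `1 + α₁ / r₁ + α₂ / r₂`. -/
def brillLindquist (y₁ y₂ : E3) (α₁ α₂ : ℝ) (x : E3) : ℝ :=
  1 + α₁ / dist x y₁ + α₂ / dist x y₂

/-- The source `Σ₍ₙ₊₁₎` of the equation `Δ σ₍ₙ₊₁₎ = Σ₍ₙ₊₁₎`: minus the coefficient of `β ^ (n + 1)`
in the constraint operator of `δ + β s` applied to `σ₀ + β σ₁ + ⋯ + β ^ n σₙ`. -/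
def source (y₁ y₂ : E3) (σ : ℕ → E3 → ℝ) (n : ℕ) (x : E3) : ℝ :=
  -betaCoeff (n + 1) fun β =>
    constraintOp (conformalMetric y₁ y₂ β) (fun z => partialSum n β fun k => σ k z) x

/-- `L` is the Hadamard finite part of `F ε` as `ε → 0⁺`: what remains after the removal of a
combination of `ln ε` and of positive powers of `1 / ε`. -/
def HasFinitePart (F : ℝ → ℝ) (L : ℝ) : Prop :=
  ∃ (A : ℝ) (p : Polynomial ℝ), p.coeff 0 = 0 ∧
    Tendsto (fun ε => F ε - A * Real.log ε - p.eval ε⁻¹) (𝓝[>] 0) (𝓝 L)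

/-- `Δ u = f` in the sense of distributions on the whole space, where the function `f`, singular at
`y₁` and `y₂`, defines a distribution by the Hadamard finite part (which is the ordinary integral or
the principal value whenever these exist). -/
def WeakPoisson (y₁ y₂ : E3) (u f : E3 → ℝ) : Prop :=
  ∀ φ : E3 → ℝ, ContDiff ℝ (⊤ : ℕ∞) φ → HasCompactSupport φ →
    HasFinitePart (fun ε => ∫ x in {x : E3 | ε ≤ dist x y₁ ∧ ε ≤ dist x y₂}, f x * φ x)
      (∫ x, u x * Laplacian.laplacian φ x)

/-- `σ₀, …, σ_N` solve, order by order in `β` up to `β ^ N`, the constraint equation for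
`Ψ = σ₀ + β σ₁ + β² σ₂ + ⋯` with the conformal metric `δ + β s`: `σ₀` is the Brill–Lindquist
factor, and each further `σₙ` is a function, smooth off the two points and tending to zero at
infinity, that solves its Poisson equation in the sense of distributions. -/
structure IsPerturbativeSolution (y₁ y₂ : E3) (α₁ α₂ : ℝ) (N : ℕ) (σ : ℕ → E3 → ℝ) : Prop where
  zero : σ 0 = brillLindquist y₁ y₂ α₁ α₂
  smooth : ∀ n < N, ContDiffOn ℝ (⊤ : ℕ∞) (σ (n + 1)) {y₁, y₂}ᶜ
  locallyIntegrable : ∀ n < N, LocallyIntegrable (σ (n + 1)) volume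
  tendsto_zero : ∀ n < N, Tendsto (σ (n + 1)) (Bornology.cobounded E3) (𝓝 0)
  poisson : ∀ n < N, WeakPoisson y₁ y₂ (σ (n + 1)) (source y₁ y₂ σ n)

/-- The physical metric `Ψ⁴ (δ + β s)`, with `Ψ` truncated after `β ^ N`. -/
def physMetric (y₁ y₂ : E3) (σ : ℕ → E3 → ℝ) (N : ℕ) (β : ℝ) : TensorField := fun x =>
  (partialSum N β fun k => σ k x) ^ 4 • conformalMetric y₁ y₂ β x

/-- The coefficient of `β ^ n` in the physical metric. -/
def physMetricCoeff (y₁ y₂ : E3) (σ : ℕ → E3 → ℝ) (n : ℕ) : TensorField := fun x =>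
  Matrix.of fun i j => betaCoeff n fun β => physMetric y₁ y₂ σ n β x i j

/-! ### Surface integrals at infinity -/

/-- `r² nⁱ (∂ⱼ h_{ij} - ∂ᵢ h_{jj})` at the point `r n`, for `n` in the unit sphere. -/
def surfaceDensity (h : TensorField) (r : ℝ) (n : sphere (0 : E3) 1) : ℝ :=
  r ^ 2 * ∑ i, ∑ j, (n : E3) i *
    (pd j (fun z => h z i j) (r • (n : E3)) - pd i (fun z => h z j j) (r • (n : E3)))

/-- The surface integral
`c² / (16 π G) lim_{r → ∞} ∫ dSⁱ (∂ⱼ h_{ij} - ∂ᵢ h_{jj})` exists and equals `m`. -/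
def HasSurfaceMass (c G : ℝ) (h : TensorField) (m : ℝ) : Prop :=
  (∀ᶠ r : ℝ in atTop, Integrable (surfaceDensity h r) (volume : Measure E3).toSphere) ∧
  Tendsto (fun r : ℝ => c ^ 2 / (16 * Real.pi * G) *
    ∫ n, surfaceDensity h r n ∂(volume : Measure E3).toSphere) atTop (𝓝 m)

/-- The ADM mass, computed up to and including order `β ^ N`, is finite and equal to `M`. -/
def HasADMMass (c G : ℝ) (y₁ y₂ : E3) (σ : ℕ → E3 → ℝ) (N : ℕ) (β M : ℝ) : Prop :=
  ∃ μ : ℕ → ℝ, (∀ n ≤ N, HasSurfaceMass c G (physMetricCoeff y₁ y₂ σ n) (μ n)) ∧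
    M = partialSum N β μ

/-- The coefficient of `1 / t` in `u` at the point `a + t n`, as `t → 0⁺`. -/
def leadingCoeff (a : E3) (u : E3 → ℝ) (n : E3) : ℝ :=
  limUnder (𝓝[>] (0 : ℝ)) fun t => t * u (a + t • n)

/-- The inversion about the puncture `a`: the point `ρ n`, `|n| = 1`, goes to `a + (ζ(n)² / ρ) n`,
where `ζ(n)`, up to order `β ^ N`, is the coefficient of `1 / |x - a|` in `Ψ`. -/
def inversion (a : E3) (σ : ℕ → E3 → ℝ) (N : ℕ) (β : ℝ) (ρ : E3) : E3 :=
  a + ((partialSum N β fun k => leadingCoeff a (σ k) (‖ρ‖⁻¹ • ρ)) ^ 2 / ‖ρ‖ ^ 2) • ρ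

/-- The physical metric in the inverted coordinates about the puncture `a`. -/
def invertedMetric (y₁ y₂ a : E3) (σ : ℕ → E3 → ℝ) (N : ℕ) (β : ℝ) : TensorField := fun ρ =>
  Matrix.of fun i j => ∑ k, ∑ l,
    pd i (fun z => inversion a σ N β z k) ρ * pd j (fun z => inversion a σ N β z l) ρ *
      physMetric y₁ y₂ σ N β (inversion a σ N β ρ) k l

/-- The coefficient of `β ^ n` in the metric in the inverted coordinates about `a`. -/
def invertedMetricCoeff (y₁ y₂ a : E3) (σ : ℕ → E3 → ℝ) (n : ℕ) : TensorField := fun ρ =>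
  Matrix.of fun i j => betaCoeff n fun β => invertedMetric y₁ y₂ a σ n β ρ i j

/-- The individual mass of the hole at the puncture `a`, computed up to and including order `β ^ N`
by the surface integral at infinity in the inverted coordinates, is finite and equal to `m`. -/
def HasHoleMass (c G : ℝ) (y₁ y₂ a : E3) (σ : ℕ → E3 → ℝ) (N : ℕ) (β m : ℝ) : Prop :=
  (∀ k ≤ N, ∀ n : E3, ‖n‖ = 1 →
    ∃ ζ, Tendsto (fun t : ℝ => t * σ k (a + t • n)) (𝓝[>] 0) (𝓝 ζ)) ∧
  ∃ μ : ℕ → ℝ, (∀ n ≤ N, HasSurfaceMass c G (invertedMetricCoeff y₁ y₂ a σ n) (μ n)) ∧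
    m = partialSum N β μ

/-! ### Post-Newtonian quantities -/

/-- The parameter `β = - 8 G² m₁ m₂ / c⁴`. -/
def betaParam (G m₁ m₂ c : ℝ) : ℝ := -(8 * G ^ 2 * m₁ * m₂) / c ^ 4

/-- The gauge vector `ξ = G² m₁² n₁ / (4 c⁴ r₁) + G² m₂² n₂ / (4 c⁴ r₂)`, with
`n_A = (x - y_A) / r_A`; a point with coordinates `x` has harmonic coordinates `x + ξ(x)` (up to
order `c⁻⁶`). -/
def gaugeVector (G m₁ m₂ c : ℝ) (y₁ y₂ x : E3) : E3 :=
  (G ^ 2 * m₁ ^ 2 / (4 * c ^ 4) / dist x y₁ ^ 2) • (x - y₁)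
    + (G ^ 2 * m₂ ^ 2 / (4 * c ^ 4) / dist x y₂ ^ 2) • (x - y₂)

/-- `v` is the Hadamard finite part of the vector field `X` at the point `a`: the finite part, as
`ε → 0⁺`, of the mean value of `X` on the sphere of radius `ε` about `a`. -/
def HasFinitePartAt (X : E3 → E3) (a v : E3) : Prop :=
  ∀ i, HasFinitePart (fun ε => (1 / (4 * Real.pi)) *
    ∫ n : sphere (0 : E3) 1, X (a + ε • (n : E3)) i ∂(volume : Measure E3).toSphere) (v i)

/-- The post-Newtonian energy of two bodies at rest, at separation `R` in harmonic coordinates,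
at the second post-Newtonian order. -/
def energy2PN (G m₁ m₂ R c : ℝ) : ℝ :=
  -(G * m₁ * m₂) / R + G ^ 2 * m₁ * m₂ * (m₁ + m₂) / (2 * R ^ 2 * c ^ 2)
    - G ^ 3 * m₁ * m₂ * (2 * m₁ ^ 2 + 19 * m₁ * m₂ + 2 * m₂ ^ 2) / (4 * R ^ 3 * c ^ 4)

end Geometrostatics

end

noncomputable section

namespace Geometrostatics

open Finset (sum_congr mul_sum sum_mul sum_add_distrib sum_comm sum_sub_distrib sum_neg_distrib
  sum_range_succ univ)
open scoped Real

/-- Smoothness at a point. -/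
notation "SmoothAt" => ContDiffAt ℝ (⊤ : ℕ∞)
/-- Smoothness. -/
notation "Smooth" => ContDiff ℝ (⊤ : ℕ∞)
/-- Differentiability at a point. -/
notation "DiffAt" => DifferentiableAt ℝ
/-- Unit vectors. -/
notation "Dir" n:max => ‖(n : E3)‖ = 1
/-- Pairs of points. -/
notation "E6" => E3 × E3
/-- Real functions on space. -/
notation "Fn" => E3 → ℝ
/-- Real functions of a distance and a direction. -/
notation "RFn" => ℝ × E3 → ℝ
/-- One-sided neighbourhoods of zero. -/
notation "N0" => 𝓝[>] (0 : ℝ)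
/-- The unit sphere. -/
notation "S2" => sphere (0 : E3) 1

variable {p : E6} {x : E3} {α1 α2 c G : ℝ} {σ : ℕ → Fn}

/-! ### Partial derivatives -/

lemma two_le_smooth : (2 : WithTop ℕ∞) ≤ ((⊤ : ℕ∞) : WithTop ℕ∞) :=
  show ((2 : ℕ∞) : WithTop ℕ∞) ≤ _ from WithTop.coe_le_coe.2 le_top

section PartialDerivatives

variable {f g : Fn} {i : Fin 3}

lemma pd_congr (h : f =ᶠ[𝓝 x] g) : pd i f x = pd i g x := by
  unfold pd; rw [h.fderiv_eq]

lemma pd_add (hf : DiffAt f x) (hg : DiffAt g x) :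
    pd i (fun z => f z + g z) x = pd i f x + pd i g x := by
  unfold pd; rw [fderiv_fun_add hf hg]; rfl

lemma pd_sub (hf : DiffAt f x) (hg : DiffAt g x) :
    pd i (fun z => f z - g z) x = pd i f x - pd i g x := by
  unfold pd; rw [fderiv_fun_sub hf hg]; rfl

lemma pd_neg : pd i (fun z => -f z) x = -pd i f x := by
  unfold pd; rw [fderiv_fun_neg]; rfl

lemma pd_const (c : ℝ) : pd i (fun _ => c) x = 0 := by
  unfold pd; simp

lemma pd_mul (hf : DiffAt f x) (hg : DiffAt g x) :
    pd i (fun z => f z * g z) x = pd i f x * g x + f x * pd i g x := by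
  unfold pd; rw [fderiv_fun_mul hf hg]; simp; ring

lemma pd_const_mul (c : ℝ) (hf : DiffAt f x) :
    pd i (fun z => c * f z) x = c * pd i f x := by
  rw [pd_mul (differentiableAt_const c) hf, pd_const]; ring

lemma pd_mul_const (c : ℝ) (hf : DiffAt f x) :
    pd i (fun z => f z * c) x = pd i f x * c := by
  rw [pd_mul hf (differentiableAt_const c), pd_const]; ring

lemma pd_sum {ι : Type*} {s : Finset ι} {F : ι → Fn}
    (hF : ∀ k ∈ s, DiffAt (F k) x) :
    pd i (fun z => ∑ k ∈ s, F k z) x = ∑ k ∈ s, pd i (F k) x := by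
  unfold pd; rw [fderiv_fun_sum hF]; simp

lemma pd_comp {h : ℝ → ℝ} {h' : ℝ} (hh : HasDerivAt h h' (f x)) (hf : DiffAt f x) :
    pd i (fun z => h (f z)) x = h' * pd i f x := by
  unfold pd
  have := (hh.comp_hasFDerivAt x hf.hasFDerivAt).fderiv
  simp only [Function.comp_def] at this
  rw [this]; simp

lemma pd_coord (j : Fin 3) : pd i (fun z : E3 => z j) x = if i = j then 1 else 0 := by
  unfold pd
  have : HasFDerivAt (fun z => z j) (EuclideanSpace.proj j : E3 →L[ℝ] ℝ) x :=
    (EuclideanSpace.proj j : E3 →L[ℝ] ℝ).hasFDerivAt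
  rw [this.fderiv]
  simp [eq_comm]

lemma differentiableAt_coord (j : Fin 3) : DiffAt (fun z : E3 => z j) x :=
  (EuclideanSpace.proj j : E3 →L[ℝ] ℝ).differentiableAt

lemma contDiff_coord {n : WithTop ℕ∞} (j : Fin 3) : ContDiff ℝ n (fun z : E3 => z j) :=
  (EuclideanSpace.proj j : E3 →L[ℝ] ℝ).contDiff

lemma fderiv_eq_sum_pd (v : E3) : fderiv ℝ f x v = ∑ j, v j * pd j f x := by
  have hv : v = ∑ j, v j • (EuclideanSpace.single j 1 : E3) := by
    ext k; simp [Fin.sum_univ_three]; fin_cases k <;> simp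
  conv_lhs => rw [hv]
  simp [pd]

lemma contDiffAt_pd (hf : SmoothAt f x) : SmoothAt (pd i f) x := by
  have h := hf.fderiv_right (m := ((⊤ : ℕ∞) : WithTop ℕ∞)) (by simp)
  exact h.clm_apply contDiffAt_const

lemma contDiff_pd (hf : Smooth f) : Smooth (pd i f) :=
  contDiff_iff_contDiffAt.2 fun _ => contDiffAt_pd hf.contDiffAt

lemma diffAt {V : Type*} [NormedAddCommGroup V] [NormedSpace ℝ V] {f : V → ℝ} {x : V}
    {n : WithTop ℕ∞} (hf : ContDiffAt ℝ n f x) (hn : n ≠ 0 := by simp) : DiffAt f x :=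
  hf.differentiableAt hn

lemma eventually_diffAt (hf : SmoothAt f x) :
    ∀ᶠ z in 𝓝 x, DiffAt f z := by
  have h1 : ContDiffAt ℝ 1 f x := hf.of_le (by exact_mod_cast le_top)
  filter_upwards [h1.eventually (by simp)] with z hz
  exact hz.differentiableAt (by simp)

lemma laplacian_eq_sum_pd (hf : SmoothAt f x) :
    Laplacian.laplacian f x = ∑ i, pd i (pd i f) x := by
  rw [InnerProductSpace.laplacian_eq_iteratedFDeriv_orthonormalBasis f
    (EuclideanSpace.basisFun (Fin 3) ℝ)]
  refine sum_congr rfl fun i _ => ?_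
  rw [iteratedFDeriv_two_apply]
  have h : DiffAt (fderiv ℝ f) x :=
    (hf.fderiv_right (m := 1) (by norm_num; exact two_le_smooth)).differentiableAt (by simp)
  unfold pd
  rw [fderiv_clm_apply h (differentiableAt_const _)]
  simp

lemma pd_comm (hf : SmoothAt f x) (i j : Fin 3) :
    pd i (pd j f) x = pd j (pd i f) x := by
  have h : DiffAt (fderiv ℝ f) x :=
    (hf.fderiv_right (m := 1) (by norm_num; exact two_le_smooth)).differentiableAt (by simp)
  have hs := (hf.isSymmSndFDerivAt (by simp; exact two_le_smooth))
  unfold pd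
  rw [fderiv_clm_apply h (differentiableAt_const _), fderiv_clm_apply h (differentiableAt_const _)]
  simpa using hs.eq _ _

lemma support_pd_subset : tsupport (pd i f) ⊆ tsupport f := by
  refine closure_minimal ?_ (isClosed_tsupport f)
  intro z hz
  by_contra h
  apply hz
  have : f =ᶠ[𝓝 z] 0 := notMem_tsupport_iff_eventuallyEq.1 h
  rw [pd_congr this]; exact pd_const 0

lemma hasCompactSupport_pd (hf : HasCompactSupport f) : HasCompactSupport (pd i f) :=
  hf.of_isClosed_subset (isClosed_tsupport _) support_pd_subset

lemma integrable_mul_of_tsupport {X : Type*} [TopologicalSpace X] [MeasurableSpace X]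
    [OpensMeasurableSpace X] {μ : Measure X} [IsFiniteMeasureOnCompacts μ] {v φ : X → ℝ}
    (hφ : Continuous φ) (hc : HasCompactSupport φ) (hv : ∀ x ∈ tsupport φ, ContinuousAt v x) :
    Integrable (fun x => v x * φ x) μ :=
  (continuous_of_tsupport fun x hx => (hv x (tsupport_mul_subset_right hx)).mul
    hφ.continuousAt).integrable_of_hasCompactSupport hc.mul_left

lemma contDiff_of_tsupport {n : WithTop ℕ∞} (hf : ∀ x ∈ tsupport f, ContDiffAt ℝ n f x) :
    ContDiff ℝ n f := contDiff_iff_contDiffAt.2 fun x => by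
  by_cases hx : x ∈ tsupport f
  exacts [hf x hx, contDiffAt_const.congr_of_eventuallyEq (notMem_tsupport_iff_eventuallyEq.1 hx)]

lemma continuousAt_pd (hf : ContDiffAt ℝ 1 f x) : ContinuousAt (pd i f) x :=
  (hf.fderiv_right (m := 0) (by simp)).continuousAt.clm_apply continuousAt_const

lemma integral_mul_pd {φ u : Fn} (hφ : Smooth φ) (hc : HasCompactSupport φ)
    (hu : ∀ x ∈ tsupport φ, ContDiffAt ℝ 1 u x) (i : Fin 3) :
    ∫ x, u x * pd i φ x = -∫ x, pd i u x * φ x :=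
  integral_mul_fderiv_eq_neg_fderiv_mul_of_integrable
   
    (integrable_mul_of_tsupport hφ.continuous hc fun x hx => continuousAt_pd (hu x hx))
    (integrable_mul_of_tsupport (contDiff_pd hφ).continuous (hasCompactSupport_pd hc)
      fun x hx => (hu x (support_pd_subset hx)).continuousAt)
    (integrable_mul_of_tsupport hφ.continuous hc fun x hx => (hu x hx).continuousAt)
    (fun x hx => (hu x hx).differentiableAt (by simp)) fun x _ => (hφ.differentiable (by simp)) x

lemma integral_pd_eq_zero {φ : Fn} (hφ : Smooth φ) (hc : HasCompactSupport φ)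
    (i : Fin 3) : ∫ x, pd i φ x = 0 := by
  have := integral_mul_pd hφ hc (u := fun _ => 1) (fun _ _ => contDiffAt_const) i
  simpa [pd_const] using this

end PartialDerivatives

/-! ### Polar coordinates -/

/-- The surface measure of the unit sphere. -/
abbrev sph : Measure (S2) := (volume : Measure E3).toSphere

lemma integrable_polar {f : Fn} (hf : Integrable f) :
    Integrable (fun q : S2 × Set.Ioi (0 : ℝ) => f ((q.2 : ℝ) • (q.1 : E3)))
      (sph.prod (Measure.volumeIoiPow 2)) := by
  have h := (volume : Measure E3).measurePreserving_homeomorphUnitSphereProd.integrable_comp_emb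
    (Homeomorph.measurableEmbedding _)
    (g := fun q : S2 × Set.Ioi (0 : ℝ) => f ((q.2 : ℝ) • (q.1 : E3)))
  have hd : Module.finrank ℝ E3 - 1 = 2 := by simp
  rw [hd] at h
  rw [← h]
  have h2 : ((fun q : sphere 0 1 × Set.Ioi 0 => f ((q.2 : ℝ) • (q.1 : E3))) ∘
      homeomorphUnitSphereProd E3) = fun x : ({0}ᶜ : Set E3) => f x := by
    funext x
    have hx : (x : E3) ≠ 0 := x.2
    simp [smul_smul, mul_inv_cancel₀ (norm_ne_zero_iff.2 hx)]
  rw [h2]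
  have h3 : IntegrableOn f ({0}ᶜ : Set E3) := hf.integrableOn
  exact (integrableOn_iff_comap_subtypeVal (by measurability)).1 h3

lemma integral_polar_prod (f : Fn) :
    ∫ x, f x = ∫ q : S2 × Set.Ioi (0 : ℝ), f ((q.2 : ℝ) • (q.1 : E3))
      ∂(sph.prod (Measure.volumeIoiPow 2)) := by
  have h := (volume : Measure E3).measurePreserving_homeomorphUnitSphereProd.integral_comp
    (Homeomorph.measurableEmbedding _)
    (fun q : sphere 0 1 × Set.Ioi 0 => f ((q.2 : ℝ) • (q.1 : E3)))
  have hd : Module.finrank ℝ E3 - 1 = 2 := by simp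
  rw [hd] at h
  rw [← h]
  have h1 : ∫ x, f x = ∫ x : ({(0)}ᶜ : Set E3), f x ∂((volume : Measure E3).comap (↑)) := by
    rw [integral_subtype_comap (measurableSet_singleton _).compl f, restrict_compl_singleton]
  rw [h1]
  refine integral_congr_ae (.of_forall fun x => ?_)
  have hx : (x : E3) ≠ 0 := x.2
  simp [smul_smul, mul_inv_cancel₀ (norm_ne_zero_iff.2 hx)]

lemma integral_volumeIoiPow (g : ℝ → ℝ) :
    ∫ r : Set.Ioi (0 : ℝ), g r ∂(Measure.volumeIoiPow 2) = ∫ r in Set.Ioi (0 : ℝ), r ^ 2 * g r := by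
  simp only [Measure.volumeIoiPow, ENNReal.ofReal]
  rw [integral_withDensity_eq_integral_smul,
    integral_subtype_comap measurableSet_Ioi fun a => Real.toNNReal (a ^ 2) • g a,
    setIntegral_congr_fun measurableSet_Ioi fun x hx => ?_]
  · rw [NNReal.smul_def, Real.coe_toNNReal _ (pow_nonneg (le_of_lt hx) _), smul_eq_mul]
  · exact (measurable_subtype_coe.pow_const _).real_toNNReal

lemma integral_polar {f : Fn} (hf : Integrable f) :
    ∫ x, f x = ∫ r in Set.Ioi (0 : ℝ), r ^ 2 * ∫ n, f (r • n.1) ∂sph := by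
  rw [integral_polar_prod, integral_prod_symm _ (integrable_polar hf),
    ← integral_volumeIoiPow (fun r => ∫ n, f (r • n) ∂sph)]

lemma integral_congr {X : Type*} {m : MeasurableSpace X} {μ : Measure X} {f g : X → ℝ}
    (h : ∀ x, f x = g x) : ∫ x, f x ∂μ = ∫ x, g x ∂μ :=
  integral_congr_ae (.of_forall h)

lemma dir (n : S2) : ‖(n : E3)‖ = 1 := by simp

lemma integral_polar_mul (g : ℝ → ℝ) (h : Fn) :
    ∫ x : E3, g ‖x‖ * h (‖x‖⁻¹ • x) =
      (∫ r in Set.Ioi (0 : ℝ), r ^ 2 * g r) * ∫ n, h n.1 ∂sph := by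
  rw [integral_polar_prod]
  have : ∀ q : S2 × Set.Ioi (0 : ℝ),
      g ‖(q.2 : ℝ) • (q.1 : E3)‖ * h (‖(q.2 : ℝ) • (q.1 : E3)‖⁻¹ • (q.2 : ℝ) • (q.1 : E3)) =
      h q.1 * g q.2 := by
    intro q
    have hq : (0 : ℝ) < q.2 := q.2.2
    rw [norm_smul, dir, Real.norm_of_nonneg hq.le, mul_one, smul_smul,
      inv_mul_cancel₀ hq.ne', one_smul, mul_comm]
  simp_rw [this]
  rw [integral_prod_mul (fun n : S2 => h n) (fun r : Set.Ioi (0 : ℝ) => g r),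
    integral_volumeIoiPow, mul_comm]

lemma sphere_integral_eq_ball (h : Fn) :
    ∫ n, h n.1 ∂sph = 3 * ∫ x in ball (0 : E3) 1, h (‖x‖⁻¹ • x) := by
  have h1 := integral_polar_mul (Set.indicator (Set.Iio 1) fun _ => 1) h
  have h2 : ∫ r in Set.Ioi 0, r ^ 2 * Set.indicator (Set.Iio 1) (fun _ => (1 : ℝ)) r
      = 1 / 3 := by
    have : ∀ r, r ^ 2 * Set.indicator (Set.Iio 1) (fun _ => (1 : ℝ)) r
        = Set.indicator (Set.Iio (1 : ℝ)) (fun r => r ^ 2) r := by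
      intro r; by_cases hr : r ∈ Set.Iio (1 : ℝ) <;> simp [hr, Set.indicator]
    simp_rw [this]
    rw [setIntegral_indicator measurableSet_Iio, Set.Ioi_inter_Iio,
      ← integral_Ioc_eq_integral_Ioo, ← intervalIntegral.integral_of_le zero_le_one]
    norm_num
  rw [h2] at h1
  rw [← integral_indicator measurableSet_ball]
  have h3 : ∀ x : E3, Set.indicator (ball (0 : E3) 1) (fun x => h (‖x‖⁻¹ • x)) x
      = Set.indicator (Set.Iio 1) (fun _ => 1) ‖x‖ * h (‖x‖⁻¹ • x) := by
    intro x; by_cases hx : ‖x‖ < 1 <;> simp [Set.indicator, hx]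
  simp_rw [h3, h1]; ring

lemma sphere_integral_comp (L : E3 ≃ₗᵢ[ℝ] E3) (h : Fn) :
    ∫ n, h (L n.1) ∂sph = ∫ n, h n.1 ∂sph := by
  rw [sphere_integral_eq_ball (fun x => h (L x)), sphere_integral_eq_ball]
  congr 1
  rw [← integral_indicator measurableSet_ball, ← integral_indicator measurableSet_ball]
  rw [← (L.measurePreserving).integral_comp L.toHomeomorph.measurableEmbedding
    (Set.indicator (ball 0 1) fun x => h (‖x‖⁻¹ • x))]
  refine integral_congr_ae (.of_forall fun x => ?_)
  by_cases hx : ‖x‖ < 1 <;> simp [Set.indicator, hx]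

lemma sphere_integral_one : ∫ _n, (1 : ℝ) ∂sph = 4 * π := by
  rw [sphere_integral_eq_ball (fun _ => 1)]
  rw [setIntegral_const, smul_eq_mul, mul_one, measureReal_def,
    EuclideanSpace.volume_ball_fin_three]
  rw [ENNReal.toReal_mul, ENNReal.toReal_pow]
  simp
  rw [ENNReal.toReal_ofReal (by positivity)]; ring

lemma sphere_integral_const (c : ℝ) : ∫ _n, c ∂sph = 4 * π * c := by
  have := integral_const_mul (μ := sph) c (fun _ => 1)
  rw [sphere_integral_one] at this
  simp only [mul_one] at this
  rw [this]; ring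

lemma sphere_integral_odd (h : Fn) (hodd : ∀ x, h (-x) = -h x) :
    ∫ n, h n.1 ∂sph = 0 := by
  have h1 := sphere_integral_comp (LinearIsometryEquiv.neg ℝ) h
  simp only [LinearIsometryEquiv.coe_neg, hodd, integral_neg] at h1
  linarith

lemma sphere_continuous_integrable {h : S2 → ℝ} (hh : Continuous h) :
    Integrable h sph := by
  have : IsFiniteMeasure sph := inferInstance
  exact hh.integrable_of_hasCompactSupport (HasCompactSupport.of_compactSpace h)

lemma sphere_integral_inner_sq (u : E3) :
    ∫ n, (inner ℝ n.1 u) ^ 2 ∂sph = 4 * π / 3 * ‖u‖ ^ 2 := by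
  have key : ∀ u v : E3, ‖u‖ = ‖v‖ →
      ∫ n, (inner ℝ n.1 u) ^ 2 ∂sph = ∫ n, (inner ℝ n.1 v) ^ 2 ∂sph := by
    intro u v huv
    let L := (Submodule.span ℝ {u - v})ᗮ.reflection
    have hL : L u = v := Submodule.reflection_sub huv
    rw [← sphere_integral_comp L (fun x => (inner ℝ x v) ^ 2)]
    refine integral_congr_ae (.of_forall fun n => ?_)
    simp only
    rw [← hL, LinearIsometryEquiv.inner_map_map]
  have hb : ∀ i : Fin 3, ∫ n, (inner ℝ n.1 u) ^ 2 ∂sph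
      = ∫ n, (inner ℝ (n : E3) (‖u‖ • EuclideanSpace.single i (1 : ℝ) : E3)) ^ 2 ∂sph := by
    intro i; apply key; rw [norm_smul]; simp
  have hi : ∀ i : Fin 3, Integrable (fun n : S2 =>
      (inner ℝ (n : E3) (‖u‖ • EuclideanSpace.single i (1 : ℝ) : E3)) ^ 2) sph := fun i =>
    sphere_continuous_integrable (by fun_prop)
  have hs : 3 * ∫ n, (inner ℝ n.1 u) ^ 2 ∂sph = ∫ _n, ‖u‖ ^ 2 ∂sph := by
    have : 3 * ∫ n, (inner ℝ n.1 u) ^ 2 ∂sph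
        = ∑ _i : Fin 3, ∫ n, (inner ℝ n.1 u) ^ 2 ∂sph := by simp
    rw [this, sum_congr rfl fun i _ => hb i, ← integral_finsetSum _ fun i _ => hi i]
    refine integral_congr fun n => ?_
    have hn : ∑ i, (n.1 i) ^ 2 = 1 := by
      rw [← EuclideanSpace.real_norm_sq_eq, dir]; norm_num
    simp only [inner_smul_right, EuclideanSpace.inner_single_right, one_mul, conj_trivial, mul_pow]
    rw [← mul_sum, hn, mul_one]
  rw [sphere_integral_const] at hs
  linarith

/-! ### Expansions near the punctures and at infinity -/

/-- Along the rays `a p + t ^ e • ν`, `t → 0⁺`, the function `f` is `t ^ m` times a function that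
is smooth up to `t = 0`. -/
structure ExpandsTo (e : ℤ) (a : E6 → E3) (m : ℤ) (f : E6 → Fn)
    (Φ : ℝ × E3 × E6 → ℝ) : Prop where
  smooth : ∀ ν p, ν ≠ 0 → p.1 ≠ p.2 → SmoothAt Φ (0, ν, p)
  eq : ∀ ν p, ν ≠ 0 → p.1 ≠ p.2 → ∀ᶠ q in 𝓝 ((0 : ℝ), ν, p), 0 < q.1 →
    f q.2.2 (a q.2.2 + q.1 ^ e • q.2.1) = q.1 ^ m * Φ q

/-- `f` has an expansion of leading order `t ^ m`. -/
def Expands (e : ℤ) (a : E6 → E3) (m : ℤ) (f : E6 → Fn) : Prop :=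
  ∃ Φ, ExpandsTo e a m f Φ

section Expansions

variable {e m m' : ℤ} {a : E6 → E3} {f g : E6 → Fn}
  {Φ Ψ : ℝ × E3 × E6 → ℝ}

lemma ExpandsTo.expands (h : ExpandsTo e a m f Φ) : Expands e a m f := ⟨Φ, h⟩

lemma ExpandsTo.add (hf : ExpandsTo e a m f Φ) (hg : ExpandsTo e a m g Ψ) :
    ExpandsTo e a m (fun p x => f p x + g p x) (fun q => Φ q + Ψ q) where
  smooth ν p hν hp := (hf.smooth ν p hν hp).add (hg.smooth ν p hν hp)
  eq ν p hν hp := by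
    filter_upwards [hf.eq ν p hν hp, hg.eq ν p hν hp] with q h1 h2 hq
    rw [h1 hq, h2 hq]; ring

lemma ExpandsTo.mul (hf : ExpandsTo e a m f Φ) (hg : ExpandsTo e a m' g Ψ) :
    ExpandsTo e a (m + m') (fun p x => f p x * g p x) (fun q => Φ q * Ψ q) where
  smooth ν p hν hp := (hf.smooth ν p hν hp).mul (hg.smooth ν p hν hp)
  eq ν p hν hp := by
    filter_upwards [hf.eq ν p hν hp, hg.eq ν p hν hp] with q h1 h2 hq
    rw [h1 hq, h2 hq, zpow_add₀ hq.ne']; ring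

lemma expandsTo_param {c : E6 → ℝ}
    (hc : ∀ p : E6, p.1 ≠ p.2 → SmoothAt c p) :
    ExpandsTo e a 0 (fun p _ => c p) (fun q => c q.2.2) where
  smooth ν p _ hp := by
    have h : SmoothAt c ((0 : ℝ), ν, p).2.2 := hc p hp
    exact h.comp ((0 : ℝ), ν, p) (contDiff_snd.snd.contDiffAt)
  eq ν p _ _ := .of_forall fun q _ => by simp

lemma ExpandsTo.congr (hf : ExpandsTo e a m f Φ)
    (h : ∀ ν p, ν ≠ 0 → p.1 ≠ p.2 → ∀ᶠ q in 𝓝 ((0 : ℝ), ν, p), 0 < q.1 →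
      g q.2.2 (a q.2.2 + q.1 ^ e • q.2.1) = f q.2.2 (a q.2.2 + q.1 ^ e • q.2.1)) :
    ExpandsTo e a m g Φ where
  smooth := hf.smooth
  eq ν p hν hp := by
    filter_upwards [hf.eq ν p hν hp, h ν p hν hp] with q h1 h2 hq
    rw [h2 hq, h1 hq]

lemma ExpandsTo.weaken (hf : ExpandsTo e a m f Φ) (h : m' ≤ m) :
    ExpandsTo e a m' f (fun q => q.1 ^ (m - m').toNat * Φ q) where
  smooth ν p hν hp := (contDiff_fst.contDiffAt.pow _).mul (hf.smooth ν p hν hp)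
  eq ν p hν hp := by
    filter_upwards [hf.eq ν p hν hp] with q h1 hq
    have : ((m - m').toNat : ℤ) = m - m' := Int.toNat_of_nonneg (by omega)
    rw [h1 hq, ← zpow_natCast, this, ← mul_assoc, ← zpow_add₀ hq.ne']
    congr 2; ring

lemma ExpandsTo.pd (hf : ExpandsTo e a m f Φ) (i : Fin 3) :
    ExpandsTo e a (m - e) (fun p x => pd i (f p) x)
      (fun q => fderiv ℝ Φ q (0, EuclideanSpace.single i 1, 0)) where
  smooth ν p hν hp := by
    have h := (hf.smooth ν p hν hp).fderiv_right (m := ((⊤ : ℕ∞) : WithTop ℕ∞)) (by simp)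
    exact h.clm_apply contDiffAt_const
  eq ν p hν hp := by
    have hd : ∀ᶠ q in 𝓝 ((0 : ℝ), ν, p), DiffAt Φ q := by
      have h1 : ContDiffAt ℝ 1 Φ ((0 : ℝ), ν, p) :=
        (hf.smooth ν p hν hp).of_le (by exact_mod_cast le_top)
      filter_upwards [h1.eventually (by simp)] with z hz
      exact diffAt hz
    filter_upwards [(hf.eq ν p hν hp).eventually_nhds, hd] with q hq hdq ht
    obtain ⟨t, ν', p'⟩ := q
    simp only at ht ⊢
    have hte : t ^ e ≠ 0 := (zpow_pos ht e).ne'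
    set x := a p' + t ^ e • ν' with hx
    let L : E3 → ℝ × E3 × E6 := fun z => (t, (t ^ e)⁻¹ • (z - a p'), p')
    have hLx : L x = (t, ν', p') := by
      simp [L, hx, smul_smul, inv_mul_cancel₀ hte]
    have hLc : Continuous L := by fun_prop
    have hev : f p' =ᶠ[𝓝 x] fun z => t ^ m * Φ (L z) := by
      have : Tendsto L (𝓝 x) (𝓝 (t, ν', p')) := hLx ▸ hLc.tendsto x
      filter_upwards [this.eventually hq] with z hz
      have := hz ht
      simp only [L, smul_smul, mul_inv_cancel₀ hte, one_smul, add_sub_cancel] at this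
      exact this
    have hLd : HasFDerivAt L ((0 : E3 →L[ℝ] ℝ).prod
        (((t ^ e)⁻¹ • ContinuousLinearMap.id ℝ E3).prod (0 : E3 →L[ℝ] E6))) x := by
      have h1 : HasFDerivAt (fun z : E3 => (t ^ e)⁻¹ • (z - a p'))
          ((t ^ e)⁻¹ • ContinuousLinearMap.id ℝ E3) x :=
        ((hasFDerivAt_id x).sub_const _).fun_const_smul _
      exact (hasFDerivAt_const t x).prodMk (h1.prodMk (hasFDerivAt_const p' x))
    have hΦ : HasFDerivAt Φ (fderiv ℝ Φ (t, ν', p')) (L x) := hLx ▸ hdq.hasFDerivAt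
    have hcomp := ((hΦ.comp x hLd).const_mul (t ^ m)).fderiv
    simp only [Function.comp_apply] at hcomp
    rw [pd_congr hev, Geometrostatics.pd, hcomp]
    have hv : (0, (t ^ e)⁻¹ • (EuclideanSpace.single i (1 : ℝ) : E3), (0 : E6))
        = (t ^ e)⁻¹ • ((0 : ℝ), (EuclideanSpace.single i (1 : ℝ) : E3), (0 : E6)) := by simp
    simp only [_root_.smul_apply, ContinuousLinearMap.comp_apply,
      ContinuousLinearMap.prod_apply, _root_.zero_apply,
      ContinuousLinearMap.id_apply, smul_eq_mul]
    rw [hv, map_smul, smul_eq_mul, zpow_sub₀ ht.ne']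
    field_simp

lemma ExpandsTo.uniform (hf : ExpandsTo e a m f Φ) {K : Set (E6)} (hK : IsCompact K)
    (hK0 : ∀ p ∈ K, p.1 ≠ p.2) :
    ∃ C > 0, ∃ δ > 0, ∀ p ∈ K, ∀ n, Dir n → |Φ (0, n, p)| ≤ C ∧ ∀ t, 0 < t → t < δ →
      |f p (a p + t ^ e • n)| ≤ C * t ^ m ∧
      |f p (a p + t ^ e • n) - t ^ m * Φ (0, n, p)| ≤ C * t ^ (m + 1) := by
  have hS : IsCompact (S2 ×ˢ K) := (isCompact_sphere _ _).prod hK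
  have key := hS.induction_on (p := fun S => ∃ C > 0, ∃ δ > 0, ∀ y ∈ S,
      |Φ (0, y.1, y.2)| ≤ C ∧ ∀ t, 0 < t → t < δ →
      |f y.2 (a y.2 + t ^ e • y.1)| ≤ C * t ^ m ∧
      |f y.2 (a y.2 + t ^ e • y.1) - t ^ m * Φ (0, y.1, y.2)| ≤ C * t ^ (m + 1))
    ⟨1, one_pos, 1, one_pos, by simp⟩ ?_ ?_ ?_
  · obtain ⟨C, hC, δ, hδ, h⟩ := key
    exact ⟨C, hC, δ, hδ, fun p hp n hn => h (n, p) ⟨by simpa using hn, hp⟩⟩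
  · rintro S T hST ⟨C, hC, δ, hδ, h⟩
    exact ⟨C, hC, δ, hδ, fun y hy => h y (hST hy)⟩
  · rintro S T ⟨C, hC, δ, hδ, h⟩ ⟨C', hC', δ', hδ', h'⟩
    refine ⟨max C C', by positivity, min δ δ', by positivity, ?_⟩
    have mono : ∀ D, D ≤ max C C' → ∀ y : E3 × E6, ∀ d, min δ δ' ≤ d →
        (|Φ (0, y.1, y.2)| ≤ D ∧ ∀ t, 0 < t → t < d →
        |f y.2 (a y.2 + t ^ e • y.1)| ≤ D * t ^ m ∧
        |f y.2 (a y.2 + t ^ e • y.1) - t ^ m * Φ (0, y.1, y.2)| ≤ D * t ^ (m + 1)) →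
        (|Φ (0, y.1, y.2)| ≤ max C C' ∧ ∀ t, 0 < t → t < min δ δ' →
        |f y.2 (a y.2 + t ^ e • y.1)| ≤ max C C' * t ^ m ∧
        |f y.2 (a y.2 + t ^ e • y.1) - t ^ m * Φ (0, y.1, y.2)| ≤ max C C' * t ^ (m + 1)) := by
      intro D hD y d hd ⟨h1, h2⟩
      refine ⟨h1.trans hD, fun t ht htd => ?_⟩
      obtain ⟨h3, h4⟩ := h2 t ht (htd.trans_le hd)
      have p1 := zpow_pos ht m
      have p2 := zpow_pos ht (m + 1)
      exact ⟨h3.trans (by gcongr), h4.trans (by gcongr)⟩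
    rintro y (hy | hy)
    · exact mono C (le_max_left _ _) y δ (min_le_left _ _) (h y hy)
    · exact mono C' (le_max_right _ _) y δ' (min_le_right _ _) (h' y hy)
  · rintro ⟨ν, p⟩ ⟨hν, hp⟩
    have hν0 : ν ≠ 0 := by
      rintro rfl; simp at hν
    have hs := (hf.smooth ν p hν0 (hK0 p hp))
    have h1 : ContDiffAt ℝ 1 Φ ((0 : ℝ), ν, p) := hs.of_le (by exact_mod_cast le_top)
    obtain ⟨L, U, hU, hL⟩ := h1.exists_lipschitzOnWith
    set M := |Φ (0, ν, p)| + 1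
    have hM : ∀ᶠ q in 𝓝 ((0 : ℝ), ν, p), |Φ q| < M :=
      hs.continuousAt.abs.eventually (gt_mem_nhds (by simp [M]))
    have hall := (hM.and (hf.eq ν p hν0 (hK0 p hp))).and (eventually_mem_set.2 hU)
    rw [nhds_prod_eq] at hall
    obtain ⟨pa, hpa, pb, hpb, hab⟩ := eventually_prod_iff.1 hall
    obtain ⟨δ, hδ, hδ'⟩ := Metric.eventually_nhds_iff.1 hpa
    refine ⟨{y | pb y}, mem_nhdsWithin_of_mem_nhds hpb, M + L, by positivity, δ, hδ, ?_⟩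
    intro y hy
    have hp0 : pa 0 := hδ' (by simpa using hδ)
    have hy0 := hab hp0 hy
    have hLn : (0 : ℝ) ≤ L := L.2
    refine ⟨by linarith [hy0.1.1], fun t ht htδ => ?_⟩
    have hpt : pa t := hδ' (by simpa [abs_of_pos ht] using htδ)
    have hyt := hab hpt hy
    have heq := hyt.1.2 ht
    simp only at heq
    have ptm := zpow_pos ht m
    constructor
    · rw [heq, abs_mul, abs_of_pos ptm, mul_comm]
      gcongr
      linarith [hyt.1.1]
    · rw [heq, ← mul_sub, abs_mul, abs_of_pos ptm, zpow_add_one₀ ht.ne']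
      have hd := hL.dist_le_mul _ hyt.2 _ hy0.2
      rw [Real.dist_eq] at hd
      have hdist : dist ((t, y) : ℝ × E3 × E6) (0, y) = t := by
        simp [Prod.dist_eq, abs_of_pos ht, ht.le]
      rw [hdist] at hd
      calc t ^ m * |Φ (t, y.1, y.2) - Φ (0, y.1, y.2)| ≤ t ^ m * (L * t) := by gcongr
        _ ≤ (M + L) * (t ^ m * t) := by
          have : 0 ≤ M * (t ^ m * t) := by positivity
          nlinarith

lemma ExpandsTo.continuous_sphere (hf : ExpandsTo e a m f Φ) (hp : p.1 ≠ p.2) :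
    Continuous fun n : S2 => Φ (0, n.1, p) := by
  rw [continuous_iff_continuousAt]
  intro n
  have hn : n.1 ≠ 0 := by
    intro h; have := dir n; rw [h] at this; simp at this
  have h1 := (hf.smooth n p hn hp).continuousAt
  exact ContinuousAt.comp (g := Φ) (f := fun n : S2 => ((0 : ℝ), n.1, p)) h1
    (by fun_prop)

end Expansions

/-- The punctures are distinct, and the field point is off them. -/
structure Off (p : E6) (x : E3) : Prop where
  ne : p.1 ≠ p.2
  fst : x ≠ p.1
  snd : x ≠ p.2

lemma Off.swap (o : Off p x) : Off p.swap x := ⟨o.1.symm, o.3, o.2⟩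

/-- Smooth in the field point and in the positions of the punctures, off the punctures. -/
def SmoothOff (f : E6 → Fn) : Prop :=
  ∀ p x, Off p x →
    SmoothAt (fun q : (E6) × E3 => f q.1 q.2) (p, x)

lemma SmoothOff.add {f g : E6 → Fn} (hf : SmoothOff f) (hg : SmoothOff g) :
    SmoothOff fun p x => f p x + g p x :=
  fun p x o => (hf p x o).add (hg p x o)

lemma SmoothOff.mul {f g : E6 → Fn} (hf : SmoothOff f) (hg : SmoothOff g) :
    SmoothOff fun p x => f p x * g p x :=
  fun p x o => (hf p x o).mul (hg p x o)

lemma SmoothOff.at {f : E6 → Fn} (hf : SmoothOff f)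
    (o : Off p x) : SmoothAt (f p) x := by
  have := (hf p x o)
  exact ContDiffAt.comp x (g := fun q : (E6) × E3 => f q.1 q.2) (f := fun z => (p, z)) this
    (by fun_prop)

lemma eventually_off (o : Off p x) :
    ∀ᶠ q : (E6) × E3 in 𝓝 (p, x), Off q.1 q.2 := by
  have c1 : Continuous fun q : (E6) × E3 => q.1.1 := by fun_prop
  have c2 : Continuous fun q : (E6) × E3 => q.1.2 := by fun_prop
  have c3 : Continuous fun q : (E6) × E3 => q.2 := by fun_prop
  filter_upwards [((isOpen_ne_fun c1 c2).mem_nhds (x := (p, x)) o.1),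
    ((isOpen_ne_fun c3 c1).mem_nhds (x := (p, x)) o.2),
    ((isOpen_ne_fun c3 c2).mem_nhds (x := (p, x)) o.3)] with q a b c using ⟨a, b, c⟩

lemma SmoothOff.congr {f g : E6 → Fn} (hf : SmoothOff f)
    (h : ∀ p x, Off p x → g p x = f p x) : SmoothOff g := by
  intro p x o
  refine (hf p x o).congr_of_eventuallyEq ?_
  filter_upwards [eventually_off o] with q hq using h _ _ hq

lemma SmoothOff.pd {f : E6 → Fn} (hf : SmoothOff f) (i : Fin 3) :
    SmoothOff fun p x => pd i (f p) x := by
  intro p x o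
  have h := hf p x o
  have h3 := (h.fderiv_right (m := ((⊤ : ℕ∞) : WithTop ℕ∞)) (by simp)).clm_apply
    (contDiffAt_const (c := ((0 : E6), (EuclideanSpace.single i (1 : ℝ) : E3))))
  refine h3.congr_of_eventuallyEq ?_
  have hd : ∀ᶠ q in 𝓝 (p, x), DiffAt (fun q : (E6) × E3 => f q.1 q.2) q := by
    have h1 := h.of_le (m := 1) (by exact_mod_cast le_top)
    filter_upwards [h1.eventually (by simp)] with z hz
    exact diffAt hz
  filter_upwards [hd] with q hq
  have hL : HasFDerivAt (fun z : E3 => (q.1, z)) (ContinuousLinearMap.inr ℝ (E6) E3) q.2 :=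
    hasFDerivAt_prodMk_right _ _
  have hq' : HasFDerivAt (fun q : (E6) × E3 => f q.1 q.2)
    (fderiv ℝ (fun q : (E6) × E3 => f q.1 q.2) q) (q.1, q.2) := hq.hasFDerivAt
  have := (HasFDerivAt.comp q.2 hq' hL).fderiv
  unfold Geometrostatics.pd
  simp only [Function.comp_def] at this
  rw [this]; simp

/-- Smooth off the punctures, with expansions of orders `k`, `l` at the punctures and `m` at
infinity. -/
structure Nice (k l m : ℤ) (f : E6 → Fn) : Prop where
  smooth : SmoothOff f
  fst : Expands 1 Prod.fst k f
  snd : Expands 1 Prod.snd l f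
  inf : Expands (-1) (fun _ => 0) m f

lemma eventually_cfg {ν : E3} (hν : ν ≠ 0) (hp : p.1 ≠ p.2) :
    ∀ᶠ q : ℝ × E3 × E6 in 𝓝 (0, ν, p), q.2.1 ≠ 0 ∧ q.2.2.1 ≠ q.2.2.2 := by
  have c1 : Continuous fun q : ℝ × E3 × E6 => q.2.1 := by fun_prop
  have c2 : Continuous fun q : ℝ × E3 × E6 => q.2.2.1 := by fun_prop
  have c3 : Continuous fun q : ℝ × E3 × E6 => q.2.2.2 := by fun_prop
  filter_upwards [((isOpen_ne_fun c1 continuous_const).mem_nhds (x := (0, ν, p)) hν),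
    ((isOpen_ne_fun c2 c3).mem_nhds (x := (0, ν, p)) hp)] with q a b using ⟨a, b⟩

lemma eventually_off_near {a b : E6 → E3} (ha : Continuous a) (hb : Continuous b)
    (hab : ∀ p : E6, p.1 ≠ p.2 → a p ≠ b p) {ν : E3}
    (hν : ν ≠ 0) (hp : p.1 ≠ p.2) :
    ∀ᶠ q : ℝ × E3 × E6 in 𝓝 (0, ν, p), 0 < q.1 →
      a q.2.2 + q.1 ^ (1 : ℤ) • q.2.1 ≠ a q.2.2 ∧ a q.2.2 + q.1 ^ (1 : ℤ) • q.2.1 ≠ b q.2.2 := by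
  have c1 : Continuous fun q : ℝ × E3 × E6 => a q.2.2 + q.1 • q.2.1 := by fun_prop
  have c2 : Continuous fun q : ℝ × E3 × E6 => b q.2.2 := by fun_prop
  filter_upwards [eventually_cfg hν hp, ((isOpen_ne_fun c1 c2).mem_nhds (x := (0, ν, p))
    (by simpa using hab p hp))] with q h1 h2 hq
  refine ⟨?_, by simpa using h2⟩
  simp [hq.ne', h1.1]

lemma eventually_off_far {ν : E3} (hν : ν ≠ 0) :
    ∀ᶠ q : ℝ × E3 × E6 in 𝓝 (0, ν, p), 0 < q.1 →
      0 + q.1 ^ (-1 : ℤ) • q.2.1 ≠ q.2.2.1 ∧ 0 + q.1 ^ (-1 : ℤ) • q.2.1 ≠ q.2.2.2 := by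
  have c0 : Continuous fun q : ℝ × E3 × E6 => q.2.1 := by fun_prop
  have c1 : Continuous fun q : ℝ × E3 × E6 => q.1 • q.2.2.1 := by fun_prop
  have c2 : Continuous fun q : ℝ × E3 × E6 => q.1 • q.2.2.2 := by fun_prop
  filter_upwards [((isOpen_ne_fun c0 c1).mem_nhds (x := (0, ν, p)) (by simpa using hν)),
    ((isOpen_ne_fun c0 c2).mem_nhds (x := (0, ν, p)) (by simpa using hν))] with q h1 h2 hq
  have aux : ∀ y : E3, q.2.1 ≠ q.1 • y → 0 + q.1 ^ (-1 : ℤ) • q.2.1 ≠ y := by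
    intro y hy h
    apply hy
    rw [← h]; simp [smul_smul, mul_inv_cancel₀ hq.ne']
  exact ⟨aux _ h1, aux _ h2⟩

section Nice

variable {k l m k' l' m' : ℤ} {f g : E6 → Fn}

lemma Expands.congr_fst (hf : Expands 1 Prod.fst k f)
    (h : ∀ p x, Off p x → g p x = f p x) : Expands 1 Prod.fst k g := by
  obtain ⟨Φ, hΦ⟩ := hf
  refine ⟨Φ, hΦ.congr fun ν p hν hp => ?_⟩
  filter_upwards [eventually_cfg hν hp, eventually_off_near continuous_fst continuous_snd
    (fun _ h => h) hν hp] with q h1 h2 hq using h _ _ ⟨h1.2, (h2 hq).1, (h2 hq).2⟩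

lemma Expands.congr_snd (hf : Expands 1 Prod.snd k f)
    (h : ∀ p x, Off p x → g p x = f p x) : Expands 1 Prod.snd k g := by
  obtain ⟨Φ, hΦ⟩ := hf
  refine ⟨Φ, hΦ.congr fun ν p hν hp => ?_⟩
  filter_upwards [eventually_cfg hν hp, eventually_off_near continuous_snd continuous_fst
    (fun _ h => h.symm) hν hp] with q h1 h2 hq using h _ _ ⟨h1.2, (h2 hq).2, (h2 hq).1⟩

lemma Expands.congr_inf (hf : Expands (-1) (fun _ => 0) k f)
    (h : ∀ p x, Off p x → g p x = f p x) :
    Expands (-1) (fun _ => 0) k g := by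
  obtain ⟨Φ, hΦ⟩ := hf
  refine ⟨Φ, hΦ.congr fun ν p hν hp => ?_⟩
  filter_upwards [eventually_cfg hν hp, eventually_off_far hν] with q h1 h2 hq
    using h _ _ ⟨h1.2, (h2 hq).1, (h2 hq).2⟩

lemma Nice.congr (hf : Nice k l m f)
    (h : ∀ p x, Off p x → g p x = f p x) : Nice k l m g :=
  ⟨hf.smooth.congr h, hf.fst.congr_fst h, hf.snd.congr_snd h, hf.inf.congr_inf h⟩

lemma Expands.weaken {e : ℤ} {a : E6 → E3} (hf : Expands e a m f) (h : m' ≤ m) :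
    Expands e a m' f := let ⟨_, hΦ⟩ := hf; ⟨_, hΦ.weaken h⟩

lemma Nice.weaken (hf : Nice k l m f) (hk : k' ≤ k) (hl : l' ≤ l) (hm : m' ≤ m) :
    Nice k' l' m' f :=
  ⟨hf.smooth, hf.fst.weaken hk, hf.snd.weaken hl, hf.inf.weaken hm⟩

lemma Nice.add (hf : Nice k l m f) (hg : Nice k l m g) : Nice k l m fun p x => f p x + g p x :=
  ⟨hf.smooth.add hg.smooth, let ⟨_, h1⟩ := hf.fst; let ⟨_, h2⟩ := hg.fst; ⟨_, h1.add h2⟩,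
    let ⟨_, h1⟩ := hf.snd; let ⟨_, h2⟩ := hg.snd; ⟨_, h1.add h2⟩,
    let ⟨_, h1⟩ := hf.inf; let ⟨_, h2⟩ := hg.inf; ⟨_, h1.add h2⟩⟩

lemma Nice.mul (hf : Nice k l m f) (hg : Nice k' l' m' g) :
    Nice (k + k') (l + l') (m + m') fun p x => f p x * g p x :=
  ⟨hf.smooth.mul hg.smooth, let ⟨_, h1⟩ := hf.fst; let ⟨_, h2⟩ := hg.fst; ⟨_, h1.mul h2⟩,
    let ⟨_, h1⟩ := hf.snd; let ⟨_, h2⟩ := hg.snd; ⟨_, h1.mul h2⟩,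
    let ⟨_, h1⟩ := hf.inf; let ⟨_, h2⟩ := hg.inf; ⟨_, h1.mul h2⟩⟩

lemma Nice.mul' {k'' l'' m'' : ℤ} (hf : Nice k l m f) (hg : Nice k' l' m' g)
    (hk : k'' ≤ k + k' := by norm_num) (hl : l'' ≤ l + l' := by norm_num)
    (hm : m'' ≤ m + m' := by norm_num) : Nice k'' l'' m'' fun p x => f p x * g p x :=
  (hf.mul hg).weaken hk hl hm

lemma nice_param {c : E6 → ℝ}
    (hc : ∀ p : E6, p.1 ≠ p.2 → SmoothAt c p) : Nice 0 0 0 fun p _ => c p :=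
  ⟨fun p x o => ContDiffAt.comp (p, x) (g := c) (f := fun q : (E6) × E3 => q.1)
    (hc p o.1) contDiffAt_fst,
    (expandsTo_param hc).expands, (expandsTo_param hc).expands, (expandsTo_param hc).expands⟩

lemma nice_const (c : ℝ) : Nice 0 0 0 fun _ _ => c := nice_param fun _ _ => contDiffAt_const

lemma Nice.const_mul (hf : Nice k l m f) (c : ℝ) : Nice k l m fun p x => c * f p x :=
  (nice_const c).mul' hf (by simp) (by simp) (by simp)

lemma Nice.neg (hf : Nice k l m f) : Nice k l m fun p x => -f p x := by
  simpa using hf.const_mul (-1)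

lemma Nice.sub (hf : Nice k l m f) (hg : Nice k l m g) : Nice k l m fun p x => f p x - g p x := by
  simpa [sub_eq_add_neg] using hf.add hg.neg

lemma nice_zero : Nice k l m fun _ _ => 0 :=
  ⟨fun _ _ _ => contDiffAt_const, ⟨fun _ => 0, fun _ _ _ _ => contDiffAt_const, by simp⟩,
    ⟨fun _ => 0, fun _ _ _ _ => contDiffAt_const, by simp⟩,
    ⟨fun _ => 0, fun _ _ _ _ => contDiffAt_const, by simp⟩⟩

lemma nice_sum {ι : Type*} (s : Finset ι) {F : ι → E6 → Fn}
    (hF : ∀ i ∈ s, Nice k l m (F i)) : Nice k l m fun p x => ∑ i ∈ s, F i p x := by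
  classical
  induction s using Finset.induction_on with
  | empty => simpa using nice_zero
  | insert i s hi ih =>
    simp only [Finset.sum_insert hi]
    exact (hF i (by simp)).add (ih fun j hj => hF j (by simp [hj]))

lemma Nice.pd (hf : Nice k l m f) (i : Fin 3) :
    Nice (k - 1) (l - 1) (m + 1) fun p x => pd i (f p) x :=
  ⟨hf.smooth.pd i, let ⟨_, h1⟩ := hf.fst; ⟨_, h1.pd i⟩, let ⟨_, h1⟩ := hf.snd; ⟨_, h1.pd i⟩,
    let ⟨_, h1⟩ := hf.inf; ⟨_, by simpa using h1.pd i⟩⟩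

lemma Nice.pd' (hf : Nice k l m f) (i : Fin 3) (hk : k' ≤ k - 1 := by norm_num)
    (hl : l' ≤ l - 1 := by norm_num) (hm : m' ≤ m + 1 := by norm_num) :
    Nice k' l' m' fun p x => Geometrostatics.pd i (f p) x := (hf.pd i).weaken hk hl hm

end Nice

/-! ### The elementary functions of two punctures -/

/-- Distance to the first puncture. -/
def r1 (p : E6) (x : E3) : ℝ := dist x p.1
/-- Distance to the second puncture. -/
def r2 (p : E6) (x : E3) : ℝ := dist x p.2
/-- Distance of the punctures. -/
def r12 (p : E6) : ℝ := dist p.1 p.2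
/-- Components of the unit vector from the first puncture to `x`. -/
def n1 (i : Fin 3) (p : E6) (x : E3) : ℝ := (x i - p.1 i) * (r1 p x)⁻¹
/-- Components of the unit vector from the second puncture to `x`. -/
def n2 (i : Fin 3) (p : E6) (x : E3) : ℝ := (x i - p.2 i) * (r2 p x)⁻¹
/-- Components of the unit vector from the second puncture to the first. -/
def n12 (i : Fin 3) (p : E6) : ℝ := (p.1 i - p.2 i) * (r12 p)⁻¹

section Inverse

variable {e m : ℤ} {a : E6 → E3} {f : E6 → Fn} {Φ : ℝ × E3 × E6 → ℝ}

lemma ExpandsTo.inv (hf : ExpandsTo e a m f Φ)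
    (h0 : ∀ ν p, ν ≠ 0 → p.1 ≠ p.2 → Φ (0, ν, p) ≠ 0) :
    ExpandsTo e a (-m) (fun p x => (f p x)⁻¹) (fun q => (Φ q)⁻¹) where
  smooth ν p hν hp := (hf.smooth ν p hν hp).inv (h0 ν p hν hp)
  eq ν p hν hp := by
    filter_upwards [hf.eq ν p hν hp] with q h1 hq
    rw [h1 hq, mul_inv, zpow_neg]

lemma SmoothOff.inv (hf : SmoothOff f)
    (h0 : ∀ p x, Off p x → f p x ≠ 0) :
    SmoothOff fun p x => (f p x)⁻¹ :=
  fun p x o => (hf p x o).inv (h0 p x o)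

lemma ExpandsTo.swap (hf : ExpandsTo e a m f Φ) :
    ExpandsTo e (fun p => a p.swap) m (fun p x => f p.swap x)
      (fun q => Φ (q.1, q.2.1, q.2.2.swap)) where
  smooth ν p hν hp := by
    have h := hf.smooth ν p.swap hν (fun h => hp (by simpa using h.symm))
    exact ContDiffAt.comp ((0 : ℝ), ν, p) (g := Φ)
      (f := fun q : ℝ × E3 × E6 => (q.1, q.2.1, q.2.2.2, q.2.2.1)) h (by fun_prop)
  eq ν p hν hp := by
    have h := hf.eq ν p.swap hν (fun h => hp (by simpa using h.symm))
    have hc : Continuous fun q : ℝ × E3 × E6 => (q.1, q.2.1, q.2.2.swap) := by fun_prop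
    exact (hc.tendsto ((0 : ℝ), ν, p)).eventually h

lemma Nice.swap {k l m : ℤ} (hf : Nice k l m f) : Nice l k m fun p x => f p.swap x := by
  refine ⟨fun p x o => ?_, ?_, ?_, ?_⟩
  · have h := hf.smooth p.swap x o.swap
    exact ContDiffAt.comp (p, x) (g := fun q : (E6) × E3 => f q.1 q.2)
      (f := fun q : (E6) × E3 => ((q.1.2, q.1.1), q.2)) h (by fun_prop)
  · obtain ⟨Φ, h⟩ := hf.snd; exact ⟨_, h.swap⟩
  · obtain ⟨Φ, h⟩ := hf.fst; exact ⟨_, h.swap⟩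
  · obtain ⟨Φ, h⟩ := hf.inf; exact ⟨_, h.swap⟩

end Inverse

lemma r1_swap (p : E6) (x : E3) : r1 p.swap x = r2 p x := rfl
lemma r1_pos (h : x ≠ p.1) : 0 < r1 p x := dist_pos.2 h
lemma r2_pos (h : x ≠ p.2) : 0 < r2 p x := dist_pos.2 h
lemma r12_pos (h : p.1 ≠ p.2) : 0 < r12 p := dist_pos.2 h

lemma Off.pos (o : Off p x) : 0 < r1 p x ∧ 0 < r2 p x ∧ 0 < r12 p :=
  ⟨r1_pos o.2, r2_pos o.3, r12_pos o.1⟩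

lemma smooth_r12 (p : E6) (hp : p.1 ≠ p.2) : SmoothAt r12 p :=
  ContDiffAt.dist ℝ contDiffAt_fst contDiffAt_snd hp

lemma smooth_n12 (i : Fin 3) (p : E6) (hp : p.1 ≠ p.2) :
    SmoothAt (n12 i) p := by
  refine ContDiffAt.mul ?_ ((smooth_r12 p hp).inv (r12_pos hp).ne')
  exact ((contDiff_coord i).contDiffAt.comp p contDiffAt_fst).sub
    ((contDiff_coord i).contDiffAt.comp p contDiffAt_snd)

lemma nice_r12 : Nice 0 0 0 fun p _ => r12 p := nice_param smooth_r12
lemma nice_inv_r12 : Nice 0 0 0 fun p _ => (r12 p)⁻¹ :=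
  nice_param fun p hp => (smooth_r12 p hp).inv (r12_pos hp).ne'
lemma nice_n12 (i : Fin 3) : Nice 0 0 0 fun p _ => n12 i p := nice_param (smooth_n12 i)

lemma smoothOff_r1 : SmoothOff r1 := fun _ _ o =>
  ContDiffAt.dist ℝ contDiffAt_snd (contDiff_fst.fst.contDiffAt) o.2

lemma expandsTo_r1_fst : ExpandsTo 1 Prod.fst 1 r1 (fun q => ‖q.2.1‖) where
  smooth ν p hν _ := ContDiffAt.norm ℝ (contDiff_snd.fst.contDiffAt) hν
  eq ν p _ _ := .of_forall fun q hq => by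
    simp [r1, norm_smul, abs_of_pos hq]

lemma expandsTo_r1_snd : ExpandsTo 1 Prod.snd 0 r1 (fun q => ‖q.2.2.2 + q.1 • q.2.1 - q.2.2.1‖) where
  smooth ν p _ hp := by
    refine ContDiffAt.norm ℝ (by fun_prop) ?_
    simpa [sub_eq_zero] using hp.symm
  eq ν p _ _ := .of_forall fun q hq => by
    simp [r1, dist_eq_norm]

lemma expandsTo_r1_inf : ExpandsTo (-1) (fun _ => 0) (-1) r1 (fun q => ‖q.2.1 - q.1 • q.2.2.1‖) where
  smooth ν p hν _ := by
    refine ContDiffAt.norm ℝ (by fun_prop) ?_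
    simpa using hν
  eq ν p _ _ := .of_forall fun q hq => by
    have : (0 : E3) + q.1 ^ (-1 : ℤ) • q.2.1 - q.2.2.1 = q.1⁻¹ • (q.2.1 - q.1 • q.2.2.1) := by
      rw [smul_sub, smul_smul, inv_mul_cancel₀ hq.ne']; simp
    rw [r1, dist_eq_norm, this, norm_smul]; simp [abs_of_pos hq]

lemma nice_r1 : Nice 1 0 (-1) r1 :=
  ⟨smoothOff_r1, expandsTo_r1_fst.expands, expandsTo_r1_snd.expands, expandsTo_r1_inf.expands⟩

lemma nice_inv_r1 : Nice (-1) 0 1 fun p x => (r1 p x)⁻¹ :=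
  ⟨smoothOff_r1.inv fun _ _ o => (r1_pos o.2).ne',
    (expandsTo_r1_fst.inv fun ν _ hν _ => by simpa using hν).expands,
    by simpa using (expandsTo_r1_snd.inv fun ν p _ hp => by
      simpa [sub_eq_zero] using hp.symm).expands,
    by simpa using (expandsTo_r1_inf.inv fun ν _ hν _ => by simpa using hν).expands⟩

lemma nice_r2 : Nice 0 1 (-1) r2 := nice_r1.swap
lemma nice_inv_r2 : Nice 0 (-1) 1 fun p x => (r2 p x)⁻¹ := nice_inv_r1.swap

lemma nice_vec1 (i : Fin 3) : Nice 1 0 (-1) fun p x => x i - p.1 i := by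
  refine ⟨fun p x _ => ?_, ⟨fun q => q.2.1 i, ⟨fun ν p _ _ => ?_, fun ν p _ _ => ?_⟩⟩,
    ⟨fun q => q.2.2.2 i + q.1 * q.2.1 i - q.2.2.1 i, ⟨fun ν p _ _ => ?_, fun ν p _ _ => ?_⟩⟩,
    ⟨fun q => q.2.1 i - q.1 * q.2.2.1 i, ⟨fun ν p _ _ => ?_, fun ν p _ _ => ?_⟩⟩⟩
  · fun_prop
  · fun_prop
  · exact .of_forall fun q hq => by simp
  · fun_prop
  · exact .of_forall fun q hq => by simp
  · fun_prop
  · exact .of_forall fun q hq => by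
      have : q.1 ≠ 0 := hq.ne'
      simp; field_simp

lemma nice_n1 (i : Fin 3) : Nice 0 0 0 (n1 i) := (nice_vec1 i).mul' nice_inv_r1
lemma nice_n2 (i : Fin 3) : Nice 0 0 0 (n2 i) := (nice_n1 i).swap

lemma nice_inv_sum (c1 c2 c3 : ℝ) (h1 : 0 ≤ c1) (h2 : 0 ≤ c2) (h3 : 0 ≤ c3)
    (h13 : 0 < c1 + c3) (h23 : 0 < c2 + c3) (h12 : 0 < c1 + c2) :
    Nice 0 0 1 fun p x => (c1 * r1 p x + c2 * r2 p x + c3 * r12 p)⁻¹ := by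
  have hc : ∀ c : ℝ, ∀ e a, ExpandsTo e a 0 (fun _ _ => c) (fun _ => c) := fun c e a =>
    expandsTo_param fun _ _ => contDiffAt_const
  have hR : ∀ e a, ExpandsTo e a 0 (fun p _ => r12 p) (fun q => r12 q.2.2) := fun e a =>
    expandsTo_param smooth_r12
  have s1 : ∀ c : ℝ, SmoothOff fun p x => c * r1 p x := fun c => (nice_r1.const_mul c).smooth
  have s2 : ∀ c : ℝ, SmoothOff fun p x => c * r2 p x := fun c => (nice_r2.const_mul c).smooth
  have s3 : SmoothOff fun p _ => c3 * r12 p := (nice_r12.const_mul c3).smooth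
  refine ⟨(((s1 c1).add (s2 c2)).add s3).inv fun p x o => ?_, ?_, ?_, ?_⟩
  · obtain ⟨_, _, _⟩ := o.pos
    have a1 : 0 ≤ c1 * r1 p x := by positivity
    have a2 : 0 ≤ c2 * r2 p x := by positivity
    have a3 : 0 ≤ c3 * r12 p := by positivity
    rcases h1.eq_or_lt with h | h
    · have h3' : 0 < c3 := by linarith
      have : 0 < c3 * r12 p := by positivity
      linarith
    · have : 0 < c1 * r1 p x := by positivity
      linarith
  · have h := (((hc c1 1 Prod.fst).mul (expandsTo_r1_fst.weaken (m' := 0) (by simp))).add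
      ((hc c2 1 Prod.fst).mul expandsTo_r1_snd.swap)).add ((hc c3 1 Prod.fst).mul (hR 1 Prod.fst))
    have h' := (h.inv fun ν p _ hp => ?_).expands
    · simpa [r1_swap] using h'
    · have hpos := r12_pos hp
      have : ‖p.1 - p.2‖ = r12 p := by rw [r12, dist_eq_norm]
      simp [this]
      rw [← add_mul]; positivity
  · have h := (((hc c1 1 Prod.snd).mul expandsTo_r1_snd).add
      ((hc c2 1 Prod.snd).mul (expandsTo_r1_fst.swap.weaken (m' := 0) (by simp)))).add
      ((hc c3 1 Prod.snd).mul (hR 1 Prod.snd))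
    have h' := (h.inv fun ν p _ hp => ?_).expands
    · simpa [r1_swap] using h'
    · have hpos := r12_pos hp
      have : ‖p.2 - p.1‖ = r12 p := by rw [r12, dist_comm, dist_eq_norm]
      simp [this]
      rw [← add_mul]; positivity
  · have h := (((hc c1 (-1) (fun _ => 0)).mul expandsTo_r1_inf).add
      ((hc c2 (-1) (fun _ => 0)).mul expandsTo_r1_inf.swap)).add
      (((hc c3 (-1) (fun _ => 0)).mul (hR (-1) (fun _ => 0))).weaken (m' := 0 + -1) (by simp))
    have h' := (h.inv fun ν p hν _ => ?_).expands
    · simpa [r1_swap] using h'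
    · have hpos := norm_pos_iff.2 hν
      simp
      rw [← add_mul]; positivity

/-- The inverse of `r1 + r2 + r12`. -/
def invPerim (p : E6) (x : E3) : ℝ := (r1 p x + r2 p x + r12 p)⁻¹

lemma nice_invPerim : Nice 0 0 1 invPerim := by
  have h := nice_inv_sum 1 1 1 (by simp) (by simp) (by simp) (by simp) (by simp) (by simp)
  simp only [one_mul] at h
  exact h

lemma nice_inv_r2_add : Nice 0 0 1 fun p x => (r2 p x + r12 p)⁻¹ := by
  simpa using nice_inv_sum 0 1 1 (by simp) (by simp) (by simp) (by simp) (by simp) (by simp)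

lemma nice_inv_r1_add_r2 : Nice 0 0 1 fun p x => (r1 p x + r2 p x)⁻¹ := by
  simpa using nice_inv_sum 1 1 0 (by simp) (by simp) (by simp) (by simp) (by simp) (by simp)

/-! ### Differential calculus of the elementary functions -/

/-- `f` is differentiable at `x` with partial derivatives `g`. -/
def HasPD (f : Fn) (x : E3) (g : Fin 3 → ℝ) : Prop :=
  DiffAt f x ∧ ∀ k, pd k f x = g k

namespace HasPD

variable {f f' : Fn} {g g' : Fin 3 → ℝ}

lemma add (h : HasPD f x g) (h' : HasPD f' x g') :
    HasPD (fun z => f z + f' z) x fun k => g k + g' k :=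
  ⟨h.1.add h'.1, fun k => by rw [pd_add h.1 h'.1, h.2, h'.2]⟩

lemma sub (h : HasPD f x g) (h' : HasPD f' x g') :
    HasPD (fun z => f z - f' z) x fun k => g k - g' k :=
  ⟨h.1.sub h'.1, fun k => by rw [pd_sub h.1 h'.1, h.2, h'.2]⟩

lemma neg (h : HasPD f x g) : HasPD (fun z => -f z) x fun k => -g k :=
  ⟨h.1.neg, fun k => by rw [pd_neg, h.2]⟩

lemma mul (h : HasPD f x g) (h' : HasPD f' x g') :
    HasPD (fun z => f z * f' z) x fun k => g k * f' x + f x * g' k :=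
  ⟨h.1.mul h'.1, fun k => by rw [pd_mul h.1 h'.1, h.2, h'.2]⟩

lemma const (c : ℝ) : HasPD (fun _ => c) x fun _ => 0 :=
  ⟨differentiableAt_const c, fun _ => pd_const c⟩

lemma const_mul (c : ℝ) (h : HasPD f x g) : HasPD (fun z => c * f z) x fun k => c * g k :=
  ⟨h.1.const_mul c, fun k => by rw [pd_const_mul c h.1, h.2]⟩

lemma comp {φ : ℝ → ℝ} {φ' : ℝ} (hφ : HasDerivAt φ φ' (f x)) (h : HasPD f x g) :
    HasPD (fun z => φ (f z)) x fun k => φ' * g k :=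
  ⟨hφ.differentiableAt.comp x h.1, fun k => by rw [pd_comp hφ h.1, h.2]⟩

lemma inv (h : HasPD f x g) (h0 : f x ≠ 0) :
    HasPD (fun z => (f z)⁻¹) x fun k => -(f x ^ 2)⁻¹ * g k := by
  simpa using h.comp (hasDerivAt_inv h0)

lemma pow (h : HasPD f x g) (n : ℕ) :
    HasPD (fun z => f z ^ n) x fun k => n * f x ^ (n - 1) * g k :=
  h.comp (hasDerivAt_pow n (f x))

lemma coord (i : Fin 3) : HasPD (fun z : E3 => z i) x fun k => if k = i then 1 else 0 :=
  ⟨differentiableAt_coord i, fun _ => pd_coord i⟩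

lemma congr (h : HasPD f x g) (hf : f' =ᶠ[𝓝 x] f) (hg : ∀ k, g' k = g k) : HasPD f' x g' :=
  ⟨h.1.congr_of_eventuallyEq hf, fun k => by rw [pd_congr hf, h.2, hg]⟩

end HasPD

lemma hasPD_dist {x c : E3} (h : x ≠ c) :
    HasPD (fun z => dist z c) x fun k => (x k - c k) * (dist x c)⁻¹ := by
  have hd : DiffAt (fun z => dist z c) x :=
    DifferentiableAt.dist ℝ differentiableAt_id (differentiableAt_const c) h
  have h0 : dist x c ≠ 0 := (dist_pos.2 h).ne'
  refine ⟨hd, fun k => ?_⟩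
  have hsq : ∀ z, dist z c * dist z c = ∑ j, (z j - c j) * (z j - c j) := by
    intro z
    rw [EuclideanSpace.dist_eq, Real.mul_self_sqrt (by positivity)]
    refine sum_congr rfl fun j _ => ?_
    rw [Real.dist_eq, ← sq, sq_abs]
  have h1 : pd k (fun z => dist z c * dist z c) x = 2 * dist x c * pd k (fun z => dist z c) x := by
    rw [pd_mul hd hd]; ring
  have h2 : pd k (fun z => dist z c * dist z c) x = 2 * (x k - c k) := by
    simp_rw [hsq]
    have hc : ∀ j, HasPD (fun z => (z j - c j)) x fun k => (if k = j then 1 else 0) - 0 :=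
      fun j => (HasPD.coord j).sub (HasPD.const (c j))
    rw [pd_sum fun j _ => ((hc j).mul (hc j)).1]
    simp_rw [((hc _).mul (hc _)).2 k]
    fin_cases k <;> simp [Fin.sum_univ_three] <;> ring
  rw [h2] at h1
  field_simp
  linarith

/-- The Kronecker symbol. -/
def δ (i j : Fin 3) : ℝ := if i = j then 1 else 0

lemma hasPD_r1 (h : x ≠ p.1) : HasPD (r1 p) x fun k => n1 k p x := hasPD_dist h
lemma hasPD_r2 (h : x ≠ p.2) : HasPD (r2 p) x fun k => n2 k p x := hasPD_dist h

lemma hasPD_inv_r1 (h : x ≠ p.1) :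
    HasPD (fun z => (r1 p z)⁻¹) x fun k => -(r1 p x ^ 2)⁻¹ * n1 k p x :=
  (hasPD_r1 h).inv (r1_pos h).ne'
lemma hasPD_inv_r2 (h : x ≠ p.2) :
    HasPD (fun z => (r2 p z)⁻¹) x fun k => -(r2 p x ^ 2)⁻¹ * n2 k p x :=
  (hasPD_r2 h).inv (r2_pos h).ne'

lemma hasPD_n1 (h : x ≠ p.1) (i : Fin 3) :
    HasPD (n1 i p) x fun k => (δ k i - n1 k p x * n1 i p x) * (r1 p x)⁻¹ := by
  refine ((((HasPD.coord i).sub (HasPD.const (p.1 i))).mul (hasPD_inv_r1 h)).congr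
    (.of_forall fun z => rfl) fun k => ?_)
  have := (r1_pos h).ne'
  simp only [n1, δ]; field_simp; ring

lemma hasPD_n2 (h : x ≠ p.2) (i : Fin 3) :
    HasPD (n2 i p) x fun k => (δ k i - n2 k p x * n2 i p x) * (r2 p x)⁻¹ :=
  hasPD_n1 (p := p.swap) h i

lemma hasPD_invPerim (o : Off p x) :
    HasPD (invPerim p) x fun k => -(invPerim p x ^ 2) * (n1 k p x + n2 k p x) := by
  obtain ⟨a, b, c⟩ := o.pos
  have h := (((hasPD_r1 o.2).add (hasPD_r2 o.3)).add (HasPD.const (r12 p))).inv (by positivity)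
  refine h.congr (.of_forall fun z => rfl) fun k => ?_
  simp only [invPerim, inv_pow]; ring

/-! #### Scalar products -/

lemma sum_sq_eq_dist (x c : E3) : ∑ k, (x k - c k) ^ 2 = dist x c ^ 2 := by
  rw [EuclideanSpace.dist_eq, Real.sq_sqrt (by positivity)]
  refine sum_congr rfl fun j _ => ?_
  rw [Real.dist_eq, sq_abs]

lemma r1_sq : r1 p x ^ 2 = ∑ k, (x k - p.1 k) ^ 2 := (sum_sq_eq_dist x p.1).symm
lemma r2_sq : r2 p x ^ 2 = ∑ k, (x k - p.2 k) ^ 2 := (sum_sq_eq_dist x p.2).symm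
lemma r12_sq : r12 p ^ 2 = ∑ k, (p.1 k - p.2 k) ^ 2 := (sum_sq_eq_dist p.1 p.2).symm

/-- The cosines of the angles between the three unit vectors. -/
def cos1 (p : E6) (x : E3) : ℝ := (r2 p x ^ 2 - r1 p x ^ 2 - r12 p ^ 2) / (2 * r1 p x * r12 p)
/-- The cosine of the angle between `n2` and `n12`. -/
def cos2 (p : E6) (x : E3) : ℝ := (r2 p x ^ 2 + r12 p ^ 2 - r1 p x ^ 2) / (2 * r2 p x * r12 p)
/-- The cosine of the angle between `n1` and `n2`. -/
def cos3 (p : E6) (x : E3) : ℝ :=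
  (r1 p x ^ 2 + r2 p x ^ 2 - r12 p ^ 2) / (2 * r1 p x * r2 p x)

lemma n1_n1 (h : x ≠ p.1) : ∑ k, n1 k p x * n1 k p x = 1 := by
  have := (r1_pos h).ne'
  have h2 := r1_sq (p := p) (x := x)
  simp only [n1, Fin.sum_univ_three] at *
  field_simp; linarith

lemma n2_n2 (h : x ≠ p.2) : ∑ k, n2 k p x * n2 k p x = 1 := n1_n1 (p := p.swap) h

lemma n12_n12 (h : p.1 ≠ p.2) : ∑ k, n12 k p * n12 k p = 1 :=
  n1_n1 (p := (p.2, p.2)) h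

lemma n1_n12 (hp : p.1 ≠ p.2) (h : x ≠ p.1) : ∑ k, n1 k p x * n12 k p = cos1 p x := by
  have := (r1_pos h).ne'; have := (r12_pos hp).ne'
  rw [cos1, r1_sq, r2_sq, r12_sq]
  simp only [n1, n12, Fin.sum_univ_three] at *
  field_simp; ring

lemma n2_n12 (hp : p.1 ≠ p.2) (h : x ≠ p.2) : ∑ k, n2 k p x * n12 k p = cos2 p x := by
  have := (r2_pos h).ne'; have := (r12_pos hp).ne'
  rw [cos2, r1_sq, r2_sq, r12_sq]
  simp only [n2, n12, Fin.sum_univ_three] at *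
  field_simp; ring

lemma n1_n2 (h1 : x ≠ p.1) (h : x ≠ p.2) : ∑ k, n1 k p x * n2 k p x = cos3 p x := by
  have := (r2_pos h).ne'; have := (r1_pos h1).ne'
  rw [cos3, r1_sq, r2_sq, r12_sq]
  simp only [n2, n1, Fin.sum_univ_three] at *
  field_simp; ring

lemma n2_eq (o : Off p x) (k : Fin 3) :
    n2 k p x = (r1 p x * n1 k p x + r12 p * n12 k p) * (r2 p x)⁻¹ := by
  have := (r1_pos o.2).ne'; have := (r2_pos o.3).ne'; have := (r12_pos o.1).ne'
  simp only [n1, n2, n12]; field_simp; ring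

/-! #### The seed -/

/-- The second derivative `∂² g / ∂y1ⁱ ∂y2ʲ` in closed form. -/
def hessg (i j : Fin 3) (p : E6) (x : E3) : ℝ :=
  -(δ i j - n12 i p * n12 j p) * (r12 p)⁻¹ * invPerim p x
    + (n12 i p - n1 i p x) * (n2 j p x + n12 j p) * invPerim p x ^ 2

/-- Its trace. -/
def trg (p : E6) (x : E3) : ℝ :=
  ((r1 p x)⁻¹ * (r2 p x)⁻¹ - (r1 p x)⁻¹ * (r12 p)⁻¹ - (r2 p x)⁻¹ * (r12 p)⁻¹) / 2

/-- The seed in closed form. -/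
def sd (i j : Fin 3) (p : E6) (x : E3) : ℝ :=
  (hessg i j p x + hessg j i p x) / 2 - δ i j * trg p x / 3

lemma kernelHess_eq (o : Off p x) (i j : Fin 3) :
    kernelHess p.1 p.2 x i j = hessg i j p x := by
  obtain ⟨y1, y2⟩ := p
  obtain ⟨hp, h1, h2⟩ := o
  simp only at hp h1 h2
  have inner : ∀ a, a ≠ y2 → pd j (fun b => kernel x a b) y2 =
      (dist a x + dist x y2 + dist a y2)⁻¹ *
        (-((x j - y2 j) * (dist x y2)⁻¹) - (a j - y2 j) * (dist a y2)⁻¹) := by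
    intro a ha
    have hpos : 0 < dist x a + dist y2 x + dist y2 a := by
      have := dist_pos.2 ha.symm
      have : 0 ≤ dist x a := dist_nonneg
      have : 0 ≤ dist y2 x := dist_nonneg
      linarith
    have h := (((HasPD.const (dist x a)).add (hasPD_dist h2.symm)).add
      (hasPD_dist ha.symm)).comp (Real.hasDerivAt_log hpos.ne')
    have hk : (fun b => kernel x a b) = fun b => Real.log (dist x a + dist b x + dist b a) := by
      funext b; rw [kernel, dist_comm b x, dist_comm b a]
    rw [hk, h.2 j, dist_comm x a, dist_comm y2 x, dist_comm y2 a]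
    ring
  have hev : (fun a => pd j (fun b => kernel x a b) y2) =ᶠ[𝓝 y1] fun a =>
      (dist a x + dist x y2 + dist a y2)⁻¹ *
        (-((x j - y2 j) * (dist x y2)⁻¹) - (a j - y2 j) * (dist a y2)⁻¹) := by
    filter_upwards [isOpen_ne.mem_nhds hp] with a ha using inner a ha
  have hR : dist y1 y2 ≠ 0 := (dist_pos.2 hp).ne'
  have hd : dist y1 x ≠ 0 := (dist_pos.2 h1.symm).ne'
  have hd2 : dist x y2 ≠ 0 := (dist_pos.2 h2).ne'
  have hS : 0 < dist y1 x + dist x y2 + dist y1 y2 := by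
    have := dist_pos.2 hp
    have : 0 ≤ dist y1 x := dist_nonneg
    have : 0 ≤ dist x y2 := dist_nonneg
    linarith
  have h := ((((hasPD_dist h1.symm).add (HasPD.const (dist x y2))).add (hasPD_dist hp)).inv
    hS.ne').mul ((HasPD.const (-((x j - y2 j) * (dist x y2)⁻¹))).sub
    (((HasPD.coord j).sub (HasPD.const (y2 j))).mul ((hasPD_dist hp).inv hR)))
  rw [kernelHess, pd_congr hev, h.2 i]
  simp only [hessg, invPerim, n1, n2, n12, r1, r2, r12, δ]
  rw [dist_comm x y1]
  have hS' := hS.ne'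
  set S := dist y1 x + dist x y2 + dist y1 y2
  field_simp
  ring

lemma trace_hessg (o : Off p x) :
    ∑ k, hessg k k p x = trg p x := by
  obtain ⟨a, b, c⟩ := o.pos
  have e1 := n12_n12 o.1
  have e2 := n1_n2 o.2 o.3
  have e3 := n1_n12 o.1 o.2
  have e4 := n2_n12 o.1 o.3
  have h : ∑ k, hessg k k p x = -2 * (r12 p)⁻¹ * invPerim p x
      + (cos2 p x + 1 - cos3 p x - cos1 p x) * invPerim p x ^ 2 := by
    simp only [hessg, δ, Fin.sum_univ_three, if_true] at *
    linear_combination ((r12 p)⁻¹ * invPerim p x + invPerim p x ^ 2) * e1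
      - invPerim p x ^ 2 * e2 - invPerim p x ^ 2 * e3 + invPerim p x ^ 2 * e4
  rw [h, trg, invPerim, cos1, cos2, cos3]
  have : r1 p x + r2 p x + r12 p ≠ 0 := by positivity
  field_simp
  ring

lemma seed_eq (o : Off p x) (i j : Fin 3) :
    seed p.1 p.2 x i j = sd i j p x := by
  simp only [seed, Matrix.of_apply, kernelHess_eq o, trace_hessg o, sd, δ]
  split_ifs <;> ring

lemma nice_hessg (i j : Fin 3) : Nice 0 0 1 (hessg i j) := by
  have h1 : Nice 0 0 1 fun p x => -(δ i j - n12 i p * n12 j p) * (r12 p)⁻¹ * invPerim p x :=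
    ((((nice_const _).sub ((nice_n12 i).mul' (nice_n12 j))).neg).mul'
      nice_inv_r12 (k'' := 0) (l'' := 0) (m'' := 0)).mul' nice_invPerim
  have h2 : Nice 0 0 1 fun p x => (n12 i p - n1 i p x) * (n2 j p x + n12 j p) * invPerim p x ^ 2 := by
    simp only [sq]
    exact (((nice_n12 i).sub (nice_n1 i)).mul' ((nice_n2 j).add (nice_n12 j))
      (k'' := 0) (l'' := 0) (m'' := 0)).mul' (nice_invPerim.mul' nice_invPerim
        (k'' := 0) (l'' := 0) (m'' := 1))
  exact h1.add h2

lemma nice_trg : Nice 0 0 1 trg := by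
  refine (nice_sum univ fun k _ => nice_hessg k k).congr fun p x o => ?_
  rw [trace_hessg o]

lemma nice_sd (i j : Fin 3) : Nice 0 0 1 (sd i j) := by
  have h := (((nice_hessg i j).add (nice_hessg j i)).const_mul (1 / 2)).sub
    (nice_trg.const_mul (δ i j / 3))
  refine h.congr fun p x _ => ?_
  simp only [sd]; ring

lemma sd_symm (i j : Fin 3) (p : E6) (x : E3) : sd i j p x = sd j i p x := by
  simp only [sd, δ, eq_comm]; ring

lemma sd_trace (o : Off p x) :
    ∑ k, sd k k p x = 0 := by
  have := trace_hessg o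
  simp only [sd, δ, Fin.sum_univ_three, if_true] at *
  linarith

/-! ### Divergence and Laplacian of the seed -/

lemma hasPD_hessg (o : Off p x) (i j : Fin 3) :
    HasPD (hessg i j p) x fun k =>
      (δ i j - n12 i p * n12 j p) * (r12 p)⁻¹ * invPerim p x ^ 2 * (n1 k p x + n2 k p x)
      - (δ k i - n1 k p x * n1 i p x) * (r1 p x)⁻¹ * (n2 j p x + n12 j p) * invPerim p x ^ 2
      + (n12 i p - n1 i p x) * (δ k j - n2 k p x * n2 j p x) * (r2 p x)⁻¹ * invPerim p x ^ 2
      - 2 * (n12 i p - n1 i p x) * (n2 j p x + n12 j p) * invPerim p x ^ 3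
        * (n1 k p x + n2 k p x) := by
  have hS := hasPD_invPerim o
  have h := (hS.const_mul (-(δ i j - n12 i p * n12 j p) * (r12 p)⁻¹)).add
    ((((HasPD.const (n12 i p)).sub (hasPD_n1 o.2 i)).mul
      ((hasPD_n2 o.3 j).add (HasPD.const (n12 j p)))).mul (hS.pow 2))
  refine h.congr (.of_forall fun z => rfl) fun k => ?_
  push_cast
  ring

lemma hasPD_trg (h1 : x ≠ p.1) (h2 : x ≠ p.2) :
    HasPD (trg p) x fun k =>
      (-(r1 p x ^ 2)⁻¹ * n1 k p x * ((r2 p x)⁻¹ - (r12 p)⁻¹)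
        - (r2 p x ^ 2)⁻¹ * n2 k p x * ((r1 p x)⁻¹ - (r12 p)⁻¹)) / 2 := by
  have a := hasPD_inv_r1 h1
  have b := hasPD_inv_r2 h2
  have h := (((a.mul b).sub (a.mul (HasPD.const (r12 p)⁻¹))).sub
    (b.mul (HasPD.const (r12 p)⁻¹))).const_mul (1 / 2)
  refine h.congr (.of_forall fun z => ?_) fun k => ?_
  · simp only [trg]; ring
  · ring

lemma δ_comm (i j : Fin 3) : δ i j = δ j i := by simp [δ, eq_comm]

lemma sum_δ_mul (j : Fin 3) (f : Fin 3 → ℝ) : ∑ i, δ i j * f i = f j := by simp [δ]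

lemma hasPD_sd (o : Off p x) (i j : Fin 3) :
    HasPD (sd i j p) x fun k =>
      (pd k (hessg i j p) x + pd k (hessg j i p) x) / 2 - δ i j * pd k (trg p) x / 3 := by
  have a := hasPD_hessg o i j
  have b := hasPD_hessg o j i
  have c := hasPD_trg o.2 o.3
  have h := ((a.add b).const_mul (1 / 2)).sub (c.const_mul (δ i j / 3))
  refine h.congr (.of_forall fun z => ?_) fun k => ?_
  · simp only [sd]; ring
  · rw [a.2, b.2, c.2]; ring

/-- The divergence of the seed, in closed form. -/
def divSd (j : Fin 3) (p : E6) (x : E3) : ℝ :=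
  -(n12 j p * ((r12 p) ^ 2)⁻¹ / 2) * ((r1 p x)⁻¹ - (r2 p x)⁻¹)
    + (-(r1 p x ^ 2)⁻¹ * n1 j p x * ((r2 p x)⁻¹ - (r12 p)⁻¹)
        - (r2 p x ^ 2)⁻¹ * n2 j p x * ((r1 p x)⁻¹ - (r12 p)⁻¹)) / 12

lemma sum_pd_hessg (o : Off p x) (j : Fin 3) :
    ∑ i, pd i (hessg i j p) x =
      (n1 j p x + n2 j p x - n12 j p * (cos1 p x + cos2 p x)) * (r12 p)⁻¹ * invPerim p x ^ 2
      - 2 * (r1 p x)⁻¹ * (n2 j p x + n12 j p) * invPerim p x ^ 2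
      + (n12 j p - n1 j p x - (cos2 p x - cos3 p x) * n2 j p x) * (r2 p x)⁻¹ * invPerim p x ^ 2
      - 2 * (cos1 p x + cos2 p x - 1 - cos3 p x) * (n2 j p x + n12 j p) * invPerim p x ^ 3 := by
  have e0 := n1_n1 o.2
  have e2 := n1_n2 o.2 o.3
  have e3 := n1_n12 o.1 o.2
  have e4 := n2_n12 o.1 o.3
  have d1 := sum_δ_mul j fun i => n1 i p x
  have d2 := sum_δ_mul j fun i => n2 i p x
  have d3 := sum_δ_mul j fun i => n12 i p
  simp_rw [(hasPD_hessg o _ j).2]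
  have dd : ∀ i, δ i i = 1 := fun i => by simp [δ]
  simp only [Fin.sum_univ_three, dd] at *
  linear_combination ((r12 p)⁻¹ * invPerim p x ^ 2 - (r2 p x)⁻¹ * invPerim p x ^ 2) * d1
    + (r12 p)⁻¹ * invPerim p x ^ 2 * d2 + (r2 p x)⁻¹ * invPerim p x ^ 2 * d3
    + ((r1 p x)⁻¹ * (n2 j p x + n12 j p) * invPerim p x ^ 2
      + 2 * (n2 j p x + n12 j p) * invPerim p x ^ 3) * e0
    + (2 * (n2 j p x + n12 j p) * invPerim p x ^ 3 + n2 j p x * (r2 p x)⁻¹ * invPerim p x ^ 2) * e2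
    - (n12 j p * (r12 p)⁻¹ * invPerim p x ^ 2
      + 2 * (n2 j p x + n12 j p) * invPerim p x ^ 3) * e3
    - (n12 j p * (r12 p)⁻¹ * invPerim p x ^ 2 + n2 j p x * (r2 p x)⁻¹ * invPerim p x ^ 2
      + 2 * (n2 j p x + n12 j p) * invPerim p x ^ 3) * e4

lemma hessg_swap (i j : Fin 3) (p : E6) (x : E3) : hessg i j p.swap x = hessg j i p x := by
  have h1 : r12 p.swap = r12 p := dist_comm _ _
  have h2 : ∀ k, n12 k p.swap = -n12 k p := fun k => by
    simp only [n12, h1]; simp; ring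
  have h3 : invPerim p.swap x = invPerim p x := by
    simp only [invPerim, h1]; simp only [r1, r2, Prod.fst_swap, Prod.snd_swap]; ring
  have h4 : ∀ k, n1 k p.swap x = n2 k p x := fun _ => rfl
  have h5 : ∀ k, n2 k p.swap x = n1 k p x := fun _ => rfl
  simp only [hessg, h1, h2, h3, h4, h5, δ_comm i j]; ring

lemma cos1_swap : cos1 p.swap x = -cos2 p x := by
  have h1 : r12 p.swap = r12 p := dist_comm _ _
  simp only [cos1, cos2, h1]; simp only [r1, r2, Prod.fst_swap, Prod.snd_swap]
  rw [← neg_div]; congr 1; ring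

lemma cos2_swap : cos2 p.swap x = -cos1 p x := by
  have := cos1_swap (p := p.swap) (x := x)
  simp only [Prod.swap_swap] at this; linarith

lemma cos3_swap : cos3 p.swap x = cos3 p x := by
  have h1 : r12 p.swap = r12 p := dist_comm _ _
  simp only [cos3, h1]; simp only [r1, r2, Prod.fst_swap, Prod.snd_swap]; ring

lemma n12_swap (k : Fin 3) : n12 k p.swap = -n12 k p := by
  have h1 : r12 p.swap = r12 p := dist_comm _ _
  simp only [n12, h1]; simp; ring

lemma invPerim_swap : invPerim p.swap x = invPerim p x := by
  have h1 : r12 p.swap = r12 p := dist_comm _ _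
  simp only [invPerim, h1]; simp only [r1, r2, Prod.fst_swap, Prod.snd_swap]; ring

lemma sum_pd_hessg_comm (o : Off p x) (j : Fin 3) :
    ∑ i, pd i (hessg j i p) x =
      (n1 j p x + n2 j p x - n12 j p * (cos1 p x + cos2 p x)) * (r12 p)⁻¹ * invPerim p x ^ 2
      - 2 * (r2 p x)⁻¹ * (n1 j p x - n12 j p) * invPerim p x ^ 2
      + (-n12 j p - n2 j p x - (-cos1 p x - cos3 p x) * n1 j p x) * (r1 p x)⁻¹ * invPerim p x ^ 2
      - 2 * (-cos1 p x - cos2 p x - 1 - cos3 p x) * (n1 j p x - n12 j p) * invPerim p x ^ 3 := by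
  have h := sum_pd_hessg o.swap j
  have hf : ∀ i, hessg i j p.swap = hessg j i p := fun i => funext fun z => hessg_swap i j p z
  have h1' : r12 p.swap = r12 p := dist_comm _ _
  simp only [hf, cos1_swap, cos2_swap, cos3_swap, n12_swap, invPerim_swap, h1'] at h
  rw [h]
  have h4 : ∀ k, n1 k p.swap x = n2 k p x := fun _ => rfl
  have h5 : ∀ k, n2 k p.swap x = n1 k p x := fun _ => rfl
  have h6 : r1 p.swap x = r2 p x := rfl
  have h7 : r2 p.swap x = r1 p x := rfl
  rw [h4, h5, h6, h7]; ring

lemma div_sd (o : Off p x) (j : Fin 3) :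
    ∑ i, pd i (sd i j p) x = divSd j p x := by
  obtain ⟨a, b, c⟩ := o.pos
  have h : ∑ i, pd i (sd i j p) x = (∑ i, pd i (hessg i j p) x + ∑ i, pd i (hessg j i p) x) / 2
      - pd j (trg p) x / 3 := by
    have d := sum_δ_mul j fun i => pd i (trg p) x
    simp_rw [(hasPD_sd o _ j).2]
    simp only [Fin.sum_univ_three] at *
    linear_combination -(1 / 3) * d
  rw [h, sum_pd_hessg o, sum_pd_hessg_comm o, (hasPD_trg o.2 o.3).2, divSd]
  beta_reduce
  rw [n2_eq o j, cos1, cos2, cos3, invPerim]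
  have : r1 p x + r2 p x + r12 p ≠ 0 := by positivity
  generalize n1 j p x = u at *
  generalize n12 j p = v at *
  generalize r1 p x = a at *
  generalize r2 p x = b at *
  generalize r12 p = c at *
  field_simp
  ring

lemma hasPD_divSd (o : Off p x) (j : Fin 3) :
    HasPD (divSd j p) x fun k =>
      -(n12 j p * ((r12 p) ^ 2)⁻¹ / 2) * (-(r1 p x ^ 2)⁻¹ * n1 k p x + (r2 p x ^ 2)⁻¹ * n2 k p x)
      + (2 * (r1 p x ^ 3)⁻¹ * n1 k p x * n1 j p x * ((r2 p x)⁻¹ - (r12 p)⁻¹)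
        - (r1 p x ^ 3)⁻¹ * (δ k j - n1 k p x * n1 j p x) * ((r2 p x)⁻¹ - (r12 p)⁻¹)
        + (r1 p x ^ 2)⁻¹ * n1 j p x * (r2 p x ^ 2)⁻¹ * n2 k p x
        + 2 * (r2 p x ^ 3)⁻¹ * n2 k p x * n2 j p x * ((r1 p x)⁻¹ - (r12 p)⁻¹)
        - (r2 p x ^ 3)⁻¹ * (δ k j - n2 k p x * n2 j p x) * ((r1 p x)⁻¹ - (r12 p)⁻¹)
        + (r2 p x ^ 2)⁻¹ * n2 j p x * (r1 p x ^ 2)⁻¹ * n1 k p x) / 12 := by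
  have a := r1_pos o.2; have b := r2_pos o.3
  have A := hasPD_inv_r1 o.2
  have B := hasPD_inv_r2 o.3
  have h := ((A.sub B).const_mul (-(n12 j p * ((r12 p) ^ 2)⁻¹ / 2))).add
    (((((A.pow 2).mul (hasPD_n1 o.2 j)).mul (B.sub (HasPD.const (r12 p)⁻¹))).add
      (((B.pow 2).mul (hasPD_n2 o.3 j)).mul (A.sub (HasPD.const (r12 p)⁻¹)))).const_mul (-1 / 12))
  refine h.congr (.of_forall fun z => ?_) fun k => ?_
  · simp only [divSd, inv_pow]; ring
  · push_cast
    field_simp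
    ring

/-- The double divergence of the seed, in closed form. -/
def divDivSd (p : E6) (x : E3) : ℝ :=
  ((r2 p x ^ 2 - r1 p x ^ 2 - r12 p ^ 2) / (r1 p x ^ 3 * r12 p ^ 3)
    + (r1 p x ^ 2 - r2 p x ^ 2 - r12 p ^ 2) / (r2 p x ^ 3 * r12 p ^ 3)) / 4
    + (r1 p x ^ 2 + r2 p x ^ 2 - r12 p ^ 2) / (12 * r1 p x ^ 3 * r2 p x ^ 3)

lemma div_divSd (o : Off p x) :
    ∑ j, pd j (divSd j p) x = divDivSd p x := by
  obtain ⟨a, b, c⟩ := o.pos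
  have e0 := n1_n1 o.2
  have e1 := n2_n2 o.3
  have e2 := n1_n2 o.2 o.3
  have e3 := n1_n12 o.1 o.2
  have e4 := n2_n12 o.1 o.3
  have dd : ∀ i, δ i i = 1 := fun i => by simp [δ]
  have h : ∑ j, pd j (divSd j p) x =
      (((r12 p) ^ 2)⁻¹ / 2) * ((r1 p x ^ 2)⁻¹ * cos1 p x - (r2 p x ^ 2)⁻¹ * cos2 p x)
      + (r1 p x ^ 2)⁻¹ * (r2 p x ^ 2)⁻¹ * cos3 p x / 6 := by
    simp_rw [(hasPD_divSd o _).2]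
    simp only [Fin.sum_univ_three, dd] at *
    linear_combination (((r12 p) ^ 2)⁻¹ / 2) * ((r1 p x ^ 2)⁻¹ * e3 - (r2 p x ^ 2)⁻¹ * e4)
      + (r1 p x ^ 2)⁻¹ * (r2 p x ^ 2)⁻¹ / 6 * e2
      + (r1 p x ^ 3)⁻¹ * ((r2 p x)⁻¹ - (r12 p)⁻¹) / 4 * e0
      + (r2 p x ^ 3)⁻¹ * ((r1 p x)⁻¹ - (r12 p)⁻¹) / 4 * e1
  rw [h, divDivSd, cos1, cos2, cos3]
  field_simp
  ring

lemma sd_n1_n1 (o : Off p x) :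
    ∑ i, ∑ j, sd i j p x * n1 i p x * n1 j p x =
      -(1 - cos1 p x ^ 2) * (r12 p)⁻¹ * invPerim p x
        + (cos1 p x - 1) * (cos3 p x + cos1 p x) * invPerim p x ^ 2 - trg p x / 3 := by
  have e0 := n1_n1 o.2
  have e2 := n1_n2 o.2 o.3
  have e3 := n1_n12 o.1 o.2
  have key : ∑ i, ∑ j, sd i j p x * n1 i p x * n1 j p x =
      -((∑ k, n1 k p x * n1 k p x) - (∑ k, n1 k p x * n12 k p) ^ 2) * (r12 p)⁻¹ * invPerim p x
      + ((∑ k, n1 k p x * n12 k p) - ∑ k, n1 k p x * n1 k p x)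
        * ((∑ k, n1 k p x * n2 k p x) + ∑ k, n1 k p x * n12 k p) * invPerim p x ^ 2
      - (∑ k, n1 k p x * n1 k p x) * trg p x / 3 := by
    simp only [sd, hessg, δ, Fin.sum_univ_three]
    simp
    ring
  rw [key, e0, e2, e3]; ring

lemma nice_divSd (j : Fin 3) : Nice (-1) (-1) 2 (divSd j) := by
  refine (nice_sum univ fun i _ => (nice_sd i j).pd' i).congr
    fun p x o => ?_
  exact (div_sd o j).symm

lemma nice_divDivSd : Nice (-2) (-2) 3 divDivSd := by
  refine (nice_sum univ fun i _ => (nice_divSd i).pd' i).congr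
    fun p x o => ?_
  exact (div_divSd o).symm

/-! ### The first-order conformal factor in closed form -/

/-- The Laplacian, by components. -/
def lap (f : Fn) (x : E3) : ℝ := ∑ i, pd i (pd i f) x

/-- `f` is smooth at `x` and has Laplacian `L` there. -/
def HasLap (f : Fn) (x : E3) (L : ℝ) : Prop := SmoothAt f x ∧ lap f x = L

section

variable {f g : Fn} {L M : ℝ}

lemma pd_add_eventually (hf : SmoothAt f x) (hg : SmoothAt g x)
    (i : Fin 3) : pd i (fun z => f z + g z) =ᶠ[𝓝 x] fun z => pd i f z + pd i g z := by
  filter_upwards [eventually_diffAt hf, eventually_diffAt hg]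
    with z h1 h2 using pd_add h1 h2

lemma HasLap.add (hf : HasLap f x L) (hg : HasLap g x M) :
    HasLap (fun z => f z + g z) x (L + M) := by
  refine ⟨hf.1.add hg.1, ?_⟩
  rw [← hf.2, ← hg.2, lap, lap, lap, ← sum_add_distrib]
  refine sum_congr rfl fun i _ => ?_
  rw [pd_congr (pd_add_eventually hf.1 hg.1 i), pd_add (diffAt (contDiffAt_pd hf.1))
    (diffAt (contDiffAt_pd hg.1))]

lemma HasLap.const_mul (c : ℝ) (hf : HasLap f x L) : HasLap (fun z => c * f z) x (c * L) := by
  refine ⟨contDiffAt_const.mul hf.1, ?_⟩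
  rw [← hf.2, lap, lap, mul_sum]
  refine sum_congr rfl fun i _ => ?_
  have h : pd i (fun z => c * f z) =ᶠ[𝓝 x] fun z => c * pd i f z := by
    filter_upwards [eventually_diffAt hf.1] with z h1 using pd_const_mul c h1
  rw [pd_congr h, pd_const_mul c (diffAt (contDiffAt_pd hf.1))]

lemma HasLap.congr (hf : HasLap f x L) (h : g =ᶠ[𝓝 x] f) : HasLap g x L := by
  refine ⟨hf.1.congr_of_eventuallyEq h, ?_⟩
  rw [← hf.2, lap, lap]
  refine sum_congr rfl fun i _ => pd_congr ?_
  filter_upwards [h.eventually_nhds] with z hz using pd_congr hz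

lemma hasLap_const (c : ℝ) : HasLap (fun _ => c) x 0 := by
  refine ⟨contDiffAt_const, ?_⟩
  have : ∀ i : Fin 3, pd i (fun _ => c) = fun _ => 0 := fun i => funext fun z => pd_const c
  simp [lap, this, pd_const]

lemma smooth_r1 (h : x ≠ p.1) : SmoothAt (r1 p) x :=
  ContDiffAt.dist ℝ contDiffAt_id contDiffAt_const h
lemma smooth_r2 (h : x ≠ p.2) : SmoothAt (r2 p) x :=
  ContDiffAt.dist ℝ contDiffAt_id contDiffAt_const h

lemma smooth_zpow (hf : SmoothAt f x) (h0 : f x ≠ 0) (m : ℤ) :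
    SmoothAt (fun z => f z ^ m) x := by
  cases m with
  | ofNat n => simpa using hf.pow n
  | negSucc n =>
    refine ((hf.pow (n + 1)).inv (pow_ne_zero _ h0)).congr_of_eventuallyEq
      (.of_forall fun z => ?_)
    exact zpow_negSucc (f z) n

lemma HasPD.zpow {G : Fin 3 → ℝ} (h : HasPD f x G) (h0 : f x ≠ 0) (m : ℤ) :
    HasPD (fun z => f z ^ m) x fun k => m * f x ^ (m - 1) * G k :=
  h.comp (hasDerivAt_zpow m (f x) (Or.inl h0))

lemma eventually_ne (c : E3) (h : x ≠ c) : ∀ᶠ z in 𝓝 x, z ≠ c := isOpen_ne.mem_nhds h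

lemma hasPD_monomial (h1 : x ≠ p.1) (h2 : x ≠ p.2) (m n : ℤ) :
    HasPD (fun z => r1 p z ^ m * r2 p z ^ n) x fun k =>
      m * (r1 p x ^ (m - 1) * r2 p x ^ n) * n1 k p x
        + n * (r1 p x ^ m * r2 p x ^ (n - 1)) * n2 k p x := by
  refine (((hasPD_r1 h1).zpow (r1_pos h1).ne' m).mul
    ((hasPD_r2 h2).zpow (r2_pos h2).ne' n)).congr (.of_forall fun _ => rfl) fun k => ?_
  ring

lemma div_monomial1 (h1 : x ≠ p.1) (h2 : x ≠ p.2) (m n : ℤ) :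
    ∑ k, pd k (fun z => r1 p z ^ m * r2 p z ^ n * n1 k p z) x =
      (m + 2) * (r1 p x ^ (m - 1) * r2 p x ^ n)
        + n * (r1 p x ^ m * r2 p x ^ (n - 1)) * cos3 p x := by
  have a := (r1_pos h1).ne'
  simp_rw [((hasPD_monomial h1 h2 m n).mul (hasPD_n1 h1 _)).2]
  have e0 := n1_n1 h1
  have e2 := n1_n2 h1 h2
  have dd : ∀ i, δ i i = 1 := fun i => by simp [δ]
  have hz : r1 p x ^ m * (r1 p x)⁻¹ = r1 p x ^ (m - 1) := by rw [zpow_sub_one₀ a]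
  simp only [Fin.sum_univ_three, dd] at *
  linear_combination (m * (r1 p x ^ (m - 1) * r2 p x ^ n) - r1 p x ^ m * r2 p x ^ n * (r1 p x)⁻¹) * e0
    + n * (r1 p x ^ m * r2 p x ^ (n - 1)) * e2 + 2 * r2 p x ^ n * hz

lemma div_monomial2 (h1 : x ≠ p.1) (h2 : x ≠ p.2) (m n : ℤ) :
    ∑ k, pd k (fun z => r1 p z ^ m * r2 p z ^ n * n2 k p z) x =
      (n + 2) * (r1 p x ^ m * r2 p x ^ (n - 1))
        + m * (r1 p x ^ (m - 1) * r2 p x ^ n) * cos3 p x := by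
  have h := div_monomial1 (p := p.swap) h2 h1 n m
  rw [cos3_swap] at h
  have e : ∀ k : Fin 3, (fun z => r1 p z ^ m * r2 p z ^ n * n2 k p z)
      = fun z => r1 p.swap z ^ n * r2 p.swap z ^ m * n1 k p.swap z := fun k => by
    funext z; simp only [r1, r2, n1, n2, Prod.fst_swap, Prod.snd_swap]; ring
  simp_rw [e, h]
  simp only [r1, r2, Prod.fst_swap, Prod.snd_swap]; ring

lemma hasLap_monomial (h1 : x ≠ p.1) (h2 : x ≠ p.2) (m n : ℤ) :
    HasLap (fun z => r1 p z ^ m * r2 p z ^ n) x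
      (m * (m + 1) * (r1 p x ^ (m - 2) * r2 p x ^ n)
        + n * (n + 1) * (r1 p x ^ m * r2 p x ^ (n - 2))
        + 2 * m * n * (r1 p x ^ (m - 1) * r2 p x ^ (n - 1)) * cos3 p x) := by
  refine ⟨(smooth_zpow (smooth_r1 h1) (r1_pos h1).ne' m).mul
    (smooth_zpow (smooth_r2 h2) (r2_pos h2).ne' n), ?_⟩
  have hev : ∀ k, pd k (fun z => r1 p z ^ m * r2 p z ^ n) =ᶠ[𝓝 x] fun z =>
      m * (r1 p z ^ (m - 1) * r2 p z ^ n * n1 k p z)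
        + n * (r1 p z ^ m * r2 p z ^ (n - 1) * n2 k p z) := by
    intro k
    filter_upwards [eventually_ne p.1 h1, eventually_ne p.2 h2] with z hz1 hz2
    rw [(hasPD_monomial hz1 hz2 m n).2]; ring
  have d1 : ∀ k, DiffAt (fun z => r1 p z ^ (m - 1) * r2 p z ^ n * n1 k p z) x :=
    fun k => ((hasPD_monomial h1 h2 (m - 1) n).mul (hasPD_n1 h1 k)).1
  have d2 : ∀ k, DiffAt (fun z => r1 p z ^ m * r2 p z ^ (n - 1) * n2 k p z) x :=
    fun k => ((hasPD_monomial h1 h2 m (n - 1)).mul (hasPD_n2 h2 k)).1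
  rw [lap]
  simp_rw [pd_congr (hev _)]
  simp_rw [pd_add ((d1 _).const_mul _) ((d2 _).const_mul _), pd_const_mul _ (d1 _),
    pd_const_mul _ (d2 _)]
  rw [sum_add_distrib, ← mul_sum, ← mul_sum, div_monomial1 h1 h2,
    div_monomial2 h1 h2]
  have em : m - 1 - 1 = m - 2 := by ring
  have en : n - 1 - 1 = n - 2 := by ring
  rw [em, en]; push_cast; ring

end

/-- A Laurent polynomial in `r1`, `r2`, `r12`, homogeneous of degree `k`: the entry `(m, n, c)`
stands for the monomial `c r1 ^ m r2 ^ n`. -/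
def laurent (L : List (ℤ × ℤ × ℝ)) (k : ℤ) (p : E6) (x : E3) : ℝ :=
  (L.map fun t => t.2.2 * r12 p ^ (k - t.1 - t.2.1) * (r1 p x ^ t.1 * r2 p x ^ t.2.1)).sum

lemma hasLap_laurent (h1 : x ≠ p.1) (h2 : x ≠ p.2)
    (L : List (ℤ × ℤ × ℝ)) (k : ℤ) :
    HasLap (laurent L k p) x (L.map fun t => t.2.2 * r12 p ^ (k - t.1 - t.2.1) *
      (t.1 * (t.1 + 1) * (r1 p x ^ (t.1 - 2) * r2 p x ^ t.2.1)
        + t.2.1 * (t.2.1 + 1) * (r1 p x ^ t.1 * r2 p x ^ (t.2.1 - 2))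
        + 2 * t.1 * t.2.1 * (r1 p x ^ (t.1 - 1) * r2 p x ^ (t.2.1 - 1)) * cos3 p x)).sum := by
  induction L with
  | nil => exact hasLap_const 0
  | cons t L ih =>
    exact (((hasLap_monomial h1 h2 t.1 t.2.1).const_mul
      (t.2.2 * r12 p ^ (k - t.1 - t.2.1))).add ih)

lemma div_laurent (h1 : x ≠ p.1) (h2 : x ≠ p.2)
    (L M : List (ℤ × ℤ × ℝ)) (k : ℤ) :
    ∑ i, pd i (fun z => laurent L k p z * n1 i p z + laurent M k p z * n2 i p z) x =
      (L.map fun t => t.2.2 * r12 p ^ (k - t.1 - t.2.1) *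
        ((t.1 + 2) * (r1 p x ^ (t.1 - 1) * r2 p x ^ t.2.1)
          + t.2.1 * (r1 p x ^ t.1 * r2 p x ^ (t.2.1 - 1)) * cos3 p x)).sum +
      (M.map fun t => t.2.2 * r12 p ^ (k - t.1 - t.2.1) *
        ((t.2.1 + 2) * (r1 p x ^ t.1 * r2 p x ^ (t.2.1 - 1))
          + t.1 * (r1 p x ^ (t.1 - 1) * r2 p x ^ t.2.1) * cos3 p x)).sum := by
  have dL : ∀ L : List (ℤ × ℤ × ℝ), DiffAt (laurent L k p) x := fun L =>
    diffAt (hasLap_laurent h1 h2 L k).1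
  have d1 : ∀ (L : List (ℤ × ℤ × ℝ)) i, DiffAt (fun z => laurent L k p z * n1 i p z) x :=
    fun L i => (dL L).mul (hasPD_n1 h1 i).1
  have d2 : ∀ (L : List (ℤ × ℤ × ℝ)) i, DiffAt (fun z => laurent L k p z * n2 i p z) x :=
    fun L i => (dL L).mul (hasPD_n2 h2 i).1
  simp_rw [pd_add (d1 _ _) (d2 _ _)]
  rw [sum_add_distrib]
  congr 1
  · induction L with
    | nil => simp [laurent, pd_const]
    | cons t L ih =>
      have m1 : ∀ i, DiffAt
          (fun z => r1 p z ^ t.1 * r2 p z ^ t.2.1 * n1 i p z) x :=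
        fun i => ((hasPD_monomial h1 h2 t.1 t.2.1).mul (hasPD_n1 h1 i)).1
      have e : ∀ i, (fun z => laurent (t :: L) k p z * n1 i p z) = fun z =>
          t.2.2 * r12 p ^ (k - t.1 - t.2.1) * (r1 p z ^ t.1 * r2 p z ^ t.2.1 * n1 i p z)
            + laurent L k p z * n1 i p z := fun i => by
        funext z; simp only [laurent, List.map_cons, List.sum_cons]; ring
      simp_rw [e, pd_add ((m1 _).const_mul _) (d1 _ _), pd_const_mul _ (m1 _)]
      rw [sum_add_distrib, ih, ← mul_sum, div_monomial1 h1 h2]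
      simp only [List.map_cons, List.sum_cons]
  · induction M with
    | nil => simp [laurent, pd_const]
    | cons t L ih =>
      have m1 : ∀ i, DiffAt
          (fun z => r1 p z ^ t.1 * r2 p z ^ t.2.1 * n2 i p z) x :=
        fun i => ((hasPD_monomial h1 h2 t.1 t.2.1).mul (hasPD_n2 h2 i)).1
      have e : ∀ i, (fun z => laurent (t :: L) k p z * n2 i p z) = fun z =>
          t.2.2 * r12 p ^ (k - t.1 - t.2.1) * (r1 p z ^ t.1 * r2 p z ^ t.2.1 * n2 i p z)
            + laurent L k p z * n2 i p z := fun i => by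
        funext z; simp only [laurent, List.map_cons, List.sum_cons]; ring
      simp_rw [e, pd_add ((m1 _).const_mul _) (d2 _ _), pd_const_mul _ (m1 _)]
      rw [sum_add_distrib, ih, ← mul_sum, div_monomial2 h1 h2]
      simp only [List.map_cons, List.sum_cons]

/-- The first-order conformal factor for the background `1`. -/
def u₀ : E6 → Fn :=
  laurent [(-1, 2, -1/64), (1, 0, 1/64), (-1, 0, 1/64 - 1/96), (0, 1, 1/64), (0, -1, 1/64 - 1/96),
    (2, -1, -1/64), (-1, -1, 1/96)] (-2)

/-- The first-order conformal factor for the background `1 / r1`. -/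
def u1 : E6 → Fn :=
  laurent [(-3, 3, -1/4), (-3, 2, 1/4), (-3, 1, 1/4), (-3, 0, -1/4), (-2, 0, -5/192),
    (-2, -1, 5/192), (-2, 2, 15/64), (-2, 1, -15/64), (-1, -1, -1/24), (-1, 1, 1/4), (1, -1, -1/32),
    (-1, 0, -1/24), (0, -1, 3/64), (0, 0, -13/64)] (-3)

/-- The first-order conformal factor for the background `1 / r2`. -/
def u2 (p : E6) (x : E3) : ℝ := u1 p.swap x

/-- `∂ᵢ (s_{ij} ∂ⱼ (1 / r1))` in closed form. -/
def divSdGrad1 (p : E6) (x : E3) : ℝ :=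
  3 * (r1 p x ^ 3)⁻¹ * (-(1 - cos1 p x ^ 2) * (r12 p)⁻¹ * invPerim p x
        + (cos1 p x - 1) * (cos3 p x + cos1 p x) * invPerim p x ^ 2 - trg p x / 3)
    - (r1 p x ^ 2)⁻¹ * (-(cos1 p x * ((r12 p) ^ 2)⁻¹ / 2) * ((r1 p x)⁻¹ - (r2 p x)⁻¹)
    + (-(r1 p x ^ 2)⁻¹ * ((r2 p x)⁻¹ - (r12 p)⁻¹)
        - (r2 p x ^ 2)⁻¹ * cos3 p x * ((r1 p x)⁻¹ - (r12 p)⁻¹)) / 12)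

lemma pd_inv_r1_eventually (h1 : x ≠ p.1) (j : Fin 3) :
    pd j (fun z => (r1 p z)⁻¹) =ᶠ[𝓝 x] fun z => -((r1 p z)⁻¹ ^ 2 * n1 j p z) := by
  filter_upwards [eventually_ne p.1 h1] with z hz
  rw [(hasPD_inv_r1 hz).2, inv_pow]; ring

lemma div_sd_grad_inv_r1 (o : Off p x) :
    ∑ i, ∑ j, pd i (fun z => sd i j p z * pd j (fun w => (r1 p w)⁻¹) z) x = divSdGrad1 p x := by
  have a := r1_pos o.2
  have hs : ∀ i j, DiffAt (sd i j p) x := fun i j => (hasPD_sd o i j).1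
  have hg : ∀ j, HasPD (fun z => -((r1 p z)⁻¹ ^ 2 * n1 j p z)) x fun k =>
      3 * (r1 p x ^ 3)⁻¹ * (n1 k p x * n1 j p x) - (r1 p x ^ 3)⁻¹ * δ k j := fun j => by
    refine ((((hasPD_inv_r1 o.2).pow 2).mul (hasPD_n1 o.2 j)).neg).congr
      (.of_forall fun _ => rfl) fun k => ?_
    push_cast; field_simp; ring
  have hterm : ∀ i j, pd i (fun z => sd i j p z * pd j (fun w => (r1 p w)⁻¹) z) x =
      pd i (sd i j p) x * -((r1 p x ^ 2)⁻¹ * n1 j p x) + sd i j p x *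
        (3 * (r1 p x ^ 3)⁻¹ * (n1 i p x * n1 j p x) - (r1 p x ^ 3)⁻¹ * δ i j) := by
    intro i j
    have hev : (fun z => sd i j p z * pd j (fun w => (r1 p w)⁻¹) z) =ᶠ[𝓝 x]
        fun z => sd i j p z * -((r1 p z)⁻¹ ^ 2 * n1 j p z) := by
      filter_upwards [pd_inv_r1_eventually o.2 j] with z hz; rw [hz]
    rw [pd_congr hev, pd_mul (hs i j) (hg j).1, (hg j).2, inv_pow]
  simp_rw [hterm]
  have htr := sd_trace o
  have hnn := sd_n1_n1 o
  have hD := fun j => div_sd o j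
  have e0 := n1_n1 o.2
  have e2 := n1_n2 o.2 o.3
  have e3 := n1_n12 o.1 o.2
  have hDn : ∑ j, divSd j p x * n1 j p x =
      -(cos1 p x * ((r12 p) ^ 2)⁻¹ / 2) * ((r1 p x)⁻¹ - (r2 p x)⁻¹)
    + (-(r1 p x ^ 2)⁻¹ * ((r2 p x)⁻¹ - (r12 p)⁻¹)
        - (r2 p x ^ 2)⁻¹ * cos3 p x * ((r1 p x)⁻¹ - (r12 p)⁻¹)) / 12 := by
    rw [← e2, ← e3]
    simp only [divSd, Fin.sum_univ_three] at *
    linear_combination (-(r1 p x ^ 2)⁻¹ * ((r2 p x)⁻¹ - (r12 p)⁻¹)) / 12 * e0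
  rw [divSdGrad1, ← hnn, ← hDn]
  simp_rw [← hD]
  have dd : ∀ i j, δ i j = if i = j then 1 else 0 := fun i j => rfl
  simp only [Fin.sum_univ_three, dd] at *
  simp
  linear_combination -(r1 p x ^ 3)⁻¹ * htr

lemma hasLap_u₀ (o : Off p x) :
    HasLap (u₀ p) x (divDivSd p x / 8) := by
  obtain ⟨a, b, c⟩ := o.pos
  refine ⟨(hasLap_laurent o.2 o.3 _ _).1, ?_⟩
  rw [u₀, (hasLap_laurent o.2 o.3 _ _).2, divDivSd, cos3]
  norm_num [zpow_neg, zpow_ofNat]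
  field_simp
  ring

lemma hasLap_u1 (o : Off p x) :
    HasLap (u1 p) x (divSdGrad1 p x + (r1 p x)⁻¹ * divDivSd p x / 8) := by
  obtain ⟨a, b, c⟩ := o.pos
  have hS : r1 p x + r2 p x + r12 p ≠ 0 := by positivity
  refine ⟨(hasLap_laurent o.2 o.3 _ _).1, ?_⟩
  rw [u1, (hasLap_laurent o.2 o.3 _ _).2, divSdGrad1, divDivSd, cos3, cos1, trg, invPerim]
  norm_num [zpow_neg, zpow_ofNat]
  field_simp
  ring

/-! ### Expansions of the first-order conformal factor -/

section Ring

variable {e m m' m'' : ℤ} {a : E6 → E3} {f g : E6 → Fn}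

lemma Expands.add (hf : Expands e a m f) (hg : Expands e a m g) :
    Expands e a m fun p x => f p x + g p x :=
  let ⟨_, h1⟩ := hf; let ⟨_, h2⟩ := hg; ⟨_, h1.add h2⟩

lemma Expands.mul (hf : Expands e a m f) (hg : Expands e a m' g) (h : m'' ≤ m + m') :
    Expands e a m'' fun p x => f p x * g p x :=
  let ⟨_, h1⟩ := hf; let ⟨_, h2⟩ := hg; Expands.weaken ⟨_, h1.mul h2⟩ h

lemma Expands.const_mul (c : ℝ) (hf : Expands e a m f) : Expands e a m fun p x => c * f p x :=
  Expands.mul ⟨_, expandsTo_param fun _ _ => contDiffAt_const⟩ hf (by simp)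

end Ring

lemma nice_cos1 : Nice 0 0 0 cos1 :=
  (nice_sum univ fun k _ => (nice_n1 k).mul' (nice_n12 k)).congr fun _ _ ⟨hp, h1, _⟩ =>
    (n1_n12 hp h1).symm

lemma nice_cos2 : Nice 0 0 0 cos2 :=
  (nice_sum univ fun k _ => (nice_n2 k).mul' (nice_n12 k)).congr fun _ _ ⟨hp, _, h2⟩ =>
    (n2_n12 hp h2).symm

/-- The difference quotient `(r2 - r12) / r1`. -/
def quot1 (p : E6) (x : E3) : ℝ := (r2 p x - r12 p) * (r1 p x)⁻¹

/-- The difference quotient `(r1 - r12) / r2`. -/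
def quot2 (p : E6) (x : E3) : ℝ := (r1 p x - r12 p) * (r2 p x)⁻¹

lemma quot1_eq (o : Off p x) :
    quot1 p x = r1 p x * (r2 p x + r12 p)⁻¹ + 2 * ((r12 p * cos1 p x) * (r2 p x + r12 p)⁻¹) := by
  obtain ⟨a, b, c⟩ := o.pos
  rw [quot1, cos1]; field_simp; ring

lemma nice_quot1 : Nice 0 0 0 quot1 := by
  refine Nice.congr ?_ fun p x o => quot1_eq o
  exact (nice_r1.mul' nice_inv_r2_add).add
    (((nice_r12.mul' nice_cos1 (k'' := 0) (l'' := 0) (m'' := 0)).mul' nice_inv_r2_add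
      (k'' := 0) (l'' := 0) (m'' := 0)).const_mul 2)

lemma nice_quot2 : Nice 0 0 0 quot2 := nice_quot1.swap.congr fun p x _ => by
  have h : r12 p.swap = r12 p := dist_comm _ _
  simp only [quot1, quot2, h]; rfl

lemma nice_r2_sub_r1 : Nice 0 0 0 fun p x => r2 p x - r1 p x := by
  have h : Nice 0 0 0 fun p x => (r12 p * r12 p + 2 * (r12 p * (r1 p x * cos1 p x)))
      * (r1 p x + r2 p x)⁻¹ :=
    (((nice_r12.mul nice_r12).weaken (by simp) (by simp)
      (by simp)).add ((nice_r12.mul' (nice_r1.mul' nice_cos1 (k'' := 0) (l'' := 0) (m'' := -1))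
      (k'' := 0) (l'' := 0) (m'' := -1)).const_mul 2)).mul' nice_inv_r1_add_r2
  refine h.congr fun p x o => ?_
  obtain ⟨a, b, c⟩ := o.pos
  rw [cos1]; field_simp; ring

lemma smoothOff_laurent (L : List (ℤ × ℤ × ℝ)) (k : ℤ) : SmoothOff (laurent L k) := by
  have hz : ∀ {f : E6 → Fn} (m : ℤ), SmoothOff f →
      (∀ p x, Off p x → f p x ≠ 0) → SmoothOff fun p x => f p x ^ m := by
    intro f m hf h0 p x o
    cases m with
    | ofNat n => simpa using (hf p x o).pow n
    | negSucc n =>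
      refine (((hf p x o).pow (n + 1)).inv (pow_ne_zero _ (h0 p x o))).congr_of_eventuallyEq
        (.of_forall fun z => ?_)
      exact zpow_negSucc _ n
  induction L with
  | nil => exact fun _ _ _ => contDiffAt_const
  | cons t L ih =>
    refine SmoothOff.add ((SmoothOff.mul (SmoothOff.mul (nice_const t.2.2).smooth
      (hz _ nice_r12.smooth fun _ _ o => (r12_pos o.1).ne')) (SmoothOff.mul
      (hz _ nice_r1.smooth fun _ _ o => (r1_pos o.2).ne')
      (hz _ nice_r2.smooth fun _ _ o => (r2_pos o.3).ne')))) ih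

lemma u₀_eq (o : Off p x) :
    u₀ p x = -1 / 32 * ((r12 p)⁻¹ * ((r12 p)⁻¹ * (cos1 p x + -1 * cos2 p x)))
      + 1 / 48 * trg p x := by
  obtain ⟨a, b, c⟩ := o.pos
  rw [u₀, laurent, cos1, cos2, trg]
  norm_num [zpow_neg, zpow_ofNat]
  field_simp
  ring

lemma cos1_sub_cos2_eq (o : Off p x) :
    cos1 p x + -1 * cos2 p x = ((r2 p x - r1 p x) * cos1 p x + -1 * r12 p) * (r2 p x)⁻¹ := by
  obtain ⟨a, b, c⟩ := o.pos
  rw [cos1, cos2]; field_simp; ring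

lemma u1_eq_fst (o : Off p x) :
    u1 p x = (r1 p x)⁻¹ * (-1 / 4 * (quot1 p x * (quot1 p x * ((r2 p x + r12 p) *
        ((r12 p)⁻¹ * ((r12 p)⁻¹ * (r12 p)⁻¹)))))
      + quot1 p x * (-5 / 192 * ((r2 p x)⁻¹ * (r12 p)⁻¹)
        + 15 / 64 * (r2 p x * ((r12 p)⁻¹ * ((r12 p)⁻¹ * (r12 p)⁻¹))))
      + -1 / 24 * ((r2 p x)⁻¹ * (r12 p)⁻¹)
      + 1 / 4 * (r2 p x * ((r12 p)⁻¹ * ((r12 p)⁻¹ * (r12 p)⁻¹)))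
      + -1 / 32 * (r1 p x * (r1 p x * ((r2 p x)⁻¹ * ((r12 p)⁻¹ * ((r12 p)⁻¹ * (r12 p)⁻¹)))))
      + -1 / 24 * ((r12 p)⁻¹ * (r12 p)⁻¹)
      + 3 / 64 * (r1 p x * ((r2 p x)⁻¹ * ((r12 p)⁻¹ * (r12 p)⁻¹)))
      + -13 / 64 * (r1 p x * ((r12 p)⁻¹ * ((r12 p)⁻¹ * (r12 p)⁻¹)))) := by
  obtain ⟨a, b, c⟩ := o.pos
  rw [u1, laurent, quot1]
  norm_num [zpow_neg, zpow_ofNat]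
  field_simp
  ring

lemma u1_eq_snd (o : Off p x) :
    u1 p x = (r12 p)⁻¹ * ((r12 p)⁻¹ * ((r12 p)⁻¹ * (
      -1 / 4 * ((r1 p x)⁻¹ * ((r1 p x)⁻¹ * ((r1 p x)⁻¹ * ((r2 p x + -1 * r12 p) *
        ((r2 p x + -1 * r12 p) * (r2 p x + r12 p))))))
      + 15 / 64 * ((r1 p x)⁻¹ * ((r1 p x)⁻¹ * (r2 p x * (r2 p x + -1 * r12 p))))
      + -5 / 192 * (r12 p * (r12 p * ((r1 p x)⁻¹ * (r1 p x)⁻¹)))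
      + 1 / 4 * (r2 p x * (r1 p x)⁻¹) + -1 / 24 * (r12 p * (r1 p x)⁻¹) + -13 / 64
      + -1 / 192 * (quot2 p x * ((r1 p x)⁻¹ * ((r1 p x)⁻¹ * (6 * (r1 p x * r1 p x) +
         -3 * (r1 p x * r12 p) + 5 * (r12 p * r12 p)))))))) := by
  obtain ⟨a, b, c⟩ := o.pos
  rw [u1, laurent, quot2]
  norm_num [zpow_neg, zpow_ofNat]
  field_simp
  ring

lemma u1_eq_inf (o : Off p x) :
    u1 p x = (r1 p x)⁻¹ * ((r12 p)⁻¹ * ((r12 p)⁻¹ * ((r12 p)⁻¹ * (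
      (r2 p x - r1 p x) * (-1 / 32 + -33 / 64 * ((r2 p x - r1 p x) * (r1 p x)⁻¹)
        + -1 / 4 * ((r2 p x - r1 p x) * ((r1 p x)⁻¹ * ((r2 p x - r1 p x) * (r1 p x)⁻¹)))
        + 1 / 32 * (r1 p x * (r2 p x)⁻¹))
      + r12 p * (1 / 4 * (r2 p x * (r1 p x)⁻¹ * (r2 p x * (r1 p x)⁻¹))
        + -15 / 64 * (r2 p x * (r1 p x)⁻¹) + -1 / 24 + 3 / 64 * (r1 p x * (r2 p x)⁻¹))
      + r12 p * (r12 p * (1 / 4 * (r2 p x * (r1 p x)⁻¹ * (r1 p x)⁻¹)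
        + -5 / 192 * (r1 p x)⁻¹ + -1 / 24 * (r2 p x)⁻¹))
      + r12 p * (r12 p * (r12 p * (-1 / 4 * ((r1 p x)⁻¹ * (r1 p x)⁻¹)
        + 5 / 192 * ((r1 p x)⁻¹ * (r2 p x)⁻¹)))))))) := by
  obtain ⟨a, b, c⟩ := o.pos
  rw [u1, laurent]
  norm_num [zpow_neg, zpow_ofNat]
  field_simp
  ring

lemma nice_u₀ : Nice 0 0 1 u₀ := by
  have hc : Nice 0 0 1 fun p x => cos1 p x + -1 * cos2 p x := by
    have h0 := nice_cos1.add (nice_cos2.const_mul (-1))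
    refine ⟨h0.smooth, h0.fst, h0.snd, ?_⟩
    refine Expands.congr_inf ?_ fun p x o => cos1_sub_cos2_eq o
    exact (((nice_r2_sub_r1.mul' nice_cos1).add
      (nice_r12.const_mul (-1))).mul' nice_inv_r2 (k'' := 0) (l'' := -1) (m'' := 1)).inf
  exact (((nice_inv_r12.mul' (nice_inv_r12.mul' hc (k'' := 0) (l'' := 0) (m'' := 1))
    (k'' := 0) (l'' := 0) (m'' := 1)).const_mul _).add (nice_trg.const_mul _)).congr
    fun p x o => u₀_eq o

lemma nice_u1 : Nice (-1) 0 1 u1 := by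
  refine ⟨smoothOff_laurent _ _, ?_, ?_, ?_⟩
  · refine Expands.congr_fst ?_ fun p x o => u1_eq_fst o
    have hR : Expands 1 Prod.fst 0 fun p _ => r12 p := nice_r12.fst
    have hR' : Expands 1 Prod.fst 0 fun p _ => (r12 p)⁻¹ := nice_inv_r12.fst
    have ha : Expands 1 Prod.fst 0 r1 := nice_r1.fst.weaken (by simp)
    have hb : Expands 1 Prod.fst 0 r2 := nice_r2.fst
    have hb' : Expands 1 Prod.fst 0 fun p x => (r2 p x)⁻¹ := nice_inv_r2.fst
    have hq : Expands 1 Prod.fst 0 quot1 := nice_quot1.fst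
    refine Expands.mul nice_inv_r1.fst (m' := 0) ?_ (by simp)
    repeat' first
      | exact hR | exact hR' | exact ha | exact hb | exact hb' | exact hq
      | exact (nice_const _).fst
      | refine Expands.add ?_ ?_
      | refine Expands.const_mul _ ?_
      | refine Expands.mul (m := 0) (m' := 0) ?_ ?_ (by simp)
  · refine Expands.congr_snd ?_ fun p x o => u1_eq_snd o
    have hR : Expands 1 Prod.snd 0 fun p _ => r12 p := nice_r12.snd
    have hR' : Expands 1 Prod.snd 0 fun p _ => (r12 p)⁻¹ := nice_inv_r12.snd
    have ha : Expands 1 Prod.snd 0 r1 := nice_r1.snd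
    have ha' : Expands 1 Prod.snd 0 fun p x => (r1 p x)⁻¹ := nice_inv_r1.snd
    have hb : Expands 1 Prod.snd 0 r2 := nice_r2.snd.weaken (by simp)
    have hq : Expands 1 Prod.snd 0 quot2 := nice_quot2.snd
    repeat' first
      | exact hR | exact hR' | exact ha | exact hb | exact ha' | exact hq
      | exact (nice_const _).snd
      | refine Expands.add ?_ ?_
      | refine Expands.const_mul _ ?_
      | refine Expands.mul (m := 0) (m' := 0) ?_ ?_ (by simp)
  · refine Expands.congr_inf ?_ fun p x o => u1_eq_inf o
    have hR : Expands (-1) (fun _ => 0) 0 fun p _ => r12 p := nice_r12.inf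
    have hR' : Expands (-1) (fun _ => 0) 0 fun p _ => (r12 p)⁻¹ := nice_inv_r12.inf
    have ha' : Expands (-1) (fun _ => 0) 0 fun p x => (r1 p x)⁻¹ :=
      nice_inv_r1.inf.weaken (by simp)
    have hb' : Expands (-1) (fun _ => 0) 0 fun p x => (r2 p x)⁻¹ :=
      nice_inv_r2.inf.weaken (by simp)
    have hab : Expands (-1) (fun _ => 0) 0 fun p x => r1 p x * (r2 p x)⁻¹ :=
      nice_r1.inf.mul nice_inv_r2.inf (by simp)
    have hba : Expands (-1) (fun _ => 0) 0 fun p x => r2 p x * (r1 p x)⁻¹ :=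
      nice_r2.inf.mul nice_inv_r1.inf (by simp)
    have hd : Expands (-1) (fun _ => 0) 0 fun p x => r2 p x - r1 p x := nice_r2_sub_r1.inf
    refine Expands.mul nice_inv_r1.inf (m' := 0) ?_ (by simp)
    repeat' first
      | exact hR | exact hR' | exact ha' | exact hb' | exact hab | exact hba | exact hd
      | exact (nice_const _).inf
      | refine Expands.add ?_ ?_
      | refine Expands.const_mul _ ?_
      | refine Expands.mul (m := 0) (m' := 0) ?_ ?_ (by simp)

lemma nice_u2 : Nice 0 (-1) 1 u2 := nice_u1.swap

/-! ### Integrals over spheres depending on a parameter -/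

section Sphere

variable {F : RFn} {w : ℝ}

/-- The derivative in the first variable. -/
def dfst (F : RFn) (q : ℝ × E3) : ℝ := fderiv ℝ F q (1, 0)

lemma contDiffAt_dfst {q : ℝ × E3} (h : SmoothAt F q) :
    SmoothAt (dfst F) q :=
  (h.fderiv_right (m := ((⊤ : ℕ∞) : WithTop ℕ∞)) (by simp)).clm_apply contDiffAt_const

lemma hasDerivAt_dfst {q : ℝ × E3} (h : DiffAt F q) :
    HasDerivAt (fun t => F (t, q.2)) (dfst F q) q.1 := by
  have h1 : HasFDerivAt F (fderiv ℝ F q) (q.1, q.2) := h.hasFDerivAt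
  have h2 : HasDerivAt (fun t : ℝ => (t, q.2)) ((1 : ℝ), (0 : E3)) q.1 :=
    (hasDerivAt_id q.1).prodMk (hasDerivAt_const _ _)
  exact h1.comp_hasDerivAt q.1 h2

lemma eventually_contDiffAt_sphere (hF : ∀ n, Dir n → SmoothAt F (w, n)) :
    ∀ᶠ v in 𝓝 w, ∀ n, Dir n → ContDiffAt ℝ 1 F (v, n) := by
  have := (isCompact_sphere (0 : E3) 1).eventually_forall_of_forall_eventually (x₀ := w)
    (P := fun v n => ContDiffAt ℝ 1 F (v, n)) fun n hn =>
      ((hF n (by simpa using hn)).of_le (by exact_mod_cast le_top)).eventually (by simp)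
  filter_upwards [this] with v hv n hn using hv n (by simpa using hn)

lemma continuous_sphere (hF : ∀ n, Dir n → ContinuousAt F (w, n)) :
    Continuous fun n : S2 => F (w, n) := by
  rw [continuous_iff_continuousAt]
  intro n
  exact ContinuousAt.comp (g := F) (f := fun n : S2 => (w, n.1))
    (hF n (dir n)) (by fun_prop)

lemma sphere_hasDerivAt_of_eventually
    (hF : ∀ᶠ v in 𝓝 w, ∀ n, Dir n → ContDiffAt ℝ 1 F (v, n)) :
    HasDerivAt (fun v => ∫ n, F (v, n.1) ∂sph) (∫ n, dfst F (w, n.1) ∂sph) w := by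
  obtain ⟨d, hd, hball⟩ := Metric.eventually_nhds_iff_ball.1 hF
  have hK : IsCompact (closedBall w (d / 2) ×ˢ S2) :=
    (isCompact_closedBall _ _).prod (isCompact_sphere _ _)
  have hsub : ∀ v ∈ closedBall w (d / 2), ∀ n, Dir n → ContDiffAt ℝ 1 F (v, n) :=
    fun v hv => hball v (closedBall_subset_ball (by linarith) hv)
  have hdc : ∀ v ∈ closedBall w (d / 2), ∀ n, Dir n → ContinuousAt (dfst F) (v, n) := by
    intro v hv n hn
    have h : ContDiffAt ℝ 0 (fderiv ℝ F) (v, n) := (hsub v hv n hn).fderiv_right (by simp)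
    exact h.continuousAt.clm_apply continuousAt_const
  obtain ⟨C, hC⟩ := hK.exists_bound_of_continuousOn (f := dfst F) fun q hq =>
    (hdc q.1 hq.1 q.2 (by simpa using hq.2)).continuousWithinAt
  have hcb : closedBall w (d / 2) ∈ 𝓝 w := closedBall_mem_nhds _ (by positivity)
  refine (hasDerivAt_integral_of_dominated_loc_of_deriv_le (μ := sph) (bound := fun _ => C)
    (F := fun v n => F (v, n.1)) (F' := fun v n => dfst F (v, n.1))
    hcb ?_ ?_ ?_ ?_ ?_ ?_).2
  · filter_upwards [hcb] with v hv
    exact (continuous_sphere fun n hn => (hsub v hv n hn).continuousAt).aestronglyMeasurable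
  · exact sphere_continuous_integrable
      (continuous_sphere fun n hn => (hF.self_of_nhds n hn).continuousAt)
  · exact (continuous_sphere fun n hn =>
      hdc w (mem_closedBall_self (by positivity)) n hn).aestronglyMeasurable
  · exact .of_forall fun n v hv => hC (v, n.1) ⟨hv, n.2⟩
  · have : IsFiniteMeasure sph := inferInstance
    exact integrable_const C
  · exact .of_forall fun n v hv =>
      hasDerivAt_dfst (q := (v, n.1)) (diffAt (hsub v hv n (dir n)))

lemma sphere_hasDerivAt (hF : ∀ n, Dir n → SmoothAt F (w, n)) :
    HasDerivAt (fun v => ∫ n, F (v, n.1) ∂sph) (∫ n, dfst F (w, n.1) ∂sph) w :=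
  sphere_hasDerivAt_of_eventually (eventually_contDiffAt_sphere hF)

lemma sphere_continuousAt (hF : ∀ n, Dir n → SmoothAt F (w, n)) :
    ContinuousAt (fun v => ∫ n, F (v, n.1) ∂sph) w := (sphere_hasDerivAt hF).continuousAt

end Sphere

lemma sphere_integral_add {f g : S2 → ℝ} (hf : Continuous f) (hg : Continuous g) :
    ∫ n, (f n + g n) ∂sph = ∫ n, f n ∂sph + ∫ n, g n ∂sph :=
  integral_add (sphere_continuous_integrable hf) (sphere_continuous_integrable hg)

lemma sphere_integral_sub {f g : S2 → ℝ} (hf : Continuous f) (hg : Continuous g) :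
    ∫ n, (f n - g n) ∂sph = ∫ n, f n ∂sph - ∫ n, g n ∂sph :=
  integral_sub (sphere_continuous_integrable hf) (sphere_continuous_integrable hg)

/-! ### The derivative of the flux -/

lemma hasPD_radial {θ : ℝ → ℝ} {x a : E3} (hθ : DiffAt θ (dist x a)) (h : x ≠ a) :
    HasPD (fun z : E3 => θ (dist z a)) x fun k => deriv θ (dist x a) * ((x k - a k) * (dist x a)⁻¹) :=
  (hasPD_dist h).comp hθ.hasDerivAt

/-- The flux of the vector field `V` through the sphere of radius `r` about `a`. -/
def flux (V : Fin 3 → Fn) (a : E3) (r : ℝ) : ℝ :=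
  ∫ n, r ^ 2 * ∑ i, V i (a + r • n.1) * n.1 i ∂sph

lemma sphere_continuousOn {F : RFn} {s : Set ℝ}
    (hF : ∀ v ∈ s, ∀ n, Dir n → ContinuousAt F (v, n)) :
    ContinuousOn (fun v => ∫ n, F (v, n.1) ∂sph) s :=
  continuousOn_integral_of_compact_support (f := fun v (n : S2) => F (v, n))
    isCompact_univ (fun q hq => (ContinuousAt.comp (g := F)
      (f := fun q : ℝ × S2 => (q.1, (q.2 : E3))) (hF _ hq.1 _ (dir _))
      (by fun_prop)).continuousWithinAt) fun _ _ _ h => absurd (Set.mem_univ _) h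

lemma eqOn_zero_of_integral_smul_eq_zero {X : Type*} [NormedAddCommGroup X] [NormedSpace ℝ X]
    [FiniteDimensional ℝ X] [MeasurableSpace X] [BorelSpace X] {μ : Measure X}
    [IsLocallyFiniteMeasure μ] [μ.IsOpenPosMeasure] {U : Set X} (hU : IsOpen U) {f : X → ℝ}
    (hf : ContinuousOn f U) (h : ∀ g : X → ℝ, Smooth g → HasCompactSupport g →
      tsupport g ⊆ U → ∫ x, g x • f x ∂μ = 0) : Set.EqOn f 0 U :=
  Measure.eqOn_open_of_ae_eq ((ae_restrict_iff' hU.measurableSet).2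
    (hU.ae_eq_zero_of_integral_contDiff_smul_eq_zero (hf.locallyIntegrableOn hU.measurableSet) h))
    hU hf continuousOn_const

lemma integral_radial_mul_div {V : Fin 3 → Fn} {a : E3} {θ : ℝ → ℝ}
    (hθ : Smooth θ) (hc : HasCompactSupport θ) (hs : tsupport θ ⊆ Set.Ioi 0)
    (hV : ∀ i, ∀ s ∈ tsupport θ, ∀ n, Dir n → ContDiffAt ℝ 1 (V i) (a + s • n)) :
    ∫ s in Set.Ioi (0 : ℝ), deriv θ s * flux V a s = -∫ s in Set.Ioi (0 : ℝ),
      θ s * (s ^ 2 * ∫ n, ∑ i, pd i (V i) (a + s • n.1) ∂sph) := by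
  let η : Fn := fun x => θ (dist x a)
  have hη0 : ∀ x ∈ tsupport η, dist x a ∈ tsupport θ :=
    fun x hx => closure_minimal (t := {x | dist x a ∈ tsupport θ}) (fun x hx => subset_tsupport _ hx)
      ((isClosed_tsupport θ).preimage (by fun_prop)) hx
  have hne : ∀ x ∈ tsupport η, x ≠ a := fun x hx => dist_pos.1 (hs (hη0 x hx))
  have hη : Smooth η := contDiff_of_tsupport fun x hx =>
    hθ.contDiffAt.comp x (ContDiffAt.dist ℝ contDiffAt_id contDiffAt_const (hne x hx))
  have hηc : HasCompactSupport η := by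
    obtain ⟨R, hR⟩ := hc.isBounded.subset_closedBall 0
    refine (isCompact_closedBall a R).of_isClosed_subset (isClosed_tsupport _) fun x hx => ?_
    simpa using hR (hη0 x hx)
  have hVη : ∀ i, ∀ x ∈ tsupport η, ContDiffAt ℝ 1 (V i) x := fun i x hx => by
    have hd := dist_pos.2 (hne x hx)
    have := hV i _ (hη0 x hx) ((dist x a)⁻¹ • (x - a)) (by
      rw [norm_smul, ← dist_eq_norm, Real.norm_of_nonneg (by positivity), inv_mul_cancel₀ hd.ne'])
    rwa [smul_smul, mul_inv_cancel₀ hd.ne', one_smul, add_sub_cancel] at this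
  have i1 : ∀ i, Integrable fun x => V i x * pd i η x := fun i =>
    integrable_mul_of_tsupport (contDiff_pd hη).continuous (hasCompactSupport_pd hηc)
      fun x hx => (hVη i x (support_pd_subset hx)).continuousAt
  have i2 : ∀ i, Integrable fun x => pd i (V i) x * η x := fun i =>
    integrable_mul_of_tsupport hη.continuous hηc fun x hx => continuousAt_pd (hVη i x hx)
  have key : ∫ x, ∑ i, V i x * pd i η x = -∫ x, ∑ i, pd i (V i) x * η x := by
    rw [integral_finsetSum _ fun i _ => i1 i, integral_finsetSum _ fun i _ => i2 i,
      ← sum_neg_distrib]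
    exact sum_congr rfl fun i _ => integral_mul_pd hη hηc (hVη i) i
  rw [← integral_add_left_eq_self _ a, ← integral_add_left_eq_self (fun x => ∑ i, pd i (V i) x * η x) a,
    integral_polar ((integrable_finsetSum _ fun i _ => i1 i).comp_add_left a),
    integral_polar ((integrable_finsetSum _ fun i _ => i2 i).comp_add_left a)] at key
  have hd : ∀ s ∈ Set.Ioi (0 : ℝ), ∀ n : S2, dist (a + s • n.1) a = s :=
    fun s hs n => by simp [norm_smul, abs_of_pos (show 0 < s from hs)]
  convert key using 1
  · refine setIntegral_congr_fun measurableSet_Ioi fun s hs => ?_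
    have hs0 : s ≠ 0 := ne_of_gt hs
    have hp : ∀ (n : S2) i, pd i η (a + s • n.1) = deriv θ s * n.1 i := by
      intro n i
      rw [(hasPD_radial (hθ.differentiable (by simp) _) (dist_pos.1 ((hd s hs n).symm ▸ hs))).2 i,
        hd s hs n]
      simp [mul_right_comm s, hs0]
    simp only [flux, hp, ← integral_const_mul, mul_sum]
    congr 1; funext n
    exact sum_congr rfl fun i _ => by ring
  · congr 1
    refine setIntegral_congr_fun measurableSet_Ioi fun s hs => ?_
    simp only [η, hd s hs, ← sum_mul, integral_mul_const]
    ring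

lemma hasDerivAt_flux {V : Fin 3 → Fn} {a : E3} {r : ℝ} (hr : 0 < r)
    (hV : ∀ i, ∀ n, Dir n → SmoothAt (V i) (a + r • n)) :
    HasDerivAt (flux V a) (r ^ 2 * ∫ n, ∑ i, pd i (V i) (a + r • n.1) ∂sph) r := by
  have hc : ∀ {f : Fn} {k : WithTop ℕ∞} {s : ℝ} {n : E3}, ContDiffAt ℝ k f (a + s • n) →
      ContDiffAt ℝ k (fun q : ℝ × E3 => f (a + q.1 • q.2)) (s, n) := fun {f k s n} h =>
    ContDiffAt.comp (s, n) (g := f) (f := fun q : ℝ × E3 => a + q.1 • q.2) h (by fun_prop)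
  have hev : ∀ᶠ s in 𝓝 r, 0 < s ∧ ∀ i, ∀ n, Dir n → ContDiffAt ℝ 1 (V i) (a + s • n) := by
    refine (lt_mem_nhds hr).and (eventually_all.2 fun i => ?_)
    have := (isCompact_sphere (0 : E3) 1).eventually_forall_of_forall_eventually (x₀ := r)
      (P := fun s n => ContDiffAt ℝ 1 (V i) (a + s • n)) fun n hn =>
        (show ContinuousAt (fun q : ℝ × E3 => a + q.1 • q.2) (r, n) by fun_prop).eventually
          (((hV i n (by simpa using hn)).of_le (by exact_mod_cast le_top)).eventually (by simp))
    exact this.mono fun s hs n hn => hs n (by simpa using hn)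
  obtain ⟨d, hd, hU⟩ := Metric.eventually_nhds_iff_ball.1 hev
  let F : RFn := fun q => q.1 ^ 2 * ∑ i, V i (a + q.1 • q.2) * q.2 i
  have hF : ∀ s ∈ ball r d, ∀ n, Dir n → ContDiffAt ℝ 1 F (s, n) := fun s hs n hn =>
    (contDiffAt_fst.pow 2).mul (ContDiffAt.sum fun i _ => (hc ((hU s hs).2 i n hn)).mul
      ((contDiff_coord i).comp contDiff_snd).contDiffAt)
  have hd1 : ∀ s ∈ ball r d, HasDerivAt (flux V a) (∫ n, dfst F (s, n.1) ∂sph) s := fun s hs =>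
    sphere_hasDerivAt_of_eventually (F := F) ((isOpen_ball.eventually_mem hs).mono hF)
  have hd2 : ContinuousOn (fun s => ∫ n, dfst F (s, n.1) ∂sph) (ball r d) :=
    sphere_continuousOn fun s hs n hn => ((hF s hs n hn).fderiv_right (m := 0)
      (by simp)).continuousAt.clm_apply continuousAt_const
  have hd3 : ContinuousOn (fun s => s ^ 2 * ∫ n, ∑ i, pd i (V i) (a + s • n.1) ∂sph) (ball r d) :=
    (continuousOn_id.pow 2).mul <| sphere_continuousOn (F := fun q => ∑ i, pd i (V i) (a + q.1 • q.2))
      fun s hs n hn => tendsto_finsetSum _ fun i _ =>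
        ((continuousAt_pd ((hU s hs).2 i n hn)).comp (f := fun q : ℝ × E3 => a + q.1 • q.2)
          (x := (s, n)) (by fun_prop)).tendsto
  have := eqOn_zero_of_integral_smul_eq_zero (μ := volume) isOpen_ball (hd2.sub hd3) fun θ hθ hθc hθs => by
    have h0 : ∀ f : ℝ → ℝ, tsupport f ⊆ tsupport θ → ∀ g : ℝ → ℝ, ∀ s ∉ Set.Ioi (0 : ℝ), f s * g s = 0 :=
      fun f hf g s hs => by
        rw [image_eq_zero_of_notMem_tsupport fun h => hs (hU s (hθs (hf h))).1, zero_mul]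
    have h1 := integral_radial_mul_div (V := V) (a := a) hθ hθc (fun s hs => (hU s (hθs hs)).1)
      fun i s hs => (hU s (hθs hs)).2 i
    rw [setIntegral_eq_integral_of_forall_compl_eq_zero (h0 _ (tsupport_deriv_subset) _),
      setIntegral_eq_integral_of_forall_compl_eq_zero (h0 _ subset_rfl _)] at h1
    have hdc : Continuous (deriv θ) := hθ.continuous_deriv (by simp)
    have i1 : ∀ {f g : ℝ → ℝ}, Continuous f → HasCompactSupport f → tsupport f ⊆ ball r d → ContinuousOn g (ball r d) → Integrable fun s => f s * g s := fun {f g} hf hfc hfs hg => by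
      simpa only [mul_comm] using integrable_mul_of_tsupport (μ := volume) hf hfc fun s hs =>
        hg.continuousAt (isOpen_ball.mem_nhds (hfs hs))
    have hfc : ContinuousOn (flux V a) (ball r d) := fun s hs => (hd1 s hs).continuousAt.continuousWithinAt
    have h2 := integral_mul_deriv_eq_deriv_mul_of_integrable (u := θ) (v := flux V a) (u' := deriv θ)
      (fun s _ => (hθ.differentiable (by simp) s).hasDerivAt) (fun s hs => hd1 s (hθs hs))
      (i1 hθ.continuous hθc hθs hd2) (i1 hdc hθc.deriv (tsupport_deriv_subset.trans hθs) hfc)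
      (i1 hθ.continuous hθc hθs hfc)
    simp only [smul_eq_mul, Pi.sub_apply, mul_sub]
    rw [integral_sub (i1 hθ.continuous hθc hθs hd2) (i1 hθ.continuous hθc hθs hd3)]
    linarith
  exact (hd1 r (mem_ball_self hd)).congr_deriv (sub_eq_zero.1 (this (mem_ball_self hd)))

/-! ### The divergence theorem outside small balls -/

lemma integral_shell {g : Fn} {a : E3} {ε d : ℝ} (hε : 0 ≤ ε) (hd : ε ≤ d)
    (hg : ∀ x, ε ≤ dist x a → dist x a ≤ d → ContinuousAt g x) :
    IntegrableOn g {x | ε ≤ dist x a ∧ dist x a ≤ d} ∧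
    ∫ x in {x : E3 | ε ≤ dist x a ∧ dist x a ≤ d}, g x =
      ∫ r in ε..d, r ^ 2 * ∫ n, g (a + r • n.1) ∂sph := by
  have hS : IsClosed {x : E3 | ε ≤ dist x a ∧ dist x a ≤ d} :=
    (isClosed_le continuous_const (continuous_id.dist continuous_const)).inter
      (isClosed_le (continuous_id.dist continuous_const) continuous_const)
  have hint : IntegrableOn g {x | ε ≤ dist x a ∧ dist x a ≤ d} :=
    ContinuousOn.integrableOn_compact ((isCompact_closedBall a d).of_isClosed_subset hS
      fun x hx => hx.2) fun x hx => (hg x hx.1 hx.2).continuousWithinAt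
  refine ⟨hint, ?_⟩
  have e : ∀ r ∈ Set.Ioi (0 : ℝ), r ^ 2 * ∫ n, Set.indicator {x : E3 | ε ≤ dist x a ∧ dist x a ≤ d} g
      (a + r • n.1) ∂sph = Set.indicator (Set.Icc ε d)
        (fun r => r ^ 2 * ∫ n, g (a + r • n.1) ∂sph) r := by
    intro r hr
    have h3 : ∀ n : S2, dist (a + r • n.1) a = r := fun n => by
      simp [norm_smul, abs_of_pos (show 0 < r from hr)]
    by_cases h : r ∈ Set.Icc ε d
    · simp [Set.indicator, h3, h.1, h.2]
    · have h' : ¬(ε ≤ r ∧ r ≤ d) := h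
      simp [Set.indicator, h3, h']
  rw [← integral_indicator hS.measurableSet, ← integral_add_left_eq_self _ a,
    integral_polar (((integrable_indicator_iff hS.measurableSet).2 hint).comp_add_left a),
    setIntegral_congr_fun measurableSet_Ioi e, setIntegral_indicator measurableSet_Icc,
    setIntegral_congr_set ((ae_eq_refl _).inter Ioc_ae_eq_Icc.symm),
    Set.inter_eq_right.2 (show Set.Ioc ε d ⊆ Set.Ioi 0 from fun r hr => hε.trans_lt hr.1),
    intervalIntegral.integral_of_le hd]

lemma shell_continuousOn {g : Fn} {a : E3} {s : Set ℝ}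
    (hg : ∀ r ∈ s, ∀ n, Dir n → ContinuousAt g (a + r • n)) :
    ContinuousOn (fun r : ℝ => r ^ 2 * ∫ n, g (a + r • n.1) ∂sph) s :=
  (continuousOn_id.pow 2).mul <| sphere_continuousOn (F := fun q => g (a + q.1 • q.2))
    fun r hr n hn => (hg r hr n hn).comp (f := fun q : ℝ × E3 => a + q.1 • q.2) (x := (r, n))
      (by fun_prop)

lemma integral_div_shell {V : Fin 3 → Fn} {a : E3} {ε d : ℝ} (hε : 0 ≤ ε) (hd : ε ≤ d)
    (hV : ∀ i x, ε ≤ dist x a → dist x a ≤ d → SmoothAt (V i) x) :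
    IntegrableOn (fun x => ∑ i, pd i (V i) x) {x | ε ≤ dist x a ∧ dist x a ≤ d} ∧
    ∫ x in {x : E3 | ε ≤ dist x a ∧ dist x a ≤ d}, ∑ i, pd i (V i) x =
      flux V a d - flux V a ε := by
  have hc : ∀ x, ε ≤ dist x a → dist x a ≤ d → SmoothAt (fun x => ∑ i, pd i (V i) x) x :=
    fun x h h' => ContDiffAt.sum fun i _ => contDiffAt_pd (hV i x h h')
  obtain ⟨h1, h2⟩ := integral_shell hε hd fun x h h' => (hc x h h').continuousAt
  refine ⟨h1, h2.trans ?_⟩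
  have hsh : ∀ r ∈ Set.Icc ε d, ∀ n, Dir n →
      ε ≤ dist (a + r • n) a ∧ dist (a + r • n) a ≤ d := fun r hr n hn => by
    simpa [norm_smul, hn, abs_of_nonneg (hε.trans hr.1)] using hr
  refine intervalIntegral.integral_eq_sub_of_hasDerivAt_of_le hd (sphere_continuousOn
    (F := fun q => q.1 ^ 2 * ∑ i, V i (a + q.1 • q.2) * q.2 i) fun r hr n hn =>
      (continuousAt_fst.pow 2).mul <| tendsto_finsetSum _ fun i _ =>
        ((hV i _ (hsh r hr n hn).1 (hsh r hr n hn).2).continuousAt.comp (x := (r, n))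
          (f := fun q : ℝ × E3 => a + q.1 • q.2) (by fun_prop)).mul (by fun_prop)) (fun r hr => hasDerivAt_flux
      (hε.trans_lt hr.1) fun i n hn => hV i _ (hsh r (Set.Ioo_subset_Icc_self hr) n hn).1
        (hsh r (Set.Ioo_subset_Icc_self hr) n hn).2) (ContinuousOn.intervalIntegrable ?_)
  rw [Set.uIcc_of_le hd]
  exact shell_continuousOn fun r hr n hn => (hc _ (hsh r hr n hn).1 (hsh r hr n hn).2).continuousAt

lemma integral_div_closedBall {V : Fin 3 → Fn} {a : E3} {d : ℝ} (hd : 0 ≤ d)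
    (hV : ∀ i x, dist x a ≤ d → SmoothAt (V i) x) :
    ∫ x in closedBall a d, ∑ i, pd i (V i) x = flux V a d := by
  have := (integral_div_shell le_rfl hd fun i x _ h => hV i x h).2
  simp only [dist_nonneg, true_and] at this
  refine this.trans ?_
  simp [flux]

lemma ball_ae_eq_closedBall (a : E3) (d : ℝ) : ball a d =ᵐ[volume] closedBall a d :=
  ae_eq_of_subset_of_measure_ge ball_subset_closedBall
    (Measure.addHaar_closedBall_eq_addHaar_ball volume a d).le measurableSet_ball.nullMeasurableSet
    measure_closedBall_lt_top.ne

/-- The domain outside balls of radius `ε` about the punctures. -/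
def outside (p : E6) (ε : ℝ) : Set E3 := {x | ε ≤ dist x p.1 ∧ ε ≤ dist x p.2}

lemma isClosed_outside (p : E6) (ε : ℝ) : IsClosed (outside p ε) :=
  (isClosed_le continuous_const (continuous_id.dist continuous_const)).inter
    (isClosed_le continuous_const (continuous_id.dist continuous_const))

lemma measurableSet_outside (p : E6) (ε : ℝ) : MeasurableSet (outside p ε) :=
  (isClosed_outside p ε).measurableSet

lemma outside_ne {ε : ℝ} (hε : 0 < ε) (hx : x ∈ outside p ε) :
    x ≠ p.1 ∧ x ≠ p.2 := by
  constructor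
  · intro h; have := hx.1; rw [h, dist_self] at this; linarith
  · intro h; have := hx.2; rw [h, dist_self] at this; linarith

lemma integrableOn_outside {g : Fn} {ε : ℝ} (hε : 0 < ε)
    (hg : ∀ x, x ≠ p.1 → x ≠ p.2 → ContinuousAt g x) (hc : HasCompactSupport g) :
    IntegrableOn g (outside p ε) := by
  have hK : IsCompact (outside p ε ∩ tsupport g) := hc.isCompact.inter_left (isClosed_outside p ε)
  have h1 : IntegrableOn g (outside p ε ∩ tsupport g) :=
    ContinuousOn.integrableOn_compact hK fun x hx =>
      (hg x (outside_ne hε hx.1).1 (outside_ne hε hx.1).2).continuousWithinAt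
  refine h1.of_forall_sdiff_eq_zero (measurableSet_outside p ε) fun x hx => ?_
  exact image_eq_zero_of_notMem_tsupport fun h => hx.2 ⟨hx.1, h⟩

lemma exists_cutoff (a : E3) {s : ℝ} (hs : 0 < s) : ∃ ψ : Fn, Smooth ψ ∧
    (∀ x, dist x a ≤ s → ψ x = 1) ∧ (∀ x, 2 * s ≤ dist x a → ψ x = 0) ∧ HasCompactSupport ψ := by
  let f : ContDiffBump a := ⟨s, 2 * s, hs, by linarith⟩
  exact ⟨f, f.contDiff, fun x hx => f.one_of_mem_closedBall (by simpa using hx),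
    fun x hx => f.zero_of_le_dist (by simpa using hx), f.hasCompactSupport⟩

lemma integral_div_outside {V : Fin 3 → Fn} (hp : p.1 ≠ p.2)
    (hV : ∀ i x, x ≠ p.1 → x ≠ p.2 → SmoothAt (V i) x)
    (hc : ∀ i, HasCompactSupport (V i)) {ε : ℝ} (hε : ε ∈ Set.Ioo 0 (r12 p / 8)) :
    ∫ x in outside p ε, ∑ i, pd i (V i) x = -flux V p.1 ε - flux V p.2 ε := by
  obtain ⟨hε0, hε⟩ := hε
  obtain ⟨ψ1, c1, o1, z1, -⟩ := exists_cutoff p.1 (show 0 < ε / 4 by positivity)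
  obtain ⟨ψ2, c2, o2, z2, -⟩ := exists_cutoff p.2 (show 0 < ε / 4 by positivity)
  have tri : ∀ x, 8 * ε < dist x p.1 + dist x p.2 := fun x => by
    have : r12 p ≤ dist p.1 x + dist x p.2 := dist_triangle _ _ _
    rw [dist_comm p.1 x] at this; linarith
  have ev : ∀ (a : E3) x, ε / 2 < dist x a → ∀ᶠ z in 𝓝 x, ε / 2 < dist z a := fun a x hx =>
    (isOpen_lt continuous_const (continuous_id.dist continuous_const)).mem_nhds hx
  let W : Fin 3 → Fn := fun i z => (1 - ψ1 z - ψ2 z) * V i z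
  have hWs : ∀ i, Smooth (W i) := fun i => contDiff_iff_contDiffAt.2 fun x => by
    by_cases h1 : x = p.1
    · refine (contDiffAt_const (c := (0 : ℝ))).congr_of_eventuallyEq ?_
      filter_upwards [closedBall_mem_nhds x (show 0 < ε / 4 by positivity)] with z hz
      rw [h1] at hz
      simp [W, o1 z hz, z2 z (by linarith [tri z, mem_closedBall.1 hz])]
    by_cases h2 : x = p.2
    · refine (contDiffAt_const (c := (0 : ℝ))).congr_of_eventuallyEq ?_
      filter_upwards [closedBall_mem_nhds x (show 0 < ε / 4 by positivity)] with z hz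
      rw [h2] at hz
      simp [W, o2 z hz, z1 z (by linarith [tri z, mem_closedBall.1 hz])]
    · exact ((contDiffAt_const.sub c1.contDiffAt).sub c2.contDiffAt).mul (hV i x h1 h2)
  have hWV : ∀ i z, ε / 2 ≤ dist z p.1 → ε / 2 ≤ dist z p.2 → W i z = V i z := fun i z h1 h2 => by
    simp [W, z1 z (by linarith), z2 z (by linarith)]
  have hWc : ∀ i, HasCompactSupport (W i) := fun i => (hc i).mul_left
  have i1 : ∀ i, Integrable (pd i (W i)) := fun i =>
    (contDiff_pd (hWs i)).continuous.integrable_of_hasCompactSupport (hasCompactSupport_pd (hWc i))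
  have i0 : Integrable fun x => ∑ i, pd i (W i) x := integrable_finsetSum _ fun i _ => i1 i
  have t0 : ∫ x, ∑ i, pd i (W i) x = 0 := by
    rw [integral_finsetSum _ fun i _ => i1 i]
    exact Finset.sum_eq_zero fun i _ => integral_pd_eq_zero (hWs i) (hWc i) i
  have key := integral_add_compl (measurableSet_ball.union measurableSet_ball :
    MeasurableSet (ball p.1 ε ∪ ball p.2 ε)) i0
  have hcompl : (ball p.1 ε ∪ ball p.2 ε)ᶜ = outside p ε := by
    ext x; simp [outside]
  have hball : ∀ a ∈ ({p.1, p.2} : Set E3), ∫ x in ball a ε, ∑ i, pd i (W i) x = flux V a ε := by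
    intro a ha
    rw [setIntegral_congr_set (ball_ae_eq_closedBall a ε),
      integral_div_closedBall hε0.le fun i x _ => (hWs i).contDiffAt]
    refine integral_congr_ae (.of_forall fun n => ?_)
    have hd : dist (a + ε • n.1) a = ε := by simp [norm_smul, abs_of_pos hε0]
    have := tri (a + ε • n.1)
    simp only
    congr 1
    refine sum_congr rfl fun i _ => ?_
    rcases ha with rfl | rfl
    all_goals rw [hWV _ _ (by linarith) (by linarith)]
  rw [hcompl, setIntegral_union (Set.disjoint_left.2 fun x h1 h2 => by
      linarith [tri x, mem_ball.1 h1, mem_ball.1 h2]) measurableSet_ball i0.integrableOn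
    i0.integrableOn, hball _ (by simp), hball _ (by simp), t0] at key
  rw [setIntegral_congr_fun (measurableSet_outside p ε) fun x hx => sum_congr rfl fun i _ =>
    pd_congr (g := W i) ?_]
  · linarith
  · filter_upwards [ev p.1 x (by linarith [hx.1]), ev p.2 x (by linarith [hx.2])] with z h1 h2
      using (hWV i z h1.le h2.le).symm

/-! ### Finite parts -/

lemma HasFinitePart.abs_sub_le {F : ℝ → ℝ} {L L' A' C : ℝ} (h : HasFinitePart F L)
    (hF : ∀ᶠ ε in N0, |F ε - A' * Real.log ε - L'| ≤ C) : |L - L'| ≤ C := by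
  obtain ⟨A, P, hP0, hlim⟩ := h
  have hinv : Tendsto (fun x : ℝ => x⁻¹) atTop N0 := tendsto_inv_atTop_nhdsGT_zero
  -- the divergent part is bounded
  have hlim' := hlim.comp hinv
  have hF' := hinv.eventually hF
  have hb : (fun x : ℝ => (A' - A) * Real.log x + P.eval x) =O[atTop] (fun _ => (1 : ℝ)) := by
    have h1 := hlim'.isBigO_one ℝ
    have h2 : (fun x : ℝ => F x⁻¹ - A' * Real.log x⁻¹ - L') =O[atTop] (fun _ => (1 : ℝ)) :=
      IsBigO.of_bound C (by filter_upwards [hF'] with x hx; simpa using hx)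
    have h3 := (h2.sub h1).add (isBigO_refl (fun _ : ℝ => L') atTop |>.trans
      (isBigO_const_const L' one_ne_zero atTop))
    refine h3.congr_left fun x => ?_
    simp only [Function.comp_apply, Real.log_inv, inv_inv]; ring
  have hx : (fun _ : ℝ => (1 : ℝ)) =o[atTop] (fun x : ℝ => x) := by
    simpa using isLittleO_const_id_atTop (1 : ℝ)
  have hlog : (fun x : ℝ => (A' - A) * Real.log x) =o[atTop] (fun x : ℝ => x) :=
    Real.isLittleO_log_id_atTop.const_mul_left _
  have hPx : (fun x : ℝ => P.eval x) =o[atTop] (fun x : ℝ => x) := by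
    refine ((hb.trans_isLittleO hx).sub hlog).congr_left fun x => ?_
    ring
  have hdeg : P.degree < 1 := by
    have := (Polynomial.div_tendsto_atTop_zero_iff_degree_lt (P := P) (Q := Polynomial.X)
      Polynomial.X_ne_zero).1 (by simpa using hPx.tendsto_div_nhds_zero)
    simpa using this
  have hP : P = 0 := by
    have h0 : P.natDegree = 0 := by
      by_cases h0 : P = 0
      · simp [h0]
      · rw [Polynomial.degree_eq_natDegree h0] at hdeg
        exact Nat.lt_one_iff.1 (by exact_mod_cast hdeg)
    rw [Polynomial.eq_C_of_natDegree_eq_zero h0, hP0, map_zero]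
  have hA : A' = A := by
    by_contra hne
    have hne' : A' - A ≠ 0 := sub_ne_zero.2 hne
    have : (fun x : ℝ => Real.log x) =O[atTop] (fun _ => (1 : ℝ)) := by
      refine (hb.const_mul_left (A' - A)⁻¹).congr_left fun x => ?_
      rw [hP]; simp [← mul_assoc, inv_mul_cancel₀ hne']
    exact not_isBoundedUnder_of_tendsto_atTop Real.tendsto_log_atTop
      (by
        have := (isBigO_one_iff ℝ).1 this
        exact this.mono_le (.of_forall fun x => le_abs_self _))
  rw [hP, ← hA] at hlim
  simp only [Polynomial.eval_zero, sub_zero] at hlim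
  exact le_of_tendsto (hlim.sub_const L').abs hF

lemma HasFinitePart.eq_of_tendsto {F : ℝ → ℝ} {L L' : ℝ} (h : HasFinitePart F L)
    (hF : Tendsto F N0 (𝓝 L')) : L = L' := by
  have : ∀ C > 0, |L - L'| ≤ C := by
    intro C hC
    refine h.abs_sub_le (A' := 0) ?_
    have := (hF.sub_const L').abs
    simp only [sub_self, abs_zero] at this
    filter_upwards [this.eventually (gt_mem_nhds hC)] with ε hε
    simpa using hε.le
  have h0 : |L - L'| ≤ 0 := le_of_forall_pos_le_add fun ε hε => by simpa using this ε hε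
  simpa [sub_eq_zero] using h0

/-! ### Uniqueness of weak solutions -/

lemma exists_newton : ∃ N : Fn, Smooth N ∧
    (∀ x : E3, 1 ≤ ‖x‖ → N x = -(4 * π)⁻¹ * ‖x‖⁻¹) ∧ ∀ x : E3, ‖x‖ ≤ 1 / 2 → N x = 0 := by
  obtain ⟨ψ, hψ, h1, h2, -⟩ := exists_cutoff (0 : E3) (s := 1 / 2) (by norm_num)
  refine ⟨fun x => -(4 * π)⁻¹ * ((1 - ψ x) * ‖x‖⁻¹), contDiff_iff_contDiffAt.2 fun x => ?_,
    fun x hx => by simp [h2 x (by simpa using hx)], fun x hx => by simp [h1 x (by simpa using hx)]⟩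
  by_cases hx : x = 0
  · refine (contDiffAt_const (c := (0 : ℝ))).congr_of_eventuallyEq ?_
    filter_upwards [closedBall_mem_nhds x (ε := 1 / 2) (by norm_num)] with z hz
    rw [hx] at hz
    simp [h1 z hz]
  · exact contDiffAt_const.mul ((contDiffAt_const.sub hψ.contDiffAt).mul
      ((contDiffAt_norm ℝ hx).inv (norm_ne_zero_iff.2 hx)))

lemma lap_inv_norm (hx : x ≠ 0) : HasLap (fun z : E3 => ‖z‖⁻¹) x 0 := by
  have h2 : x ≠ -x := fun h => hx (by
    have : (2 : ℝ) • x = 0 := by rw [two_smul]; nth_rw 2 [h]; simp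
    simpa using this)
  have h := hasLap_monomial (p := (0, -x)) (x := x) hx h2 (-1) 0
  simp only [r1, dist_zero_right] at h
  norm_num at h
  refine h.congr (.of_forall fun z => ?_)
  simp

lemma lap_congr {f g : Fn} (h : f =ᶠ[𝓝 x] g) : lap f x = lap g x := by
  refine sum_congr rfl fun i _ => pd_congr ?_
  filter_upwards [h.eventually_nhds] with z hz using pd_congr hz

lemma pd_scale {f : Fn} (c : ℝ) (a x : E3) (i : Fin 3)
    (hf : DiffAt f (c • (x - a))) :
    pd i (fun z => f (c • (z - a))) x = c * pd i f (c • (x - a)) := by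
  have h1 : HasFDerivAt (fun z : E3 => c • (z - a)) (c • ContinuousLinearMap.id ℝ E3) x :=
    ((hasFDerivAt_id x).sub_const a).fun_const_smul c
  have := (HasFDerivAt.comp x (f := fun z : E3 => c • (z - a)) hf.hasFDerivAt h1).fderiv
  simp only [Function.comp_def] at this
  simp only [pd, this]; simp

lemma lap_scale {f : Fn} (hf : Smooth f) (c : ℝ) (a x : E3) :
    lap (fun z => f (c • (z - a))) x = c ^ 2 * lap f (c • (x - a)) := by
  rw [lap, lap, mul_sum]
  refine sum_congr rfl fun i _ => ?_
  have h1 : ∀ z, pd i (fun z => f (c • (z - a))) z = c * pd i f (c • (z - a)) := fun z =>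
    pd_scale c a z i (diffAt hf.contDiffAt)
  have h2 : pd i (fun z => f (c • (z - a))) = fun z => c * pd i f (c • (z - a)) := funext h1
  have hd : DiffAt (pd i f) (c • (x - a)) :=
    diffAt (contDiff_pd hf).contDiffAt
  have h3 : DiffAt (fun z => pd i f (c • (z - a))) x :=
    DifferentiableAt.comp x (g := pd i f) (f := fun z => c • (z - a)) hd (by fun_prop)
  rw [h2, pd_const_mul c h3, pd_scale c a x i hd]; ring

lemma contDiff_lap {f : Fn} (hf : Smooth f) : Smooth (lap f) :=
  ContDiff.sum fun _ _ => contDiff_pd (contDiff_pd hf)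

lemma exists_mollifier : ∃ N : Fn, Smooth N ∧
    (∀ x : E3, 1 ≤ ‖x‖ → N x = -(4 * π)⁻¹ * ‖x‖⁻¹) ∧
    (∀ x : E3, 1 < ‖x‖ ∨ ‖x‖ < 1 / 2 → lap N x = 0) ∧ ∫ x, lap N x = 1 := by
  obtain ⟨N, hN, hN1, hN0⟩ := exists_newton
  have hev : ∀ x : E3, 1 < ‖x‖ → N =ᶠ[𝓝 x] fun z => -(4 * π)⁻¹ * ‖z‖⁻¹ := fun x hx =>
    ((isOpen_lt continuous_const continuous_norm).eventually_mem hx).mono fun z hz => hN1 z hz.le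
  have hx0 : ∀ x : E3, 1 < ‖x‖ → x ≠ 0 := fun x hx => norm_pos_iff.1 (one_pos.trans hx)
  have hl : ∀ x : E3, 1 < ‖x‖ ∨ ‖x‖ < 1 / 2 → lap N x = 0 := by
    rintro x (hx | hx)
    · rw [lap_congr (hev x hx), ((lap_inv_norm (hx0 x hx)).const_mul _).2, mul_zero]
    · rw [lap_congr (g := fun _ => 0) (((isOpen_lt continuous_norm continuous_const).eventually_mem
        hx).mono fun z hz => hN0 z hz.le)]
      simp [lap, show ∀ i, pd i (fun _ : E3 => (0 : ℝ)) = fun _ => 0 from fun i => funext fun x => pd_const 0]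
  refine ⟨N, hN, hN1, hl, ?_⟩
  rw [← setIntegral_eq_integral_of_forall_compl_eq_zero (s := closedBall (0 : E3) 2) fun x hx =>
    hl x (.inl (by linarith [show 2 < ‖x‖ by simpa using hx]))]
  refine (integral_div_closedBall (V := fun i => pd i N) zero_le_two fun i x _ =>
    (contDiff_pd hN).contDiffAt).trans ?_
  have h : ∀ n : S2, (2 : ℝ) ^ 2 * ∑ i, pd i N (0 + (2 : ℝ) • n.1) * n.1 i
      = (4 * π)⁻¹ := by
    intro n
    have hnx : ‖(0 : E3) + (2 : ℝ) • n.1‖ = 2 := by rw [zero_add, norm_smul]; simp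
    have h1 : 1 < ‖(0 : E3) + (2 : ℝ) • n.1‖ := by rw [hnx]; norm_num
    have h2 := ((hasPD_dist (hx0 _ h1)).inv (by simpa using hx0 _ h1)).const_mul (-(4 * π)⁻¹)
    have h4 : ∑ i, n.1 i ^ 2 = 1 := by
      rw [← EuclideanSpace.real_norm_sq_eq, dir]; norm_num
    simp only [dist_zero_right, hnx] at h2
    simp only [pd_congr (hev _ h1), h2.2, Fin.sum_univ_three] at h4 ⊢
    simp
    linear_combination (4 * π)⁻¹ * h4
  rw [flux, integral_congr_ae (.of_forall h), sphere_integral_const]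
  have := Real.pi_ne_zero
  field_simp

lemma weakly_harmonic_eq_zero {w : Fn} (hw : LocallyIntegrable w volume)
    (h0 : Tendsto w (Bornology.cobounded E3) (𝓝 0))
    (hΔ : ∀ φ : Fn, Smooth φ → HasCompactSupport φ → ∫ x, w x * lap φ x = 0)
    (hx : ContinuousAt w x) : w x = 0 := by
  obtain ⟨N, hN, hN1, hl, hint⟩ := exists_mollifier
  have hηs := contDiff_lap hN
  let m : ℝ → Fn := fun d z => d⁻¹ ^ 3 * lap N (d⁻¹ • (z - x))
  have hnorm : ∀ {d : ℝ}, 0 < d → ∀ z : E3, ‖d⁻¹ • (z - x)‖ = d⁻¹ * dist z x := fun hd z => by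
    rw [norm_smul, norm_inv, Real.norm_of_nonneg hd.le, ← dist_eq_norm]
  have hmz : ∀ d, 0 < d → ∀ z, d < dist z x ∨ dist z x < d / 2 → m d z = 0 := fun d hd z hz => by
    have : lap N (d⁻¹ • (z - x)) = 0 := hl _ (by
      rw [hnorm hd, lt_inv_mul_iff₀ hd, inv_mul_lt_iff₀ hd, mul_one, mul_one_div]; exact hz)
    simp [m, this]
  have hmc : ∀ d, Continuous (m d) := fun d => by
    have := hηs.continuous
    fun_prop
  have hmsupp : ∀ d, 0 < d → HasCompactSupport (m d) := fun d hd => HasCompactSupport.intro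
    (isCompact_closedBall x d) fun z hz => hmz d hd z (.inl (by simpa using hz))
  have scale : ∀ (g : Fn) (d : ℝ), 0 < d → ∫ z, d⁻¹ ^ 3 * g (d⁻¹ • (z - x)) = ∫ z, g z := by
    intro g d hd
    rw [integral_const_mul, integral_sub_right_eq_self (fun z => g (d⁻¹ • z)) x,
      Measure.integral_comp_smul]
    have : |((d⁻¹) ^ 3)⁻¹| = (d⁻¹ ^ 3)⁻¹ := abs_of_pos (by positivity)
    simp only [finrank_euclideanSpace, Fintype.card_fin, smul_eq_mul, this]
    field_simp
  set B := ∫ z, |lap N z|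
  have hmB : ∀ d, 0 < d → ∫ z, |m d z| = B := fun d hd => by
    refine Eq.trans ?_ (scale (fun z => |lap N z|) d hd)
    congr 1; funext z
    simp only [m]; rw [abs_mul, abs_of_pos (by positivity : 0 < d⁻¹ ^ 3)]
  have hwm : ∀ d, 0 < d → Integrable fun z => w z * m d z := fun d hd => by
    simpa [mul_comm] using hw.integrable_smul_left_of_hasCompactSupport (hmc d) (hmsupp d hd)
  have hmi : ∀ d, 0 < d → Integrable (m d) := fun d hd =>
    (hmc d).integrable_of_hasCompactSupport (hmsupp d hd)
  have hconst : ∀ d l, 0 < d → 0 < l → ∫ z, w z * m d z = ∫ z, w z * m l z := by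
    intro d l hd hl'
    let φ : Fn := fun z => d⁻¹ * N (d⁻¹ • (z - x)) + -1 * (l⁻¹ * N (l⁻¹ • (z - x)))
    have hNs : ∀ c : ℝ, Smooth fun z : E3 => N (c • (z - x)) := fun c =>
      hN.comp (f := fun z : E3 => c • (z - x)) (by fun_prop)
    have hφc : HasCompactSupport φ := by
      refine HasCompactSupport.intro (isCompact_closedBall x (max d l)) fun z hz => ?_
      have hz' : d < dist z x ∧ l < dist z x := by simpa using hz
      have key : ∀ c, 0 < c → c < dist z x → c⁻¹ * N (c⁻¹ • (z - x)) =
          -(4 * π)⁻¹ * (dist z x)⁻¹ := by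
        intro c hc hcm
        rw [hN1 _ (by rw [hnorm hc, le_inv_mul_iff₀ hc]; linarith), hnorm hc]
        field_simp
      simp only [φ]; rw [key d hd hz'.1, key l hl' hz'.2]; ring
    have hlap : ∀ z, lap φ z = m d z - m l z := by
      intro z
      have hh : ∀ c : ℝ, HasLap (fun z : E3 => c * N (c • (z - x))) z
          (c * (c ^ 2 * lap N (c • (z - x)))) := fun c =>
        (show HasLap _ z _ from ⟨(hNs c).contDiffAt, lap_scale hN c x z⟩).const_mul c
      rw [((hh d⁻¹).add ((hh l⁻¹).const_mul (-1))).2]; simp only [m]; ring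
    have := hΔ φ ((contDiff_const.mul (hNs _)).add
      (contDiff_const.mul (contDiff_const.mul (hNs _)))) hφc
    simp_rw [hlap, mul_sub] at this
    rw [integral_sub (hwm d hd) (hwm l hl')] at this
    linarith
  have mean : ∀ c e d, 0 < d → (∀ z, d / 2 ≤ dist z x → dist z x ≤ d → |w z - c| ≤ e) →
      |(∫ z, w z * m d z) - c| ≤ e * B := by
    intro c e d hd h
    have h1 : (∫ z, w z * m d z) - c = ∫ z, (w z - c) * m d z := by
      simp_rw [sub_mul]
      rw [integral_sub (hwm _ hd) ((hmi _ hd).const_mul _), integral_const_mul, scale _ d hd, hint,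
        mul_one]
    rw [h1, ← hmB _ hd, ← integral_const_mul]
    refine abs_integral_le_integral_abs.trans (integral_mono_of_nonneg
      (.of_forall fun z => abs_nonneg _) ((hmi _ hd).abs.const_mul e) (.of_forall fun z => ?_))
    simp only [abs_mul]
    by_cases hz : d < dist z x ∨ dist z x < d / 2
    · simp [hmz d hd z hz]
    · push Not at hz
      exact mul_le_mul_of_nonneg_right (h z hz.2 hz.1) (abs_nonneg _)
  refine abs_eq_zero.1 (le_antisymm (le_of_forall_pos_le_add fun e he => ?_) (abs_nonneg _))
  have hB0 : 0 ≤ B := integral_nonneg fun z => abs_nonneg _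
  set e' := e / (2 * (B + 1))
  have he' : 0 < e' := by positivity
  obtain ⟨d, hd, h1⟩ := Metric.continuousAt_iff.1 hx e' he'
  obtain ⟨ρ, -, hρ⟩ := (hasBasis_cobounded_compl_closedBall x).eventually_iff.1
    (h0.eventually (Metric.ball_mem_nhds (0 : ℝ) he'))
  have s1 := mean (w x) e' (d / 2) (by positivity) fun z _ hz => (h1 (by linarith)).le
  have s2 := mean 0 e' (2 * (|ρ| + 1)) (by positivity) fun z hz _ => by
    have : ρ < dist z x := by linarith [le_abs_self ρ]
    simpa using (hρ (x := z) (by simpa using this)).le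
  rw [hconst (d / 2) (2 * (|ρ| + 1)) (by positivity) (by positivity)] at s1
  have h3 : e' * B ≤ e / 2 := by
    rw [show e / 2 = e' * (B + 1) by simp only [e']; field_simp]
    gcongr; linarith
  rw [zero_add, ← sub_zero (w x)]
  have := abs_sub_le (w x) (∫ z, w z * m (2 * (|ρ| + 1)) z) 0
  rw [abs_sub_comm] at s1
  linarith

/-! ### Expansions along rays, for fixed punctures -/

/-- `f (a + t ^ e • n) = t ^ m * Φ (t, n)` for small `t > 0` and unit vectors `n`, with `Φ` smooth
up to `t = 0`. -/
structure Ray (e : ℤ) (a : E3) (m : ℤ) (f : Fn) (Φ : RFn) : Prop where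
  smooth : ∀ n, Dir n → SmoothAt Φ (0, n)
  eq : ∀ᶠ t in N0, ∀ n, Dir n → f (a + t ^ e • n) = t ^ m * Φ (t, n)

lemma eventually_sphere {P : ℝ × E3 → Prop} (h : ∀ n, Dir n → ∀ᶠ q in 𝓝 ((0 : ℝ), n), P q) :
    ∀ᶠ t in 𝓝 (0 : ℝ), ∀ n, Dir n → P (t, n) := by
  have := (isCompact_sphere (0 : E3) 1).eventually_forall_of_forall_eventually (x₀ := (0 : ℝ))
    (P := fun v n => P (v, n)) fun n hn => h n (by simpa using hn)
  filter_upwards [this] with v hv n hn using hv n (by simpa using hn)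

lemma ExpandsTo.ray {e m : ℤ} {a : E6 → E3} {f : E6 → Fn}
    {Φ : ℝ × E3 × E6 → ℝ} (h : ExpandsTo e a m f Φ) (hp : p.1 ≠ p.2) :
    Ray e (a p) m (f p) fun q => Φ (q.1, q.2, p) := by
  have hne : ∀ n, Dir n → n ≠ 0 := fun n hn h0 => by rw [h0, norm_zero] at hn; norm_num at hn
  have hc : ∀ n : E3, SmoothAt (fun q : ℝ × E3 => (q.1, q.2, p)) (0, n) := fun n => by
    fun_prop
  refine ⟨fun n hn => ContDiffAt.comp (g := Φ) (f := fun q : ℝ × E3 => (q.1, q.2, p)) (0, n)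
    (h.smooth n p (hne n hn) hp) (hc n), ?_⟩
  have := eventually_sphere (P := fun q : ℝ × E3 => 0 < q.1 → f p (a p + q.1 ^ e • q.2)
    = q.1 ^ m * Φ (q.1, q.2, p)) fun n hn =>
      (hc n).continuousAt.tendsto.eventually (h.eq n p (hne n hn) hp)
  filter_upwards [nhdsWithin_le_nhds this, self_mem_nhdsWithin] with t ht ht0 n hn
    using ht n hn ht0

section Ray

variable {e m : ℤ} {a : E3} {f g : Fn} {Φ Ψ : RFn}

lemma Ray.add (hf : Ray e a m f Φ) (hg : Ray e a m g Ψ) :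
    Ray e a m (fun x => f x + g x) fun q => Φ q + Ψ q :=
  ⟨fun n hn => (hf.smooth n hn).add (hg.smooth n hn), by
    filter_upwards [hf.eq, hg.eq] with t h1 h2 n hn; rw [h1 n hn, h2 n hn]; ring⟩

lemma Ray.const_mul (c : ℝ) (hf : Ray e a m f Φ) : Ray e a m (fun x => c * f x) fun q => c * Φ q :=
  ⟨fun n hn => contDiffAt_const.mul (hf.smooth n hn), by
    filter_upwards [hf.eq] with t h1 n hn; rw [h1 n hn]; ring⟩

lemma Ray.mul {m' : ℤ} (hf : Ray e a m f Φ) (hg : Ray e a m' g Ψ) :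
    Ray e a (m + m') (fun x => f x * g x) fun q => Φ q * Ψ q :=
  ⟨fun n hn => (hf.smooth n hn).mul (hg.smooth n hn), by
    filter_upwards [hf.eq, hg.eq, self_mem_nhdsWithin] with t h1 h2 h3 n hn
    have : (0 : ℝ) < t := h3
    rw [h1 n hn, h2 n hn, zpow_add₀ this.ne']; ring⟩

lemma Ray.bound (hf : Ray e a m f Φ) :
    ∃ C > 0, ∀ᶠ t in N0, ∀ n, Dir n → |f (a + t ^ e • n)| ≤ C * t ^ m := by
  obtain ⟨C, hC⟩ := (isCompact_sphere (0 : E3) 1).exists_bound_of_continuousOn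
    (f := fun n => Φ (0, n)) fun n hn => ContinuousAt.continuousWithinAt
      (ContinuousAt.comp (g := Φ) (f := fun n : E3 => ((0 : ℝ), n))
        (hf.smooth n (by simpa using hn)).continuousAt (by fun_prop))
  have h1 := eventually_sphere (P := fun q => |Φ q| < |C| + 1) fun n hn =>
    (hf.smooth n hn).continuousAt.abs.eventually (gt_mem_nhds (by
      have := hC n (by simpa using hn)
      rw [Real.norm_eq_abs] at this
      linarith [le_abs_self C]))
  refine ⟨|C| + 1, by positivity, ?_⟩
  filter_upwards [nhdsWithin_le_nhds h1, hf.eq, self_mem_nhdsWithin] with t ht he ht0 n hn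
  have : (0 : ℝ) < t ^ m := zpow_pos ht0 m
  rw [he n hn, abs_mul, abs_of_pos this, mul_comm]
  gcongr
  exact (ht n hn).le

lemma Ray.radial (hf : Ray 1 a m f Φ)
    (hd : ∀ᶠ t in N0, ∀ n, Dir n → DiffAt f (a + t • n)) :
    ∀ᶠ t in N0, ∀ n, Dir n →
      ∑ i, n i * pd i f (a + t • n) = t ^ (m - 1) * (m * Φ (t, n) + t * dfst Φ (t, n)) := by
  have h1 := eventually_sphere (P := fun q => DiffAt Φ q) fun n hn => by
    filter_upwards [((hf.smooth n hn).of_le (m := 1) (by exact_mod_cast le_top)).eventually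
      (by simp)] with q hq using diffAt hq
  filter_upwards [eventually_eventually_nhdsWithin.2 hf.eq, hd, nhdsWithin_le_nhds h1,
    self_mem_nhdsWithin] with t ht hd h1 ht0 n hn
  have ht0' : (0 : ℝ) < t := ht0
  have e1 : (fun s : ℝ => f (a + s • n)) =ᶠ[𝓝 t] fun s => s ^ m * Φ (s, n) := by
    rw [nhdsWithin_eq_nhds.2 (Ioi_mem_nhds ht0')] at ht
    filter_upwards [ht] with s hs
    simpa using hs n hn
  have e2 : HasDerivAt (fun s : ℝ => a + s • n) n t := by
    simpa using ((hasDerivAt_id t).smul_const n).const_add a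
  have e3 := (hd n hn).hasFDerivAt.comp_hasDerivAt t e2
  rw [fderiv_eq_sum_pd] at e3
  have e4 := (hasDerivAt_zpow m t (Or.inl ht0'.ne')).mul (hasDerivAt_dfst (q := (t, n)) (h1 n hn))
  rw [e3.unique (e4.congr_of_eventuallyEq e1)]
  have : t ^ m = t ^ (m - 1) * t := by rw [← zpow_add_one₀ ht0'.ne']; congr 1; ring
  rw [this]; ring

lemma tendsto_sphere_integral {F : RFn}
    (hF : ∀ n, Dir n → SmoothAt F (0, n)) :
    Tendsto (fun t => ∫ n, F (t, n.1) ∂sph) N0 (𝓝 (∫ n, F (0, n.1) ∂sph)) :=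
  (sphere_continuousAt hF).tendsto.mono_left nhdsWithin_le_nhds

lemma contDiffAt_along {φ : Fn} (hφ : Smooth φ) (a : E3) (q : ℝ × E3) :
    SmoothAt (fun q : ℝ × E3 => φ (a + q.1 • q.2)) q :=
  ContDiffAt.comp q (g := φ) (f := fun q : ℝ × E3 => a + q.1 • q.2) hφ.contDiffAt
    (contDiffAt_const.add (contDiffAt_fst.smul contDiffAt_snd))

lemma Ray.green_flux (hf : Ray 1 a (-1) f Φ) (hΦ : ∫ n, Φ (0, (n : E3)) ∂sph = 0)
    (hd : ∀ᶠ t in N0, ∀ n, Dir n → DiffAt f (a + t • n))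
    {φ : Fn} (hφ : Smooth φ) :
    Tendsto (flux (fun i z => φ z * pd i f z - f z * pd i φ z) a) N0 (𝓝 0) := by
  let F : RFn := fun q => φ (a + q.1 • q.2) * (-1 * Φ q + q.1 * dfst Φ q)
    - q.1 * (Φ q * ∑ i, q.2 i * pd i φ (a + q.1 • q.2))
  have hF : ∀ n, Dir n → SmoothAt F (0, n) := by
    intro n hn
    have h1 := hf.smooth n hn
    have h2 : ∀ i, SmoothAt (fun q : ℝ × E3 => q.2 i) (0, n) := fun i =>
      ((contDiff_coord i).comp contDiff_snd).contDiffAt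
    exact ((contDiffAt_along hφ a _).mul ((contDiffAt_const.mul h1).add
      (contDiffAt_fst.mul (contDiffAt_dfst h1)))).sub (contDiffAt_fst.mul (h1.mul
      (ContDiffAt.sum fun i _ => (h2 i).mul (contDiffAt_along (contDiff_pd hφ) a _))))
  have h0 : ∫ n, F (0, n.1) ∂sph = 0 := by
    have : ∀ n : S2, F (0, n.1) = -φ a * Φ (0, n.1) := fun n => by
      simp [F]
    simp_rw [this]
    rw [integral_const_mul, hΦ, mul_zero]
  have ht := tendsto_sphere_integral hF
  rw [h0] at ht
  refine ht.congr' ?_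
  filter_upwards [hf.eq, hf.radial hd, self_mem_nhdsWithin] with t h1 h2 ht0
  refine integral_congr fun n => ?_
  have ht0' : (0 : ℝ) < t := ht0
  have e1 := h1 n (dir n)
  have e2 := h2 n (dir n)
  rw [zpow_one] at e1
  have e3 : ∑ i, (φ (a + t • n.1) * pd i f (a + t • n.1)
        - f (a + t • n.1) * pd i φ (a + t • n.1)) * n.1 i
      = φ (a + t • n.1) * ∑ i, n.1 i * pd i f (a + t • n.1)
        - f (a + t • n.1) * ∑ i, n.1 i * pd i φ (a + t • n.1) := by
    rw [mul_sum, mul_sum, ← sum_sub_distrib]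
    exact sum_congr rfl fun i _ => by ring
  simp only [F]
  rw [e3, e1, e2]
  norm_num [zpow_neg, zpow_ofNat]
  field_simp

lemma flux_tendsto_zero {V : Fin 3 → Fn} {Ψ : Fin 3 → RFn}
    (hV : ∀ i, Ray 1 a (-1) (V i) (Ψ i)) : Tendsto (flux V a) N0 (𝓝 0) := by
  let F : RFn := fun q => q.1 * ∑ i, Ψ i q * q.2 i
  have hF : ∀ n, Dir n → SmoothAt F (0, n) := fun n hn =>
    contDiffAt_fst.mul (ContDiffAt.sum fun i _ => ((hV i).smooth n hn).mul
      ((contDiff_coord i).comp contDiff_snd).contDiffAt)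
  have ht := tendsto_sphere_integral hF
  have h0 : ∫ n, F (0, n.1) ∂sph = 0 := by simp [F]
  rw [h0] at ht
  refine ht.congr' ?_
  filter_upwards [eventually_all.2 fun i => (hV i).eq, self_mem_nhdsWithin] with t h1 ht0
  refine integral_congr fun n => ?_
  have ht0' : (0 : ℝ) < t := ht0
  simp only [F]
  rw [mul_sum, mul_sum]
  refine sum_congr rfl fun i _ => ?_
  have := h1 i n (dir n)
  rw [zpow_one] at this
  rw [this]; norm_num [zpow_neg]; field_simp

lemma Ray.integrableAt (hf : Ray 1 a (-1) f Φ) (hc : ∀ᶠ x in 𝓝[≠] a, ContinuousAt f x) :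
    IntegrableAtFilter f (𝓝 a) := by
  obtain ⟨C, hC, hb⟩ := hf.bound
  obtain ⟨d, hd, hd'⟩ := mem_nhdsGT_iff_exists_Ioo_subset.1 hb
  obtain ⟨d₂, hd2, hd2'⟩ := Metric.eventually_nhds_iff.1 (eventually_nhdsWithin_iff.1 hc)
  have hd0 : (0 : ℝ) < d := hd
  set s := min d d₂ with hs
  have hs0 : 0 < s := lt_min hd0 hd2
  refine ⟨ball a s, ball_mem_nhds a hs0, ?_⟩
  have hpol : Integrable (fun x : E3 => Set.indicator (Set.Iio s) (fun r => r⁻¹) ‖x‖) := by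
    rw [integrable_fun_norm_addHaar volume (f := Set.indicator (Set.Iio s) fun r => r⁻¹)]
    have : IntegrableOn (Set.indicator (Set.Ioo 0 s) fun r : ℝ => r) (Set.Ioi 0) := by
      refine Integrable.integrableOn ((integrable_indicator_iff measurableSet_Ioo).2 ?_)
      exact (continuous_id.integrableOn_Icc (a := (0 : ℝ)) (b := s)).mono_set Set.Ioo_subset_Icc_self
    refine this.congr_fun (fun r hr => ?_) measurableSet_Ioi
    have hr0 : (0 : ℝ) < r := hr
    by_cases h : r < s
    · simp [Set.indicator, h, hr0]; field_simp
    · simp [Set.indicator, h]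
  have hpol' := (hpol.comp_sub_right a).const_mul C
  have hmeas : AEStronglyMeasurable f (volume.restrict (ball a s)) := by
    have h1 : ContinuousOn f (ball a s \ {a}) := fun x hx =>
      (hd2' (lt_of_lt_of_le hx.1 (min_le_right _ _)) hx.2).continuousWithinAt
    have h2 := h1.aestronglyMeasurable (μ := volume) (measurableSet_ball.diff (measurableSet_singleton a))
    rwa [Measure.restrict_congr_set (sdiff_null_ae_eq_self (measure_singleton a))] at h2
  refine Integrable.mono' hpol'.integrableOn hmeas ?_
  have hae : ∀ᵐ x ∂(volume : Measure E3), x ≠ a := by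
    simp [ae_iff, measure_singleton]
  filter_upwards [ae_restrict_mem measurableSet_ball, ae_restrict_of_ae hae] with x hx hxa
  have hx' : dist x a < s := hx
  have hr : 0 < dist x a := dist_pos.2 hxa
  have hn : ‖(dist x a)⁻¹ • (x - a)‖ = 1 := by
    rw [norm_smul, norm_inv, Real.norm_of_nonneg hr.le, ← dist_eq_norm, inv_mul_cancel₀ hr.ne']
  have := hd' ⟨hr, lt_of_lt_of_le hx' (min_le_left _ _)⟩ _ hn
  rw [zpow_one, smul_smul, mul_inv_cancel₀ hr.ne', one_smul, add_sub_cancel] at this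
  rw [Real.norm_eq_abs]
  refine this.trans (le_of_eq ?_)
  have hx'' : ‖x - a‖ < s := by rwa [← dist_eq_norm]
  simp [Set.indicator, hx'', dist_eq_norm]

lemma Ray.tendsto_zero (hf : Ray (-1) 0 1 f Φ) : Tendsto f (Bornology.cobounded E3) (𝓝 0) := by
  obtain ⟨C, hC, hb⟩ := hf.bound
  have h1 : Tendsto (fun x : E3 => ‖x‖⁻¹) (Bornology.cobounded E3) N0 :=
    tendsto_inv_atTop_nhdsGT_zero.comp tendsto_norm_cobounded_atTop
  have h2 : Tendsto (fun x : E3 => C * ‖x‖⁻¹) (Bornology.cobounded E3) (𝓝 0) := by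
    simpa using (h1.mono_right nhdsWithin_le_nhds).const_mul C
  refine squeeze_zero_norm' ?_ h2
  filter_upwards [h1.eventually hb, h1.eventually self_mem_nhdsWithin] with x hx hx0
  have hr : 0 < ‖x‖ := inv_pos.1 hx0
  have hn : ‖‖x‖⁻¹ • x‖ = 1 := by rw [norm_smul, norm_inv, norm_norm, inv_mul_cancel₀ hr.ne']
  have := hx _ hn
  rwa [zpow_neg, zpow_one, inv_inv, smul_smul, mul_inv_cancel₀ hr.ne', one_smul, zero_add] at this

end Ray

/-! ### Identification of a weak solution -/

lemma tendsto_integral_outside {g : Fn} (hg : Integrable g) (p : E6) :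
    Tendsto (fun ε => ∫ x in outside p ε, g x) N0 (𝓝 (∫ x, g x)) := by
  simp_rw [← integral_indicator (measurableSet_outside p _)]
  refine tendsto_integral_filter_of_dominated_convergence (fun x => ‖g x‖) ?_ ?_ hg.norm ?_
  · exact .of_forall fun ε => hg.aestronglyMeasurable.indicator (measurableSet_outside p ε)
  · exact .of_forall fun ε => .of_forall fun x => norm_indicator_le_norm_self _ _
  · have h1 : ∀ᵐ x ∂(volume : Measure E3), x ≠ p.1 := by simp [ae_iff, measure_singleton]
    have h2 : ∀ᵐ x ∂(volume : Measure E3), x ≠ p.2 := by simp [ae_iff, measure_singleton]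
    filter_upwards [h1, h2] with x h1 h2
    refine tendsto_const_nhds.congr' ?_
    filter_upwards [Ioo_mem_nhdsGT (dist_pos.2 h1), Ioo_mem_nhdsGT (dist_pos.2 h2)] with ε e1 e2
    rw [Set.indicator_of_mem]
    exact ⟨e1.2.le, e2.2.le⟩

/-- Smooth off the punctures, with at most first-order poles there, whose leading coefficients have
mean zero, and vanishing at infinity. -/
structure Mild (p : E6) (u : Fn) : Prop where
  smooth : ∀ x, x ≠ p.1 → x ≠ p.2 → SmoothAt u x
  fst : ∃ Φ, Ray 1 p.1 (-1) u Φ ∧ ∫ n, Φ (0, n.1) ∂sph = 0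
  snd : ∃ Φ, Ray 1 p.2 (-1) u Φ ∧ ∫ n, Φ (0, n.1) ∂sph = 0
  inf : ∃ Φ, Ray (-1) 0 1 u Φ

lemma eventually_off_ray (a b : E3) (hab : a ≠ b) :
    ∀ᶠ t in N0, ∀ n, Dir n → a + t • n ≠ a ∧ a + t • n ≠ b := by
  filter_upwards [Ioo_mem_nhdsGT (dist_pos.2 hab)] with t ht n hn
  have hd : dist (a + t • n) a = t := by simp [norm_smul, hn, abs_of_pos ht.1]
  constructor
  · exact dist_pos.1 (by rw [hd]; exact ht.1)
  · intro h
    rw [h, dist_comm] at hd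
    exact ht.2.ne hd.symm

section Mild

variable {u : Fn}

lemma Mild.locallyIntegrable (hp : p.1 ≠ p.2) (hu : Mild p u) : LocallyIntegrable u volume := by
  intro x
  have hev : ∀ a b : E3, a ≠ b → (a = p.1 ∧ b = p.2 ∨ a = p.2 ∧ b = p.1) →
      ∀ᶠ x in 𝓝[≠] a, ContinuousAt u x := by
    intro a b hab h
    filter_upwards [nhdsWithin_le_nhds (eventually_ne b hab), self_mem_nhdsWithin] with x h1 h2
    rcases h with ⟨rfl, rfl⟩ | ⟨rfl, rfl⟩
    · exact (hu.smooth x h2 h1).continuousAt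
    · exact (hu.smooth x h1 h2).continuousAt
  by_cases h1 : x = p.1
  · obtain ⟨Φ, hΦ, -⟩ := hu.fst
    rw [h1]; exact hΦ.integrableAt (hev _ _ hp (Or.inl ⟨rfl, rfl⟩))
  by_cases h2 : x = p.2
  · obtain ⟨Φ, hΦ, -⟩ := hu.snd
    rw [h2]; exact hΦ.integrableAt (hev _ _ hp.symm (Or.inr ⟨rfl, rfl⟩))
  have hU : IsOpen {x : E3 | x ≠ p.1 ∧ x ≠ p.2} := isOpen_ne.inter isOpen_ne
  have hc : ContinuousOn u {x : E3 | x ≠ p.1 ∧ x ≠ p.2} := fun z hz =>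
    (hu.smooth z hz.1 hz.2).continuousAt.continuousWithinAt
  have h3 := hc.locallyIntegrableOn (μ := volume) hU.measurableSet x ⟨h1, h2⟩
  rwa [nhdsWithin_eq_nhds.2 (hU.mem_nhds ⟨h1, h2⟩)] at h3

lemma hasCompactSupport_lap {φ : Fn} (hc : HasCompactSupport φ) : HasCompactSupport (lap φ) := by
  refine hc.of_isClosed_subset (isClosed_tsupport _) (closure_minimal (fun x hx => ?_)
    (isClosed_tsupport _))
  by_contra h
  exact hx (Finset.sum_eq_zero fun i _ => image_eq_zero_of_notMem_tsupport fun h' =>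
    h (support_pd_subset (support_pd_subset h')))

lemma tendsto_green (hp : p.1 ≠ p.2)
    (hu : ∀ x, x ≠ p.1 → x ≠ p.2 → SmoothAt u x) (hl : LocallyIntegrable u volume)
    {φ : Fn} (hφ : Smooth φ) (hc : HasCompactSupport φ) :
    Tendsto (fun ε => (∫ x in outside p ε, lap u x * φ x)
      + flux (fun i z => φ z * pd i u z - u z * pd i φ z) p.1 ε
      + flux (fun i z => φ z * pd i u z - u z * pd i φ z) p.2 ε) N0
      (𝓝 (∫ x, u x * lap φ x)) := by
  have hi : Integrable fun x => u x * lap φ x := by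
    simpa [mul_comm] using hl.integrable_smul_left_of_hasCompactSupport
      (contDiff_lap hφ).continuous (hasCompactSupport_lap hc)
  have hdiv : ∀ x, x ≠ p.1 → x ≠ p.2 → ∑ i, pd i (fun z => φ z * pd i u z - u z * pd i φ z) x =
      lap u x * φ x - u x * lap φ x := by
    intro x h1 h2
    rw [lap, lap, sum_mul, mul_sum, ← sum_sub_distrib]
    refine sum_congr rfl fun i _ => ?_
    have d1 := diffAt (hu x h1 h2)
    have d2 := diffAt (hφ.contDiffAt (x := x))
    have d3 := diffAt (contDiffAt_pd (i := i) (hu x h1 h2))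
    have d4 := diffAt ((contDiff_pd (i := i) hφ).contDiffAt (x := x))
    rw [pd_sub (d2.fun_mul d3) (d1.fun_mul d4), pd_mul d2 d3, pd_mul d1 d4]
    ring
  refine (tendsto_integral_outside hi p).congr' ?_
  have := r12_pos hp
  filter_upwards [Ioo_mem_nhdsGT (show 0 < r12 p / 8 by positivity)] with ε hε
  have hd := integral_div_outside hp (V := fun i z => φ z * pd i u z - u z * pd i φ z)
    (fun i x h1 h2 => (hφ.contDiffAt.mul (contDiffAt_pd (hu x h1 h2))).sub
      ((hu x h1 h2).mul (contDiff_pd hφ).contDiffAt))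
    (fun i => hc.mul_right.sub (hasCompactSupport_pd hc).mul_left) hε
  have hcont : ∀ x, x ≠ p.1 → x ≠ p.2 → ContinuousAt (fun x => lap u x * φ x) x := fun x h1 h2 =>
    (tendsto_finsetSum _ fun i _ => (contDiffAt_pd (contDiffAt_pd
      (hu x h1 h2))).continuousAt : ContinuousAt (lap u) x).mul hφ.continuous.continuousAt
  rw [setIntegral_congr_fun (measurableSet_outside p ε) fun x hx =>
    hdiv x (outside_ne hε.1 hx).1 (outside_ne hε.1 hx).2,
    integral_sub (integrableOn_outside hε.1 hcont hc.mul_left) hi.integrableOn] at hd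
  linarith

lemma Mild.weak (hp : p.1 ≠ p.2) (hu : Mild p u) {φ : Fn} (hφ : Smooth φ)
    (hc : HasCompactSupport φ) :
    Tendsto (fun ε => ∫ x in outside p ε, lap u x * φ x) N0 (𝓝 (∫ x, u x * lap φ x)) := by
  obtain ⟨Φ1, hΦ1, m1⟩ := hu.fst
  obtain ⟨Φ2, hΦ2, m2⟩ := hu.snd
  have f1 := hΦ1.green_flux m1 ((eventually_off_ray _ _ hp).mono fun t ht n hn =>
    diffAt (hu.smooth _ (ht n hn).1 (ht n hn).2)) hφ
  have f2 := hΦ2.green_flux m2 ((eventually_off_ray _ _ hp.symm).mono fun t ht n hn =>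
    diffAt (hu.smooth _ (ht n hn).2 (ht n hn).1)) hφ
  simpa using ((tendsto_green hp hu.smooth (hu.locallyIntegrable hp) hφ hc).sub f2).sub f1

lemma Mild.eq_of_weakPoisson (hp : p.1 ≠ p.2) (hu : Mild p u) {σ f : Fn}
    (hs : ContDiffOn ℝ (⊤ : ℕ∞) σ {p.1, p.2}ᶜ) (hl : LocallyIntegrable σ volume)
    (h0 : Tendsto σ (Bornology.cobounded E3) (𝓝 0)) (hW : WeakPoisson p.1 p.2 σ f)
    (hf : ∀ x, x ≠ p.1 → x ≠ p.2 → f x = lap u x) (h1 : x ≠ p.1) (h2 : x ≠ p.2) :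
    σ x = u x := by
  obtain ⟨Φ, hΦ⟩ := hu.inf
  have hul := hu.locallyIntegrable hp
  have hopen : IsOpen ({p.1, p.2}ᶜ : Set E3) := (Set.toFinite {p.1, p.2}).isClosed.isOpen_compl
  have hx : x ∈ ({p.1, p.2}ᶜ : Set E3) := by simp [h1, h2]
  have hσx : ContinuousAt σ x := (hs.contDiffAt (hopen.mem_nhds hx)).continuousAt
  have := weakly_harmonic_eq_zero (w := fun z => σ z - u z) (hl.sub hul)
    (by simpa using h0.sub hΦ.tendsto_zero) (fun φ hφ hc => ?_)
    (hσx.sub (hu.smooth x h1 h2).continuousAt)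
  · simpa [sub_eq_zero] using this
  · have hlap : ∀ x, Laplacian.laplacian φ x = lap φ x := fun x =>
      laplacian_eq_sum_pd hφ.contDiffAt
    have hP := hW φ hφ hc
    simp_rw [hlap] at hP
    have hT := hu.weak hp hφ hc
    have hT' : Tendsto (fun ε => ∫ x in {x : E3 | ε ≤ dist x p.1 ∧ ε ≤ dist x p.2}, f x * φ x)
        N0 (𝓝 (∫ x, u x * lap φ x)) := by
      refine hT.congr' ?_
      filter_upwards [self_mem_nhdsWithin] with ε hε0
      refine setIntegral_congr_fun (measurableSet_outside p ε) fun x hx => ?_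
      rw [hf x (outside_ne hε0 hx).1 (outside_ne hε0 hx).2]
    have heq := hP.eq_of_tendsto hT'
    have hlc := hasCompactSupport_lap hc
    have hi : ∀ w : Fn, LocallyIntegrable w volume → Integrable fun x => w x * lap φ x := by
      intro w hw
      have := hw.integrable_smul_left_of_hasCompactSupport (contDiff_lap hφ).continuous hlc
      simpa [mul_comm] using this
    simp_rw [sub_mul]
    rw [integral_sub (hi σ hl) (hi u hul), heq, sub_self]

end Mild

/-! ### Second-order expansions in `β` -/

/-- Near `β = 0` and `x`, the family `f` is `a + β b + β² c + O(β³)`, smoothly. -/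
structure Jet (x : E3) (f : ℝ → Fn) (a b c : Fn) : Prop where
  zero : SmoothAt a x
  one : SmoothAt b x
  two : SmoothAt c x
  rem : ∃ r : RFn, SmoothAt r (0, x) ∧ ∀ᶠ q in 𝓝 ((0 : ℝ), x),
    f q.1 q.2 = a q.2 + q.1 * b q.2 + q.1 ^ 2 * c q.2 + q.1 ^ 3 * r q

section Jet

variable {f g : ℝ → Fn} {a b c a' b' c' : Fn}

lemma contDiffAt_snd_comp {u : Fn} (h : SmoothAt u x) :
    SmoothAt (fun q : ℝ × E3 => u q.2) (0, x) :=
  ContDiffAt.comp ((0 : ℝ), x) (g := u) (f := fun q : ℝ × E3 => q.2) h contDiffAt_snd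

lemma Jet.add (hf : Jet x f a b c) (hg : Jet x g a' b' c') :
    Jet x (fun β z => f β z + g β z) (fun z => a z + a' z) (fun z => b z + b' z)
      (fun z => c z + c' z) := by
  obtain ⟨r, hr, hr'⟩ := hf.rem
  obtain ⟨s, hs, hs'⟩ := hg.rem
  refine ⟨hf.zero.add hg.zero, hf.one.add hg.one, hf.two.add hg.two, fun q => r q + s q,
    hr.add hs, ?_⟩
  filter_upwards [hr', hs'] with q h1 h2
  rw [h1, h2]; ring

lemma Jet.mul (hf : Jet x f a b c) (hg : Jet x g a' b' c') :
    Jet x (fun β z => f β z * g β z) (fun z => a z * a' z) (fun z => a z * b' z + b z * a' z)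
      (fun z => a z * c' z + b z * b' z + c z * a' z) := by
  obtain ⟨r, hr, hr'⟩ := hf.rem
  obtain ⟨s, hs, hs'⟩ := hg.rem
  have A := contDiffAt_snd_comp hf.zero
  have B := contDiffAt_snd_comp hf.one
  have C := contDiffAt_snd_comp hf.two
  have A' := contDiffAt_snd_comp hg.zero
  have B' := contDiffAt_snd_comp hg.one
  have C' := contDiffAt_snd_comp hg.two
  refine ⟨hf.zero.mul hg.zero, (hf.zero.mul hg.one).add (hf.one.mul hg.zero),
    ((hf.zero.mul hg.two).add (hf.one.mul hg.one)).add (hf.two.mul hg.zero),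
    fun q => (b q.2 * c' q.2 + c q.2 * b' q.2 + q.1 * (c q.2 * c' q.2))
      + r q * (a' q.2 + q.1 * b' q.2 + q.1 ^ 2 * c' q.2 + q.1 ^ 3 * s q)
      + s q * (a q.2 + q.1 * b q.2 + q.1 ^ 2 * c q.2), ?_, ?_⟩
  · have F : SmoothAt (fun q : ℝ × E3 => q.1) (0, x) := contDiffAt_fst
    exact ((((B.mul C').add (C.mul B')).add (F.mul (C.mul C'))).add (hr.mul
      (((A'.add (F.mul B')).add ((F.pow 2).mul C')).add ((F.pow 3).mul hs)))).add
      (hs.mul ((A.add (F.mul B)).add ((F.pow 2).mul C)))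
  · filter_upwards [hr', hs'] with q h1 h2
    rw [h1, h2]; ring

lemma Jet.const_mul (k : ℝ) (hf : Jet x f a b c) :
    Jet x (fun β z => k * f β z) (fun z => k * a z) (fun z => k * b z) (fun z => k * c z) := by
  obtain ⟨r, hr, hr'⟩ := hf.rem
  refine ⟨contDiffAt_const.mul hf.zero, contDiffAt_const.mul hf.one, contDiffAt_const.mul hf.two,
    fun q => k * r q, contDiffAt_const.mul hr, ?_⟩
  filter_upwards [hr'] with q h1
  rw [h1]; ring

lemma Jet.congr (hf : Jet x f a b c) (ha : a' = a) (hb : b' = b) (hc : c' = c) :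
    Jet x f a' b' c' := by rw [ha, hb, hc]; exact hf

lemma Jet.sub (hf : Jet x f a b c) (hg : Jet x g a' b' c') :
    Jet x (fun β z => f β z - g β z) (fun z => a z - a' z) (fun z => b z - b' z)
      (fun z => c z - c' z) := by
  simpa [sub_eq_add_neg] using hf.add (hg.const_mul (-1))

lemma jet_poly (ha : SmoothAt a x) (hb : SmoothAt b x) :
    Jet x (fun β z => a z + β * b z) a b (fun _ => 0) :=
  ⟨ha, hb, contDiffAt_const, fun _ => 0, contDiffAt_const, .of_forall fun q => by ring⟩

lemma jet_zero : Jet x (fun _ _ => 0) (fun _ => 0) (fun _ => 0) (fun _ => 0) :=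
  ⟨contDiffAt_const, contDiffAt_const, contDiffAt_const, fun _ => 0, contDiffAt_const,
    Eventually.of_forall fun q => by ring⟩

lemma Jet.sum {ι : Type*} (s : Finset ι) {F : ι → ℝ → Fn} {A B C : ι → Fn}
    (h : ∀ i, Jet x (F i) (A i) (B i) (C i)) :
    Jet x (fun β z => ∑ i ∈ s, F i β z) (fun z => ∑ i ∈ s, A i z) (fun z => ∑ i ∈ s, B i z)
      (fun z => ∑ i ∈ s, C i z) := by
  classical
  induction s using Finset.induction_on with
  | empty => simpa using jet_zero
  | insert i s hi ih =>
    simp only [Finset.sum_insert hi]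
    exact (h i).add ih

lemma Jet.pd (hf : Jet x f a b c) (i : Fin 3) :
    Jet x (fun β z => pd i (f β) z) (pd i a) (pd i b) (pd i c) := by
  obtain ⟨r, hr, hr'⟩ := hf.rem
  refine ⟨contDiffAt_pd hf.zero, contDiffAt_pd hf.one, contDiffAt_pd hf.two,
    fun q => fderiv ℝ r q (0, EuclideanSpace.single i 1),
    (hr.fderiv_right (m := ((⊤ : ℕ∞) : WithTop ℕ∞)) (by simp)).clm_apply contDiffAt_const, ?_⟩
  have hd : ∀ᶠ q in 𝓝 ((0 : ℝ), x), DiffAt r q := by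
    filter_upwards [(hr.of_le (m := 1) (by exact_mod_cast le_top)).eventually (by simp)] with q hq
      using diffAt hq
  have hs : Tendsto (fun q : ℝ × E3 => q.2) (𝓝 ((0 : ℝ), x)) (𝓝 x) := continuous_snd.tendsto _
  filter_upwards [hr'.eventually_nhds, hd, hs.eventually (eventually_diffAt hf.zero),
    hs.eventually (eventually_diffAt hf.one),
    hs.eventually (eventually_diffAt hf.two)] with q h1 h2 h3 h4 h5
  obtain ⟨β, z⟩ := q
  have hc : Tendsto (fun w : E3 => (β, w)) (𝓝 z) (𝓝 (β, z)) := (by fun_prop : Continuous _).tendsto z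
  have h6 : f β =ᶠ[𝓝 z] fun w => ((a w + β * b w) + β ^ 2 * c w) + β ^ 3 * r (β, w) := by
    filter_upwards [hc.eventually h1] with w hw using hw
  have hL : HasFDerivAt (fun w : E3 => (β, w)) (ContinuousLinearMap.inr ℝ ℝ E3) z :=
    hasFDerivAt_prodMk_right _ _
  have h2' : HasFDerivAt r (fderiv ℝ r (β, z)) (β, z) := h2.hasFDerivAt
  have h7 := HasFDerivAt.comp z h2' hL
  have h8 : DiffAt (fun w => r (β, w)) z := h7.differentiableAt
  have h9 : Geometrostatics.pd i (fun w => r (β, w)) z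
      = fderiv ℝ r (β, z) (0, EuclideanSpace.single i 1) := by
    have := h7.fderiv
    simp only [Function.comp_def] at this
    simp only [Geometrostatics.pd, this]; simp
  simp only at h3 h4 h5 ⊢
  have d1 : DiffAt (fun w => a w + β * b w) z := h3.add (h4.const_mul β)
  have d2 : DiffAt (fun w => (a w + β * b w) + β ^ 2 * c w) z :=
    d1.add (h5.const_mul _)
  rw [pd_congr h6, pd_add d2 (h8.const_mul _), pd_add d1 (h5.const_mul _),
    pd_add h3 (h4.const_mul _), pd_const_mul _ h4, pd_const_mul _ h5, pd_const_mul _ h8, h9]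

lemma betaCoeff_congr {φ ψ : ℝ → ℝ} (h : φ =ᶠ[𝓝 0] ψ) (n : ℕ) : betaCoeff n φ = betaCoeff n ψ := by
  rw [betaCoeff, betaCoeff, h.iteratedDeriv_eq n]

lemma Jet.slice (hf : Jet x f a b c) : ∃ r : ℝ → ℝ, SmoothAt r 0 ∧
    (fun β => f β x) =ᶠ[𝓝 0] fun β => a x + β * b x + β ^ 2 * c x + β ^ 3 * r β := by
  obtain ⟨r, hr, hr'⟩ := hf.rem
  have hc : Tendsto (fun β : ℝ => (β, x)) (𝓝 0) (𝓝 (0, x)) :=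
    (by fun_prop : Continuous fun β : ℝ => (β, x)).tendsto 0
  refine ⟨fun β => r (β, x), ContDiffAt.comp (0 : ℝ) (g := r) (f := fun β : ℝ => (β, x)) hr
    (by fun_prop), ?_⟩
  filter_upwards [hc.eventually hr'] with β hβ using hβ

lemma deriv_jet {r : ℝ → ℝ} (hr : SmoothAt r 0) (A B C : ℝ) :
    deriv (fun β => A + β * B + β ^ 2 * C + β ^ 3 * r β) =ᶠ[𝓝 0]
      fun β => B + β * (2 * C) + β ^ 2 * (3 * r β + β * deriv r β) := by
  have hd : ∀ᶠ β in 𝓝 (0 : ℝ), DiffAt r β := by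
    filter_upwards [(hr.of_le (m := 1) (by exact_mod_cast le_top)).eventually (by simp)] with q hq
      using diffAt hq
  filter_upwards [hd] with β hβ
  have h := ((((hasDerivAt_const β A).add ((hasDerivAt_id β).mul_const B)).add
    ((hasDerivAt_pow 2 β).mul_const C)).add ((hasDerivAt_pow 3 β).mul hβ.hasDerivAt)).deriv
  refine Eq.trans (Eq.trans ?_ h) ?_
  · rfl
  · push_cast; ring

lemma Jet.betaCoeff_zero (hf : Jet x f a b c) : betaCoeff 0 (fun β => f β x) = a x := by
  obtain ⟨r, -, h⟩ := hf.slice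
  simp [betaCoeff, h.self_of_nhds]

lemma Jet.betaCoeff_one (hf : Jet x f a b c) : betaCoeff 1 (fun β => f β x) = b x := by
  obtain ⟨r, hr, h⟩ := hf.slice
  rw [betaCoeff_congr h, betaCoeff, iteratedDeriv_one, (deriv_jet hr _ _ _).self_of_nhds]
  simp

lemma Jet.betaCoeff_two (hf : Jet x f a b c) : betaCoeff 2 (fun β => f β x) = c x := by
  obtain ⟨r, hr, h⟩ := hf.slice
  rw [betaCoeff_congr h, betaCoeff, iteratedDeriv_succ, iteratedDeriv_one,
    (deriv_jet hr _ _ _).deriv_eq]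
  have hd : DiffAt r 0 := diffAt hr
  have hr' : ContDiffAt ℝ 1 (deriv r) 0 := by
    have h1 : ContDiffAt ℝ 1 (fderiv ℝ r) 0 :=
      hr.fderiv_right (m := 1) (by norm_num; exact two_le_smooth)
    exact (h1.clm_apply (contDiffAt_const (c := (1 : ℝ))))
  have hd' : DiffAt (deriv r) 0 := diffAt hr'
  have h := (((hasDerivAt_const (0 : ℝ) (b x)).add ((hasDerivAt_id (0 : ℝ)).mul_const (2 * c x))).add
    ((hasDerivAt_pow 2 (0 : ℝ)).mul ((hd.hasDerivAt.const_mul 3).add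
      ((hasDerivAt_id (0 : ℝ)).mul hd'.hasDerivAt)))).deriv
  have h2 : deriv (fun β => b x + β * (2 * c x) + β ^ 2 * (3 * r β + β * deriv r β)) 0 = 2 * c x := by
    refine Eq.trans (Eq.trans ?_ h) ?_
    · rfl
    · simp
  rw [h2]; norm_num

end Jet

/-! ### The inverse of a matrix of functions -/

section Inverse

variable {E : Type*} [NormedAddCommGroup E] [NormedSpace ℝ E] {q : E}
  {A : E → Matrix (Fin 3) (Fin 3) ℝ}

lemma contDiffAt_det (hA : ∀ i j, SmoothAt (fun z => A z i j) q) :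
    SmoothAt (fun z => (A z).det) q := by
  simp only [Matrix.det_apply]
  exact ContDiffAt.sum fun s _ => ContDiffAt.const_smul _ (contDiffAt_prod fun i _ => hA _ _)

lemma contDiffAt_inv_apply (hA : ∀ i j, SmoothAt (fun z => A z i j) q)
    (h0 : (A q).det ≠ 0) (i j : Fin 3) : SmoothAt (fun z => (A z)⁻¹ i j) q := by
  have h1 : ∀ z, (A z)⁻¹ i j = ((A z).det)⁻¹ * ((A z).updateRow j (Pi.single i 1)).det := by
    intro z
    rw [Matrix.inv_def, Matrix.smul_apply, Matrix.adjugate_apply, smul_eq_mul, Ring.inverse_eq_inv']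
  simp only [h1]
  refine ((contDiffAt_det hA).inv h0).mul (contDiffAt_det fun k l => ?_)
  by_cases hk : k = j
  · subst hk; simp only [Matrix.updateRow_self]; exact contDiffAt_const
  · simp only [Matrix.updateRow_ne hk]; exact hA k l

end Inverse

/-- The perturbed Euclidean metric `δ + β S`. -/
def perturbed (S : Fin 3 → Fin 3 → Fn) (β : ℝ) : TensorField := fun z =>
  Matrix.of fun i j => δ i j + β * S i j z

section Perturbed

variable {S : Fin 3 → Fin 3 → Fn}

lemma jet_inverse (hS : ∀ i j, SmoothAt (S i j) x) (i j : Fin 3) :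
    Jet x (fun β z => (perturbed S β z)⁻¹ i j) (fun _ => δ i j) (fun z => -S i j z)
      (fun z => ∑ k, S i k z * S k j z) := by
  let A : ℝ × E3 → Matrix (Fin 3) (Fin 3) ℝ := fun q => perturbed S q.1 q.2
  have hS' := fun i j => contDiffAt_snd_comp (hS i j)
  have hA : ∀ i j, SmoothAt (fun q => A q i j) (0, x) := fun i j =>
    contDiffAt_const.add (contDiffAt_fst.mul (hS' i j))
  have h1 : A (0, x) = 1 := by
    ext i j; simp [A, perturbed, δ, Matrix.one_apply]
  have h0 : (A (0, x)).det ≠ 0 := by rw [h1]; simp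
  have hinv := contDiffAt_inv_apply hA h0
  refine ⟨contDiffAt_const, (hS i j).neg, ContDiffAt.sum fun k _ => (hS i k).mul (hS k j),
    fun q => -∑ l, (∑ k, S i k q.2 * (∑ m, S k m q.2 * S m l q.2)) * (A q)⁻¹ l j,
    (ContDiffAt.sum fun l _ => (ContDiffAt.sum fun k _ => (hS' i k).mul
      (ContDiffAt.sum fun m _ => (hS' k m).mul (hS' m l))).mul (hinv l j)).neg, ?_⟩
  filter_upwards [(contDiffAt_det hA).continuousAt.eventually_ne h0] with q hq
  let T : Matrix (Fin 3) (Fin 3) ℝ := Matrix.of fun i j => S i j q.2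
  have hT : A q = 1 + q.1 • T := by
    ext i j; simp [A, perturbed, δ, Matrix.one_apply, T]
  have hmul : A q * (A q)⁻¹ = 1 := Matrix.mul_nonsing_inv _ (isUnit_iff_ne_zero.2 hq)
  have e1 : (A q)⁻¹ = 1 - q.1 • (T * (A q)⁻¹) := by
    nth_rewrite 1 [hT] at hmul
    rw [add_mul, one_mul, smul_mul_assoc] at hmul
    exact eq_sub_of_add_eq hmul
  have e2 : (A q)⁻¹ = 1 - q.1 • T + q.1 ^ 2 • (T * T) - q.1 ^ 3 • (T * (T * T) * (A q)⁻¹) := by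
    have s1 : T * (A q)⁻¹ = T - q.1 • (T * T * (A q)⁻¹) := by
      nth_rewrite 1 [e1]
      rw [mul_sub, mul_one, mul_smul_comm, mul_assoc]
    have s2 : T * T * (A q)⁻¹ = T * T - q.1 • (T * (T * T) * (A q)⁻¹) := by
      nth_rewrite 1 [e1]
      rw [mul_sub, mul_one, mul_smul_comm]; simp only [mul_assoc]
    nth_rewrite 1 [e1]
    rw [s1, s2]
    simp only [smul_sub, smul_smul]
    ring_nf
    abel
  have e3 := congrFun (congrFun e2 i) j
  simp only [Matrix.sub_apply, Matrix.add_apply, Matrix.smul_apply, Matrix.mul_apply,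
    smul_eq_mul, Matrix.one_apply, T, Matrix.of_apply] at e3
  have e4 : (perturbed S q.1 q.2)⁻¹ i j = (A q)⁻¹ i j := rfl
  rw [e4, e3]
  simp only [δ]; ring

/-- The Christoffel symbols at first order. -/
def chr (S : Fin 3 → Fin 3 → Fn) (k i j : Fin 3) (z : E3) : ℝ :=
  (pd i (S j k) z + pd j (S i k) z - pd k (S i j) z) / 2

/-- The Christoffel symbols at second order. -/
def chr2 (S : Fin 3 → Fin 3 → Fn) (k i j : Fin 3) (z : E3) : ℝ :=
  -∑ l, S k l z * chr S l i j z

lemma jet_metric (hS : ∀ i j, SmoothAt (S i j) x) (i j : Fin 3) :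
    Jet x (fun β z => perturbed S β z i j) (fun _ => δ i j) (S i j) (fun _ => 0) :=
  jet_poly contDiffAt_const (hS i j)

lemma jet_pd_metric (hS : ∀ i j, SmoothAt (S i j) x) (k i j : Fin 3) :
    Jet x (fun β z => pd k (fun w => perturbed S β w i j) z) (fun _ => 0) (pd k (S i j))
      (fun _ => 0) :=
  ((jet_metric hS i j).pd k).congr (funext fun z => (pd_const _).symm) rfl
    (funext fun z => (pd_const _).symm)

lemma sum_δ_mul_left (i : Fin 3) (f : Fin 3 → ℝ) : ∑ j, δ i j * f j = f i := by simp [δ]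

lemma jet_christoffel (hS : ∀ i j, SmoothAt (S i j) x) (k i j : Fin 3) :
    Jet x (fun β z => christoffel (perturbed S β) k i j z) (fun _ => 0) (chr S k i j)
      (chr2 S k i j) := by
  have h := (Jet.sum univ fun l => (jet_inverse hS k l).mul
    (((jet_pd_metric hS i j l).add (jet_pd_metric hS j i l)).sub
      (jet_pd_metric hS l i j))).const_mul (1 / 2)
  refine h.congr (funext fun z => ?_) (funext fun z => ?_) (funext fun z => ?_)
  · simp
  · simp only [add_zero, sub_zero, mul_zero, sum_δ_mul_left, chr]; ring
  · simp only [add_zero, sub_zero, mul_zero, zero_add, chr2, chr, mul_sum,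
      ← sum_neg_distrib]
    exact sum_congr rfl fun l _ => by ring

/-- The Ricci tensor at first order. -/
def ric (S : Fin 3 → Fin 3 → Fn) (i j : Fin 3) (z : E3) : ℝ :=
  ∑ k, (pd k (chr S k i j) z - pd j (chr S k i k) z)

/-- The Ricci tensor at second order. -/
def ric2 (S : Fin 3 → Fin 3 → Fn) (i j : Fin 3) (z : E3) : ℝ :=
  ∑ k, (pd k (chr2 S k i j) z - pd j (chr2 S k i k) z
    + ∑ l, (chr S k k l z * chr S l i j z - chr S k j l z * chr S l i k z))

lemma jet_ricci (hS : ∀ i j, SmoothAt (S i j) x) (i j : Fin 3) :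
    Jet x (fun β z => ricci (perturbed S β) i j z) (fun _ => 0) (ric S i j) (ric2 S i j) := by
  have h := Jet.sum univ fun k => (((jet_christoffel hS k i j).pd k).sub
    ((jet_christoffel hS k i k).pd j)).add (Jet.sum univ fun l =>
      ((jet_christoffel hS k k l).mul (jet_christoffel hS l i j)).sub
        ((jet_christoffel hS k j l).mul (jet_christoffel hS l i k)))
  refine h.congr (funext fun z => ?_) (funext fun z => ?_) (funext fun z => ?_)
  · simp [pd_const]
  · simp [ric]
  · simp [ric2]

/-- The scalar curvature at first order. -/
def scal (S : Fin 3 → Fin 3 → Fn) (z : E3) : ℝ := ∑ i, ric S i i z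

/-- The scalar curvature at second order. -/
def scal2 (S : Fin 3 → Fin 3 → Fn) (z : E3) : ℝ :=
  ∑ i, (ric2 S i i z - ∑ j, S i j z * ric S i j z)

lemma jet_scalar (hS : ∀ i j, SmoothAt (S i j) x) :
    Jet x (fun β z => scalarCurvature (perturbed S β) z) (fun _ => 0) (scal S) (scal2 S) := by
  have h := Jet.sum univ fun i => Jet.sum univ fun j =>
    (jet_inverse hS i j).mul (jet_ricci hS i j)
  refine h.congr (funext fun z => ?_) (funext fun z => ?_) (funext fun z => ?_)
  · simp
  · simp only [mul_zero, add_zero, sum_δ_mul_left, scal]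
  · simp only [mul_zero, add_zero, scal2, sum_add_distrib, sum_δ_mul_left, neg_mul,
      sum_neg_distrib, sum_sub_distrib, sub_eq_add_neg]

/-- The first-order part of the Laplace–Beltrami operator. -/
def lap1 (S : Fin 3 → Fin 3 → Fn) (u : Fn) (z : E3) : ℝ :=
  -∑ i, (∑ k, chr S k i i z * pd k u z + ∑ j, S i j z * pd i (pd j u) z)

/-- The second-order part of the Laplace–Beltrami operator. -/
def lap2 (S : Fin 3 → Fin 3 → Fn) (u : Fn) (z : E3) : ℝ :=
  ∑ i, (-(∑ k, chr2 S k i i z * pd k u z) + ∑ j, (S i j z * (∑ k, chr S k i j z * pd k u z)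
    + (∑ k, S i k z * S k j z) * pd i (pd j u) z))

lemma jet_laplaceBeltrami (hS : ∀ i j, SmoothAt (S i j) x) {u : ℝ → Fn}
    {a b : Fn} (hu : Jet x u a b (fun _ => 0)) :
    Jet x (fun β z => laplaceBeltrami (perturbed S β) (u β) z) (lap a)
      (fun z => lap b z + lap1 S a z) (fun z => lap1 S b z + lap2 S a z) := by
  have h := Jet.sum univ fun i => Jet.sum univ fun j =>
    (jet_inverse hS i j).mul (((hu.pd j).pd i).sub (Jet.sum univ fun k =>
      (jet_christoffel hS k i j).mul (hu.pd k)))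
  have p0 : ∀ i : Fin 3, pd i (fun _ : E3 => (0 : ℝ)) = fun _ => 0 := fun i =>
    funext fun z => pd_const 0
  refine h.congr (funext fun z => ?_) (funext fun z => ?_) (funext fun z => ?_)
  · simp [sum_δ_mul_left, lap]
  · simp only [zero_mul, Finset.sum_const_zero, sub_zero, zero_add, lap, lap1,
      sum_add_distrib, sum_δ_mul_left, neg_mul, sum_neg_distrib,
      sum_sub_distrib]
    ring
  · simp only [p0, zero_mul, mul_zero, Finset.sum_const_zero, sub_zero, zero_add, lap1, lap2,
      sum_add_distrib, sum_δ_mul_left, neg_mul, sum_neg_distrib, mul_sub,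
      sum_sub_distrib]
    ring

lemma jet_constraintOp (hS : ∀ i j, SmoothAt (S i j) x) {u : ℝ → Fn}
    {a b : Fn} (hu : Jet x u a b (fun _ => 0)) :
    Jet x (fun β z => constraintOp (perturbed S β) (u β) z) (lap a)
      (fun z => lap b z + lap1 S a z - a z * scal S z / 8)
      (fun z => lap1 S b z + lap2 S a z - (a z * scal2 S z + b z * scal S z) / 8) := by
  have h := (jet_laplaceBeltrami hS hu).sub ((hu.const_mul (1 / 8)).mul (jet_scalar hS))
  obtain ⟨r, hr, hr'⟩ := h.rem
  have h' : Jet x (fun β z => constraintOp (perturbed S β) (u β) z) _ _ _ :=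
    ⟨h.zero, h.one, h.two, r, hr, by
      filter_upwards [hr'] with q hq
      rw [← hq, constraintOp]; ring⟩
  refine h'.congr (funext fun z => ?_) (funext fun z => ?_) (funext fun z => ?_)
  · simp
  · simp only [mul_zero, add_zero]; ring
  · simp only [mul_zero, add_zero]; ring

end Perturbed

/-! ### The sources of the perturbation equations -/

section Congr

variable {h h' : TensorField} {u u' : Fn}

lemma christoffel_congr (H : h =ᶠ[𝓝 x] h') (k i j : Fin 3) :
    christoffel h k i j =ᶠ[𝓝 x] christoffel h' k i j := by
  filter_upwards [H.eventually_nhds] with z hz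
  have e : ∀ i j m, pd m (fun w => h w i j) z = pd m (fun w => h' w i j) z := fun i j m =>
    pd_congr (by filter_upwards [hz] with w hw; rw [hw])
  simp only [christoffel, e, hz.self_of_nhds]

lemma scalarCurvature_congr (H : h =ᶠ[𝓝 x] h') : scalarCurvature h x = scalarCurvature h' x := by
  have e : ∀ k i j m, pd m (christoffel h k i j) x = pd m (christoffel h' k i j) x :=
    fun k i j m => pd_congr (christoffel_congr H k i j)
  have e' : ∀ k i j, christoffel h k i j x = christoffel h' k i j x :=
    fun k i j => (christoffel_congr H k i j).self_of_nhds
  simp only [scalarCurvature, ricci, e, e', H.self_of_nhds]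

lemma pd_eventuallyEq (Hu : u =ᶠ[𝓝 x] u') (j : Fin 3) : pd j u =ᶠ[𝓝 x] pd j u' := by
  filter_upwards [Hu.eventually_nhds] with z hz using pd_congr hz

lemma constraintOp_congr (H : h =ᶠ[𝓝 x] h') (Hu : u =ᶠ[𝓝 x] u') :
    constraintOp h u x = constraintOp h' u' x := by
  have e' : ∀ k i j, christoffel h k i j x = christoffel h' k i j x :=
    fun k i j => (christoffel_congr H k i j).self_of_nhds
  have f : ∀ j, pd j u x = pd j u' x := fun j => pd_congr Hu
  have f' : ∀ i j, pd i (pd j u) x = pd i (pd j u') x := fun i j => pd_congr (pd_eventuallyEq Hu j)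
  simp only [constraintOp, laplaceBeltrami, scalarCurvature_congr H, e', f, f', H.self_of_nhds,
    Hu.self_of_nhds]

end Congr

/-- The components of the seed. -/
def sdComp (p : E6) (i j : Fin 3) : Fn := sd i j p

lemma eventually_off_point (h1 : x ≠ p.1) (h2 : x ≠ p.2) : ∀ᶠ z in 𝓝 x, z ≠ p.1 ∧ z ≠ p.2 :=
  (eventually_ne p.1 h1).and (eventually_ne p.2 h2)

lemma Off.eventually (o : Off p x) : ∀ᶠ z in 𝓝 x, Off p z :=
  (eventually_off_point o.2 o.3).mono fun _ h => ⟨o.1, h.1, h.2⟩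

lemma conformalMetric_eventuallyEq (o : Off p x) (β : ℝ) :
    conformalMetric p.1 p.2 β =ᶠ[𝓝 x] perturbed (sdComp p) β := by
  filter_upwards [o.eventually] with z hz
  ext i j
  simp [conformalMetric, perturbed, sdComp, seed_eq hz, δ, Matrix.one_apply]

lemma smooth_sdComp (o : Off p x) (i j : Fin 3) :
    SmoothAt (sdComp p i j) x := (nice_sd i j).smooth.at o

lemma source_zero_eq (o : Off p x) {a : Fn}
    (h : σ 0 =ᶠ[𝓝 x] a) (ha : SmoothAt a x) : source p.1 p.2 σ 0 x =
      -(lap1 (sdComp p) a x - a x * scal (sdComp p) x / 8) := by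
  have J := jet_constraintOp (smooth_sdComp o)
    (jet_poly ha (contDiffAt_const (c := (0 : ℝ))))
  have e : (fun β => constraintOp (conformalMetric p.1 p.2 β)
      (fun z => partialSum 0 β fun k => σ k z) x) =
      fun β => constraintOp (perturbed (sdComp p) β) (fun z => a z + β * 0) x := by
    funext β
    refine constraintOp_congr (conformalMetric_eventuallyEq o β) ?_
    filter_upwards [h] with z hz
    simp [partialSum, hz]
  rw [source, e, J.betaCoeff_one]
  simp [lap, pd_const, show ∀ i : Fin 3, pd i (fun _ => 0) = fun _ => 0 from
    fun i => funext fun z => pd_const 0]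

lemma source_one_eq (o : Off p x)
    {a b : Fn} (h : σ 0 =ᶠ[𝓝 x] a) (h' : σ 1 =ᶠ[𝓝 x] b) (ha : SmoothAt a x)
    (hb : SmoothAt b x) : source p.1 p.2 σ 1 x =
      -(lap1 (sdComp p) b x + lap2 (sdComp p) a x
        - (a x * scal2 (sdComp p) x + b x * scal (sdComp p) x) / 8) := by
  have J := jet_constraintOp (smooth_sdComp o) (jet_poly ha hb)
  have e : (fun β => constraintOp (conformalMetric p.1 p.2 β)
      (fun z => partialSum 1 β fun k => σ k z) x) =
      fun β => constraintOp (perturbed (sdComp p) β) (fun z => a z + β * b z) x := by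
    funext β
    refine constraintOp_congr (conformalMetric_eventuallyEq o β) ?_
    filter_upwards [h, h'] with z hz hz'
    simp [partialSum, hz, hz', sum_range_succ]
  rw [source, e, J.betaCoeff_two]

lemma sdComp_comm (i j : Fin 3) : sdComp p i j = sdComp p j i := funext fun _ => sd_symm _ _ _ _

lemma diff_sdComp (o : Off p x) (i j : Fin 3) :
    DiffAt (sdComp p i j) x := diffAt (smooth_sdComp o i j)

lemma diff_pd_sdComp (o : Off p x) (k i j : Fin 3) :
    DiffAt (pd k (sdComp p i j)) x :=
  diffAt (contDiffAt_pd (smooth_sdComp o i j))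

lemma pd_trace_sdComp (o : Off p x) (m : Fin 3) :
    ∑ k, pd m (sdComp p k k) x = 0 := by
  rw [← pd_sum fun k _ => diff_sdComp o k k]
  have e : (fun z => ∑ k, sdComp p k k z) =ᶠ[𝓝 x] fun _ => 0 := by
    filter_upwards [o.eventually] with z hz using sd_trace hz
  rw [pd_congr e, pd_const]

lemma div_sdComp (o : Off p x) (j : Fin 3) :
    ∑ i, pd i (sdComp p i j) x = divSd j p x := div_sd o j

lemma div_sdComp_right (o : Off p x) (j : Fin 3) :
    ∑ i, pd i (sdComp p j i) x = divSd j p x := by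
  rw [← div_sdComp o j]
  exact sum_congr rfl fun i _ => by rw [sdComp_comm]

lemma sum_chr_sdComp (o : Off p x) (k : Fin 3) :
    ∑ i, chr (sdComp p) k i i x = divSd k p x := by
  have e1 := div_sdComp o k
  have e2 := pd_trace_sdComp o k
  simp only [chr, Fin.sum_univ_three] at *
  linear_combination e1 - e2 / 2

lemma sum_chr_sdComp_trace (o : Off p x) (i : Fin 3) :
    ∑ k, chr (sdComp p) k i k x = 0 := by
  have e2 := pd_trace_sdComp o i
  simp only [chr, Fin.sum_univ_three, sdComp_comm i] at *
  linear_combination e2 / 2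

lemma contDiffAt_chr (o : Off p x) (k i j : Fin 3) :
    SmoothAt (chr (sdComp p) k i j) x :=
  (((contDiffAt_pd (smooth_sdComp o j k)).add
    (contDiffAt_pd (smooth_sdComp o i k))).sub
    (contDiffAt_pd (smooth_sdComp o i j))).div_const 2

lemma diff_chr (o : Off p x) (k i j : Fin 3) :
    DiffAt (chr (sdComp p) k i j) x :=
  diffAt (contDiffAt_chr o k i j)

lemma diff_chr2 (o : Off p x) (k i j : Fin 3) :
    DiffAt (chr2 (sdComp p) k i j) x :=
  (DifferentiableAt.fun_sum fun l _ => (diff_sdComp o k l).mul (diff_chr o l i j)).neg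

lemma sum_pd_chr_trace (o : Off p x) (m i : Fin 3) :
    ∑ k, pd m (chr (sdComp p) k i k) x = 0 := by
  rw [← pd_sum fun k _ => diff_chr o k i k]
  have e : (fun z => ∑ k, chr (sdComp p) k i k z) =ᶠ[𝓝 x] fun _ => 0 := by
    filter_upwards [o.eventually] with z hz using sum_chr_sdComp_trace hz i
  rw [pd_congr e, pd_const]

lemma scal_sdComp (o : Off p x) :
    scal (sdComp p) x = divDivSd p x := by
  have h : ∑ k, ∑ i, pd k (chr (sdComp p) k i i) x = divDivSd p x := by
    rw [← div_divSd o]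
    refine sum_congr rfl fun k _ => ?_
    rw [← pd_sum fun i _ => diff_chr o k i i]
    refine pd_congr ?_
    filter_upwards [o.eventually] with z hz using sum_chr_sdComp hz k
  simp only [scal, ric, sum_sub_distrib, sum_pd_chr_trace o, sub_zero]
  rw [sum_comm, h]

/-- The operator `∂ᵢ (s_{ij} ∂ⱼ u)`. -/
def divGrad (p : E6) (u : Fn) (x : E3) : ℝ :=
  ∑ i, ∑ j, pd i (fun z => sd i j p z * pd j u z) x

lemma divGrad_eq (o : Off p x) {u : Fn}
    (hu : SmoothAt u x) : divGrad p u x =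
      ∑ j, divSd j p x * pd j u x + ∑ i, ∑ j, sd i j p x * pd i (pd j u) x := by
  have e : ∀ i j, pd i (fun z => sd i j p z * pd j u z) x =
      pd i (sd i j p) x * pd j u x + sd i j p x * pd i (pd j u) x := fun i j =>
    pd_mul (diff_sdComp o i j) (diffAt (contDiffAt_pd hu))
  simp only [divGrad, e, sum_add_distrib]
  rw [sum_comm]
  simp only [← sum_mul, div_sd o]

lemma lap1_sdComp (o : Off p x) {u : Fn}
    (hu : SmoothAt u x) : lap1 (sdComp p) u x = -divGrad p u x := by
  rw [divGrad_eq o hu, lap1, sum_add_distrib, sum_comm]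
  simp only [← sum_mul, sum_chr_sdComp o]
  rfl

lemma divGrad_add (o : Off p x) {u v : Fn}
    (hu : SmoothAt u x) (hv : SmoothAt v x) :
    divGrad p (fun z => u z + v z) x = divGrad p u x + divGrad p v x := by
  have e : ∀ i j, pd i (pd j fun z => u z + v z) x = pd i (pd j u) x + pd i (pd j v) x :=
    fun i j => by
      rw [pd_congr (pd_add_eventually hu hv j), pd_add (diffAt (contDiffAt_pd hu))
        (diffAt (contDiffAt_pd hv))]
  rw [divGrad_eq o (hu.add hv), divGrad_eq o hu, divGrad_eq o hv]
  simp only [e, pd_add (diffAt hu) (diffAt hv), mul_add,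
    sum_add_distrib]
  ring

lemma pd_pd_const_mul {u : Fn} (hu : SmoothAt u x) (c : ℝ) (i j : Fin 3) :
    pd i (pd j fun z => c * u z) x = c * pd i (pd j u) x := by
  have h : pd j (fun z => c * u z) =ᶠ[𝓝 x] fun z => c * pd j u z := by
    filter_upwards [eventually_diffAt hu] with z h1 using pd_const_mul c h1
  rw [pd_congr h, pd_const_mul c (diffAt (contDiffAt_pd hu))]

lemma pd_pd_add {u v : Fn} (hu : SmoothAt u x) (hv : SmoothAt v x)
    (i j : Fin 3) : pd i (pd j fun z => u z + v z) x = pd i (pd j u) x + pd i (pd j v) x := by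
  rw [pd_congr (pd_add_eventually hu hv j), pd_add (diffAt (contDiffAt_pd hu))
    (diffAt (contDiffAt_pd hv))]

lemma divGrad_const_mul (o : Off p x) {u : Fn}
    (hu : SmoothAt u x) (c : ℝ) :
    divGrad p (fun z => c * u z) x = c * divGrad p u x := by
  rw [divGrad_eq o (contDiffAt_const.mul hu), divGrad_eq o hu]
  simp only [pd_pd_const_mul hu, pd_const_mul c (diffAt hu), mul_add,
    mul_sum, mul_left_comm]

lemma divGrad_const (c : ℝ) : divGrad p (fun _ => c) x = 0 := by
  simp [divGrad, pd_const]

lemma lap2_add {S : Fin 3 → Fin 3 → Fn} {u v : Fn}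
    (hu : SmoothAt u x) (hv : SmoothAt v x) :
    lap2 S (fun z => u z + v z) x = lap2 S u x + lap2 S v x := by
  simp only [lap2, pd_pd_add hu hv, pd_add (diffAt hu) (diffAt hv),
    mul_add, sum_add_distrib, neg_add]
  ring

lemma lap2_const_mul {S : Fin 3 → Fin 3 → Fn} {u : Fn}
    (hu : SmoothAt u x) (c : ℝ) :
    lap2 S (fun z => c * u z) x = c * lap2 S u x := by
  simp only [lap2, pd_pd_const_mul hu, pd_const_mul c (diffAt hu), mul_add,
    mul_sum, sum_add_distrib, mul_neg, mul_left_comm]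

lemma lap2_const {S : Fin 3 → Fin 3 → Fn} (c : ℝ) : lap2 S (fun _ => c) x = 0 := by
  simp [lap2, show ∀ j : Fin 3, pd j (fun _ => c) = fun _ => 0 from
    fun i => funext fun z => pd_const c, pd_const]

lemma divGrad_inv_r1 (o : Off p x) :
    divGrad p (fun z => (r1 p z)⁻¹) x = divSdGrad1 p x := div_sd_grad_inv_r1 o

lemma sd_swap (i j : Fin 3) (p : E6) (x : E3) : sd i j p.swap x = sd i j p x := by
  have ht : trg p.swap x = trg p x := by
    have h : r12 p.swap = r12 p := dist_comm _ _
    have h' : r2 p.swap x = r1 p x := rfl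
    simp only [trg, r1_swap, h, h']; ring
  rw [sd, hessg_swap, hessg_swap, ht, sd]; ring

lemma divDivSd_swap (p : E6) (x : E3) : divDivSd p.swap x = divDivSd p x := by
  have h : r12 p.swap = r12 p := dist_comm _ _
  have h' : r2 p.swap x = r1 p x := rfl
  simp only [divDivSd, r1_swap, h, h']; ring

lemma divGrad_swap (u : Fn) : divGrad p.swap u x = divGrad p u x := by
  simp only [divGrad, sd_swap]

lemma divGrad_inv_r2 (o : Off p x) :
    divGrad p (fun z => (r2 p z)⁻¹) x = divSdGrad1 p.swap x := by
  rw [← divGrad_swap]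
  exact divGrad_inv_r1 o.swap

lemma hasLap_u2 (o : Off p x) :
    HasLap (u2 p) x (divSdGrad1 p.swap x + (r2 p x)⁻¹ * divDivSd p x / 8) := by
  have h := hasLap_u1 o.swap
  rwa [divDivSd_swap] at h

lemma smooth_inv_r1 (h1 : x ≠ p.1) : SmoothAt (fun z => (r1 p z)⁻¹) x :=
  (smooth_r1 h1).inv (r1_pos h1).ne'

lemma smooth_inv_r2 (h2 : x ≠ p.2) : SmoothAt (fun z => (r2 p z)⁻¹) x :=
  (smooth_r2 h2).inv (r2_pos h2).ne'

/-- The first-order conformal factor. -/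
def firstOrder (p : E6) (α1 α2 : ℝ) (x : E3) : ℝ := u₀ p x + (α1 * u1 p x + α2 * u2 p x)

lemma brillLindquist_eq (p : E6) (α1 α2 : ℝ) : brillLindquist p.1 p.2 α1 α2 =
    fun x => 1 + (α1 * (r1 p x)⁻¹ + α2 * (r2 p x)⁻¹) := by
  funext x; simp only [brillLindquist, r1, r2, div_eq_mul_inv]; ring

lemma smooth_brillLindquist (h1 : x ≠ p.1) (h2 : x ≠ p.2) :
    SmoothAt (fun x => 1 + (α1 * (r1 p x)⁻¹ + α2 * (r2 p x)⁻¹)) x :=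
  contDiffAt_const.add ((contDiffAt_const.mul (smooth_inv_r1 h1)).add
    (contDiffAt_const.mul (smooth_inv_r2 h2)))

lemma divGrad_combination (o : Off p x) {u v w : Fn}
    (hu : SmoothAt u x) (hv : SmoothAt v x)
    (hw : SmoothAt w x) (a b : ℝ) :
    divGrad p (fun z => u z + (a * v z + b * w z)) x =
      divGrad p u x + (a * divGrad p v x + b * divGrad p w x) := by
  rw [divGrad_add o hu ((contDiffAt_const.mul hv).add (contDiffAt_const.mul hw)),
    divGrad_add o (contDiffAt_const.mul hv) (contDiffAt_const.mul hw),
    divGrad_const_mul o hv, divGrad_const_mul o hw]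

lemma source_zero_brillLindquist (o : Off p x)
    (h : σ 0 = brillLindquist p.1 p.2 α1 α2) :
    source p.1 p.2 σ 0 x = lap (firstOrder p α1 α2) x := by
  have hs := smooth_brillLindquist (α1 := α1) (α2 := α2) o.2 o.3
  have hL := ((hasLap_u₀ o).add (((hasLap_u1 o).const_mul α1).add
    ((hasLap_u2 o).const_mul α2))).2
  have hU : lap (firstOrder p α1 α2) x = lap (fun z => u₀ p z + (α1 * u1 p z + α2 * u2 p z)) x := rfl
  rw [source_zero_eq o (by rw [h, brillLindquist_eq]) hs, lap1_sdComp o hs,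
    scal_sdComp o, hU, hL, divGrad_combination o contDiffAt_const (smooth_inv_r1 o.2)
    (smooth_inv_r2 o.3), divGrad_const, divGrad_inv_r1 o, divGrad_inv_r2 o]
  ring

/-- The part of the second source that does not depend on the `α`s. -/
def src₀ (p : E6) (x : E3) : ℝ :=
  divGrad p (u₀ p) x + (scal2 (sdComp p) x + u₀ p x * divDivSd p x) / 8

/-- The coefficient of `α1` in the second source. -/
def src1 (p : E6) (x : E3) : ℝ :=
  divGrad p (u1 p) x - lap2 (sdComp p) (fun z => (r1 p z)⁻¹) x
    + ((r1 p x)⁻¹ * scal2 (sdComp p) x + u1 p x * divDivSd p x) / 8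

/-- The coefficient of `α2` in the second source. -/
def src2 (p : E6) (x : E3) : ℝ :=
  divGrad p (u2 p) x - lap2 (sdComp p) (fun z => (r2 p z)⁻¹) x
    + ((r2 p x)⁻¹ * scal2 (sdComp p) x + u2 p x * divDivSd p x) / 8

lemma source_one_brillLindquist (o : Off p x)
    (h : σ 0 = brillLindquist p.1 p.2 α1 α2)
    (h' : ∀ z, z ≠ p.1 → z ≠ p.2 → σ 1 z = firstOrder p α1 α2 z) :
    source p.1 p.2 σ 1 x = src₀ p x + (α1 * src1 p x + α2 * src2 p x) := by
  have hs := smooth_brillLindquist (α1 := α1) (α2 := α2) o.2 o.3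
  have s0 := (hasLap_u₀ o).1
  have s1 := (hasLap_u1 o).1
  have s2 := (hasLap_u2 o).1
  have hU : SmoothAt (fun z => u₀ p z + (α1 * u1 p z + α2 * u2 p z)) x :=
    s0.add ((contDiffAt_const.mul s1).add (contDiffAt_const.mul s2))
  have e : σ 1 =ᶠ[𝓝 x] fun z => u₀ p z + (α1 * u1 p z + α2 * u2 p z) := by
    filter_upwards [o.eventually] with z hz using h' z hz.2 hz.3
  have i1 := smooth_inv_r1 o.2
  have i2 := smooth_inv_r2 o.3
  rw [source_one_eq o (by rw [h, brillLindquist_eq]) e hs hU, lap1_sdComp o hU,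
    divGrad_combination o s0 s1 s2, scal_sdComp o,
    lap2_add contDiffAt_const ((contDiffAt_const.mul i1).add (contDiffAt_const.mul i2)),
    lap2_add (contDiffAt_const.mul i1) (contDiffAt_const.mul i2), lap2_const_mul i1,
    lap2_const_mul i2, lap2_const, src₀, src1, src2]
  ring

/-! ### The scalar curvature at second order -/

lemma sum_chr_mul_chr {S : Fin 3 → Fin 3 → Fn} (hS : ∀ i j, S i j = S j i) :
    ∑ i, ∑ k, ∑ l, chr S k i l x * chr S l i k x =
      -(∑ i, ∑ k, ∑ l, pd i (S k l) x * pd i (S k l) x) / 4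
        + (∑ i, ∑ k, ∑ l, pd l (S i k) x * pd k (S i l) x) / 2 := by
  have s1 := hS 1 0
  have s2 := hS 2 0
  have s3 := hS 2 1
  simp only [chr, Fin.sum_univ_three, s1, s2, s3]
  ring

/-- The quadratic vector fields in the seed. -/
def quadSD (p : E6) (k : Fin 3) (x : E3) : ℝ := ∑ l, sdComp p k l x * divSd l p x

/-- The gradient of half the square of the seed. -/
def quadGrad (p : E6) (k : Fin 3) (x : E3) : ℝ :=
  ∑ i, ∑ j, sdComp p i j x * pd k (sdComp p i j) x

/-- The contraction of the seed with its own derivative. -/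
def quadMixed (p : E6) (l : Fin 3) (x : E3) : ℝ :=
  ∑ i, ∑ k, sdComp p i k x * pd k (sdComp p i l) x

lemma div_quadSD (o : Off p x) :
    ∑ k, pd k (quadSD p k) x = ∑ l, divSd l p x * divSd l p x
      + ∑ k, ∑ l, sdComp p k l x * pd k (divSd l p) x := by
  have hd : ∀ l, DiffAt (divSd l p) x := fun l => (hasPD_divSd o l).1
  have e : ∀ k, pd k (quadSD p k) x = ∑ l, (pd k (sdComp p k l) x * divSd l p x
      + sdComp p k l x * pd k (divSd l p) x) := fun k => by
    have : quadSD p k = fun z => ∑ l, sdComp p k l z * divSd l p z := rfl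
    rw [this, pd_sum fun l _ => (diff_sdComp o k l).fun_mul (hd l)]
    exact sum_congr rfl fun l _ => pd_mul (diff_sdComp o k l) (hd l)
  simp only [e, sum_add_distrib]
  rw [sum_comm]
  simp only [← sum_mul, div_sdComp o]

lemma div_quadGrad (o : Off p x) :
    ∑ k, pd k (quadGrad p k) x = ∑ k, ∑ i, ∑ j, pd k (sdComp p i j) x * pd k (sdComp p i j) x
      + ∑ i, ∑ j, sdComp p i j x * lap (sdComp p i j) x := by
  have hs := diff_sdComp o
  have hs' := diff_pd_sdComp o
  have e : ∀ k, pd k (quadGrad p k) x = ∑ i, ∑ j, (pd k (sdComp p i j) x * pd k (sdComp p i j) x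
      + sdComp p i j x * pd k (pd k (sdComp p i j)) x) := fun k => by
    have : quadGrad p k = fun z => ∑ i, ∑ j, sdComp p i j z * pd k (sdComp p i j) z := rfl
    rw [this, pd_sum fun i _ => DifferentiableAt.fun_sum fun j _ => (hs i j).fun_mul (hs' k i j)]
    refine sum_congr rfl fun i _ => ?_
    rw [pd_sum fun j _ => (hs i j).fun_mul (hs' k i j)]
    exact sum_congr rfl fun j _ => pd_mul (hs i j) (hs' k i j)
  simp only [e, sum_add_distrib, lap, mul_sum]
  congr 1
  rw [sum_comm]
  exact sum_congr rfl fun i _ => sum_comm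

lemma pd_divSd (o : Off p x) (m l : Fin 3) :
    ∑ k, pd m (pd k (sdComp p k l)) x = pd m (divSd l p) x := by
  rw [← pd_sum fun k _ => diff_pd_sdComp o k k l]
  refine pd_congr ?_
  filter_upwards [o.eventually] with z hz using div_sdComp hz l

lemma div_quadMixed (o : Off p x) :
    ∑ l, pd l (quadMixed p l) x = ∑ i, ∑ k, ∑ l, pd l (sdComp p i k) x * pd k (sdComp p i l) x
      + ∑ i, ∑ k, sdComp p i k x * pd k (divSd i p) x := by
  have hs := diff_sdComp o
  have hs' := diff_pd_sdComp o
  have e : ∀ l, pd l (quadMixed p l) x = ∑ i, ∑ k, (pd l (sdComp p i k) x * pd k (sdComp p i l) x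
      + sdComp p i k x * pd k (pd l (sdComp p l i)) x) := fun l => by
    have : quadMixed p l = fun z => ∑ i, ∑ k, sdComp p i k z * pd k (sdComp p i l) z := rfl
    rw [this, pd_sum fun i _ => DifferentiableAt.fun_sum fun k _ => (hs i k).fun_mul (hs' k i l)]
    refine sum_congr rfl fun i _ => ?_
    rw [pd_sum fun k _ => (hs i k).fun_mul (hs' k i l)]
    refine sum_congr rfl fun k _ => ?_
    rw [pd_mul (hs i k) (hs' k i l), pd_comm (smooth_sdComp o i l) l k, sdComp_comm i l]
  simp only [e, sum_add_distrib, ← pd_divSd o, mul_sum]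
  congr 1
  · rw [sum_comm]
    exact sum_congr rfl fun i _ => sum_comm
  · rw [sum_comm]
    exact sum_congr rfl fun i _ => sum_comm

lemma sum_ric2_first (o : Off p x) :
    ∑ i, ∑ k, pd k (chr2 (sdComp p) k i i) x = -∑ k, pd k (quadSD p k) x := by
  rw [sum_comm, ← sum_neg_distrib]
  refine sum_congr rfl fun k _ => ?_
  rw [← pd_sum fun i _ => diff_chr2 o k i i, ← pd_neg]
  refine pd_congr ?_
  filter_upwards [o.eventually] with z hz
  simp only [chr2, quadSD, sum_neg_distrib]
  rw [sum_comm]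
  simp only [← mul_sum, sum_chr_sdComp hz]

lemma sum_chr2_trace (i : Fin 3) (z : E3) :
    ∑ k, chr2 (sdComp p) k i k z = -(1 / 2) * quadGrad p i z := by
  have s1 := sdComp_comm (p := p) 1 0
  have s2 := sdComp_comm (p := p) 2 0
  have s3 := sdComp_comm (p := p) 2 1
  simp only [chr2, quadGrad, chr, Fin.sum_univ_three]
  fin_cases i <;> simp only [Fin.zero_eta, Fin.mk_one, Fin.reduceFinMk, s1, s2, s3] <;> ring

lemma diff_quadGrad (o : Off p x) (i : Fin 3) :
    DiffAt (quadGrad p i) x :=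
  DifferentiableAt.fun_sum fun j _ => DifferentiableAt.fun_sum fun k _ =>
    (diff_sdComp o j k).mul (diff_pd_sdComp o i j k)

lemma sum_ric2_second (o : Off p x) :
    ∑ i, ∑ k, pd i (chr2 (sdComp p) k i k) x = -(1 / 2) * ∑ k, pd k (quadGrad p k) x := by
  rw [mul_sum]
  refine sum_congr rfl fun i _ => ?_
  rw [← pd_sum fun k _ => diff_chr2 o k i k, ← pd_const_mul _ (diff_quadGrad o i)]
  exact congrArg (fun f => pd i f x) (funext fun z => sum_chr2_trace i z)

lemma ric_sdComp (o : Off p x) (i j : Fin 3) :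
    ric (sdComp p) i j x =
      (pd i (divSd j p) x + pd j (divSd i p) x - lap (sdComp p i j) x) / 2 := by
  have hs' := diff_pd_sdComp o
  have e : ∀ k, pd k (chr (sdComp p) k i j) x = (pd i (pd k (sdComp p k j)) x
      + pd j (pd k (sdComp p k i)) x - pd k (pd k (sdComp p i j)) x) / 2 := fun k => by
    have : chr (sdComp p) k i j = fun z => (1 / 2) * (pd i (sdComp p j k) z + pd j (sdComp p i k) z
      - pd k (sdComp p i j) z) := funext fun z => by simp only [chr]; ring
    rw [this, pd_const_mul _ (((hs' i j k).fun_add (hs' j i k)).fun_sub (hs' k i j)),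
      pd_sub ((hs' i j k).fun_add (hs' j i k)) (hs' k i j), pd_add (hs' i j k) (hs' j i k),
      pd_comm (smooth_sdComp o j k) k i, pd_comm (smooth_sdComp o i k) k j,
      sdComp_comm j k, sdComp_comm i k]
    ring
  simp only [ric, sum_sub_distrib, sum_pd_chr_trace o, sub_zero, e,
    ← Finset.sum_div, sum_add_distrib, pd_divSd o]
  rfl

lemma scal2_sdComp (o : Off p x) :
    scal2 (sdComp p) x = -(3 / 2) * ∑ k, pd k (quadSD p k) x + 3 / 4 * ∑ k, pd k (quadGrad p k) x
      - 1 / 2 * ∑ k, pd k (quadMixed p k) x + 1 / 2 * ∑ l, divSd l p x * divSd l p x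
      + 1 / 4 * ∑ i, ∑ j, sdComp p i j x * lap (sdComp p i j) x := by
  have A := div_quadSD o
  have B := div_quadGrad o
  have C := div_quadMixed o
  have F := sum_ric2_first o
  have F' := sum_ric2_second o
  have Q := sum_chr_mul_chr (x := x) fun i j => sdComp_comm (p := p) i j
  have Z : ∑ i, ∑ k, ∑ l, chr (sdComp p) k k l x * chr (sdComp p) l i i x = 0 := by
    have e : ∀ k l, chr (sdComp p) k k l x = chr (sdComp p) k l k x := fun k l => by
      simp only [chr, sdComp_comm l k]; ring
    have : ∀ i, ∑ k, ∑ l, chr (sdComp p) k k l x * chr (sdComp p) l i i x = 0 := fun i => by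
      rw [sum_comm]
      simp only [e, ← sum_mul, sum_chr_sdComp_trace o, zero_mul,
        Finset.sum_const_zero]
    simp only [this, Finset.sum_const_zero]
  have R : ∑ i, ∑ j, sdComp p i j x * ric (sdComp p) i j x =
      ∑ k, ∑ l, sdComp p k l x * pd k (divSd l p) x
        - 1 / 2 * ∑ i, ∑ j, sdComp p i j x * lap (sdComp p i j) x := by
    have s1 := sdComp_comm (p := p) 1 0
    have s2 := sdComp_comm (p := p) 2 0
    have s3 := sdComp_comm (p := p) 2 1
    simp only [ric_sdComp o, Fin.sum_univ_three, s1, s2, s3]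
    ring
  have D : ∑ i, ∑ k, sdComp p i k x * pd k (divSd i p) x =
      ∑ k, ∑ l, sdComp p k l x * pd k (divSd l p) x := by
    rw [sum_comm]
    exact sum_congr rfl fun i _ => sum_congr rfl fun k _ => by rw [sdComp_comm]
  have E : scal2 (sdComp p) x = (∑ i, ∑ k, pd k (chr2 (sdComp p) k i i) x
      - ∑ i, ∑ k, pd i (chr2 (sdComp p) k i k) x
      + (∑ i, ∑ k, ∑ l, chr (sdComp p) k k l x * chr (sdComp p) l i i x
        - ∑ i, ∑ k, ∑ l, chr (sdComp p) k i l x * chr (sdComp p) l i k x))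
      - ∑ i, ∑ j, sdComp p i j x * ric (sdComp p) i j x := by
    simp only [scal2, ric2, sum_sub_distrib, sum_add_distrib]
  rw [E, F, F', Z, Q, R]
  linear_combination (1 / 2) * A - (1 / 4) * B + (1 / 2) * C + (1 / 2) * D

lemma lap_mul {f g : Fn} (hf : SmoothAt f x) (hg : SmoothAt g x) :
    lap (fun z => f z * g z) x = lap f x * g x + 2 * ∑ k, pd k f x * pd k g x + f x * lap g x := by
  have e : ∀ k, pd k (pd k fun z => f z * g z) x = pd k (pd k f) x * g x
      + 2 * (pd k f x * pd k g x) + f x * pd k (pd k g) x := fun k => by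
    have h : pd k (fun z => f z * g z) =ᶠ[𝓝 x] fun z => pd k f z * g z + f z * pd k g z := by
      filter_upwards [eventually_diffAt hf, eventually_diffAt hg]
        with z h1 h2 using pd_mul h1 h2
    have df := diffAt hf
    have dg := diffAt hg
    have df' := diffAt (contDiffAt_pd (i := k) hf)
    have dg' := diffAt (contDiffAt_pd (i := k) hg)
    rw [pd_congr h, pd_add (df'.fun_mul dg) (df.fun_mul dg'), pd_mul df' dg, pd_mul df dg']
    ring
  simp only [lap, e, sum_add_distrib, ← sum_mul, ← mul_sum]

lemma HasLap.mul {f g : Fn} {L M : ℝ} {f' g' : Fin 3 → ℝ} (hf : HasLap f x L)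
    (hg : HasLap g x M) (hf' : HasPD f x f') (hg' : HasPD g x g') :
    HasLap (fun z => f z * g z) x (L * g x + 2 * ∑ k, f' k * g' k + f x * M) := by
  refine ⟨hf.1.mul hg.1, ?_⟩
  rw [lap_mul hf.1 hg.1, hf.2, hg.2]
  simp only [hf'.2, hg'.2]

lemma smooth_n1 (h1 : x ≠ p.1) (i : Fin 3) : SmoothAt (n1 i p) x :=
  ((contDiff_coord i).contDiffAt.sub contDiffAt_const).mul (smooth_inv_r1 h1)

lemma hasLap_n1 (h1 : x ≠ p.1) (i : Fin 3) :
    HasLap (n1 i p) x (-2 * n1 i p x * (r1 p x ^ 2)⁻¹) := by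
  refine ⟨smooth_n1 h1 i, ?_⟩
  have e : ∀ k, pd k (n1 i p) =ᶠ[𝓝 x] fun z => (δ k i - n1 k p z * n1 i p z) * (r1 p z)⁻¹ :=
    fun k => by filter_upwards [eventually_ne p.1 h1] with z hz using (hasPD_n1 hz i).2 k
  have h : ∀ k, pd k (pd k (n1 i p)) x = _ := fun k => (pd_congr (e k)).trans
    ((((HasPD.const (δ k i)).sub ((hasPD_n1 h1 k).mul (hasPD_n1 h1 i))).mul (hasPD_inv_r1 h1)).2 k)
  have dd : ∀ k, δ k k = 1 := fun i => by simp [δ]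
  have e0 := n1_n1 h1
  have e1 := sum_δ_mul i fun k => n1 k p x
  have a := r1_pos h1
  simp only [lap, h, dd, Fin.sum_univ_three] at *
  field_simp
  linear_combination (3 * n1 i p x) * e0 - 2 * e1

lemma hasLap_n2 (h2 : x ≠ p.2) (i : Fin 3) :
    HasLap (n2 i p) x (-2 * n2 i p x * (r2 p x ^ 2)⁻¹) := hasLap_n1 (p := p.swap) h2 i

/-! ### The second source is a divergence when the `α`s vanish -/

lemma contract_n1 (h1 : x ≠ p.1) (h2 : x ≠ p.2) (i : Fin 3) :
    ∑ k, (δ k i - n1 k p x * n1 i p x) * (n1 k p x + n2 k p x) =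
      n2 i p x - cos3 p x * n1 i p x := by
  have e0 := n1_n1 h1
  have e2 := n1_n2 h1 h2
  have e3 := sum_δ_mul i fun k => n1 k p x + n2 k p x
  simp only [Fin.sum_univ_three] at *
  linear_combination e3 - n1 i p x * e0 - n1 i p x * e2

lemma contract_n2 (h1 : x ≠ p.1) (h2 : x ≠ p.2) (i : Fin 3) :
    ∑ k, (δ k i - n2 k p x * n2 i p x) * (n1 k p x + n2 k p x) =
      n1 i p x - cos3 p x * n2 i p x := by
  have h := contract_n1 (p := p.swap) h2 h1 i
  rw [cos3_swap] at h
  exact (sum_congr rfl fun k _ => by rw [add_comm (n1 k p x)]; rfl).trans h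

lemma contract_n1_n2 (h1 : x ≠ p.1) (h2 : x ≠ p.2) (i j : Fin 3) :
    ∑ k, (δ k i - n1 k p x * n1 i p x) * (δ k j - n2 k p x * n2 j p x) =
      δ i j - n1 i p x * n1 j p x - n2 i p x * n2 j p x + cos3 p x * (n1 i p x * n2 j p x) := by
  have e2 := n1_n2 h1 h2
  have e3 := sum_δ_mul j fun k => n1 k p x
  have e4 := sum_δ_mul i fun k => n2 k p x
  have e5 := sum_δ_mul i fun k => δ k j
  simp only [Fin.sum_univ_three] at *
  linear_combination e5 - n2 j p x * e4 - n1 i p x * e3 + n1 i p x * n2 j p x * e2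

lemma hasLap_invPerim (o : Off p x) :
    HasLap (invPerim p) x (2 * invPerim p x ^ 3 * (2 + 2 * cos3 p x)
      - invPerim p x ^ 2 * (2 * (r1 p x)⁻¹ + 2 * (r2 p x)⁻¹)) := by
  obtain ⟨a, b, c⟩ := o.pos
  refine ⟨nice_invPerim.smooth.at o, ?_⟩
  have e : ∀ k, pd k (invPerim p) =ᶠ[𝓝 x]
      fun z => -1 * (invPerim p z * invPerim p z * (n1 k p z + n2 k p z)) := fun k => by
    filter_upwards [o.eventually] with z hz
    rw [(hasPD_invPerim hz).2]; ring
  have P := hasPD_invPerim o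
  have h : ∀ k, pd k (pd k (invPerim p)) x = _ := fun k => (pd_congr (e k)).trans
    ((((P.mul P).mul ((hasPD_n1 o.2 k).add (hasPD_n2 o.3 k))).const_mul (-1)).2 k)
  have dd : ∀ k, δ k k = 1 := fun i => by simp [δ]
  have e0 := n1_n1 o.2
  have e1 := n2_n2 o.3
  have e2 := n1_n2 o.2 o.3
  simp only [lap, h, dd, Fin.sum_univ_three] at *
  generalize invPerim p x = w at *
  linear_combination (2 * w ^ 3 + w ^ 2 * (r1 p x)⁻¹) * e0 + (2 * w ^ 3 + w ^ 2 * (r2 p x)⁻¹) * e1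
    + 4 * w ^ 3 * e2

lemma hasLap_hessg (o : Off p x) (i j : Fin 3) :
    HasLap (hessg i j p) x ((r1 p x ^ 2)⁻¹ * n1 i p x * ((r2 p x ^ 2)⁻¹ * n2 j p x)) := by
  obtain ⟨a, b, c⟩ := o.pos
  have hS : r1 p x + r2 p x + r12 p ≠ 0 := by positivity
  have Lw := hasLap_invPerim o
  have Pw := hasPD_invPerim o
  have Lw2 := Lw.mul Lw Pw Pw
  have Pw2 := Pw.mul Pw
  have LA := (hasLap_const (x := x) (n12 i p)).add ((hasLap_n1 o.2 i).const_mul (-1))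
  have PA := (HasPD.const (x := x) (n12 i p)).add ((hasPD_n1 o.2 i).const_mul (-1))
  have LB := (hasLap_n2 o.3 j).add (hasLap_const (x := x) (n12 j p))
  have PB := (hasPD_n2 o.3 j).add (HasPD.const (x := x) (n12 j p))
  have h := (Lw.const_mul (-(δ i j - n12 i p * n12 j p) * (r12 p)⁻¹)).add
    ((LA.mul LB PA PB).mul Lw2 (PA.mul PB) Pw2)
  have h' : HasLap (hessg i j p) x _ := h.congr (.of_forall fun z => by
    simp only [hessg]; ring)
  refine ⟨h'.1, h'.2.trans ?_⟩
  have c1 := contract_n1 o.2 o.3 i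
  have c2 := contract_n2 o.2 o.3 j
  have c3 := contract_n1_n2 o.2 o.3 i j
  have e0 := n1_n1 o.2
  have e1 := n2_n2 o.3
  have e2 := n1_n2 o.2 o.3
  have s1 : ∑ k, -(invPerim p x ^ 2) * (n1 k p x + n2 k p x)
      * (-(invPerim p x ^ 2) * (n1 k p x + n2 k p x)) = invPerim p x ^ 4 * (2 + 2 * cos3 p x) := by
    simp only [Fin.sum_univ_three] at *
    linear_combination invPerim p x ^ 4 * (e0 + e1 + 2 * e2)
  have s2 : ∑ k, (0 + -1 * ((δ k i - n1 k p x * n1 i p x) * (r1 p x)⁻¹))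
      * ((δ k j - n2 k p x * n2 j p x) * (r2 p x)⁻¹ + 0) =
      -((r1 p x)⁻¹ * (r2 p x)⁻¹ * (δ i j - n1 i p x * n1 j p x - n2 i p x * n2 j p x
        + cos3 p x * (n1 i p x * n2 j p x))) := by
    simp only [Fin.sum_univ_three] at *
    linear_combination -((r1 p x)⁻¹ * (r2 p x)⁻¹) * c3
  have s3 : ∀ A B w : ℝ, ∑ k, ((0 + -1 * ((δ k i - n1 k p x * n1 i p x) * (r1 p x)⁻¹)) * B
      + A * ((δ k j - n2 k p x * n2 j p x) * (r2 p x)⁻¹ + 0))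
      * (-(w ^ 2) * (n1 k p x + n2 k p x) * w + w * (-(w ^ 2) * (n1 k p x + n2 k p x))) =
      2 * w ^ 3 * (B * (r1 p x)⁻¹ * (n2 i p x - cos3 p x * n1 i p x)
        - A * (r2 p x)⁻¹ * (n1 j p x - cos3 p x * n2 j p x)) := fun A B w => by
    simp only [Fin.sum_univ_three] at *
    linear_combination 2 * w ^ 3 * B * (r1 p x)⁻¹ * c1 - 2 * w ^ 3 * A * (r2 p x)⁻¹ * c2
  simp only [s1, s2, s3]
  have he : ∀ k, n12 k p = (r2 p x * n2 k p x - r1 p x * n1 k p x) * (r12 p)⁻¹ := fun k => by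
    rw [n2_eq o]; field_simp; ring
  rw [he i, he j, cos3, invPerim]
  generalize n1 i p x = u at *
  generalize n1 j p x = u' at *
  generalize n2 i p x = v at *
  generalize n2 j p x = v' at *
  generalize r1 p x = a at *
  generalize r2 p x = b at *
  generalize r12 p = c at *
  generalize δ i j = d
  field_simp
  ring

lemma sum_sdComp_mul_lap (o : Off p x) :
    ∑ i, ∑ j, sdComp p i j x * lap (sdComp p i j) x =
      ∑ i, ∑ j, sd i j p x * (-(r1 p x ^ 2)⁻¹ * n1 j p x) * (-(r2 p x ^ 2)⁻¹ * n2 i p x) := by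
  have ht : HasLap (trg p) x (lap (trg p) x) := ⟨nice_trg.smooth.at o, rfl⟩
  have e : ∀ i j, lap (sdComp p i j) x = _ := fun i j =>
    ((((hasLap_hessg o i j).add (hasLap_hessg o j i)).const_mul (1 / 2)).add
      (ht.const_mul (-δ i j / 3)) |>.congr (g := sdComp p i j) (.of_forall fun z => by
        simp only [sdComp, sd]; ring)).2
  have tr := sd_trace o
  have s1 := sd_symm 1 0 p x
  have s2 := sd_symm 2 0 p x
  have s3 := sd_symm 2 1 p x
  simp only [e, sdComp, Fin.sum_univ_three, s1, s2, s3] at *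
  simp [δ]
  linear_combination (-1 / 3 * lap (trg p) x) * tr

/-- A vector field whose divergence captures the square of the seed's gradient. -/
def seedFlux (p : E6) (k : Fin 3) (x : E3) : ℝ :=
  (∑ j, sd k j p x * pd j (fun z => (r1 p z)⁻¹) x) * ((r2 p x)⁻¹ - (r12 p)⁻¹)

lemma div_seedFlux (o : Off p x) :
    ∑ k, pd k (seedFlux p k) x = divSdGrad1 p x * ((r2 p x)⁻¹ - (r12 p)⁻¹)
      + ∑ i, ∑ j, sdComp p i j x * lap (sdComp p i j) x := by
  have hd : ∀ k j, DiffAt (fun z => sd k j p z * pd j (fun w => (r1 p w)⁻¹) z) x :=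
    fun k j => (diff_sdComp o k j).fun_mul
      (diffAt (contDiffAt_pd (smooth_inv_r1 o.2)))
  have hB : HasPD (fun z => (r2 p z)⁻¹ - (r12 p)⁻¹) x fun k => -(r2 p x ^ 2)⁻¹ * n2 k p x - 0 :=
    (hasPD_inv_r2 o.3).sub (HasPD.const _)
  have e : ∀ k, pd k (seedFlux p k) x =
      (∑ j, pd k (fun z => sd k j p z * pd j (fun w => (r1 p w)⁻¹) z) x)
        * ((r2 p x)⁻¹ - (r12 p)⁻¹)
      + ∑ j, sd k j p x * (-(r1 p x ^ 2)⁻¹ * n1 j p x) * (-(r2 p x ^ 2)⁻¹ * n2 k p x) := fun k => by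
    have : seedFlux p k = fun z => (∑ j, sd k j p z * pd j (fun w => (r1 p w)⁻¹) z)
      * ((r2 p z)⁻¹ - (r12 p)⁻¹) := rfl
    rw [this, pd_mul (DifferentiableAt.fun_sum fun j _ => hd k j) hB.1, pd_sum fun j _ => hd k j,
      hB.2, sum_mul]
    simp only [(hasPD_inv_r1 o.2).2, sub_zero, sum_mul]
  simp only [e, sum_add_distrib, ← sum_mul]
  rw [div_sd_grad_inv_r1 o, sum_sdComp_mul_lap o]
  simp only [sum_mul]

lemma sum_divSd_sq (o : Off p x) :
    ∑ l, divSd l p x * divSd l p x =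
      ((r12 p ^ 2)⁻¹ * ((r1 p x)⁻¹ - (r2 p x)⁻¹) / 2) ^ 2
      + ((r1 p x ^ 2)⁻¹ * ((r2 p x)⁻¹ - (r12 p)⁻¹) / 12) ^ 2
      + ((r2 p x ^ 2)⁻¹ * ((r1 p x)⁻¹ - (r12 p)⁻¹) / 12) ^ 2
      + 2 * ((r12 p ^ 2)⁻¹ * ((r1 p x)⁻¹ - (r2 p x)⁻¹) / 2)
        * ((r1 p x ^ 2)⁻¹ * ((r2 p x)⁻¹ - (r12 p)⁻¹) / 12) * cos1 p x
      + 2 * ((r12 p ^ 2)⁻¹ * ((r1 p x)⁻¹ - (r2 p x)⁻¹) / 2)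
        * ((r2 p x ^ 2)⁻¹ * ((r1 p x)⁻¹ - (r12 p)⁻¹) / 12) * cos2 p x
      + 2 * ((r1 p x ^ 2)⁻¹ * ((r2 p x)⁻¹ - (r12 p)⁻¹) / 12)
        * ((r2 p x ^ 2)⁻¹ * ((r1 p x)⁻¹ - (r12 p)⁻¹) / 12) * cos3 p x := by
  have e0 := n1_n1 o.2
  have e1 := n2_n2 o.3
  have e2 := n1_n2 o.2 o.3
  have e3 := n1_n12 o.1 o.2
  have e4 := n2_n12 o.1 o.3
  have e5 := n12_n12 o.1
  have h : ∀ l, divSd l p x = -(n12 l p * ((r12 p ^ 2)⁻¹ * ((r1 p x)⁻¹ - (r2 p x)⁻¹) / 2)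
    + n1 l p x * ((r1 p x ^ 2)⁻¹ * ((r2 p x)⁻¹ - (r12 p)⁻¹) / 12)
    + n2 l p x * ((r2 p x ^ 2)⁻¹ * ((r1 p x)⁻¹ - (r12 p)⁻¹) / 12)) := fun l => by
      rw [divSd]; ring
  simp only [h]
  generalize (r12 p ^ 2)⁻¹ * ((r1 p x)⁻¹ - (r2 p x)⁻¹) / 2 = A
  generalize (r1 p x ^ 2)⁻¹ * ((r2 p x)⁻¹ - (r12 p)⁻¹) / 12 = B
  generalize (r2 p x ^ 2)⁻¹ * ((r1 p x)⁻¹ - (r12 p)⁻¹) / 12 = C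
  simp only [Fin.sum_univ_three] at *
  linear_combination B ^ 2 * e0 + C ^ 2 * e1 + 2 * B * C * e2 + 2 * A * B * e3 + 2 * A * C * e4
    + A ^ 2 * e5

/-- The coefficient of `n1` in the field whose divergence is the Laurent part of the source. -/
def tailCoeff1 : E6 → Fn :=
  laurent [(-3, -2, 11/9216), (-3, -1, -17/9216), (-3, 0, -43/3072), (-3, 1, 265/9216),
    (-3, 2, -65/4608), (-2, -2, -25/18432), (-2, -1, 1/576), (-2, 0, -127/18432), (-2, 1, 5/768),
    (-1, -1, 5/1024), (-1, 0, 197/18432), (-1, 2, -1/2048), (0, -2, -17/6144), (0, -1, -17/3072),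
    (0, 1, 1/1024), (1, -2, 5/2048), (2, -1, -1/1024), (3, -2, 1/2048)] (-5)

/-- The coefficient of `n2` in the field whose divergence is the Laurent part of the source. -/
def tailCoeff2 : E6 → Fn :=
  laurent [(-3, -1, -1/64), (-3, 0, 1/64), (-3, 1, 1/64), (-3, 2, -1/64), (-2, -3, -1/2304),
    (-2, -1, 15/1024), (-2, 0, -151/4608), (-2, 1, 37/2048), (-2, 3, 1/2048), (-1, -3, 1/1152),
    (-1, -1, -11/1024), (-1, 0, -15/1024), (-1, 2, -1/1024), (0, -3, -1/2304), (0, -1, 25/2048),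
    (1, 0, 1/1024), (2, -1, -1/2048)] (-5)

/-- The part of the source field that has a flux at infinity. -/
def tailField (p : E6) (i : Fin 3) (x : E3) : ℝ :=
  tailCoeff1 p x * n1 i p x + tailCoeff2 p x * n2 i p x

lemma div_tailField (o : Off p x) :
    ∑ i, pd i (tailField p i) x = u₀ p x * divDivSd p x / 8
      + (1 / 16) * ∑ l, divSd l p x * divSd l p x
      - (1 / 32) * (divSdGrad1 p x * ((r2 p x)⁻¹ - (r12 p)⁻¹)) := by
  obtain ⟨a, b, c⟩ := o.pos
  have hS : r1 p x + r2 p x + r12 p ≠ 0 := by positivity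
  have h := div_laurent o.2 o.3 [(-3, -2, 11/9216), (-3, -1, -17/9216), (-3, 0, -43/3072),
    (-3, 1, 265/9216), (-3, 2, -65/4608), (-2, -2, -25/18432), (-2, -1, 1/576),
    (-2, 0, -127/18432), (-2, 1, 5/768), (-1, -1, 5/1024), (-1, 0, 197/18432), (-1, 2, -1/2048),
    (0, -2, -17/6144), (0, -1, -17/3072), (0, 1, 1/1024), (1, -2, 5/2048), (2, -1, -1/1024),
    (3, -2, 1/2048)] [(-3, -1, -1/64), (-3, 0, 1/64), (-3, 1, 1/64), (-3, 2, -1/64),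
    (-2, -3, -1/2304), (-2, -1, 15/1024), (-2, 0, -151/4608), (-2, 1, 37/2048), (-2, 3, 1/2048),
    (-1, -3, 1/1152), (-1, -1, -11/1024), (-1, 0, -15/1024), (-1, 2, -1/1024), (0, -3, -1/2304),
    (0, -1, 25/2048), (1, 0, 1/1024), (2, -1, -1/2048)] (-5)
  refine Eq.trans (show _ = _ from h) ?_
  rw [sum_divSd_sq o, u₀, laurent, divSdGrad1, divDivSd, cos3, cos1, cos2, trg, invPerim]
  generalize r1 p x = a at *
  generalize r2 p x = b at *
  generalize r12 p = c at *
  norm_num [zpow_neg, zpow_ofNat]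
  field_simp
  ring

/-- The field whose divergence is the second source when the `α`s vanish. -/
def srcField (p : E6) (k : Fin 3) (x : E3) : ℝ :=
  ((∑ j, sd k j p x * pd j (u₀ p) x) + (-3 / 16 * quadSD p k x + (3 / 32 * quadGrad p k x
    + (-1 / 16 * quadMixed p k x + 1 / 32 * seedFlux p k x)))) + tailField p k x

lemma diff_quadSD (o : Off p x) (k : Fin 3) :
    DiffAt (quadSD p k) x := DifferentiableAt.fun_sum fun l _ =>
  (diff_sdComp o k l).fun_mul (hasPD_divSd o l).1

lemma diff_quadMixed (o : Off p x) (l : Fin 3) :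
    DiffAt (quadMixed p l) x := DifferentiableAt.fun_sum fun i _ =>
  DifferentiableAt.fun_sum fun k _ =>
    (diff_sdComp o i k).fun_mul (diff_pd_sdComp o k i l)

lemma diff_seedFlux (o : Off p x) (k : Fin 3) :
    DiffAt (seedFlux p k) x :=
  (DifferentiableAt.fun_sum fun j _ => (diff_sdComp o k j).fun_mul
    (diffAt (contDiffAt_pd (smooth_inv_r1 o.2)))).fun_mul
    ((hasPD_inv_r2 o.3).1.sub (differentiableAt_const _))

lemma diff_tailField (h1 : x ≠ p.1) (h2 : x ≠ p.2) (k : Fin 3) :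
    DiffAt (tailField p k) x :=
  ((diffAt (hasLap_laurent h1 h2 _ _).1).fun_mul (hasPD_n1 h1 k).1).fun_add
    ((diffAt (hasLap_laurent h1 h2 _ _).1).fun_mul (hasPD_n2 h2 k).1)

lemma div_srcField (o : Off p x) :
    ∑ k, pd k (srcField p k) x = src₀ p x := by
  have d0 : ∀ k j, DiffAt (fun z => sd k j p z * pd j (u₀ p) z) x := fun k j =>
    (diff_sdComp o k j).fun_mul (diffAt (contDiffAt_pd
      (hasLap_u₀ o).1))
  have d1 := diff_quadSD o
  have d2 := diff_quadGrad o
  have d3 := diff_quadMixed o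
  have d4 := diff_seedFlux o
  have d5 := diff_tailField o.2 o.3
  have e : ∀ k, pd k (srcField p k) x = ((∑ j, pd k (fun z => sd k j p z * pd j (u₀ p) z) x)
      + (-3 / 16 * pd k (quadSD p k) x + (3 / 32 * pd k (quadGrad p k) x
      + (-1 / 16 * pd k (quadMixed p k) x + 1 / 32 * pd k (seedFlux p k) x))))
      + pd k (tailField p k) x := fun k => by
    have c1 := (d1 k).const_mul (-3 / 16)
    have c2 := (d2 k).const_mul (3 / 32)
    have c3 := (d3 k).const_mul (-1 / 16)
    have c4 := (d4 k).const_mul (1 / 32)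
    have : srcField p k = fun z => ((∑ j, sd k j p z * pd j (u₀ p) z) + (-3 / 16 * quadSD p k z
      + (3 / 32 * quadGrad p k z + (-1 / 16 * quadMixed p k z + 1 / 32 * seedFlux p k z))))
      + tailField p k z := rfl
    have c0 : DiffAt (fun z => ∑ j, sd k j p z * pd j (u₀ p) z) x :=
      DifferentiableAt.fun_sum fun j _ => d0 k j
    rw [this, pd_add (c0.fun_add (c1.fun_add (c2.fun_add (c3.fun_add c4)))) (d5 k),
      pd_add c0 (c1.fun_add (c2.fun_add (c3.fun_add c4))), pd_add c1 (c2.fun_add (c3.fun_add c4)),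
      pd_add c2 (c3.fun_add c4), pd_add c3 c4, pd_const_mul _ (d1 k), pd_const_mul _ (d2 k),
      pd_const_mul _ (d3 k), pd_const_mul _ (d4 k), pd_sum fun j _ => d0 k j]
  simp only [e, sum_add_distrib, ← mul_sum]
  have hdg : ∑ k, ∑ j, pd k (fun z => sd k j p z * pd j (u₀ p) z) x = divGrad p (u₀ p) x := rfl
  rw [hdg, src₀]
  linear_combination (-1 / 8) * scal2_sdComp o + (1 / 32) * div_seedFlux o
    + div_tailField o

/-! ### Expansions of the second source -/

section Laurent

variable {e m : ℤ} {a : E6 → E3} {f : E6 → Fn}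

lemma Expands.npow (hf : Expands e a m f) (n : ℕ) : Expands e a (n * m) fun p x => f p x ^ n := by
  induction n with
  | zero =>
    have h : Expands e a 0 fun _ _ => (1 : ℝ) := ⟨_, expandsTo_param fun _ _ => contDiffAt_const⟩
    simp only [pow_zero, Nat.cast_zero, zero_mul]
    exact h
  | succ n ih =>
    simp only [pow_succ]
    exact Expands.mul ih hf (by push_cast; linarith)

lemma Expands.zpow (hf : Expands e a m f) (hf' : Expands e a (-m) fun p x => (f p x)⁻¹) (n : ℤ) :
    Expands e a (n * m) fun p x => f p x ^ n := by
  cases n with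
  | ofNat n => simpa using hf.npow n
  | negSucc n =>
    have h := hf'.npow (n + 1)
    have e1 : (((n + 1 : ℕ) : ℤ)) * -m = Int.negSucc n * m := by
      rw [Int.negSucc_eq]; push_cast; ring
    rw [e1] at h
    simpa [zpow_negSucc, inv_pow] using h

lemma Expands.laurent {m1 m2 : ℤ} (h1 : Expands e a m1 r1)
    (h1' : Expands e a (-m1) fun p x => (r1 p x)⁻¹) (h2 : Expands e a m2 r2)
    (h2' : Expands e a (-m2) fun p x => (r2 p x)⁻¹) (L : List (ℤ × ℤ × ℝ)) (k : ℤ)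
    (hL : ∀ t ∈ L, m ≤ t.1 * m1 + t.2.1 * m2) : Expands e a m (laurent L k) := by
  induction L with
  | nil => exact ⟨fun _ => 0, fun _ _ _ _ => contDiffAt_const, by simp [Geometrostatics.laurent]⟩
  | cons t L ih =>
    refine Expands.add ?_ (ih fun s hs => hL s (List.mem_cons_of_mem _ hs))
    refine Expands.mul (m := 0) ⟨_, expandsTo_param fun p hp => ?_⟩
      (Expands.mul (h1.zpow h1' _) (h2.zpow h2' _) le_rfl) (by simpa using hL t (by simp))
    refine contDiffAt_const.mul ?_
    generalize k - t.1 - t.2.1 = j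
    have h := smooth_r12 p hp
    cases j with
    | ofNat n => simpa using h.pow n
    | negSucc n =>
      simp only [zpow_negSucc]
      exact (h.pow (n + 1)).inv (pow_ne_zero _ (r12_pos hp).ne')

end Laurent

lemma expands_laurent_fst (L : List (ℤ × ℤ × ℝ)) (k : ℤ) (m : ℤ) (hL : ∀ t ∈ L, m ≤ t.1) :
    Expands 1 Prod.fst m (laurent L k) :=
  Expands.laurent nice_r1.fst nice_inv_r1.fst nice_r2.fst nice_inv_r2.fst L k (by simpa using hL)

lemma expands_laurent_snd (L : List (ℤ × ℤ × ℝ)) (k : ℤ) (m : ℤ) (hL : ∀ t ∈ L, m ≤ t.2.1) :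
    Expands 1 Prod.snd m (laurent L k) :=
  Expands.laurent nice_r1.snd nice_inv_r1.snd nice_r2.snd nice_inv_r2.snd L k (by simpa using hL)

lemma expands_laurent_inf (L : List (ℤ × ℤ × ℝ)) (k : ℤ) (m : ℤ) (hL : ∀ t ∈ L, m ≤ -(t.1 + t.2.1)) :
    Expands (-1) (fun _ => 0) m (laurent L k) :=
  Expands.laurent nice_r1.inf nice_inv_r1.inf nice_r2.inf nice_inv_r2.inf L k fun t ht => by
    have := hL t ht; linarith

lemma tailCoeff1_eq_fst (o : Off p x) :
    tailCoeff1 p x = (r1 p x)⁻¹ * (quot1 p x * (quot1 p x * laurent [(0, -2, 11/9216),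
        (0, -1, 5/9216), (0, 0, -65/4608)] (-4) p x)
      + (quot1 p x * laurent [(0, -2, 25/18432), (0, -1, -7/18432), (0, 0, 5/768)] (-4) p x
      + laurent [(0, -1, 5/1024), (0, 0, 197/18432), (0, 2, -1/2048), (1, -2, -17/6144),
        (1, -1, -17/3072), (1, 1, 1/1024), (2, -2, 5/2048), (3, -1, -1/1024),
        (4, -2, 1/2048)] (-4) p x)) := by
  obtain ⟨a, b, c⟩ := o.pos
  simp only [tailCoeff1, laurent, quot1]
  norm_num [zpow_neg, zpow_ofNat]
  field_simp
  ring

lemma tailCoeff1_eq_snd (o : Off p x) :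
    tailCoeff1 p x = (r2 p x)⁻¹ * (quot2 p x * laurent [(-3, 0, -11/9216), (-2, 0, 1/6144),
        (-1, 0, 1/6144), (0, 0, 3/1024), (1, 0, 1/2048), (2, 0, 1/2048)] (-4) p x
      + laurent [(-3, 0, -17/9216), (-3, 1, -43/3072), (-3, 2, 265/9216), (-3, 3, -65/4608),
        (-2, 0, 1/576), (-2, 1, -127/18432), (-2, 2, 5/768), (-1, 0, 5/1024), (-1, 1, 197/18432),
        (-1, 3, -1/2048), (0, 0, -17/3072), (0, 2, 1/1024), (2, 0, -1/1024)] (-4) p x) := by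
  obtain ⟨a, b, c⟩ := o.pos
  simp only [tailCoeff1, laurent, quot2]
  norm_num [zpow_neg, zpow_ofNat]
  field_simp
  ring

lemma tailCoeff1_eq_inf (o : Off p x) :
    tailCoeff1 p x = laurent [(-3, -2, 11/9216), (-3, -1, -17/9216), (-3, 0, -43/3072),
        (-3, 1, 265/9216), (-2, -2, -25/18432), (-2, -1, 1/576), (-2, 0, -127/18432),
        (-1, -1, 5/1024), (0, -2, -17/6144)] (-5) p x
      + ((r2 p x - r1 p x) * laurent [(-3, 1, -65/4608), (-2, 0, -35/4608), (-1, -1, 19/6144),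
        (0, -2, -5/2048)] (-6) p x
      + (r2 p x - r1 p x) * ((r2 p x - r1 p x) * ((r2 p x - r1 p x) *
        laurent [(-1, -1, -1/2048), (0, -2, -1/2048)] (-8) p x))) := by
  obtain ⟨a, b, c⟩ := o.pos
  simp only [tailCoeff1, laurent]
  norm_num [zpow_neg, zpow_ofNat]
  field_simp
  ring

lemma tailCoeff2_eq_fst (o : Off p x) :
    tailCoeff2 p x = (r1 p x)⁻¹ * (quot1 p x * (quot1 p x * laurent [(0, -1, -1/64),
        (0, 0, -1/64)] (-4) p x)
      + (quot1 p x * laurent [(0, -3, 1/2304), (0, -2, 1/2304), (0, -1, -131/9216),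
        (0, 0, 19/1024), (0, 1, 1/2048), (0, 2, 1/2048)] (-4) p x
      + laurent [(0, -3, 1/1152), (0, -1, -11/1024), (0, 0, -15/1024), (0, 2, -1/1024),
        (1, -3, -1/2304), (1, -1, 25/2048), (2, 0, 1/1024), (3, -1, -1/2048)] (-4) p x)) := by
  obtain ⟨a, b, c⟩ := o.pos
  simp only [tailCoeff2, laurent, quot1]
  norm_num [zpow_neg, zpow_ofNat]
  field_simp
  ring

lemma tailCoeff2_eq_snd (o : Off p x) :
    tailCoeff2 p x = (r2 p x)⁻¹ * (quot2 p x * (quot2 p x * laurent [(-2, 0, -1/2304)] (-4) p x)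
      + laurent [(-3, 0, -1/64), (-3, 1, 1/64), (-3, 2, 1/64), (-3, 3, -1/64), (-2, 0, 15/1024),
        (-2, 1, -151/4608), (-2, 2, 37/2048), (-2, 4, 1/2048), (-1, 0, -11/1024),
        (-1, 1, -15/1024), (-1, 3, -1/1024), (0, 0, 25/2048), (1, 1, 1/1024),
        (2, 0, -1/2048)] (-4) p x) := by
  obtain ⟨a, b, c⟩ := o.pos
  simp only [tailCoeff2, laurent, quot2]
  norm_num [zpow_neg, zpow_ofNat]
  field_simp
  ring

lemma tailCoeff2_eq_inf (o : Off p x) :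
    tailCoeff2 p x = laurent [(-3, -1, -1/64), (-3, 0, 1/64), (-3, 1, 1/64), (-2, -3, -1/2304),
        (-2, -1, 15/1024), (-2, 0, -151/4608), (-1, -3, 1/1152), (-1, -1, -11/1024),
        (0, -3, -1/2304)] (-5) p x
      + ((r2 p x - r1 p x) * laurent [(-3, 1, -1/64), (-2, 0, 5/2048),
        (-1, -1, -25/2048)] (-6) p x
      + (r2 p x - r1 p x) * ((r2 p x - r1 p x) * ((r2 p x - r1 p x) *
        laurent [(-2, 0, 1/2048), (-1, -1, 1/2048)] (-8) p x))) := by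
  obtain ⟨a, b, c⟩ := o.pos
  simp only [tailCoeff2, laurent]
  norm_num [zpow_neg, zpow_ofNat]
  field_simp
  ring

lemma nice_tailCoeff1 : Nice (-1) (-1) 2 tailCoeff1 := by
  refine ⟨smoothOff_laurent _ _, ?_, ?_, ?_⟩
  · refine Expands.congr_fst ?_ fun p x o => tailCoeff1_eq_fst o
    have hq : Expands 1 Prod.fst 0 quot1 := nice_quot1.fst
    refine Expands.mul nice_inv_r1.fst (m' := 0) ?_ (by simp)
    repeat' first
      | exact hq | exact expands_laurent_fst _ _ _ (by simp)
      | refine Expands.add ?_ ?_ | refine Expands.mul (m := 0) (m' := 0) ?_ ?_ (by simp)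
  · refine Expands.congr_snd ?_ fun p x o => tailCoeff1_eq_snd o
    have hq : Expands 1 Prod.snd 0 quot2 := nice_quot2.snd
    refine Expands.mul nice_inv_r2.snd (m' := 0) ?_ (by simp)
    repeat' first
      | exact hq | exact expands_laurent_snd _ _ _ (by simp)
      | refine Expands.add ?_ ?_ | refine Expands.mul (m := 0) (m' := 0) ?_ ?_ (by simp)
  · refine Expands.congr_inf ?_ fun p x o => tailCoeff1_eq_inf o
    have hd : Expands (-1) (fun _ => 0) 0 fun p x => r2 p x - r1 p x := nice_r2_sub_r1.inf
    repeat' first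
      | exact expands_laurent_inf _ _ _ (by simp)
      | refine Expands.add ?_ ?_ | refine Expands.mul (m := 0) (m' := 2) hd ?_ (by simp)

lemma nice_tailCoeff2 : Nice (-1) (-1) 2 tailCoeff2 := by
  refine ⟨smoothOff_laurent _ _, ?_, ?_, ?_⟩
  · refine Expands.congr_fst ?_ fun p x o => tailCoeff2_eq_fst o
    have hq : Expands 1 Prod.fst 0 quot1 := nice_quot1.fst
    refine Expands.mul nice_inv_r1.fst (m' := 0) ?_ (by simp)
    repeat' first
      | exact hq | exact expands_laurent_fst _ _ _ (by simp)
      | refine Expands.add ?_ ?_ | refine Expands.mul (m := 0) (m' := 0) ?_ ?_ (by simp)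
  · refine Expands.congr_snd ?_ fun p x o => tailCoeff2_eq_snd o
    have hq : Expands 1 Prod.snd 0 quot2 := nice_quot2.snd
    refine Expands.mul nice_inv_r2.snd (m' := 0) ?_ (by simp)
    repeat' first
      | exact hq | exact expands_laurent_snd _ _ _ (by simp)
      | refine Expands.add ?_ ?_ | refine Expands.mul (m := 0) (m' := 0) ?_ ?_ (by simp)
  · refine Expands.congr_inf ?_ fun p x o => tailCoeff2_eq_inf o
    have hd : Expands (-1) (fun _ => 0) 0 fun p x => r2 p x - r1 p x := nice_r2_sub_r1.inf
    repeat' first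
      | exact expands_laurent_inf _ _ _ (by simp)
      | refine Expands.add ?_ ?_ | refine Expands.mul (m := 0) (m' := 2) hd ?_ (by simp)

lemma nice_tailField (i : Fin 3) : Nice (-1) (-1) 2 fun p x => tailField p i x :=
  (nice_tailCoeff1.mul' (nice_n1 i)).add (nice_tailCoeff2.mul' (nice_n2 i))

lemma nice_sdComp (i j : Fin 3) : Nice 0 0 1 fun p x => sdComp p i j x := nice_sd i j

lemma nice_pd_sdComp (k i j : Fin 3) : Nice (-1) (-1) 2 fun p x => pd k (sdComp p i j) x :=
  (nice_sdComp i j).pd' k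

lemma nice_inv_sub : Nice 1 (-1) 0 fun p x => (r2 p x)⁻¹ - (r12 p)⁻¹ := by
  refine Nice.congr (((nice_quot1.mul' nice_r1 (k'' := 1) (l'' := 0) (m'' := -1)).mul'
    (nice_inv_r2.mul' nice_inv_r12 (k'' := 0) (l'' := -1) (m'' := 1)) (k'' := 1) (l'' := -1)
    (m'' := 0)).const_mul (-1)) fun p x o => ?_
  obtain ⟨a, b, c⟩ := o.pos
  rw [quot1]; field_simp; ring

lemma nice_pd_inv_r1 (j : Fin 3) : Nice (-2) 0 2 fun p x => pd j (fun z => (r1 p z)⁻¹) x := by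
  refine Nice.congr (((nice_inv_r1.mul' nice_inv_r1 (k'' := -2) (l'' := 0) (m'' := 2)).mul'
    (nice_n1 j) (k'' := -2) (l'' := 0) (m'' := 2)).neg) fun p x ⟨_, h1, _⟩ => ?_
  rw [(hasPD_inv_r1 h1).2]; field_simp

lemma nice_seedFlux (k : Fin 3) : Nice (-1) (-1) 3 fun p x => seedFlux p k x :=
  (nice_sum univ fun j _ => (nice_sd k j).mul' (nice_pd_inv_r1 j) (k'' := -2) (l'' := 0) (m'' := 3)).mul' nice_inv_sub

/-- The part of the source field that has no flux at infinity. -/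
def fastField (p : E6) (k : Fin 3) (x : E3) : ℝ :=
  (∑ j, sd k j p x * pd j (u₀ p) x) + (-3 / 16 * quadSD p k x + (3 / 32 * quadGrad p k x
    + (-1 / 16 * quadMixed p k x + 1 / 32 * seedFlux p k x)))

lemma nice_fastField (k : Fin 3) : Nice (-1) (-1) 3 fun p x => fastField p k x := by
  refine Nice.add (nice_sum univ fun j _ => (nice_sd k j).mul' (nice_u₀.pd' j (k' := -1)
    (l' := -1) (m' := 2))) (Nice.add (Nice.const_mul ?_ _) (Nice.add (Nice.const_mul ?_ _)
    (Nice.add (Nice.const_mul ?_ _) ((nice_seedFlux k).const_mul _))))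
  · exact nice_sum univ fun l _ => (nice_sdComp k l).mul' (nice_divSd l)
  · exact nice_sum univ fun i _ => nice_sum univ fun j _ =>
      (nice_sdComp i j).mul' (nice_pd_sdComp k i j)
  · exact nice_sum univ fun i _ => nice_sum univ fun j _ =>
      (nice_sdComp i j).mul' (nice_pd_sdComp j i k)

lemma nice_srcField (k : Fin 3) : Nice (-1) (-1) 2 fun p x => srcField p k x :=
  ((nice_fastField k).weaken le_rfl le_rfl (by norm_num)).add (nice_tailField k)

lemma nice_src₀ : Nice (-2) (-2) 3 src₀ :=
  (nice_sum univ fun k _ => (nice_srcField k).pd' (k' := -2) (l' := -2) (m' := 3) k).congr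
    fun _ _ o => (div_srcField o).symm

lemma nice_chr (k i j : Fin 3) : Nice (-1) (-1) 2 fun p x => chr (sdComp p) k i j x := by
  refine ((((nice_pd_sdComp i j k).add (nice_pd_sdComp j i k)).sub
    (nice_pd_sdComp k i j)).const_mul (1 / 2)).congr fun p x _ => ?_
  rw [chr]; ring

lemma nice_chr2 (k i j : Fin 3) : Nice (-1) (-1) 3 fun p x => chr2 (sdComp p) k i j x :=
  (nice_sum univ fun l _ => (nice_sdComp k l).mul' (nice_chr l i j)).neg

lemma nice_scal2 : Nice (-2) (-2) 4 fun p x => scal2 (sdComp p) x := by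
  refine nice_sum univ fun i _ => Nice.sub (nice_sum univ fun k _ => Nice.add
    (Nice.sub ((nice_chr2 k i i).pd' k) ((nice_chr2 k i k).pd' i)) (nice_sum univ
    fun l _ => Nice.sub ((nice_chr k k l).mul' (nice_chr l i i))
      ((nice_chr k i l).mul' (nice_chr l i k)))) (nice_sum univ fun j _ =>
        (nice_sdComp i j).mul' (nice_sum univ fun k _ => Nice.sub
          ((nice_chr k i j).pd' k (k' := -2) (l' := -2) (m' := 3)) ((nice_chr k i k).pd' j)))

lemma nice_divGrad {k l m : ℤ} {u : E6 → Fn} (hu : Nice k l m u) :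
    Nice (k - 2) (l - 2) (m + 3) fun p x => divGrad p (u p) x :=
  nice_sum univ fun i _ => nice_sum univ fun j _ =>
    (((nice_sd i j).mul' (hu.pd j) (k'' := k - 1) (l'' := l - 1) (m'' := m + 2) (by linarith)
      (by linarith) (by linarith)).pd' i (by linarith) (by linarith) (by linarith))

lemma nice_lap2 {k l m : ℤ} {u : E6 → Fn} (hu : Nice k l m u) :
    Nice (k - 2) (l - 2) (m + 3) fun p x => lap2 (sdComp p) (u p) x :=
  nice_sum univ fun i _ => Nice.add (Nice.neg (nice_sum univ fun k _ =>
      (nice_chr2 k i i).mul' (hu.pd k) (by linarith) (by linarith) (by linarith)))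
    (nice_sum univ fun j _ => Nice.add ((nice_sdComp i j).mul' (nice_sum univ
      fun k' _ => (nice_chr k' i j).mul' (hu.pd k') (k'' := k - 2) (l'' := l - 2) (m'' := m + 2)
        (by linarith) (by linarith) (by linarith)) (by linarith) (by linarith) (by linarith))
      ((nice_sum univ fun k _ => (nice_sdComp i k).mul' (nice_sdComp k j)
        (k'' := 0) (l'' := 0) (m'' := 2)).mul' ((hu.pd j).pd i) (by linarith) (by linarith)
        (by linarith)))

lemma nice_src1 : Nice (-3) (-3) 4 src1 := by
  refine Nice.congr (Nice.add (Nice.sub ((nice_divGrad nice_u1).weaken (by norm_num) (by norm_num)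
    (by norm_num)) ((nice_lap2 nice_inv_r1).weaken (by norm_num) (by norm_num)
    (by norm_num))) (Nice.const_mul (Nice.add (nice_inv_r1.mul' nice_scal2)
      (nice_u1.mul' nice_divDivSd)) (1 / 8))) fun p x _ => ?_
  rw [src1]; ring

lemma nice_src2 : Nice (-3) (-3) 4 src2 := by
  refine Nice.congr (Nice.add (Nice.sub ((nice_divGrad nice_u2).weaken (by norm_num) (by norm_num)
    (by norm_num)) ((nice_lap2 nice_inv_r2).weaken (by norm_num) (by norm_num)
    (by norm_num))) (Nice.const_mul (Nice.add (nice_inv_r2.mul' nice_scal2)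
      (nice_u2.mul' nice_divDivSd)) (1 / 8))) fun p x _ => ?_
  rw [src2]; ring

/-! ### Leading coefficients at infinity and at the punctures -/

lemma tendsto_to {f : ℝ → ℝ} {l : Filter ℝ} {L M : ℝ} (h : Tendsto f l (𝓝 L)) (e : L = M) :
    Tendsto f l (𝓝 M) := e ▸ h

/-- The cosine of the angle between `n` and the axis of the punctures. -/
def axisCos (p : E6) (n : E3) : ℝ := ∑ i, n i * n12 i p

lemma axisCos_neg (p : E6) (n : E3) : axisCos p (-n) = -axisCos p n := by
  simp [axisCos]

lemma axisCos_swap (p : E6) (n : E3) : axisCos p.swap n = -axisCos p n := by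
  simp [axisCos, n12_swap]

lemma continuous_axisCos (p : E6) : Continuous (axisCos p) := by unfold axisCos; fun_prop

lemma sphere_integral_axis (hp : p.1 ≠ p.2) (A B C D : ℝ) :
    ∫ n, (A + B * axisCos p n + C * axisCos p n ^ 2 + D * axisCos p n ^ 3) ∂sph =
      4 * π * (A + C / 3) := by
  have hc := continuous_axisCos p
  let e : E3 := WithLp.toLp 2 fun i => n12 i p
  have he : ‖e‖ ^ 2 = 1 := by
    rw [EuclideanSpace.real_norm_sq_eq, ← n12_n12 hp]
    exact sum_congr rfl fun i _ => by simp [e, sq]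
  have hi : ∀ n : E3, axisCos p n = inner ℝ n e := fun n => by
    simp [axisCos, PiLp.inner_apply, e, mul_comm]
  have h2 : ∫ n, C * axisCos p n.1 ^ 2 ∂sph = C * (4 * π / 3) := by
    rw [integral_const_mul]
    simp only [hi]
    rw [sphere_integral_inner_sq, he, mul_one]
  have hodd : ∫ n, (B * axisCos p n.1 + D * axisCos p n.1 ^ 3) ∂sph = 0 :=
    sphere_integral_odd (fun n => B * axisCos p n + D * axisCos p n ^ 3) fun n => by
      rw [axisCos_neg]; ring
  have e1 : ∫ n, (A + B * axisCos p n.1 + C * axisCos p n.1 ^ 2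
      + D * axisCos p n.1 ^ 3) ∂sph = ∫ n, (A + C * axisCos p n.1 ^ 2) ∂sph
      + ∫ n, (B * axisCos p n.1 + D * axisCos p n.1 ^ 3) ∂sph := by
    rw [← sphere_integral_add (by fun_prop) (by fun_prop)]
    exact integral_congr_ae (.of_forall fun n => by ring)
  rw [e1, sphere_integral_add (by fun_prop) (by fun_prop), h2, hodd, sphere_integral_const]
  ring

section Ray

variable {e : ℤ} {m : ℤ} {a : E3} {f : Fn} {Φ : RFn}

lemma Ray.tendsto (h : Ray e a m f Φ) {n : E3} (hn : Dir n) :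
    Tendsto (fun t : ℝ => t ^ (-m) * f (a + t ^ e • n)) N0 (𝓝 (Φ (0, n))) := by
  have hc : Tendsto (fun t : ℝ => Φ (t, n)) N0 (𝓝 (Φ (0, n))) :=
    ((h.smooth n hn).continuousAt.comp (f := fun t : ℝ => (t, n)) (by fun_prop)).tendsto.mono_left
      nhdsWithin_le_nhds
  refine hc.congr' ?_
  filter_upwards [h.eq, self_mem_nhdsWithin] with t ht h0
  rw [ht n hn, ← mul_assoc, ← zpow_add₀ (ne_of_gt h0)]; simp

/-- The value and the derivative of `F` at `0`. -/
structure FstJet (F : ℝ → ℝ) (v d : ℝ) : Prop where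
  val : F 0 = v
  deriv : HasDerivAt F d 0

lemma Ray.fstJet (h : Ray e a m f Φ) {n : E3} (hn : Dir n) {F : ℝ → ℝ} {v d : ℝ}
    (hF : FstJet F v d) (hfF : ∀ᶠ t in N0, f (a + t ^ e • n) = t ^ m * F t) :
    Φ (0, n) = v ∧ dfst Φ (0, n) = d := by
  have hd : HasDerivAt (fun t => Φ (t, n)) (dfst Φ (0, n)) 0 :=
    hasDerivAt_dfst (q := (0, n)) (diffAt (h.smooth n hn))
  have hev : (fun t => Φ (t, n)) =ᶠ[𝓝[>] 0] F := by
    filter_upwards [h.eq, hfF, self_mem_nhdsWithin] with t h1 h2 h0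
    have : (t : ℝ) ^ m ≠ 0 := zpow_ne_zero _ (ne_of_gt h0)
    exact mul_left_cancel₀ this ((h1 n hn).symm.trans h2)
  have hv : Φ (0, n) = v := by
    rw [← hF.val]
    exact tendsto_nhds_unique ((hd.continuousAt.tendsto.mono_left nhdsWithin_le_nhds).congr' hev)
      (hF.deriv.continuousAt.tendsto.mono_left nhdsWithin_le_nhds)
  refine ⟨hv, ?_⟩
  have h1 := (hd.hasDerivWithinAt (s := Set.Ioi 0)).congr_of_eventuallyEq hev.symm
    (by rw [hF.val, hv])
  exact (uniqueDiffWithinAt_Ioi 0).eq_deriv _ h1 hF.deriv.hasDerivWithinAt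

namespace FstJet

variable {F G : ℝ → ℝ} {v d v' d' : ℝ}

lemma add (h : FstJet F v d) (h' : FstJet G v' d') :
    FstJet (fun t => F t + G t) (v + v') (d + d') :=
  ⟨by simp only [h.val, h'.val], h.deriv.add h'.deriv⟩

lemma mul (h : FstJet F v d) (h' : FstJet G v' d') :
    FstJet (fun t => F t * G t) (v * v') (d * v' + v * d') :=
  ⟨by simp only [h.val, h'.val], by have := h.deriv.mul h'.deriv; rwa [h.val, h'.val] at this⟩

lemma const (c : ℝ) : FstJet (fun _ => c) c 0 := ⟨rfl, hasDerivAt_const _ _⟩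

lemma inv (h : FstJet F v d) (h0 : v ≠ 0) : FstJet (fun t => (F t)⁻¹) v⁻¹ (-d / v ^ 2) :=
  ⟨by rw [h.val], by have := h.deriv.inv (by rwa [h.val]); rwa [h.val] at this⟩

lemma id : FstJet (fun t => t) 0 1 := ⟨rfl, hasDerivAt_id _⟩

lemma of_eq (h : FstJet F v d) (hv : v = v') (hd : d = d') : FstJet F v' d' := hv ▸ hd ▸ h

end FstJet

end Ray

section Puncture

variable {n : E3}

/-- The distance to the second puncture along a ray from the first one. -/
def farDist (p : E6) (n : E3) (t : ℝ) : ℝ :=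
  Real.sqrt (t ^ 2 + 2 * r12 p * axisCos p n * t + r12 p ^ 2)

lemma fstJet_farDist (hp : p.1 ≠ p.2) : FstJet (farDist p n) (r12 p) (axisCos p n) := by
  have hR := r12_pos hp
  have h0 : farDist p n 0 = r12 p := by simp [farDist, Real.sqrt_sq hR.le]
  refine ⟨h0, ?_⟩
  have h1 : HasDerivAt (fun t : ℝ => t ^ 2 + 2 * r12 p * axisCos p n * t + r12 p ^ 2)
      (2 * r12 p * axisCos p n) 0 := by
    have := ((hasDerivAt_pow 2 (0 : ℝ)).add ((hasDerivAt_id (0 : ℝ)).const_mul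
      (2 * r12 p * axisCos p n))).add_const (r12 p ^ 2)
    simpa using this
  have h2 := h1.sqrt (by simp; exact hR.ne')
  have e : 2 * r12 p * axisCos p n / (2 * Real.sqrt ((0 : ℝ) ^ 2 + 2 * r12 p * axisCos p n * 0
      + r12 p ^ 2)) = axisCos p n := by
    simp only [ne_eq, OfNat.ofNat_ne_zero, not_false_eq_true, zero_pow, mul_zero, add_zero,
      zero_add, Real.sqrt_sq hR.le]
    field_simp
  rw [e] at h2
  exact h2

lemma ray_fst (hp : p.1 ≠ p.2) (hn : Dir n) {t : ℝ} (ht : 0 < t) :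
    r1 p (p.1 + t • n) = t ∧ r2 p (p.1 + t • n) = farDist p n t ∧
      (∀ i, n1 i p (p.1 + t • n) = n i) := by
  have hR := r12_pos hp
  have h1 : r1 p (p.1 + t • n) = t := by simp [r1, norm_smul, hn, abs_of_pos ht]
  refine ⟨h1, ?_, fun i => ?_⟩
  · have hsq : r2 p (p.1 + t • n) ^ 2 = t ^ 2 + 2 * r12 p * axisCos p n * t + r12 p ^ 2 := by
      have e1 : ∑ i, n i * n i = 1 := by
        have := EuclideanSpace.real_norm_sq_eq n
        rw [hn] at this
        simpa [sq] using this.symm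
      have e2 : r12 p * axisCos p n = ∑ i, n i * (p.1 i - p.2 i) := by
        rw [axisCos, mul_sum]
        exact sum_congr rfl fun i _ => by rw [n12]; field_simp
      rw [r2_sq, r12_sq, mul_assoc 2, e2]
      simp only [PiLp.add_apply, PiLp.smul_apply, smul_eq_mul, Fin.sum_univ_three] at *
      linear_combination t ^ 2 * e1
    rw [farDist, ← hsq, Real.sqrt_sq]; exact dist_nonneg
  · rw [n1, h1]; simp; field_simp

/-- The first difference quotient along a ray from the first puncture. -/
def farQuot (p : E6) (n : E3) (t : ℝ) : ℝ :=
  (t + 2 * (r12 p * axisCos p n)) * (farDist p n t + r12 p)⁻¹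

lemma fstJet_farQuot (hp : p.1 ≠ p.2) :
    FstJet (farQuot p n) (axisCos p n) ((1 - axisCos p n ^ 2) / (2 * r12 p)) := by
  have hR := r12_pos hp
  refine ((FstJet.id.add (FstJet.const (2 * (r12 p * axisCos p n)))).mul
    (((fstJet_farDist hp).add (FstJet.const (r12 p))).inv (by positivity))).of_eq ?_ ?_
  · field_simp; ring
  · field_simp; ring

lemma farDist_pos (hp : p.1 ≠ p.2) : ∀ᶠ t in N0, 0 < farDist p n t := by
  have h := (fstJet_farDist (n := n) hp)
  have : 0 < farDist p n 0 := by rw [h.val]; exact r12_pos hp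
  exact (h.deriv.continuousAt.eventually (lt_mem_nhds this)).filter_mono nhdsWithin_le_nhds

lemma ray_fst_cos (hp : p.1 ≠ p.2) (hn : Dir n) : ∀ᶠ t in N0,
    0 < t ∧ 0 < farDist p n t ∧ Off p (p.1 + t • n) ∧
      cos1 p (p.1 + t • n) = axisCos p n ∧ quot1 p (p.1 + t • n) = farQuot p n t := by
  filter_upwards [farDist_pos hp, eventually_off_ray p.1 p.2 hp, self_mem_nhdsWithin] with t h1 h2 h3
  have o : Off p (p.1 + t • n) := ⟨hp, (h2 n hn).1, (h2 n hn).2⟩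
  obtain ⟨e1, e2, e3⟩ := ray_fst hp hn h3
  have hc : cos1 p (p.1 + t • n) = axisCos p n := by
    rw [← n1_n12 hp o.2]; simp only [e3, axisCos]
  refine ⟨h3, h1, o, hc, ?_⟩
  rw [quot1_eq o, hc, e1, e2, farQuot]; ring

lemma sd_data_fst (hp : p.1 ≠ p.2) {Φ : Fin 3 → Fin 3 → RFn}
    (hΦ : ∀ i j, Ray 1 p.1 0 (sd i j p) (Φ i j)) (hn : Dir n) :
    (∑ i, ∑ j, Φ i j (0, n) * n i * n j =
      (-1 / 3 - axisCos p n / 3 + axisCos p n ^ 2) / r12 p ^ 2) ∧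
    dfst (fun q => ∑ i, ∑ j, Φ i j q * q.2 i * q.2 j) (0, n) =
      (1 / 12 + 5 / 6 * axisCos p n - axisCos p n ^ 2 / 4 - axisCos p n ^ 3) / r12 p ^ 3 := by
  have hR := r12_pos hp
  have hray : Ray 1 p.1 0 (fun x => ∑ i, ∑ j, sd i j p x * n1 i p x * n1 j p x)
      (fun q => ∑ i, ∑ j, Φ i j q * q.2 i * q.2 j) := by
    refine ⟨fun n hn => ContDiffAt.sum fun i _ => ContDiffAt.sum fun j _ =>
      (((hΦ i j).smooth n hn).mul ?_).mul ?_, ?_⟩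
    · exact ((contDiff_coord i).comp contDiff_snd).contDiffAt
    · exact ((contDiff_coord j).comp contDiff_snd).contDiffAt
    · have hall : ∀ᶠ t in N0, ∀ i j, ∀ n, Dir n →
          sd i j p (p.1 + t ^ (1 : ℤ) • n) = t ^ (0 : ℤ) * Φ i j (t, n) :=
        eventually_all.2 fun i => eventually_all.2 fun j => (hΦ i j).eq
      filter_upwards [hall, self_mem_nhdsWithin] with t h h0 n hn
      simp only [h _ _ n hn]
      simp only [zpow_one, (ray_fst hp hn h0).2.2, zpow_zero, one_mul]
  let c := axisCos p n
  have hb := fstJet_farDist (n := n) hp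
  have hb' := hb.inv hR.ne'
  have hq := fstJet_farQuot (n := n) hp
  have hw := ((FstJet.id.add hb).add (FstJet.const (r12 p))).inv (by positivity)
  refine hray.fstJet hn (FstJet.of_eq (F := fun t => -(1 - c ^ 2) * (r12 p)⁻¹ * (t + farDist p n t + r12 p)⁻¹
      + (c - 1) * ((t + r12 p * c) * (farDist p n t)⁻¹ + c) *
        ((t + farDist p n t + r12 p)⁻¹ * (t + farDist p n t + r12 p)⁻¹)
      + 1 / 6 * ((farQuot p n t + 1) * ((farDist p n t)⁻¹ * (r12 p)⁻¹))) (by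
    repeat' first
      | exact hw | exact hb' | exact hb | exact hq | exact FstJet.id | exact FstJet.const _
      | apply FstJet.add | apply FstJet.mul) ?_ ?_) ?_
  · simp only [c]; field_simp; ring
  · simp only [c]; field_simp; ring
  · filter_upwards [ray_fst_cos hp hn] with t ⟨h0, hb0, o, hc, hq⟩
    obtain ⟨e1, e2, -⟩ := ray_fst hp hn h0
    have hcd := hc
    have hqd := hq
    rw [cos1, e1, e2] at hcd
    rw [quot1, e1, e2] at hqd
    rw [zpow_one, zpow_zero, one_mul, sd_n1_n1 o, hc, cos3, trg, invPerim, e1, e2, ← hqd]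
    have hS : t + farDist p n t + r12 p ≠ 0 := by positivity
    have hcd' : farDist p n t ^ 2 = t ^ 2 + r12 p ^ 2 + 2 * t * r12 p * c := by
      simp only [c]; rw [← hcd]; field_simp; ring
    have e3 : (t ^ 2 + farDist p n t ^ 2 - r12 p ^ 2) / (2 * t * farDist p n t) =
        (t + r12 p * c) * (farDist p n t)⁻¹ := by
      rw [hcd']; field_simp; ring
    rw [e3]
    have h0' := h0.ne'
    simp only [c]
    field_simp
    ring

lemma firstOrder_data_fst (hp : p.1 ≠ p.2) {Φ : RFn}
    (hΦ : Ray 1 p.1 (-1) (firstOrder p α1 α2) Φ) (hn : Dir n) :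
    Φ (0, n) = α1 * (1 / 6 + 5 / 24 * axisCos p n - axisCos p n ^ 2 / 2) / r12 p ^ 2 ∧
    dfst Φ (0, n) = (1 - axisCos p n) / (32 * r12 p ^ 2) - (1 + axisCos p n) / (96 * r12 p ^ 2)
      + α1 * (-5 / 96 - 5 / 24 * axisCos p n + 5 / 32 * axisCos p n ^ 2 + axisCos p n ^ 3 / 4)
        / r12 p ^ 3 + α2 * (-25 / 48 - axisCos p n / 24) / r12 p ^ 3 := by
  have hR := r12_pos hp
  let c := axisCos p n
  have hb := fstJet_farDist (n := n) hp
  have hb' := hb.inv hR.ne'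
  have hq := fstJet_farQuot (n := n) hp
  let R := r12 p
  let S := (r12 p)⁻¹
  let q := farQuot p n
  let b := farDist p n
  refine hΦ.fstJet hn (FstJet.of_eq (F := fun t => t * (-1 / 32 * (S * S * (c + -1 * ((R + c * t) * (b t)⁻¹)))
      + -1 / 96 * ((q t + 1) * ((b t)⁻¹ * S)))
      + (α1 * (-1 / 4 * (q t * (q t * ((b t + R) * (S * (S * S)))))
      + q t * (-5 / 192 * ((b t)⁻¹ * S) + 15 / 64 * (b t * (S * (S * S))))
      + -1 / 24 * ((b t)⁻¹ * S) + 1 / 4 * (b t * (S * (S * S)))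
      + -1 / 32 * (t * (t * ((b t)⁻¹ * (S * (S * S))))) + -1 / 24 * (S * S)
      + 3 / 64 * (t * ((b t)⁻¹ * (S * S))) + -13 / 64 * (t * (S * (S * S))))
      + α2 * (t * (S * (S * (S * (
      -1 / 4 * ((b t)⁻¹ * ((b t)⁻¹ * ((b t)⁻¹ * ((t + -1 * R) * ((t + -1 * R) * (t + R))))))
      + 15 / 64 * ((b t)⁻¹ * ((b t)⁻¹ * (t * (t + -1 * R))))
      + -5 / 192 * (R * (R * ((b t)⁻¹ * (b t)⁻¹)))
      + 1 / 4 * (t * (b t)⁻¹) + -1 / 24 * (R * (b t)⁻¹) + -13 / 64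
      + -1 / 192 * (q t * ((b t)⁻¹ * ((b t)⁻¹ * (6 * (b t * b t) + -3 * (b t * R)
        + 5 * (R * R)))))))))))) (by
    repeat' first
      | exact hb' | exact hb | exact hq | exact FstJet.id | exact FstJet.const _
      | apply FstJet.add | apply FstJet.mul) ?_ ?_) ?_
  · simp only [c, R, S]; field_simp; ring
  · simp only [c, R, S]; field_simp; ring
  · filter_upwards [ray_fst_cos hp hn] with t ⟨h0, hb0, o, hc, hq⟩
    obtain ⟨e1, e2, -⟩ := ray_fst hp hn h0
    have hs : r12 p.swap = r12 p := dist_comm _ _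
    have hq2 : quot2 p.swap (p.1 + t • n) = farQuot p n t := by
      rw [← hq, quot2, quot1, hs]; rfl
    have s1 : r1 p.swap (p.1 + t • n) = farDist p n t := e2
    have s2 : r2 p.swap (p.1 + t • n) = t := e1
    have hcd := hc
    have hqd := hq
    rw [cos1, e1, e2] at hcd
    rw [quot1, e1, e2] at hqd
    have hcd' : farDist p n t ^ 2 = t ^ 2 + r12 p ^ 2 + 2 * t * r12 p * axisCos p n := by
      rw [← hcd]; field_simp; ring
    have e3 : cos2 p (p.1 + t • n) = (r12 p + axisCos p n * t) * (farDist p n t)⁻¹ := by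
      rw [cos2, e1, e2, hcd']; field_simp; ring
    have e4 : trg p (p.1 + t • n) =
        -1 / 2 * ((farQuot p n t + 1) * ((farDist p n t)⁻¹ * (r12 p)⁻¹)) := by
      rw [trg, e1, e2, ← hqd]; have := h0.ne'; field_simp; ring
    rw [zpow_one, zpow_neg_one, firstOrder, u₀_eq o, u1_eq_fst o, u2,
      u1_eq_snd o.swap, hc, hq, hq2, hs, s1, s2, e1, e2, e3, e4]
    simp only [c, R, S, q, b]
    have := h0.ne'
    field_simp
    ring

end Puncture

section Infinity

variable {n : E3}

lemma Ray.tendsto_inf {m : ℤ} {f : Fn} {Φ : RFn} (h : Ray (-1) 0 m f Φ) (hn : Dir n) :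
    Tendsto (fun t : ℝ => t ^ (-m) * f (t⁻¹ • n)) N0 (𝓝 (Φ (0, n))) := by
  simpa using h.tendsto hn

lemma tendsto_r1_inf (hp : p.1 ≠ p.2) (hn : Dir n) :
    Tendsto (fun t : ℝ => t * r1 p (t⁻¹ • n)) N0 (𝓝 1) := by
  simpa [hn] using (expandsTo_r1_inf.ray hp).tendsto_inf hn

lemma tendsto_n1_inf (hp : p.1 ≠ p.2) (hn : Dir n) (i : Fin 3) :
    Tendsto (fun t : ℝ => n1 i p (t⁻¹ • n)) N0 (𝓝 (n i)) := by
  have h0 : Tendsto (fun t : ℝ => t) N0 (𝓝 0) := tendsto_id.mono_left nhdsWithin_le_nhds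
  have h : Tendsto (fun t : ℝ => (n i - t * p.1 i) * (t * r1 p (t⁻¹ • n))⁻¹) N0
      (𝓝 ((n i - 0 * p.1 i) * 1⁻¹)) :=
    (tendsto_const_nhds.sub (h0.mul_const _)).mul ((tendsto_r1_inf hp hn).inv₀ one_ne_zero)
  refine (tendsto_to h (by simp)).congr' ?_
  filter_upwards [self_mem_nhdsWithin] with t ht
  have : t ≠ 0 := ne_of_gt ht
  simp only [n1, PiLp.smul_apply, smul_eq_mul, mul_inv]
  field_simp

lemma eventually_off_inf (p : E6) (hn : Dir n) :
    ∀ᶠ t in N0, 0 < t ∧ t⁻¹ • n ≠ p.1 ∧ t⁻¹ • n ≠ p.2 := by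
  have h : Tendsto (fun t : ℝ => ‖t⁻¹ • n‖) N0 atTop := by
    refine tendsto_inv_nhdsGT_zero.congr' ?_
    filter_upwards [self_mem_nhdsWithin] with t ht
    rw [norm_smul, hn, mul_one, Real.norm_of_nonneg (inv_nonneg.2 (le_of_lt ht))]
  filter_upwards [h.eventually_gt_atTop ‖p.1‖, h.eventually_gt_atTop ‖p.2‖, self_mem_nhdsWithin]
    with t h1 h2 h3
  exact ⟨h3, fun h => by rw [h] at h1; exact lt_irrefl _ h1,
    fun h => by rw [h] at h2; exact lt_irrefl _ h2⟩

/-- The limits at infinity, along the ray with direction `n`, of the basic quantities. -/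
structure InfLimits (p : E6) (n : E3) : Prop where
  a : Tendsto (fun t : ℝ => t * r1 p (t⁻¹ • n)) N0 (𝓝 1)
  b : Tendsto (fun t : ℝ => t * r2 p (t⁻¹ • n)) N0 (𝓝 1)
  n1 : ∀ i, Tendsto (fun t : ℝ => n1 i p (t⁻¹ • n)) N0 (𝓝 (n i))
  n2 : ∀ i, Tendsto (fun t : ℝ => n2 i p (t⁻¹ • n)) N0 (𝓝 (n i))
  cos1 : Tendsto (fun t : ℝ => cos1 p (t⁻¹ • n)) N0 (𝓝 (axisCos p n))
  d : Tendsto (fun t : ℝ => r2 p (t⁻¹ • n) - r1 p (t⁻¹ • n)) N0 (𝓝 (r12 p * axisCos p n))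

lemma infLimits (hp : p.1 ≠ p.2) (hn : Dir n) : InfLimits p n := by
  have ha := tendsto_r1_inf hp hn
  have hb : Tendsto (fun t : ℝ => t * r2 p (t⁻¹ • n)) N0 (𝓝 1) :=
    tendsto_r1_inf (p := p.swap) hp.symm hn
  have hn1 := tendsto_n1_inf hp hn
  have h0 : Tendsto (fun t : ℝ => t) N0 (𝓝 0) := tendsto_id.mono_left nhdsWithin_le_nhds
  have hc : Tendsto (fun t : ℝ => cos1 p (t⁻¹ • n)) N0 (𝓝 (axisCos p n)) := by
    have h : Tendsto (fun t : ℝ => ∑ i, Geometrostatics.n1 i p (t⁻¹ • n) * n12 i p) N0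
        (𝓝 (axisCos p n)) := tendsto_finsetSum _ fun i _ => (hn1 i).mul_const _
    refine h.congr' ?_
    filter_upwards [eventually_off_inf p hn] with t ht using n1_n12 hp ht.2.1
  refine ⟨ha, hb, hn1, fun i => tendsto_n1_inf (p := p.swap) hp.symm hn i, hc, ?_⟩
  have h : Tendsto (fun t : ℝ => (t * r12 p ^ 2 + 2 * r12 p * (t * r1 p (t⁻¹ • n))
      * cos1 p (t⁻¹ • n)) * (t * r1 p (t⁻¹ • n) + t * r2 p (t⁻¹ • n))⁻¹) N0 _ :=
    ((h0.mul_const _).add ((ha.const_mul (2 * r12 p)).mul hc)).mul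
      ((ha.add hb).inv₀ (by norm_num))
  refine (tendsto_to h (by ring)).congr' ?_
  filter_upwards [eventually_off_inf p hn] with t ⟨ht, h1, h2⟩
  have a := r1_pos h1; have b := r2_pos h2; have c := r12_pos hp
  have hab : r1 p (t⁻¹ • n) + r2 p (t⁻¹ • n) ≠ 0 := by positivity
  rw [Geometrostatics.cos1]
  generalize r1 p (t⁻¹ • n) = a at *
  generalize r2 p (t⁻¹ • n) = b at *
  field_simp; ring

namespace InfLimits

lemma inv_a (h : InfLimits p n) :
    Tendsto (fun t : ℝ => t⁻¹ * (r1 p (t⁻¹ • n))⁻¹) N0 (𝓝 1) := by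
  simpa [mul_comm] using h.a.inv₀ one_ne_zero

lemma inv_b (h : InfLimits p n) :
    Tendsto (fun t : ℝ => t⁻¹ * (r2 p (t⁻¹ • n))⁻¹) N0 (𝓝 1) := by
  simpa [mul_comm] using h.b.inv₀ one_ne_zero

lemma of_inv {f : ℝ → ℝ} {L : ℝ} (h : Tendsto (fun t : ℝ => t⁻¹ * f t) N0 (𝓝 L)) :
    Tendsto f N0 (𝓝 0) := by
  have h0 : Tendsto (fun t : ℝ => t) N0 (𝓝 0) := tendsto_id.mono_left nhdsWithin_le_nhds
  refine (tendsto_to (h0.mul h) (zero_mul _)).congr' ?_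
  filter_upwards [self_mem_nhdsWithin] with t ht
  rw [mul_inv_cancel_left₀ (ne_of_gt ht)]

lemma ratio (h : InfLimits p n) :
    Tendsto (fun t : ℝ => r1 p (t⁻¹ • n) * (r2 p (t⁻¹ • n))⁻¹) N0 (𝓝 1) := by
  refine (tendsto_to (h.a.mul h.inv_b) (one_mul _)).congr' ?_
  filter_upwards [self_mem_nhdsWithin] with t ht
  have : t ≠ 0 := ne_of_gt ht
  field_simp

lemma ratio' (h : InfLimits p n) :
    Tendsto (fun t : ℝ => r2 p (t⁻¹ • n) * (r1 p (t⁻¹ • n))⁻¹) N0 (𝓝 1) := by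
  simpa [mul_inv, mul_comm] using h.ratio.inv₀ one_ne_zero

lemma trg (h : InfLimits p n) :
    Tendsto (fun t : ℝ => t⁻¹ * trg p (t⁻¹ • n)) N0 (𝓝 (-(r12 p)⁻¹)) := by
  have A := of_inv h.inv_a
  have H := ((h.inv_b.mul A).sub ((h.inv_a.mul_const (r12 p)⁻¹).add
    (h.inv_b.mul_const (r12 p)⁻¹))).const_mul (1 / 2)
  refine (tendsto_to H (by ring)).congr' (.of_forall fun t => ?_)
  simp only [Geometrostatics.trg]; ring

lemma perim (h : InfLimits p n) :
    Tendsto (fun t : ℝ => t⁻¹ * invPerim p (t⁻¹ • n)) N0 (𝓝 (1 / 2)) := by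
  have h0 : Tendsto (fun t : ℝ => t) N0 (𝓝 0) := tendsto_id.mono_left nhdsWithin_le_nhds
  have H := ((h.a.add h.b).add (h0.mul_const (r12 p))).inv₀ (by norm_num)
  refine (tendsto_to H (by norm_num)).congr' ?_
  filter_upwards [self_mem_nhdsWithin] with t ht
  rw [invPerim, ← mul_inv]; congr 1; ring

lemma u₀ (hp : p.1 ≠ p.2) (hn : Dir n) (h : InfLimits p n) :
    Tendsto (fun t : ℝ => t⁻¹ * u₀ p (t⁻¹ • n)) N0
      (𝓝 (-(axisCos p n ^ 2 - 1) / (32 * r12 p) - 1 / (48 * r12 p))) := by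
  have hR := r12_pos hp
  have H := ((((h.d.mul h.cos1).sub_const (r12 p)).mul h.inv_b).const_mul
    (-1 / 32 * ((r12 p)⁻¹ * (r12 p)⁻¹))).add (h.trg.const_mul (1 / 48))
  refine (tendsto_to H (by field_simp; ring)).congr' ?_
  filter_upwards [eventually_off_inf p hn] with t ⟨ht, h1, h2⟩
  rw [u₀_eq ⟨hp, h1, h2⟩, cos1_sub_cos2_eq ⟨hp, h1, h2⟩]; ring

lemma u1 (hp : p.1 ≠ p.2) (hn : Dir n) (h : InfLimits p n) :
    Tendsto (fun t : ℝ => t⁻¹ * u1 p (t⁻¹ • n)) N0 (𝓝 (1 / (48 * r12 p ^ 2))) := by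
  have hR := r12_pos hp
  have A := of_inv h.inv_a
  have B := of_inv h.inv_b
  have D := h.d
  have R := h.ratio
  have R' := h.ratio'
  have C : ∀ c : ℝ, Tendsto (fun _ : ℝ => c) N0 (𝓝 c) := fun c => tendsto_const_nhds
  have H := h.inv_a.mul ((C ((r12 p)⁻¹ ^ 3)).mul (((D.mul ((((C (-1 / 32)).add
    ((C (-33 / 64)).mul (D.mul A))).add ((C (-1 / 4)).mul (D.mul (A.mul (D.mul A))))).add
    ((C (1 / 32)).mul R))).add ((C (r12 p)).mul (((((C (1 / 4)).mul (R'.mul R')).add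
    ((C (-15 / 64)).mul R')).add (C (-1 / 24))).add ((C (3 / 64)).mul R)))).add
    (((C (r12 p ^ 2)).mul ((((C (1 / 4)).mul (R'.mul A)).add ((C (-5 / 192)).mul A)).add
    ((C (-1 / 24)).mul B))).add ((C (r12 p ^ 3)).mul (((C (-1 / 4)).mul (A.mul A)).add
    ((C (5 / 192)).mul (A.mul B)))))))
  refine (tendsto_to H (by field_simp; norm_num)).congr' ?_
  filter_upwards [eventually_off_inf p hn] with t ⟨ht, h1, h2⟩
  rw [u1_eq_inf ⟨hp, h1, h2⟩]; ring

end InfLimits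

lemma firstOrder_data_inf (hp : p.1 ≠ p.2) {Φ : RFn}
    (hΦ : Ray (-1) 0 1 (firstOrder p α1 α2) Φ) (hn : Dir n) :
    Φ (0, n) = -(axisCos p n ^ 2 - 1) / (32 * r12 p) - 1 / (48 * r12 p)
      + (α1 + α2) / (48 * r12 p ^ 2) := by
  have h := infLimits hp hn
  have hs : r12 p.swap = r12 p := dist_comm _ _
  have h2 : Tendsto (fun t : ℝ => t⁻¹ * u2 p (t⁻¹ • n)) N0 (𝓝 (1 / (48 * r12 p ^ 2))) := by
    have := (infLimits (p := p.swap) hp.symm hn).u1 hp.symm hn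
    rwa [hs] at this
  refine tendsto_nhds_unique (hΦ.tendsto_inf hn) ?_
  refine (tendsto_to ((h.u₀ hp hn).add (((h.u1 hp hn).const_mul α1).add (h2.const_mul α2)))
    (by ring)).congr fun t => ?_
  rw [zpow_neg_one, firstOrder]; ring

lemma sd_data_inf (hp : p.1 ≠ p.2) {Φ : Fin 3 → Fin 3 → RFn}
    (hΦ : ∀ i j, Ray (-1) 0 1 (sd i j p) (Φ i j)) (hn : Dir n) :
    ∑ i, ∑ j, Φ i j (0, n) * n i * n j =
      -(1 - axisCos p n ^ 2) / (2 * r12 p) + 1 / (3 * r12 p) := by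
  have hR := r12_pos hp
  have h := infLimits hp hn
  have e1 : ∑ i, n i * n i = 1 := by
    have := EuclideanSpace.real_norm_sq_eq n
    rw [hn] at this
    simpa [sq] using this.symm
  have W := InfLimits.of_inv h.perim
  have s1 : Tendsto (fun t : ℝ => ∑ i, n1 i p (t⁻¹ • n) * n i) N0 (𝓝 (∑ i, n i * n i)) :=
    tendsto_finsetSum _ fun i _ => (h.n1 i).mul_const _
  have s2 : Tendsto (fun t : ℝ => ∑ i, n2 i p (t⁻¹ • n) * n i) N0 (𝓝 (∑ i, n i * n i)) :=
    tendsto_finsetSum _ fun i _ => (h.n2 i).mul_const _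
  have H := ((h.perim.const_mul (-(1 - axisCos p n ^ 2) * (r12 p)⁻¹)).add
    (((s1.const_sub (axisCos p n)).mul (s2.add_const (axisCos p n))).mul (h.perim.mul W))).sub
    (h.trg.const_mul (1 / 3))
  have H' : Tendsto (fun t : ℝ => ∑ i, ∑ j, t ^ (-1 : ℤ) * sd i j p (t⁻¹ • n) * n i * n j) N0
      (𝓝 (∑ i, ∑ j, Φ i j (0, n) * n i * n j)) := tendsto_finsetSum _ fun i _ =>
    tendsto_finsetSum _ fun j _ => (((hΦ i j).tendsto_inf hn).mul_const _).mul_const _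
  refine tendsto_nhds_unique H' ((tendsto_to H (by field_simp; ring)).congr fun t => ?_)
  rw [zpow_neg_one]
  simp only [sd, hessg, δ, axisCos, Fin.sum_univ_three] at *
  simp
  linear_combination (-(t⁻¹ * (r12 p)⁻¹ * invPerim p (t⁻¹ • n)) + (1 / 3) * t⁻¹ * (-trg p (t⁻¹ • n)))
    * (e1 * -1)

/-! ### The flux of the source field at infinity -/

lemma tendsto_laurent_inf (hp : p.1 ≠ p.2) (hn : Dir n) (L : List (ℤ × ℤ × ℝ)) (k : ℤ)
    (hL : ∀ s ∈ L, s.1 + s.2.1 ≤ -2) :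
    Tendsto (fun t : ℝ => t ^ (-2 : ℤ) * laurent L k p (t⁻¹ • n)) N0
      (𝓝 (L.map fun s => if s.1 + s.2.1 = -2 then s.2.2 * r12 p ^ (k + 2) else 0).sum) := by
  have h := infLimits hp hn
  have h0 : Tendsto (fun t : ℝ => t) N0 (𝓝 0) := tendsto_id.mono_left nhdsWithin_le_nhds
  induction L with
  | nil => simp [laurent]
  | cons s L ih =>
    have hs := hL s (by simp)
    have hz : ∀ {f : ℝ → ℝ}, Tendsto f N0 (𝓝 1) → ∀ m : ℤ,
        Tendsto (fun t => f t ^ m) N0 (𝓝 1) := fun hf m => by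
      simpa using hf.zpow₀ m (Or.inl one_ne_zero)
    have hj : Tendsto (fun t : ℝ => t ^ (-2 - s.1 - s.2.1)) N0
        (𝓝 (if s.1 + s.2.1 = -2 then 1 else 0)) := by
      obtain ⟨j, hj⟩ := Int.eq_ofNat_of_zero_le (show 0 ≤ -2 - s.1 - s.2.1 by linarith)
      rw [hj]
      split_ifs with h
      · have : j = 0 := by omega
        simp [this]
      · have : j ≠ 0 := by omega
        simpa [zero_pow this] using h0.pow j
    have H := ((((hz h.a s.1).mul (hz h.b s.2.1)).mul hj).const_mul
      (s.2.2 * r12 p ^ (k - s.1 - s.2.1))).add (ih fun s' h' => hL s' (List.mem_cons_of_mem _ h'))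
    refine (tendsto_to H ?_).congr' ?_
    · simp only [List.map_cons, List.sum_cons]
      congr 1
      split_ifs with hk
      · rw [show k - s.1 - s.2.1 = k + 2 by linarith]; ring
      · ring
    · filter_upwards [self_mem_nhdsWithin] with t ht
      have ht : t ≠ 0 := ne_of_gt ht
      simp only [laurent, List.map_cons, List.sum_cons, mul_zpow, mul_add]
      congr 1
      have : t ^ s.1 * t ^ s.2.1 * t ^ (-2 - s.1 - s.2.1) = t ^ (-2 : ℤ) := by
        rw [← zpow_add₀ ht, ← zpow_add₀ ht]; congr 1; ring
      rw [← this]; ring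

lemma tendsto_tailCoeff (hp : p.1 ≠ p.2) (hn : Dir n) :
    Tendsto (fun t : ℝ => t ^ (-2 : ℤ) * tailCoeff1 p (t⁻¹ • n)) N0 (𝓝 ((221 / 9216
      - 97 / 4608 * axisCos p n - 1 / 1024 * axisCos p n ^ 3) / r12 p ^ 3)) ∧
    Tendsto (fun t : ℝ => t ^ (-2 : ℤ) * tailCoeff2 p (t⁻¹ • n)) N0 (𝓝 ((-257 / 9216
      - 13 / 512 * axisCos p n + 1 / 1024 * axisCos p n ^ 3) / r12 p ^ 3)) := by
  have hR := r12_pos hp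
  have D := (infLimits hp hn).d
  have T := tendsto_laurent_inf hp hn
  constructor
  · have H := (T [(-3, -2, 11/9216), (-3, -1, -17/9216), (-3, 0, -43/3072),
        (-3, 1, 265/9216), (-2, -2, -25/18432), (-2, -1, 1/576), (-2, 0, -127/18432),
        (-1, -1, 5/1024), (0, -2, -17/6144)] (-5) (by simp)).add ((D.mul (T [(-3, 1, -65/4608),
        (-2, 0, -35/4608), (-1, -1, 19/6144), (0, -2, -5/2048)] (-6) (by simp))).add
      (D.mul (D.mul (D.mul (T [(-1, -1, -1/2048), (0, -2, -1/2048)] (-8) (by simp))))))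
    refine (tendsto_to H ?_).congr' ?_
    · norm_num [zpow_neg, zpow_ofNat]; field_simp; ring
    · filter_upwards [eventually_off_inf p hn] with t ⟨ht, h1, h2⟩
      rw [tailCoeff1_eq_inf ⟨hp, h1, h2⟩]; ring
  · have H := (T [(-3, -1, -1/64), (-3, 0, 1/64), (-3, 1, 1/64), (-2, -3, -1/2304),
        (-2, -1, 15/1024), (-2, 0, -151/4608), (-1, -3, 1/1152), (-1, -1, -11/1024),
        (0, -3, -1/2304)] (-5) (by simp)).add ((D.mul (T [(-3, 1, -1/64), (-2, 0, 5/2048),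
        (-1, -1, -25/2048)] (-6) (by simp))).add
      (D.mul (D.mul (D.mul (T [(-2, 0, 1/2048), (-1, -1, 1/2048)] (-8) (by simp))))))
    refine (tendsto_to H ?_).congr' ?_
    · norm_num [zpow_neg, zpow_ofNat]; field_simp; ring
    · filter_upwards [eventually_off_inf p hn] with t ⟨ht, h1, h2⟩
      rw [tailCoeff2_eq_inf ⟨hp, h1, h2⟩]; ring

lemma tendsto_flux_inf {V : Fin 3 → Fn} {Φ : Fin 3 → RFn}
    (hV : ∀ i, Ray (-1) 0 2 (V i) (Φ i)) :
    Tendsto (flux V 0) atTop (𝓝 (∫ n, ∑ i, Φ i (0, n.1) * n.1 i ∂sph)) := by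
  have hs := tendsto_sphere_integral (F := fun q => ∑ i, Φ i q * q.2 i) fun n hn =>
    ContDiffAt.sum fun i _ => ((hV i).smooth n hn).mul
      ((contDiff_coord i).comp contDiff_snd).contDiffAt
  have hev := eventually_all.2 fun i => (hV i).eq
  refine (hs.comp tendsto_inv_atTop_nhdsGT_zero).congr' ?_
  filter_upwards [tendsto_inv_atTop_nhdsGT_zero.eventually hev, eventually_gt_atTop 0] with r h h0
  refine integral_congr fun n => ?_
  beta_reduce
  rw [mul_sum]
  refine sum_congr rfl fun i _ => ?_
  have := h i n (dir n)
  rw [zpow_neg_one, inv_inv] at this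
  rw [this, inv_zpow, zpow_ofNat]
  field_simp

lemma tendsto_flux_srcField (hp : p.1 ≠ p.2) :
    Tendsto (flux (srcField p) 0) atTop (𝓝 (-(π / (64 * r12 p ^ 3)))) := by
  have hR := r12_pos hp
  choose Φ hΦ using fun i => (nice_srcField i).inf
  choose Ψ hΨ using fun i => (nice_fastField i).inf
  refine tendsto_to (tendsto_flux_inf fun i => (hΦ i).ray hp) ?_
  have h0 : Tendsto (fun t : ℝ => t) N0 (𝓝 0) := tendsto_id.mono_left nhdsWithin_le_nhds
  have key : ∀ n : S2, ∑ i, Φ i (0, n.1, p) * n.1 i =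
      -1 / (256 * r12 p ^ 3) + -107 / (2304 * r12 p ^ 3) * axisCos p n
        + 0 * axisCos p n ^ 2 + 0 * axisCos p n ^ 3 := fun n => by
    have hn := dir n
    have h := infLimits hp hn
    obtain ⟨t1, t2⟩ := tendsto_tailCoeff hp hn
    have e1 : ∑ i, n.1 i * n.1 i = 1 := by
      have := EuclideanSpace.real_norm_sq_eq n.1
      rw [hn] at this
      simpa [sq] using this.symm
    have e : ∀ i, Φ i (0, n.1, p) = (-1 / 256 - 107 / 2304 * axisCos p n) / r12 p ^ 3
        * n.1 i := fun i => by
      refine tendsto_nhds_unique (((hΦ i).ray hp).tendsto_inf hn) ?_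
      have H := (h0.mul (((hΨ i).ray hp).tendsto_inf hn)).add
        ((t1.mul (h.n1 i)).add (t2.mul (h.n2 i)))
      refine (tendsto_to H (by ring)).congr' ?_
      filter_upwards [self_mem_nhdsWithin] with t ht
      have ht : t ≠ 0 := ne_of_gt ht
      have : srcField p i (t⁻¹ • n.1) = fastField p i (t⁻¹ • n.1)
        + tailField p i (t⁻¹ • n.1) := rfl
      rw [this, tailField, ← mul_assoc, mul_comm t, ← zpow_add_one₀ ht]
      norm_num; ring
    simp only [e, mul_assoc, ← mul_sum, e1]
    field_simp; ring
  simp only [key]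
  rw [sphere_integral_axis hp]
  field_simp; norm_num

end Infinity

section SurfaceMass

variable {h h' : TensorField} {X Y : RFn}

lemma continuous_sphere_comp {g : Fn} {a : E3} {r : ℝ}
    (hg : ∀ n, Dir n → ContinuousAt g (a + r • n)) :
    Continuous fun n : S2 => g (a + r • n.1) := by
  rw [continuous_iff_continuousAt]
  exact fun n => ContinuousAt.comp (g := g) (hg n (dir n)) (by fun_prop)

lemma continuous_surfaceDensity {r : ℝ}
    (hh : ∀ i j, ∀ n, Dir n → SmoothAt (fun z => h z i j) (r • n)) :
    Continuous (surfaceDensity h r) := by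
  have c1 : ∀ k i j, Continuous fun n : S2 => pd k (fun z => h z i j) (r • n.1) :=
    fun k i j => by
      simpa using continuous_sphere_comp (a := 0) (r := r) (g := pd k fun z => h z i j) fun n hn =>
        (by simpa using (contDiffAt_pd (hh i j n hn)).continuousAt)
  unfold surfaceDensity
  have := fun i : Fin 3 => (by fun_prop : Continuous fun n : S2 => n.1 i)
  fun_prop

lemma div_radial_defect (hx : x ≠ 0) (hh : ∀ i j, DiffAt (fun z => h z i j) x) :
    ∑ j, pd j (fun z => (n1 0 (0, 0) z * h z 0 j + n1 1 (0, 0) z * h z 1 j + n1 2 (0, 0) z * h z 2 j)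
        - n1 j (0, 0) z * (h z 0 0 + h z 1 1 + h z 2 2)) x =
      (∑ i, ∑ j, n1 i (0, 0) x * (pd j (fun z => h z i j) x - pd i (fun z => h z j j) x))
      - ((∑ i, ∑ j, n1 i (0, 0) x * n1 j (0, 0) x * h x i j) + ∑ i, h x i i) * (r1 (0, 0) x)⁻¹ := by
  have hn := fun i => hasPD_n1 (p := ((0 : E3), (0 : E3))) hx i
  have hH : ∀ i j, HasPD (fun z => h z i j) x fun k => pd k (fun z => h z i j) x :=
    fun i j => ⟨hh i j, fun _ => rfl⟩
  have hV := fun j => ((((hn 0).mul (hH 0 j)).add ((hn 1).mul (hH 1 j))).add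
    ((hn 2).mul (hH 2 j))).sub ((hn j).mul (((hH 0 0).add (hH 1 1)).add (hH 2 2)))
  simp_rw [(hV _).2]
  have h1 : n1 0 (0, 0) x ^ 2 + n1 1 (0, 0) x ^ 2 + n1 2 (0, 0) x ^ 2 = 1 := by
    have := r1_sq (p := ((0 : E3), (0 : E3))) (x := x)
    have h0 := (r1_pos (p := ((0 : E3), (0 : E3))) hx).ne'
    rw [Fin.sum_univ_three] at this
    simp only [n1, mul_pow]
    rw [← add_mul, ← add_mul, ← this]; field_simp
  generalize (r1 ((0 : E3), (0 : E3)) x)⁻¹ = w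
  simp only [Fin.sum_univ_three, δ, Fin.isValue, ↓reduceIte, Fin.reduceEq]
  linear_combination (h x 0 0 + h x 1 1 + h x 2 2) * w * h1

lemma hasSurfaceMass_of_expansion
    (hh : ∀ᶠ r : ℝ in atTop, ∀ i j, ∀ n, Dir n →
      SmoothAt (fun z => h z i j) (r • n))
    (hX : ∀ n, Dir n → SmoothAt X (0, n))
    (hY : ∀ n, Dir n → SmoothAt Y (0, n))
    (hXe : ∀ᶠ t in N0, ∀ n, Dir n →
      ∑ i, ∑ j, n i * n j * h (t⁻¹ • n) i j = X (t, n))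
    (hYe : ∀ᶠ t in N0, ∀ n, Dir n → ∑ i, h (t⁻¹ • n) i i = Y (t, n))
    (h0 : ∫ n, (3 * X (0, n.1) - Y (0, n.1)) ∂sph = 0) :
    HasSurfaceMass c G h (c ^ 2 / (16 * π * G) * (2 * ∫ n, dfst X (0, n.1) ∂sph)) := by
  refine ⟨hh.mono fun r hr => sphere_continuous_integrable (continuous_surfaceDensity hr),
    Tendsto.const_mul _ ?_⟩
  let V : Fin 3 → Fn := fun j z =>
    (n1 0 (0, 0) z * h z 0 j + n1 1 (0, 0) z * h z 1 j + n1 2 (0, 0) z * h z 2 j)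
      - n1 j (0, 0) z * (h z 0 0 + h z 1 1 + h z 2 2)
  have hQ : ∀ n, Dir n → SmoothAt (fun q => 3 * X q - Y q) (0, n) :=
    fun n hn => (contDiffAt_const.mul (hX n hn)).sub (hY n hn)
  have hK : ∀ n, Dir n → SmoothAt (fun q => X q - Y q) (0, n) :=
    fun n hn => (hX n hn).sub (hY n hn)
  have hQ' := sphere_hasDerivAt hQ
  have hlim1 : Tendsto (fun r : ℝ => r * ∫ n, (3 * X (r⁻¹, n.1) - Y (r⁻¹, n.1)) ∂sph) atTop
      (𝓝 (∫ n, dfst (fun q => 3 * X q - Y q) (0, n.1) ∂sph)) := by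
    have := hQ'.tendsto_slope_zero_right.comp tendsto_inv_atTop_nhdsGT_zero
    refine this.congr fun r => ?_
    simp [h0]
  have hlim2 : Tendsto (fun r : ℝ => ∫ n, dfst (fun q => X q - Y q) (r⁻¹, n.1) ∂sph) atTop
      (𝓝 (∫ n, dfst (fun q => X q - Y q) (0, n.1) ∂sph)) :=
    (tendsto_sphere_integral fun n hn => contDiffAt_dfst (hK n hn)).comp
      tendsto_inv_atTop_nhdsGT_zero
  have hval : ∫ n, dfst (fun q => 3 * X q - Y q) (0, n.1) ∂sph
      - ∫ n, dfst (fun q => X q - Y q) (0, n.1) ∂sph = 2 * ∫ n, dfst X (0, n.1) ∂sph := by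
    have cd : ∀ {F : RFn}, (∀ n, Dir n → SmoothAt F (0, n)) →
        Continuous fun n : S2 => dfst F (0, n.1) := fun hF =>
      continuous_sphere fun n hn => (contDiffAt_dfst (hF n hn)).continuousAt
    rw [← sphere_integral_sub (cd hQ) (cd hK), ← integral_const_mul]
    refine integral_congr fun n => ?_
    have dX := diffAt (hX n (dir n))
    have dY := diffAt (hY n (dir n))
    have e1 := (((hasDerivAt_dfst dX).const_mul 3).sub (hasDerivAt_dfst dY)).unique
      (hasDerivAt_dfst (diffAt (hQ n (dir n))))
    have e2 := ((hasDerivAt_dfst dX).sub (hasDerivAt_dfst dY)).unique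
      (hasDerivAt_dfst (diffAt (hK n (dir n))))
    change dfst _ _ - dfst _ _ = 2 * dfst _ _
    rw [← e1, ← e2]; ring
  rw [← hval]
  refine (hlim1.sub hlim2).congr' ?_
  have hc1 := fun (F : RFn) (hF : ∀ n, Dir n → SmoothAt F (0, n)) =>
    tendsto_inv_atTop_nhdsGT_zero.eventually (nhdsWithin_le_nhds (eventually_eventually_nhds.2
      (eventually_contDiffAt_sphere hF)))
  have hXe' := tendsto_inv_atTop_nhdsGT_zero.eventually (eventually_eventually_nhdsWithin.2 hXe)
  have hYe' := tendsto_inv_atTop_nhdsGT_zero.eventually (eventually_eventually_nhdsWithin.2 hYe)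
  filter_upwards [hc1 X hX, hc1 Y hY, hh, hXe', hYe', eventually_gt_atTop 0] with r hX1 hY1 hr hXr hYr r0
  have ri : 0 < r⁻¹ := inv_pos.2 r0
  rw [nhdsWithin_eq_nhds.2 (Ioi_mem_nhds ri)] at hXr hYr
  have hne : ∀ n, Dir n → ∀ s : ℝ, 0 < s → s • n ≠ 0 := fun n hn s hs =>
    smul_ne_zero hs.ne' (norm_ne_zero_iff.1 (by rw [hn]; norm_num))
  have hnu : ∀ n, Dir n → ∀ s : ℝ, 0 < s → (∀ i, n1 i (0, 0) (s • n) = n i) ∧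
      r1 (0, 0) (s • n) = s := by
    intro n hn s hs
    have hr : r1 (0, 0) (s • n) = s := by simp [r1, norm_smul, hn, abs_of_pos hs]
    exact ⟨fun i => by simp [n1, hr]; field_simp, hr⟩
  have hV : ∀ j, ∀ n, Dir n → SmoothAt (V j) (0 + r • n) := by
    intro j n hn
    rw [zero_add]
    have hν : ∀ i, SmoothAt (n1 i ((0 : E3), (0 : E3))) (r • n) := fun i =>
      ((contDiff_coord i).contDiffAt.sub contDiffAt_const).mul
        ((smooth_r1 (p := ((0 : E3), (0 : E3))) (hne n hn r r0)).inv
          (r1_pos (p := ((0 : E3), (0 : E3))) (hne n hn r r0)).ne')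
    have H := fun i j => hr i j n hn
    exact ((((hν 0).mul (H 0 j)).add ((hν 1).mul (H 1 j))).add ((hν 2).mul (H 2 j))).sub
      ((hν j).mul (((H 0 0).add (H 1 1)).add (H 2 2)))
  have hd1 := hasDerivAt_flux r0 hV
  have hXc := hX1.self_of_nhds
  have hYc := hY1.self_of_nhds
  have cX := continuous_sphere fun n hn => (hXc n hn).continuousAt
  have cY := continuous_sphere fun n hn => (hYc n hn).continuousAt
  have cS := continuous_surfaceDensity hr
  have hdiv : r ^ 2 * ∫ n, ∑ i, pd i (V i) (0 + r • n.1) ∂sph =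
      ∫ n, surfaceDensity h r n ∂sph
        - r * ∫ n, (X (r⁻¹, n.1) + Y (r⁻¹, n.1)) ∂sph := by
    have cXY : Continuous fun n : S2 => r * (X (r⁻¹, n.1) + Y (r⁻¹, n.1)) :=
      continuous_const.mul (cX.add cY)
    rw [← integral_const_mul, ← integral_const_mul, ← sphere_integral_sub cS cXY]
    refine integral_congr fun n => ?_
    have hn := dir n
    have := div_radial_defect (h := h) (hne n hn r r0) fun i j =>
      diffAt (hr i j n hn)
    beta_reduce
    rw [zero_add]
    change r ^ 2 * ∑ j, pd j (fun z => _ - _) _ = _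
    rw [this, (hnu n hn r r0).2]
    have e1 := hXr.self_of_nhds n hn
    have e2 := hYr.self_of_nhds n hn
    rw [inv_inv] at e1 e2
    simp only [(hnu n hn r r0).1, e1, e2, surfaceDensity]
    field_simp
  have hfl : flux V 0 =ᶠ[𝓝 r] fun s => s ^ 2 * ∫ n, (X (s⁻¹, n.1) - Y (s⁻¹, n.1)) ∂sph := by
    have hi : Tendsto (fun s : ℝ => s⁻¹) (𝓝 r) (𝓝 r⁻¹) := (continuousAt_inv₀ r0.ne').tendsto
    filter_upwards [hi.eventually hXr, hi.eventually hYr, lt_mem_nhds r0] with s h1 h2 s0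
    rw [← integral_const_mul]
    refine integral_congr fun n => ?_
    have hn := dir n
    have e1 := h1 n hn
    have e2 := h2 n hn
    rw [inv_inv] at e1 e2
    have hn2 : n.1 0 ^ 2 + n.1 1 ^ 2 + n.1 2 ^ 2 = 1 := by
      have := EuclideanSpace.norm_sq_eq n.1
      rw [hn] at this
      simpa [Fin.sum_univ_three] using this.symm
    simp only [V, zero_add, (hnu n hn s s0).1, ← e1, ← e2, Fin.sum_univ_three]
    linear_combination (-s ^ 2 * (h (s • n.1) 0 0 + h (s • n.1) 1 1
      + h (s • n.1) 2 2)) * hn2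
  have hk : HasDerivAt (fun w => ∫ n, (X (w, n.1) - Y (w, n.1)) ∂sph)
      (∫ n, dfst (fun q => X q - Y q) (r⁻¹, n.1) ∂sph) r⁻¹ :=
    sphere_hasDerivAt_of_eventually (F := fun q => X q - Y q) (by
      filter_upwards [hX1, hY1] with v h1 h2 n hn using (h1 n hn).sub (h2 n hn))
  have hd2 := ((hasDerivAt_pow 2 r).mul (hk.comp r (hasDerivAt_inv r0.ne'))).congr_of_eventuallyEq hfl
  have heq := hd1.unique hd2
  rw [hdiv] at heq
  have hs : ∫ n, (3 * X (r⁻¹, n.1) - Y (r⁻¹, n.1)) ∂sph =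
      2 * ∫ n, (X (r⁻¹, n.1) - Y (r⁻¹, n.1)) ∂sph
        + ∫ n, (X (r⁻¹, n.1) + Y (r⁻¹, n.1)) ∂sph := by
    have c1 : Continuous fun n : S2 => 2 * (X (r⁻¹, n.1) - Y (r⁻¹, n.1)) :=
      continuous_const.mul (cX.sub cY)
    have c2 : Continuous fun n : S2 => X (r⁻¹, n.1) + Y (r⁻¹, n.1) :=
      cX.add cY
    rw [← integral_const_mul, ← sphere_integral_add c1 c2]
    exact integral_congr_ae (.of_forall fun n => by ring)
  rw [hs]
  simp only [Function.comp_apply] at heq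
  have : r ^ 2 * ((∫ n, dfst (fun q => X q - Y q) (r⁻¹, n.1) ∂sph) * -(r ^ 2)⁻¹) =
      -∫ n, dfst (fun q => X q - Y q) (r⁻¹, n.1) ∂sph := by field_simp
  rw [this] at heq
  push_cast at heq
  linear_combination -heq

end SurfaceMass

section Coefficients

lemma jet_quadratic (a b c : ℝ) : Jet 0 (fun β _ => a + β * b + β ^ 2 * c) (fun _ => a) (fun _ => b)
    (fun _ => c) :=
  ⟨contDiffAt_const, contDiffAt_const, contDiffAt_const, fun _ => 0, contDiffAt_const,
    Eventually.of_forall fun q => by simp⟩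

lemma jet_fourth_mul (a b c d e : ℝ) : Jet 0
    (fun β _ => (a + β * b + β ^ 2 * c) ^ 4 * (d + β * e)) (fun _ => a ^ 4 * d)
    (fun _ => 4 * a ^ 3 * b * d + a ^ 4 * e)
    (fun _ => (4 * a ^ 3 * c + 6 * a ^ 2 * b ^ 2) * d + 4 * a ^ 3 * b * e) := by
  have h := jet_quadratic a b c
  have h4 := ((h.mul h).mul (h.mul h)).mul (jet_poly (x := 0) (contDiffAt_const (c := d))
    (contDiffAt_const (c := e)))
  have e : (fun (β : ℝ) (_ : E3) => (a + β * b + β ^ 2 * c) ^ 4 * (d + β * e)) = fun β _ =>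
    ((a + β * b + β ^ 2 * c) * (a + β * b + β ^ 2 * c)) * ((a + β * b + β ^ 2 * c)
      * (a + β * b + β ^ 2 * c)) * (d + β * e) := by funext β _; ring
  rw [e]
  exact h4.congr (by funext; ring) (by funext; ring) (by funext; ring)

variable {y1 y2 x : E3}

lemma physMetric_apply (N : ℕ) (β : ℝ) (i j : Fin 3) : physMetric y1 y2 σ N β x i j =
    (partialSum N β fun k => σ k x) ^ 4 * (δ i j + β * seed y1 y2 x i j) := by
  simp [physMetric, conformalMetric, Matrix.one_apply, δ]

lemma physMetricCoeff_zero (i j : Fin 3) :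
    physMetricCoeff y1 y2 σ 0 x i j = σ 0 x ^ 4 * δ i j := by
  have := (jet_fourth_mul (σ 0 x) 0 0 (δ i j) (seed y1 y2 x i j)).betaCoeff_zero
  simp only [physMetricCoeff, physMetric_apply, Matrix.of_apply, partialSum]
  simpa using this

lemma physMetricCoeff_one (i j : Fin 3) : physMetricCoeff y1 y2 σ 1 x i j =
    4 * σ 0 x ^ 3 * σ 1 x * δ i j + σ 0 x ^ 4 * seed y1 y2 x i j := by
  have := (jet_fourth_mul (σ 0 x) (σ 1 x) 0 (δ i j) (seed y1 y2 x i j)).betaCoeff_one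
  simp only [physMetricCoeff, physMetric_apply, Matrix.of_apply, partialSum, sum_range_succ]
  simpa using this

lemma physMetricCoeff_two (i j : Fin 3) : physMetricCoeff y1 y2 σ 2 x i j =
    (4 * σ 0 x ^ 3 * σ 2 x + 6 * σ 0 x ^ 2 * σ 1 x ^ 2) * δ i j
      + 4 * σ 0 x ^ 3 * σ 1 x * seed y1 y2 x i j := by
  have := (jet_fourth_mul (σ 0 x) (σ 1 x) (σ 2 x) (δ i j) (seed y1 y2 x i j)).betaCoeff_two
  simp only [physMetricCoeff, physMetric_apply, Matrix.of_apply, partialSum, sum_range_succ]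
  simpa using this

end Coefficients

lemma u₀_swap (p : E6) (x : E3) : u₀ p.swap x = u₀ p x := by
  have h : r12 p.swap = r12 p := dist_comm _ _
  have h1 : r1 p.swap x = r2 p x := rfl
  have h2 : r2 p.swap x = r1 p x := rfl
  simp only [u₀, laurent, List.map_cons, List.map_nil, List.sum_cons, List.sum_nil, h, h1, h2]
  ring

lemma firstOrder_swap (p : E6) (α1 α2 : ℝ) :
    firstOrder p.swap α2 α1 = firstOrder p α1 α2 := by
  funext x
  simp only [firstOrder, u₀_swap, u2, Prod.swap_swap]
  ring

lemma nice_firstOrder (α1 α2 : ℝ) : Nice (-1) (-1) 1 fun p => firstOrder p α1 α2 :=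
  (nice_u₀.weaken (by norm_num) (by norm_num) le_rfl).add
    (((nice_u1.weaken le_rfl (by norm_num) le_rfl).const_mul α1).add
      ((nice_u2.weaken (by norm_num) le_rfl le_rfl).const_mul α2))

lemma exists_ray_firstOrder_fst (hp : p.1 ≠ p.2) (α1 α2 : ℝ) :
    ∃ Φ, Ray 1 p.1 (-1) (firstOrder p α1 α2) Φ ∧ ∫ n, Φ (0, n.1) ∂sph = 0 := by
  obtain ⟨Φ, hΦ⟩ := (nice_firstOrder α1 α2).fst
  refine ⟨_, hΦ.ray hp, ?_⟩
  have h := sphere_integral_axis hp (α1 * (1 / 6) / r12 p ^ 2) (α1 * (5 / 24) / r12 p ^ 2)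
    (α1 * (-1 / 2) / r12 p ^ 2) 0
  rw [show 4 * π * (α1 * (1 / 6) / r12 p ^ 2 + α1 * (-1 / 2) / r12 p ^ 2 / 3) = 0 by ring] at h
  refine Eq.trans (integral_congr fun n => ?_) h
  have := (firstOrder_data_fst hp (hΦ.ray hp) (dir n)).1
  beta_reduce at this ⊢
  rw [this]; ring

lemma mild_firstOrder (hp : p.1 ≠ p.2) (α1 α2 : ℝ) : Mild p (firstOrder p α1 α2) where
  smooth _ h1 h2 := (nice_firstOrder α1 α2).smooth.at ⟨hp, h1, h2⟩
  fst := exists_ray_firstOrder_fst hp α1 α2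
  snd := by
    have := exists_ray_firstOrder_fst (p := p.swap) (Ne.symm hp) α2 α1
    rwa [firstOrder_swap] at this
  inf := by
    obtain ⟨Φ, hΦ⟩ := (nice_firstOrder α1 α2).inf
    exact ⟨_, hΦ.ray hp⟩

lemma sigma_one_eq (hp : p.1 ≠ p.2) {N : ℕ} (hN : 1 ≤ N)
    (h : IsPerturbativeSolution p.1 p.2 α1 α2 N σ) (h1 : x ≠ p.1) (h2 : x ≠ p.2) :
    σ 1 x = firstOrder p α1 α2 x :=
  (mild_firstOrder hp α1 α2).eq_of_weakPoisson hp (h.smooth 0 hN) (h.locallyIntegrable 0 hN)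
    (h.tendsto_zero 0 hN) (h.poisson 0 hN)
    (fun _ h1 h2 => source_zero_brillLindquist ⟨hp, h1, h2⟩ h.zero) h1 h2

section ADM

variable {h : TensorField} {f g : Fn} {F Γ : RFn}
 

lemma eventually_off_sphere (p : E6) :
    ∀ᶠ r : ℝ in atTop, ∀ n, Dir n → r • n ≠ p.1 ∧ r • n ≠ p.2 := by
  filter_upwards [eventually_gt_atTop ‖p.1‖, eventually_gt_atTop ‖p.2‖, eventually_gt_atTop 0]
    with r h1 h2 h0 n hn
  have : ‖r • n‖ = r := by rw [norm_smul, hn, Real.norm_of_nonneg h0.le, mul_one]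
  exact ⟨fun e => by rw [e] at this; linarith, fun e => by rw [e] at this; linarith⟩

lemma hasSurfaceMass_seed (hp : p.1 ≠ p.2) (hf : Ray (-1) 0 0 f F) (hg : Ray (-1) 0 0 g Γ)
    (hfs : ∀ x, x ≠ p.1 → x ≠ p.2 → SmoothAt f x)
    (hgs : ∀ x, x ≠ p.1 → x ≠ p.2 → SmoothAt g x)
    (hh : ∀ x, x ≠ p.1 → x ≠ p.2 → ∀ i j, h x i j = f x * δ i j + g x * seed p.1 p.2 x i j) :
    HasSurfaceMass c G h (c ^ 2 / (16 * π * G) * (2 * ∫ n, (dfst F (0, n.1)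
      + Γ (0, n.1) * (-(1 - axisCos p n ^ 2) / (2 * r12 p) + 1 / (3 * r12 p))) ∂sph)) := by
  have hh' : ∀ x, x ≠ p.1 → x ≠ p.2 → ∀ i j, h x i j = f x * δ i j + g x * sd i j p x := by
    intro x h1 h2 i j
    rw [hh x h1 h2, seed_eq ⟨hp, h1, h2⟩]
  choose Ψ hΨ using fun i j => (nice_sd i j).inf
  have hs := fun i j => (hΨ i j).ray hp
  have hss := fun i j (n : E3) (hn : Dir n) => (hs i j).smooth n hn
  have hci : ∀ i, Smooth (fun q : ℝ × E3 => q.2 i) := fun i =>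
    (contDiff_coord i).comp contDiff_snd
  let D : RFn := fun q => ∑ i, ∑ j, Ψ i j (q.1, q.2, p) * q.2 i * q.2 j
  have hD : ∀ n, Dir n → SmoothAt D (0, n) := fun n hn =>
    ContDiffAt.sum fun i _ => ContDiffAt.sum fun j _ =>
      ((hss i j n hn).mul (hci i).contDiffAt).mul (hci j).contDiffAt
  have hX : ∀ n, Dir n →
      SmoothAt (fun q : ℝ × E3 => F q + q.1 * (Γ q * D q)) (0, n) := fun n hn =>
    (hf.smooth n hn).add (contDiffAt_fst.mul ((hg.smooth n hn).mul (hD n hn)))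
  have hoff : ∀ᶠ t in N0, ∀ n, Dir n → t⁻¹ • n ≠ p.1 ∧ t⁻¹ • n ≠ p.2 :=
    tendsto_inv_nhdsGT_zero.eventually (eventually_off_sphere p)
  have hn2 : ∀ n, Dir n → ∑ i, n i * n i = 1 := by
    intro n hn
    have := EuclideanSpace.norm_sq_eq n
    rw [hn, one_pow] at this
    simpa [sq] using this.symm
  have key := hasSurfaceMass_of_expansion (c := c) (G := G) (h := h) (Y := fun q => 3 * F q) ?_ hX
    (fun n hn => contDiffAt_const.mul (hf.smooth n hn)) ?_ ?_ ?_
  · refine (congrArg (fun I => HasSurfaceMass c G h (c ^ 2 / (16 * π * G) * (2 * I)))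
      (integral_congr fun n => ?_)).mpr key
    have hn := dir n
    have d1 := hasDerivAt_dfst (diffAt (hf.smooth n hn))
    have d2 := hasDerivAt_dfst (diffAt ((hg.smooth n hn).mul (hD n hn)))
    have := (d1.add ((hasDerivAt_id (0 : ℝ)).mul d2)).unique
      (hasDerivAt_dfst (diffAt (hX n hn)))
    beta_reduce
    rw [← this, ← sd_data_inf hp hs hn]
    simp [D]
  · filter_upwards [eventually_off_sphere p] with r hr i j n hn
    obtain ⟨h1, h2⟩ := hr n hn
    refine ContDiffAt.congr_of_eventuallyEq (f := fun z => f z * δ i j + g z * sd i j p z)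
      (((hfs _ h1 h2).mul contDiffAt_const).add ((hgs _ h1 h2).mul ((nice_sd i j).smooth.at ⟨hp, h1, h2⟩)))
      ?_
    filter_upwards [eventually_off_point h1 h2] with z hz using hh' z hz.1 hz.2 i j
  · filter_upwards [hoff, hf.eq, hg.eq, eventually_all.2 fun i => eventually_all.2 fun j => (hs i j).eq]
      with t ht hft hgt hst n hn
    have e1 := hft n hn
    have e2 := hgt n hn
    simp only [zero_add, zpow_neg_one, zpow_zero, one_mul] at e1 e2
    have e3 : ∀ i j, sd i j p (t⁻¹ • n) = t * Ψ i j (t, n, p) := fun i j => by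
      simpa using hst i j n hn
    simp only [hh' _ (ht n hn).1 (ht n hn).2, e1, e2, e3, D]
    have := hn2 n hn
    simp only [Fin.sum_univ_three, δ, Fin.isValue, ↓reduceIte, Fin.reduceEq] at this ⊢
    linear_combination (F (t, n)) * this
  · filter_upwards [hoff, hf.eq] with t ht hft n hn
    have e1 := hft n hn
    simp only [zero_add, zpow_neg_one, zpow_zero, one_mul] at e1
    have e2 : ∑ i, seed p.1 p.2 (t⁻¹ • n) i i = 0 := by
      simp only [seed, Matrix.of_apply, Fin.sum_univ_three, ↓reduceIte]; ring
    simp only [hh _ (ht n hn).1 (ht n hn).2, e1, sum_add_distrib, ← mul_sum, e2]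
    simp [δ, mul_comm]
  · simp

lemma nice_brillLindquist (α1 α2 : ℝ) :
    Nice (-1) (-1) 0 fun p x => 1 + (α1 * (r1 p x)⁻¹ + α2 * (r2 p x)⁻¹) :=
  ((nice_const 1).weaken (by norm_num) (by norm_num) le_rfl).add
    (((nice_inv_r1.weaken le_rfl (by norm_num) (by norm_num)).const_mul α1).add
      ((nice_inv_r2.weaken (by norm_num) le_rfl (by norm_num)).const_mul α2))

lemma exists_ray_brillLindquist (hp : p.1 ≠ p.2) (α1 α2 : ℝ) :
    ∃ Φ, Ray (-1) 0 0 (brillLindquist p.1 p.2 α1 α2) Φ ∧ ∀ n, Dir n →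
      Φ (0, n) = 1 ∧ dfst Φ (0, n) = α1 + α2 := by
  obtain ⟨Ψ1, h₁⟩ := nice_inv_r1.inf
  obtain ⟨Ψ2, h₂⟩ := nice_inv_r2.inf
  have k1 := h₁.ray hp
  have k2 := h₂.ray hp
  have hs : ∀ n, Dir n → SmoothAt
      (fun q : ℝ × E3 => α1 * Ψ1 (q.1, q.2, p) + α2 * Ψ2 (q.1, q.2, p)) (0, n) := fun n hn =>
    (contDiffAt_const.mul (k1.smooth n hn)).add (contDiffAt_const.mul (k2.smooth n hn))
  refine ⟨fun q => 1 + q.1 * (α1 * Ψ1 (q.1, q.2, p) + α2 * Ψ2 (q.1, q.2, p)),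
    ⟨fun n hn => contDiffAt_const.add (contDiffAt_fst.mul (hs n hn)), ?_⟩, fun n hn => ⟨by simp, ?_⟩⟩
  · filter_upwards [k1.eq, k2.eq] with t h1 h2 n hn
    rw [brillLindquist_eq]
    beta_reduce
    rw [h1 n hn, h2 n hn, zpow_one, zpow_zero]; ring
  · have d := (((hasDerivAt_id (0 : ℝ)).mul (hasDerivAt_dfst ((hs n hn).differentiableAt
      (by simp)))).const_add 1).unique (hasDerivAt_dfst (diffAt ((contDiffAt_const (c := (1 : ℝ))).add
      (contDiffAt_fst.mul (hs n hn)))))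
    have l := infLimits hp hn
    have e₁ := tendsto_nhds_unique (k1.tendsto_inf hn) (by simpa using l.inv_a)
    have e₂ := tendsto_nhds_unique (k2.tendsto_inf hn) (by simpa using l.inv_b)
    change dfst (fun q : ℝ × E3 => 1 + q.1 * (α1 * Ψ1 (q.1, q.2, p) + α2 * Ψ2 (q.1, q.2, p))) _ = _
    rw [← d]
    simp only [id, e₁, e₂] at *
    simp [e₁, e₂]

lemma adm_mass_zero (hp : p.1 ≠ p.2) (hG : G ≠ 0) (h0 : σ 0 = brillLindquist p.1 p.2 α1 α2) :
    HasSurfaceMass c G (physMetricCoeff p.1 p.2 σ 0) (2 * c ^ 2 / G * (α1 + α2)) := by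
  obtain ⟨Φ, hΦ, hd⟩ := exists_ray_brillLindquist hp α1 α2
  have h4 := (hΦ.mul hΦ).mul (hΦ.mul hΦ)
  have hz : Ray (-1) 0 0 (fun _ => (0 : ℝ)) fun _ => 0 :=
    ⟨fun _ _ => contDiffAt_const, .of_forall fun _ _ _ => by simp⟩
  have hs : ∀ x, x ≠ p.1 → x ≠ p.2 → SmoothAt (brillLindquist p.1 p.2 α1 α2) x :=
    fun x h1 h2 => by rw [brillLindquist_eq]; exact smooth_brillLindquist h1 h2
  have key := hasSurfaceMass_seed (c := c) (G := G) (h := physMetricCoeff p.1 p.2 σ 0) hp h4 hz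
    (fun x h1 h2 => ((hs x h1 h2).mul (hs x h1 h2)).mul ((hs x h1 h2).mul (hs x h1 h2)))
    (fun _ _ _ => contDiffAt_const) (fun x _ _ i j => by rw [physMetricCoeff_zero, h0]; ring)
  convert key using 1
  have e : ∀ n : S2, dfst (fun q => Φ q * Φ q * (Φ q * Φ q)) (0, n.1)
      = 4 * (α1 + α2) := by
    intro n
    have hn := dir n
    have hD := diffAt (hΦ.smooth n hn)
    have d := hasDerivAt_dfst hD
    refine (((d.mul d).mul (d.mul d)).unique (hasDerivAt_dfst
      ((hD.mul hD).mul (hD.mul hD)))).symm.trans ?_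
    simp only [Pi.mul_apply, (hd n hn).1, (hd n hn).2]; ring
  simp only [e, zero_mul, add_zero, sphere_integral_const]
  have := Real.pi_ne_zero
  field_simp; ring

lemma adm_mass_one (hp : p.1 ≠ p.2) (hG : G ≠ 0) (h0 : σ 0 = brillLindquist p.1 p.2 α1 α2)
    (h1 : ∀ x, x ≠ p.1 → x ≠ p.2 → σ 1 x = firstOrder p α1 α2 x) :
    HasSurfaceMass c G (physMetricCoeff p.1 p.2 σ 1)
      (2 * c ^ 2 / G * ((α1 + α2) / (48 * r12 p ^ 2))) := by
  obtain ⟨Φ, hΦ, hd⟩ := exists_ray_brillLindquist hp α1 α2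
  obtain ⟨U, hU⟩ := (nice_firstOrder α1 α2).inf
  have hU' := hU.ray hp
  have hU0 : Ray (-1) 0 0 (firstOrder p α1 α2) fun q => q.1 * U (q.1, q.2, p) :=
    ⟨fun n hn => contDiffAt_fst.mul (hU'.smooth n hn), by
      filter_upwards [hU'.eq] with t ht n hn
      rw [ht n hn, zpow_one, zpow_zero, one_mul]⟩
  have hf := (((hΦ.mul hΦ).mul hΦ).mul hU0).const_mul 4
  have h4 := (hΦ.mul hΦ).mul (hΦ.mul hΦ)
  have hs : ∀ x, x ≠ p.1 → x ≠ p.2 → SmoothAt (brillLindquist p.1 p.2 α1 α2) x :=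
    fun x h1 h2 => by rw [brillLindquist_eq]; exact smooth_brillLindquist h1 h2
  have hu : ∀ x, x ≠ p.1 → x ≠ p.2 → SmoothAt (firstOrder p α1 α2) x :=
    fun x h1 h2 => (nice_firstOrder α1 α2).smooth.at ⟨hp, h1, h2⟩
  have key := hasSurfaceMass_seed (c := c) (G := G) (h := physMetricCoeff p.1 p.2 σ 1) hp hf h4
    (fun x h1 h2 => contDiffAt_const.mul ((((hs x h1 h2).mul (hs x h1 h2)).mul (hs x h1 h2)).mul
      (hu x h1 h2)))
    (fun x h1 h2 => ((hs x h1 h2).mul (hs x h1 h2)).mul ((hs x h1 h2).mul (hs x h1 h2)))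
    (fun x h1' h2' i j => by rw [physMetricCoeff_one, h0, h1 x h1' h2']; ring)
  convert key using 1
  have e : ∀ n : S2,
      dfst (fun q => 4 * (Φ q * Φ q * Φ q * (q.1 * U (q.1, q.2, p)))) (0, n.1)
        + (Φ (0, n.1) * Φ (0, n.1) * (Φ (0, n.1) * Φ (0, n.1)))
          * (-(1 - axisCos p n ^ 2) / (2 * r12 p) + 1 / (3 * r12 p))
      = (1 / 8 - 1 / 12 - 1 / 2 + 1 / 3) / r12 p + (α1 + α2) / (12 * r12 p ^ 2) + 0 * axisCos p n
        + (-1 / 8 + 1 / 2) / r12 p * axisCos p n ^ 2 + 0 * axisCos p n ^ 3 := by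
    intro n
    have hn := dir n
    have hR := (r12_pos hp).ne'
    have hD := diffAt (hΦ.smooth n hn)
    have d := hasDerivAt_dfst hD
    have hDU := diffAt (hU'.smooth n hn)
    have hDU0 : DiffAt (fun q : ℝ × E3 => q.1 * U (q.1, q.2, p)) (0, n.1) :=
      differentiableAt_fst.mul hDU
    have dU := (hasDerivAt_id (0 : ℝ)).mul (hasDerivAt_dfst hDU)
    have hd4 := ((((d.mul d).mul d).mul dU).const_mul 4).unique (hasDerivAt_dfst
      ((((hD.mul hD).mul hD).mul hDU0).const_mul 4))
    change _ = dfst (fun q => 4 * (Φ q * Φ q * Φ q * (q.1 * U (q.1, q.2, p)))) _ at hd4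
    rw [← hd4]
    have hv := firstOrder_data_inf hp hU' hn
    beta_reduce at hv
    simp only [Pi.mul_apply, (hd n hn).1, (hd n hn).2, id, hv]
    field_simp; ring
  simp only [e, sphere_integral_axis hp]
  have := Real.pi_ne_zero
  have hR := (r12_pos hp).ne'
  field_simp; ring

end ADM

section Classical

variable {u f : Fn}

lemma lap_eq_of_weakPoisson (hu : ContDiffOn ℝ (⊤ : ℕ∞) u {p.1, p.2}ᶜ)
    (hf : ContinuousOn f {p.1, p.2}ᶜ) (hW : WeakPoisson p.1 p.2 u f) :
    Set.EqOn (lap u) f {p.1, p.2}ᶜ := by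
  have hopen : IsOpen ({p.1, p.2}ᶜ : Set E3) := (Set.toFinite {p.1, p.2}).isClosed.isOpen_compl
  have hat : ∀ x ∈ ({p.1, p.2}ᶜ : Set E3), SmoothAt u x := fun x hx =>
    hu.contDiffAt (hopen.mem_nhds hx)
  have hlc : ContinuousOn (lap u) {p.1, p.2}ᶜ := fun x hx =>
    (tendsto_finsetSum _ fun i _ =>
      (contDiffAt_pd (contDiffAt_pd (hat x hx))).continuousAt.tendsto).mono_left nhdsWithin_le_nhds
  refine fun x hx => sub_eq_zero.1 (eqOn_zero_of_integral_smul_eq_zero (μ := volume) hopen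
    (f := fun x => lap u x - f x) (hlc.sub hf) (fun φ hφ hc hs => ?_) hx)
  have hsm : ∀ x ∈ tsupport φ, SmoothAt u x := fun x hx => hat x (hs hx)
  have i1 : ∀ {v : Fn}, ContinuousOn v {p.1, p.2}ᶜ → Integrable fun x => v x * φ x :=
    fun hv => integrable_mul_of_tsupport hφ.continuous hc fun x hx =>
      hv.continuousAt (hopen.mem_nhds (hs hx))
  have h2 := (hW φ hφ hc).eq_of_tendsto (tendsto_integral_outside (i1 hf) p)
  have h3 : ∫ x, u x * Laplacian.laplacian φ x = ∫ x, lap u x * φ x := by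
    simp_rw [laplacian_eq_sum_pd hφ.contDiffAt, lap, mul_sum, sum_mul]
    rw [integral_finsetSum _ fun i _ => integrable_mul_of_tsupport
        (contDiff_pd (contDiff_pd hφ)).continuous (hasCompactSupport_pd (hasCompactSupport_pd hc))
        fun x hx => (hsm x (support_pd_subset (support_pd_subset hx))).continuousAt,
      integral_finsetSum _ fun i _ => i1 fun x hx =>
        (contDiffAt_pd (contDiffAt_pd (hat x hx))).continuousAt.continuousWithinAt]
    refine sum_congr rfl fun i _ => ?_
    rw [integral_mul_pd (contDiff_pd hφ) (hasCompactSupport_pd hc) (fun x hx =>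
        (hsm x (support_pd_subset hx)).of_le (by exact_mod_cast le_top)) i,
      integral_mul_pd hφ hc (fun x hx => (contDiffAt_pd (hsm x hx)).of_le
        (by exact_mod_cast le_top)) i, neg_neg]
  have e : ∀ x, φ x • (lap u x - f x) = lap u x * φ x - f x * φ x := fun x => by
    rw [smul_eq_mul]; ring
  simp_rw [e]
  rw [integral_sub (i1 hlc) (i1 hf), ← h3, h2, sub_self]

end Classical

lemma exists_limit_of_deriv_bound {f f' : ℝ → ℝ} {a C : ℝ} (ha : 0 < a)
    (hf : ∀ r, a ≤ r → HasDerivAt f (f' r) r) (hb : ∀ r, a ≤ r → |f' r| ≤ C * (r ^ 2)⁻¹) :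
    ∃ L, Tendsto f atTop (𝓝 L) ∧ ∀ r, a ≤ r → |f r - L| ≤ C * r⁻¹ := by
  have hp : ∀ r : ℝ, 0 < r → (r ^ 2)⁻¹ = r ^ (-2 : ℝ) := fun r hr => by
    rw [Real.rpow_neg hr.le]; norm_cast
  have hi : ∀ b, a ≤ b → IntegrableOn (fun r => C * (r ^ 2)⁻¹) (Set.Ioi b) := fun b hb =>
    ((integrableOn_Ioi_rpow_of_lt (by norm_num : (-2 : ℝ) < -1) (ha.trans_le hb)).congr_fun
      (fun r hr => (hp r ((ha.trans_le hb).trans hr)).symm) measurableSet_Ioi).const_mul C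
  have hint : ∀ b, a ≤ b → IntegrableOn f' (Set.Ioi b) := by
    intro b hab
    refine Integrable.mono' (hi b hab) ?_ ?_
    · refine (stronglyMeasurable_deriv f).aestronglyMeasurable.congr ?_
      filter_upwards [ae_restrict_mem measurableSet_Ioi] with r hr
      exact (hf r (hab.trans (le_of_lt hr))).deriv
    · filter_upwards [ae_restrict_mem measurableSet_Ioi] with r hr
      exact hb r (hab.trans (le_of_lt hr))
  have hL := tendsto_limUnder_of_hasDerivAt_of_integrableOn_Ioi
    (fun r hr => hf r (le_of_lt hr)) (hint a le_rfl)
  refine ⟨_, hL, fun r hr => ?_⟩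
  have h1 := integral_Ioi_of_hasDerivAt_of_tendsto (hf r hr).continuousAt.continuousWithinAt
    (fun s hs => hf s (hr.trans (le_of_lt hs))) (hint r hr) hL
  rw [abs_sub_comm, ← h1]
  have h2 : |∫ s in Set.Ioi r, f' s| ≤ ∫ s in Set.Ioi r, C * (s ^ 2)⁻¹ :=
    norm_integral_le_of_norm_le (f := f') (hi r hr) ?_
  refine h2.trans (le_of_eq ?_)
  rotate_left
  · filter_upwards [ae_restrict_mem measurableSet_Ioi] with s hs
    exact hb s (hr.trans (le_of_lt hs))
  · have r0 := ha.trans_le hr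
    rw [integral_const_mul, setIntegral_congr_fun measurableSet_Ioi
      (fun s hs => hp s (r0.trans hs)), integral_Ioi_rpow_of_lt (by norm_num) r0]
    congr 1
    rw [show (-2 : ℝ) + 1 = -1 by norm_num, Real.rpow_neg_one]; ring

lemma flux_congr {V V' : Fin 3 → Fn} {a : E3} {r : ℝ}
    (h : ∀ n, Dir n → ∀ i, V i (a + r • n) = V' i (a + r • n)) : flux V a r = flux V' a r :=
  integral_congr_ae (.of_forall fun n => by
    simp only [h n (dir n)])

lemma flux_add {V V' : Fin 3 → Fn} {a : E3} {r : ℝ}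
    (h : ∀ i, ∀ n, Dir n → ContinuousAt (V i) (a + r • n))
    (h' : ∀ i, ∀ n, Dir n → ContinuousAt (V' i) (a + r • n)) :
    flux (fun i x => V i x + V' i x) a r = flux V a r + flux V' a r := by
  have c := fun i => continuous_sphere_comp (h i)
  have c' := fun i => continuous_sphere_comp (h' i)
  have k : ∀ {W : Fin 3 → S2 → ℝ}, (∀ i, Continuous (W i)) →
      Continuous fun n : S2 => r ^ 2 * ∑ i, W i n * n.1 i := fun hW =>
    continuous_const.mul (continuous_finsetSum _ fun i _ => (hW i).mul (by fun_prop))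
  unfold flux
  rw [← sphere_integral_add (k c) (k c')]
  refine integral_congr fun n => ?_
  simp only [Fin.sum_univ_three]; ring

lemma abs_sphere_integral_le {f : Fn} {C : ℝ} (h : ∀ n, Dir n → |f n| ≤ C) :
    |∫ n, f n.1 ∂sph| ≤ 4 * π * C := by
  have : IsFiniteMeasure sph := inferInstance
  rw [← sphere_integral_const]
  exact norm_integral_le_of_norm_le (f := fun n : S2 => f n) (integrable_const C)
    (.of_forall fun n => h _ (dir n))

lemma exists_flux_limit {V : Fin 3 → Fn} {a C : ℝ} (ha : 0 < a)
    (hV : ∀ i, ∀ r, a ≤ r → ∀ n, Dir n → SmoothAt (V i) (r • n))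
    (hb : ∀ r, a ≤ r → ∀ n, Dir n → |∑ i, pd i (V i) (r • n)| ≤ C * (r ^ 4)⁻¹) :
    ∃ L, Tendsto (flux V 0) atTop (𝓝 L) ∧ ∀ r, a ≤ r → |flux V 0 r - L| ≤ 4 * π * C * r⁻¹ := by
  refine exists_limit_of_deriv_bound ha (fun r hr => hasDerivAt_flux (ha.trans_le hr) fun i n hn => by
    rw [zero_add]; exact hV i r hr n hn) fun r hr => ?_
  have r0 := ha.trans_le hr
  rw [abs_mul, abs_of_pos (by positivity)]
  have := abs_sphere_integral_le (f := fun n => ∑ i, pd i (V i) (0 + r • n)) (C := C * (r ^ 4)⁻¹)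
    fun n hn => by rw [zero_add]; exact hb r hr n hn
  calc _ ≤ r ^ 2 * (4 * π * (C * (r ^ 4)⁻¹)) := by gcongr
    _ = _ := by field_simp

lemma tendsto_sphere_of_uniform {g : ℝ → Fn} {l : Filter ℝ}
    (h : ∀ ε > 0, ∀ᶠ r in l, ∀ n, Dir n → |g r n| ≤ ε) :
    Tendsto (fun r => ∫ n, g r n.1 ∂sph) l (𝓝 0) := by
  rw [Metric.tendsto_nhds]
  intro ε hε
  have hpi := Real.pi_pos
  filter_upwards [h (ε / (8 * π)) (by positivity)] with r hr
  rw [dist_zero_right, Real.norm_eq_abs]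
  refine (abs_sphere_integral_le hr).trans_lt ?_
  rw [show 4 * π * (ε / (8 * π)) = ε / 2 by field_simp; ring]
  linarith

lemma abs_coord_le {n : E3} (hn : Dir n) (i : Fin 3) : |n i| ≤ 1 := by
  rw [← hn]; exact PiLp.norm_apply_le n i

lemma tendsto_flux_grad_mul {w u : Fn} {a C : ℝ} (ha : 0 < a)
    (hw : ∀ r, a ≤ r → ∀ n, Dir n → SmoothAt w (r • n))
    (hu : ∀ r, a ≤ r → ∀ n, Dir n → SmoothAt u (r • n))
    (hu0 : Tendsto u (Bornology.cobounded E3) (𝓝 0))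
    (hwb : ∀ r, a ≤ r → ∀ n, Dir n → |w (r • n)| ≤ C * r⁻¹)
    (hpb : ∀ i, ∀ r, a ≤ r → ∀ n, Dir n → |pd i w (r • n)| ≤ C * (r ^ 2)⁻¹)
    (hlw : ∀ r, a ≤ r → ∀ n, Dir n → |lap w (r • n)| ≤ C * (r ^ 4)⁻¹)
    (hlu : ∀ r, a ≤ r → ∀ n, Dir n → |lap u (r • n)| ≤ C * (r ^ 3)⁻¹) :
    Tendsto (flux (fun i => pd i fun z => w z * u z) 0) atTop (𝓝 0) := by
  have hC : 0 ≤ C := by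
    have := (abs_nonneg _).trans (hwb a le_rfl (EuclideanSpace.single 0 1) (by simp))
    exact nonneg_of_mul_nonneg_left this (inv_pos.2 ha)
  have hsmall : ∀ ε > 0, ∀ᶠ r : ℝ in atTop, ∀ n, Dir n → |u (r • n)| ≤ ε := by
    intro ε hε
    obtain ⟨d, -, hd⟩ := (hasBasis_cobounded_norm (E := E3)).eventually_iff.1
      (hu0.eventually (closedBall_mem_nhds 0 hε))
    filter_upwards [eventually_ge_atTop d, eventually_ge_atTop 0] with r h1 h2 n hn
    have := @hd (r • n) (by simpa [norm_smul, hn, abs_of_nonneg h2] using h1)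
    simpa using this
  obtain ⟨b, hab, hb1⟩ : ∃ b, a ≤ b ∧ ∀ r, b ≤ r → ∀ n, Dir n → |u (r • n)| ≤ 1 := by
    obtain ⟨b, hb⟩ := eventually_atTop.1 (hsmall 1 one_pos)
    exact ⟨max a b, le_max_left _ _, fun r hr => hb r ((le_max_right _ _).trans hr)⟩
  have hb0 := ha.trans_le hab
  let V : Fin 3 → Fn := fun i z => w z * pd i u z - u z * pd i w z
  have hVs : ∀ i, ∀ r, b ≤ r → ∀ n, Dir n → SmoothAt (V i) (r • n) :=
    fun i r hr n hn => by
      have w1 := hw r (hab.trans hr) n hn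
      have u1 := hu r (hab.trans hr) n hn
      exact (w1.mul (contDiffAt_pd u1)).sub (u1.mul (contDiffAt_pd w1))
  obtain ⟨Q, hQ, -⟩ := exists_flux_limit (V := V) (C := C * C + C) hb0 hVs fun r hr n hn => by
    have w1 := hw r (hab.trans hr) n hn
    have u1 := hu r (hab.trans hr) n hn
    have e : ∑ i, pd i (V i) (r • n) = w (r • n) * lap u (r • n) - u (r • n) * lap w (r • n) := by
      rw [lap, lap, mul_sum, mul_sum, ← sum_sub_distrib]
      refine sum_congr rfl fun i _ => ?_
      have dw := diffAt w1
      have du := diffAt u1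
      have dpw := diffAt (contDiffAt_pd (i := i) w1)
      have dpu := diffAt (contDiffAt_pd (i := i) u1)
      rw [pd_sub (dw.fun_mul dpu) (du.fun_mul dpw), pd_mul dw dpu, pd_mul du dpw]; ring
    have r0 := hb0.trans_le hr
    rw [e]
    refine (abs_sub _ _).trans ?_
    rw [abs_mul, abs_mul]
    have h1 := mul_le_mul (hwb r (hab.trans hr) n hn) (hlu r (hab.trans hr) n hn) (abs_nonneg _)
      (by positivity)
    have h2 := mul_le_mul (hb1 r hr n hn) (hlw r (hab.trans hr) n hn) (abs_nonneg _) zero_le_one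
    calc _ ≤ C * r⁻¹ * (C * (r ^ 3)⁻¹) + 1 * (C * (r ^ 4)⁻¹) := add_le_add h1 h2
      _ = _ := by field_simp
  have h2 : Tendsto (flux (fun i z => 2 * (u z * pd i w z)) 0) atTop (𝓝 0) := by
    refine tendsto_sphere_of_uniform (g := fun r n =>
      r ^ 2 * ∑ i, 2 * (u (0 + r • n) * pd i w (0 + r • n)) * n i) fun ε hε => ?_
    filter_upwards [hsmall (ε / (6 * C + 1)) (by positivity), eventually_ge_atTop a] with r h1 hr n hn
    have r0 := ha.trans_le hr
    rw [zero_add, mul_sum]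
    have hi : ∀ i, |r ^ 2 * (2 * (u (r • n) * pd i w (r • n)) * n i)| ≤ 2 * C * (ε / (6 * C + 1)) := by
      intro i
      rw [show r ^ 2 * (2 * (u (r • n) * pd i w (r • n)) * n i)
        = u (r • n) * (2 * r ^ 2 * pd i w (r • n)) * n i by ring, abs_mul, abs_mul, abs_mul,
        abs_of_pos (by positivity : 0 < 2 * r ^ 2)]
      calc _ ≤ ε / (6 * C + 1) * (2 * r ^ 2 * (C * (r ^ 2)⁻¹)) * 1 := by
            gcongr
            · exact h1 n hn
            · exact hpb i r hr n hn
            · exact abs_coord_le hn i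
        _ = _ := by field_simp
    calc _ ≤ ∑ i : Fin 3, |r ^ 2 * (2 * (u (r • n) * pd i w (r • n)) * n i)| :=
          Finset.abs_sum_le_sum_abs _ _
      _ ≤ ∑ _i : Fin 3, 2 * C * (ε / (6 * C + 1)) := Finset.sum_le_sum fun i _ => hi i
      _ = 6 * C / (6 * C + 1) * ε := by simp; ring
      _ ≤ 1 * ε := by gcongr; rw [div_le_one (by positivity)]; linarith
      _ = ε := one_mul ε
  have hsm : ∀ r, a ≤ r → ∀ n, Dir n →
      SmoothAt (fun z => w z * u z) (0 + r • n) := fun r hr n hn => by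
    rw [zero_add]; exact (hw r hr n hn).mul (hu r hr n hn)
  have hP : Tendsto (flux (fun i => pd i fun z => w z * u z) 0) atTop (𝓝 Q) := by
    rw [← add_zero Q]
    refine (hQ.add h2).congr' ?_
    filter_upwards [eventually_ge_atTop b] with r hr
    have w1 := fun n hn => hw r (hab.trans hr) n hn
    have u1 := fun n hn => hu r (hab.trans hr) n hn
    rw [← flux_add (fun i n hn => by rw [zero_add]; exact (hVs i r hr n hn).continuousAt)
      fun i n hn => by
        rw [zero_add]
        exact (contDiffAt_const.mul ((u1 n hn).mul (contDiffAt_pd (w1 n hn)))).continuousAt]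
    refine flux_congr fun n hn i => ?_
    rw [zero_add, pd_mul (diffAt (w1 n hn)) (diffAt (u1 n hn))]
    simp only [V]; ring
  have hk : ∀ r, a ≤ r → HasDerivAt (fun r => ∫ n, (fun z => w z * u z) (0 + r • n.1) ∂sph)
      ((r ^ 2)⁻¹ * flux (fun i => pd i fun z => w z * u z) 0 r) r := by
    intro r hr
    have r0 := ha.trans_le hr
    let F : RFn := fun q => (fun z => w z * u z) (0 + q.1 • q.2)
    have hF : ∀ n, Dir n → SmoothAt F (r, n) := fun n hn =>
      ContDiffAt.comp (r, n) (g := fun z => w z * u z) (f := fun q : ℝ × E3 => 0 + q.1 • q.2)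
        (hsm r hr n hn) (contDiffAt_const.add (contDiffAt_fst.smul contDiffAt_snd))
    refine (sphere_hasDerivAt hF).congr_deriv ?_
    rw [flux, ← integral_const_mul]
    refine integral_congr fun n => ?_
    have hn := dir n
    have h1 : HasDerivAt (fun t : ℝ => (0 : E3) + t • n.1) n.1 r := by
      simpa using ((hasDerivAt_id r).smul_const n.1).const_add 0
    have := (diffAt (hsm r hr n hn)).hasFDerivAt.comp_hasDerivAt r h1
    rw [fderiv_eq_sum_pd] at this
    refine ((hasDerivAt_dfst (diffAt (hF n hn))).unique this).trans ?_
    beta_reduce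
    rw [← mul_assoc, inv_mul_cancel₀ (by positivity), one_mul]
    exact sum_congr rfl fun i _ => mul_comm _ _
  let k : ℝ → ℝ := fun s => ∫ n, (fun z => w z * u z) (0 + s⁻¹ • n.1) ∂sph
  have hslope : Tendsto (fun s => k s / s) N0 (𝓝 0) := by
    have : Tendsto (fun r => ∫ n, r * (w (r • n.1) * u (r • n.1)) ∂sph) atTop (𝓝 0) := by
      refine tendsto_sphere_of_uniform (g := fun r n => r * (w (r • n) * u (r • n))) fun ε hε => ?_
      filter_upwards [hsmall (ε / (C + 1)) (by positivity), eventually_ge_atTop a] with r h1 hr n hn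
      have r0 := ha.trans_le hr
      rw [abs_mul, abs_mul, abs_of_pos r0]
      calc _ ≤ r * (C * r⁻¹ * (ε / (C + 1))) := by
            gcongr
            · exact hwb r hr n hn
            · exact h1 n hn
        _ = C / (C + 1) * ε := by field_simp
        _ ≤ 1 * ε := by gcongr; rw [div_le_one (by positivity)]; linarith
        _ = ε := one_mul ε
    refine (this.comp tendsto_inv_nhdsGT_zero).congr fun s => ?_
    simp only [Function.comp, integral_const_mul, k, zero_add]
    rw [div_eq_mul_inv, mul_comm]
  have hk0 : Tendsto k N0 (𝓝 0) := by
    have := hslope.mul (tendsto_id.mono_left nhdsWithin_le_nhds : Tendsto id N0 (𝓝 0))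
    rw [zero_mul] at this
    refine this.congr' ?_
    filter_upwards [self_mem_nhdsWithin] with s hs
    exact div_mul_cancel₀ _ (ne_of_gt hs)
  have hlop := HasDerivAt.lhopital_zero_nhdsGT (f := k) (g := fun s => s) (g' := fun _ => 1)
    (f' := fun s => -flux (fun i => pd i fun z => w z * u z) 0 s⁻¹) (l := 𝓝 (-Q)) ?_
    (.of_forall fun s => hasDerivAt_id s) (by simp) hk0
    (tendsto_id.mono_left nhdsWithin_le_nhds)
    (by simpa using (hP.comp tendsto_inv_nhdsGT_zero).neg)
  · have : Q = 0 := by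
      have := tendsto_nhds_unique hlop hslope
      linarith
    rwa [this] at hP
  · filter_upwards [self_mem_nhdsWithin, tendsto_inv_nhdsGT_zero.eventually (eventually_ge_atTop a)]
      with s hs h1
    have hs0 : (0 : ℝ) < s := hs
    refine ((hk s⁻¹ h1).comp s (hasDerivAt_inv hs0.ne')).congr_deriv ?_
    field_simp

lemma Nice.bound_inf {k l : ℤ} {m : ℕ} {f : E6 → Fn} (hf : Nice k l m f)
    (hp : p.1 ≠ p.2) :
    ∃ C > 0, ∀ᶠ r : ℝ in atTop, ∀ n, Dir n → |f p (r • n)| ≤ C * (r ^ m)⁻¹ := by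
  obtain ⟨Φ, hΦ⟩ := hf.inf
  obtain ⟨C, hC, hb⟩ := (hΦ.ray hp).bound
  refine ⟨C, hC, ?_⟩
  filter_upwards [tendsto_inv_atTop_nhdsGT_zero.eventually hb] with r hr n hn
  simpa using hr n hn

/-- The singular part of the Brill–Lindquist factor. -/
def poles (α1 α2 : ℝ) (p : E6) (x : E3) : ℝ := α1 * (r1 p x)⁻¹ + α2 * (r2 p x)⁻¹

lemma nice_poles (α1 α2 : ℝ) : Nice (-1) (-1) 1 (poles α1 α2) :=
  ((nice_inv_r1.weaken le_rfl (by norm_num) (by norm_num)).const_mul α1).add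
    ((nice_inv_r2.weaken (by norm_num) le_rfl (by norm_num)).const_mul α2)

lemma hasLap_poles (h1 : x ≠ p.1) (h2 : x ≠ p.2) : HasLap (poles α1 α2 p) x 0 := by
  have e1 : HasLap (fun z => (r1 p z)⁻¹) x 0 := by
    have := hasLap_monomial h1 h2 (-1) 0
    simpa using this
  have e2 : HasLap (fun z => (r2 p z)⁻¹) x 0 := by
    have := hasLap_monomial h1 h2 0 (-1)
    simpa using this
  refine ⟨((e1.const_mul α1).add (e2.const_mul α2)).1, ?_⟩
  exact ((e1.const_mul α1).add (e2.const_mul α2)).2.trans (by ring)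

/-- The excess of the cube of the Brill–Lindquist factor over its value at infinity. -/
def cubeExcess (α1 α2 : ℝ) (p : E6) (x : E3) : ℝ :=
  3 * poles α1 α2 p x + (3 * (poles α1 α2 p x * poles α1 α2 p x)
    + poles α1 α2 p x * (poles α1 α2 p x * poles α1 α2 p x))

lemma nice_cubeExcess (α1 α2 : ℝ) : Nice (-3) (-3) 1 (cubeExcess α1 α2) := by
  have h := nice_poles α1 α2
  exact ((h.weaken (by norm_num) (by norm_num) le_rfl).const_mul 3).add
    (((h.mul' h (by norm_num) (by norm_num) (by norm_num)).const_mul 3).add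
      (h.mul' (h.mul h) (by norm_num) (by norm_num) (by norm_num)))

lemma lap_cubeExcess (h1 : x ≠ p.1) (h2 : x ≠ p.2) : lap (cubeExcess α1 α2 p) x =
    6 * ((1 + poles α1 α2 p x) * ∑ i, pd i (poles α1 α2 p) x * pd i (poles α1 α2 p) x) := by
  have h := hasLap_poles (α1 := α1) (α2 := α2) h1 h2
  have d : HasPD (poles α1 α2 p) x fun i => pd i (poles α1 α2 p) x :=
    ⟨diffAt h.1, fun _ => rfl⟩
  rw [show cubeExcess α1 α2 p = _ from rfl]
  refine (((h.const_mul 3).add (((h.mul h d d).const_mul 3).add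
    (h.mul (h.mul h d d) d (d.mul d)))).2).trans ?_
  simp only [Fin.sum_univ_three]; ring

/-- The difference of the gradient of the second-order factor and the field that accounts for the
source at vanishing `α1`, `α2`. -/
def residualField (p : E6) (u : Fn) (i : Fin 3) (x : E3) : ℝ := pd i u x - srcField p i x

/-- The source of the second-order factor. -/
def secondSource (α1 α2 : ℝ) (p : E6) (x : E3) : ℝ :=
  src₀ p x + (α1 * src1 p x + α2 * src2 p x)

lemma sigma_two_smooth (h : IsPerturbativeSolution p.1 p.2 α1 α2 2 σ) (h1 : x ≠ p.1)
    (h2 : x ≠ p.2) : SmoothAt (σ 2) x :=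
  (h.smooth 1 one_lt_two).contDiffAt ((Set.toFinite {p.1, p.2}).isClosed.isOpen_compl.mem_nhds
    (by simp [h1, h2]))

lemma source_one (hp : p.1 ≠ p.2) (h : IsPerturbativeSolution p.1 p.2 α1 α2 2 σ) (h1 : x ≠ p.1)
    (h2 : x ≠ p.2) : source p.1 p.2 σ 1 x = secondSource α1 α2 p x :=
  source_one_brillLindquist ⟨hp, h1, h2⟩ h.zero fun _ h1 h2 => sigma_one_eq hp one_le_two h h1 h2

lemma lap_sigma_two (hp : p.1 ≠ p.2) (h : IsPerturbativeSolution p.1 p.2 α1 α2 2 σ)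
    (h1 : x ≠ p.1) (h2 : x ≠ p.2) : lap (σ 2) x = secondSource α1 α2 p x := by
  have hoff : ∀ z ∈ ({p.1, p.2}ᶜ : Set E3), z ≠ p.1 ∧ z ≠ p.2 := fun z hz => by simpa using hz
  have hc : ContinuousOn (source p.1 p.2 σ 1) {p.1, p.2}ᶜ := by
    refine ContinuousOn.congr (f := secondSource α1 α2 p) (fun z hz => ?_)
      fun z hz => source_one hp h (hoff z hz).1 (hoff z hz).2
    obtain ⟨k1, k2⟩ := hoff z hz
    exact ((nice_src₀.smooth.at ⟨hp, k1, k2⟩).continuousAt.add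
      ((continuousAt_const.mul (nice_src1.smooth.at ⟨hp, k1, k2⟩).continuousAt).add
        (continuousAt_const.mul (nice_src2.smooth.at ⟨hp, k1, k2⟩).continuousAt))).continuousWithinAt
  rw [lap_eq_of_weakPoisson (h.smooth 1 one_lt_two) hc (h.poisson 1 one_lt_two)
    (show x ∈ ({p.1, p.2}ᶜ : Set E3) by simp [h1, h2]), source_one hp h h1 h2]

lemma smooth_residualField (hp : p.1 ≠ p.2) (h : IsPerturbativeSolution p.1 p.2 α1 α2 2 σ)
    (h1 : x ≠ p.1) (h2 : x ≠ p.2) (i : Fin 3) :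
    SmoothAt (residualField p (σ 2) i) x :=
  (contDiffAt_pd (sigma_two_smooth h h1 h2)).sub ((nice_srcField i).smooth.at ⟨hp, h1, h2⟩)

lemma div_residualField (hp : p.1 ≠ p.2) (h : IsPerturbativeSolution p.1 p.2 α1 α2 2 σ)
    (h1 : x ≠ p.1) (h2 : x ≠ p.2) :
    ∑ i, pd i (residualField p (σ 2) i) x = α1 * src1 p x + α2 * src2 p x := by
  have e : ∀ i, pd i (residualField p (σ 2) i) x = pd i (pd i (σ 2)) x - pd i (srcField p i) x :=
    fun i => pd_sub (diffAt (contDiffAt_pd (sigma_two_smooth h h1 h2)))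
      (diffAt ((nice_srcField i).smooth.at ⟨hp, h1, h2⟩))
  have hl : ∑ i, pd i (pd i (σ 2)) x = _ := lap_sigma_two hp h h1 h2
  simp_rw [e]
  rw [sum_sub_distrib, hl, div_srcField ⟨hp, h1, h2⟩, secondSource]; ring

lemma exists_flux_residualField (hp : p.1 ≠ p.2)
    (h : IsPerturbativeSolution p.1 p.2 α1 α2 2 σ) :
    ∃ L, Tendsto (flux (residualField p (σ 2)) 0) atTop (𝓝 L) := by
  obtain ⟨C, hC, hb⟩ := ((nice_src1.const_mul α1).add (nice_src2.const_mul α2)).bound_inf (m := 4) hp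
  obtain ⟨a, ha⟩ := eventually_atTop.1 (hb.and ((eventually_off_sphere p).and (eventually_gt_atTop 0)))
  obtain ⟨L, hL, -⟩ := exists_flux_limit (V := residualField p (σ 2)) (C := C) (ha a le_rfl).2.2
    (fun i r hr n hn => smooth_residualField hp h ((ha r hr).2.1 n hn).1 ((ha r hr).2.1 n hn).2 i)
    fun r hr n hn => by
      rw [div_residualField hp h ((ha r hr).2.1 n hn).1 ((ha r hr).2.1 n hn).2]
      exact (ha r hr).1 n hn
  exact ⟨L, hL⟩

lemma HasSurfaceMass.add {h h' : TensorField} {m m' : ℝ} (hm : HasSurfaceMass c G h m)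
    (hm' : HasSurfaceMass c G h' m')
    (hd : ∀ᶠ r : ℝ in atTop, ∀ i j, ∀ n, Dir n →
      DiffAt (fun z => h z i j) (r • n) ∧ DiffAt (fun z => h' z i j) (r • n)) :
    HasSurfaceMass c G (fun z => h z + h' z) (m + m') := by
  have e : ∀ᶠ r : ℝ in atTop, surfaceDensity (fun z => h z + h' z) r =
      fun n => surfaceDensity h r n + surfaceDensity h' r n := by
    filter_upwards [hd] with r hr
    funext n
    have hn := dir n
    have a := fun k i j => pd_add (i := k) (hr i j n hn).1 (hr i j n hn).2
    simp only [surfaceDensity, Matrix.add_apply, a, Fin.sum_univ_three]; ring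
  refine ⟨?_, (hm.2.add hm'.2).congr' ?_⟩
  · filter_upwards [e, hm.1, hm'.1] with r h1 h2 h3
    rw [h1]; exact h2.add h3
  · filter_upwards [e, hm.1, hm'.1] with r h1 h2 h3
    rw [h1, integral_add h2 h3, mul_add]

lemma HasSurfaceMass.congr {h h' : TensorField} {m m' : ℝ} (hm : HasSurfaceMass c G h m)
    (hh : ∀ x, x ≠ p.1 → x ≠ p.2 → h' x = h x) (e : m' = m) : HasSurfaceMass c G h' m' := by
  have key : ∀ᶠ r : ℝ in atTop, surfaceDensity h' r = surfaceDensity h r := by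
    filter_upwards [eventually_off_sphere p] with r hr
    funext n
    obtain ⟨h1, h2⟩ := hr n (dir n)
    have a : ∀ k i j, pd k (fun z => h' z i j) (r • n.1) = pd k (fun z => h z i j) (r • n.1) :=
      fun k i j => pd_congr (by
        filter_upwards [eventually_off_point h1 h2] with z hz
        rw [hh z hz.1 hz.2])
    simp only [surfaceDensity, a]
  refine ⟨?_, e ▸ hm.2.congr' ?_⟩
  · filter_upwards [key, hm.1] with r h1 h2
    rwa [h1]
  · filter_upwards [key] with r h1
    rw [h1]

lemma hasSurfaceMass_isotropic {f : Fn} {κ : ℝ}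
    (hf : ∀ᶠ r : ℝ in atTop, ∀ n, Dir n → SmoothAt f (r • n))
    (hκ : Tendsto (flux (fun i => pd i f) 0) atTop (𝓝 κ)) :
    HasSurfaceMass c G (fun z => Matrix.of fun i j => f z * δ i j)
      (c ^ 2 / (16 * π * G) * (-2 * κ)) := by
  refine ⟨?_, Tendsto.const_mul _ ((hκ.const_mul (-2)).congr' ?_)⟩
  · filter_upwards [hf] with r hr
    exact sphere_continuous_integrable (continuous_surfaceDensity fun i j n hn =>
      (hr n hn).mul contDiffAt_const)
  · filter_upwards [hf] with r hr
    rw [flux, ← integral_const_mul]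
    refine integral_congr fun n => ?_
    have a := fun k i j => pd_mul_const (i := k) (δ i j)
      (diffAt (hr n (dir n)))
    simp only [surfaceDensity, Matrix.of_apply, a]
    simp only [Fin.sum_univ_three, δ, zero_add, Fin.isValue, ↓reduceIte, Fin.reduceEq]
    ring

lemma flux_const_mul (k : ℝ) (V : Fin 3 → Fn) (a : E3) (r : ℝ) :
    flux (fun i x => k * V i x) a r = k * flux V a r := by
  rw [flux, flux, ← integral_const_mul]
  exact integral_congr_ae (.of_forall fun n => by simp only [Fin.sum_univ_three]; ring)

lemma adm_mass_two (hp : p.1 ≠ p.2) (hG : G ≠ 0) (h : IsPerturbativeSolution p.1 p.2 α1 α2 2 σ)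
    {L : ℝ} (hL : Tendsto (flux (residualField p (σ 2)) 0) atTop (𝓝 L)) :
    HasSurfaceMass c G (physMetricCoeff p.1 p.2 σ 2)
      (-(c ^ 2 / (2 * π * G)) * (L - π / (64 * r12 p ^ 3))) := by
  have hoff := eventually_off_sphere p
  have hs2 : ∀ x, x ≠ p.1 → x ≠ p.2 → SmoothAt (σ 2) x := fun x h1 h2 =>
    sigma_two_smooth h h1 h2
  have hcs : ∀ x, x ≠ p.1 → x ≠ p.2 → SmoothAt (cubeExcess α1 α2 p) x :=
    fun x h1 h2 => (nice_cubeExcess α1 α2).smooth.at ⟨hp, h1, h2⟩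
  have hgrad : Tendsto (flux (fun i => pd i (σ 2)) 0) atTop
      (𝓝 (L - π / (64 * r12 p ^ 3))) := by
    rw [sub_eq_add_neg]
    refine (hL.add (tendsto_flux_srcField hp)).congr' ?_
    filter_upwards [hoff] with r hr
    rw [← flux_add (fun i n hn => by
        rw [zero_add]; exact (smooth_residualField hp h (hr n hn).1 (hr n hn).2 i).continuousAt)
      fun i n hn => by
        rw [zero_add]; exact ((nice_srcField i).smooth.at ⟨hp, (hr n hn).1, (hr n hn).2⟩).continuousAt]
    exact flux_congr fun n _ i => sub_add_cancel _ _
  have hprod : Tendsto (flux (fun i => pd i fun z => cubeExcess α1 α2 p z * σ 2 z) 0) atTop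
      (𝓝 0) := by
    have n1 := nice_poles α1 α2
    have n2 := nice_cubeExcess α1 α2
    have n3 := (((nice_const 1).weaken (by norm_num) (by norm_num) le_rfl).add
      (n1.weaken le_rfl le_rfl (by norm_num : (0 : ℤ) ≤ 1))).mul
      (nice_sum (k := -4) (l := -4) (m := 4) univ fun i _ =>
        (n1.pd i).mul' (n1.pd i) (by norm_num) (by norm_num) (by norm_num))
    have n4 : Nice (-3) (-3) 3 (secondSource α1 α2) :=
      (nice_src₀.weaken (by norm_num) (by norm_num) le_rfl).add
        (((nice_src1.weaken le_rfl le_rfl (by norm_num)).const_mul α1).add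
          ((nice_src2.weaken le_rfl le_rfl (by norm_num)).const_mul α2))
    obtain ⟨C1, p1, b1⟩ := n2.bound_inf (m := 1) hp
    choose C2 p2 b2 using fun i => (n2.pd i).bound_inf (m := 2) hp
    obtain ⟨C3, p3, b3⟩ := (n3.const_mul 6).bound_inf (m := 4) hp
    obtain ⟨C₄, p₄, b₄⟩ := n4.bound_inf (m := 3) hp
    obtain ⟨a, ha⟩ := eventually_atTop.1 ((((b1.and (eventually_all.2 b2)).and b3).and b₄).and
      (hoff.and (eventually_gt_atTop 0)))
    have hS : ∀ i, C2 i ≤ C2 0 + C2 1 + C2 2 := fun i => by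
      have := (p2 0).le; have := (p2 1).le; have := (p2 2).le
      fin_cases i <;> simp <;> linarith
    have hP : 0 ≤ C2 0 + C2 1 + C2 2 := (p2 0).le.trans (hS 0)
    refine tendsto_flux_grad_mul (C := C1 + (C2 0 + C2 1 + C2 2) + C3 + C₄) (ha a le_rfl).2.2
      (fun r hr n hn => hcs _ ((ha r hr).2.1 n hn).1 ((ha r hr).2.1 n hn).2)
      (fun r hr n hn => hs2 _ ((ha r hr).2.1 n hn).1 ((ha r hr).2.1 n hn).2)
      (h.tendsto_zero 1 one_lt_two) ?_ ?_ ?_ ?_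
    · intro r hr n hn
      obtain ⟨⟨⟨⟨k1, -⟩, -⟩, -⟩, -, r0⟩ := ha r hr
      have := k1 n hn
      rw [pow_one] at this
      exact this.trans (by gcongr; linarith)
    · intro i r hr n hn
      obtain ⟨⟨⟨⟨-, k2⟩, -⟩, -⟩, -, r0⟩ := ha r hr
      exact (k2 i n hn).trans (by gcongr; linarith [hS i])
    · intro r hr n hn
      obtain ⟨⟨⟨-, k3⟩, -⟩, ho, r0⟩ := ha r hr
      rw [lap_cubeExcess (ho n hn).1 (ho n hn).2]
      exact (k3 n hn).trans (by gcongr; linarith)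
    · intro r hr n hn
      obtain ⟨⟨-, k4⟩, ho, r0⟩ := ha r hr
      rw [lap_sigma_two hp h (ho n hn).1 (ho n hn).2]
      exact (k4 n hn).trans (by gcongr; linarith)
  have hsum : Tendsto (flux (fun i => pd i fun z => 4 * (σ 2 z + cubeExcess α1 α2 p z * σ 2 z)) 0)
      atTop (𝓝 (4 * (L - π / (64 * r12 p ^ 3)))) := by
    have := (hgrad.add hprod).const_mul 4
    rw [add_zero] at this
    refine this.congr' ?_
    filter_upwards [hoff] with r hr
    have s1 := fun n hn => hs2 _ (hr n hn).1 (hr n hn).2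
    have s2 := fun n hn => (hcs _ (hr n hn).1 (hr n hn).2).mul (s1 n hn)
    rw [← flux_add (fun i n hn => by rw [zero_add]; exact (contDiffAt_pd (s1 n hn)).continuousAt)
      (fun i n hn => by rw [zero_add]; exact (contDiffAt_pd (s2 n hn)).continuousAt),
      ← flux_const_mul]
    refine flux_congr fun n hn i => ?_
    have d1 := diffAt (s1 n hn)
    have d2 := diffAt (s2 n hn)
    rw [zero_add, pd_const_mul 4 (d1.fun_add d2), pd_add d1 d2]
  have hiso := hasSurfaceMass_isotropic (c := c) (G := G) (by
    filter_upwards [hoff] with r hr n hn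
    have s1 := hs2 _ (hr n hn).1 (hr n hn).2
    exact contDiffAt_const.mul (s1.add ((hcs _ (hr n hn).1 (hr n hn).2).mul s1))) hsum
  obtain ⟨Φ, hΦ, hd⟩ := exists_ray_brillLindquist hp α1 α2
  obtain ⟨U, hU⟩ := (nice_firstOrder α1 α2).inf
  have hU' := hU.ray hp
  have hU0 : Ray (-1) 0 0 (firstOrder p α1 α2) fun q => q.1 * U (q.1, q.2, p) :=
    ⟨fun n hn => contDiffAt_fst.mul (hU'.smooth n hn), by
      filter_upwards [hU'.eq] with t ht n hn
      rw [ht n hn, zpow_one, zpow_zero, one_mul]⟩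
  have hs0 : ∀ x, x ≠ p.1 → x ≠ p.2 → SmoothAt (brillLindquist p.1 p.2 α1 α2) x :=
    fun x h1 h2 => by rw [brillLindquist_eq]; exact smooth_brillLindquist h1 h2
  have hu : ∀ x, x ≠ p.1 → x ≠ p.2 → SmoothAt (firstOrder p α1 α2) x :=
    fun x h1 h2 => (nice_firstOrder α1 α2).smooth.at ⟨hp, h1, h2⟩
  let f : Fn := fun x => brillLindquist p.1 p.2 α1 α2 x * firstOrder p α1 α2 x
  let g : Fn := fun x => 4 * (brillLindquist p.1 p.2 α1 α2 x * brillLindquist p.1 p.2 α1 α2 x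
    * f x)
  have hfr := hΦ.mul hU0
  have hfs : ∀ x, x ≠ p.1 → x ≠ p.2 → SmoothAt f x := fun x h1 h2 =>
    (hs0 x h1 h2).mul (hu x h1 h2)
  have hgs : ∀ x, x ≠ p.1 → x ≠ p.2 → SmoothAt g x := fun x h1 h2 =>
    contDiffAt_const.mul (((hs0 x h1 h2).mul (hs0 x h1 h2)).mul (hfs x h1 h2))
  let h₂ : TensorField := fun x => Matrix.of fun i j =>
    6 * (f x * f x) * δ i j + g x * seed p.1 p.2 x i j
  have key := hasSurfaceMass_seed (c := c) (G := G) (h := h₂) hp ((hfr.mul hfr).const_mul 6)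
    (((hΦ.mul hΦ).mul hfr).const_mul 4)
    (fun x h1 h2 => contDiffAt_const.mul ((hfs x h1 h2).mul (hfs x h1 h2))) hgs
    (fun x _ _ i j => rfl)
  have e0 : ∀ n : S2, dfst (fun q => 6 * (Φ q * (q.1 * U (q.1, q.2, p))
      * (Φ q * (q.1 * U (q.1, q.2, p))))) (0, n.1) + 4 * (Φ (0, n.1) * Φ (0, n.1)
      * (Φ (0, n.1) * ((0, n.1).1 * U ((0, n.1).1, (0, n.1).2, p))))
      * (-(1 - axisCos p n ^ 2) / (2 * r12 p) + 1 / (3 * r12 p)) = 0 := by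
    intro n
    have hn := dir n
    have hD := diffAt (hfr.smooth n hn)
    have hq := hasDerivAt_dfst hD
    have hd4 := ((hq.mul hq).const_mul 6).unique (hasDerivAt_dfst ((hD.mul hD).const_mul 6))
    change _ = dfst (fun q => 6 * (Φ q * (q.1 * U (q.1, q.2, p))
      * (Φ q * (q.1 * U (q.1, q.2, p))))) _ at hd4
    rw [← hd4]; simp
  simp only [e0, integral_zero, mul_zero] at key
  have hall := hiso.add key ?_
  · refine hall.congr (p := p) (fun x h1 h2 => ?_) ?_
    · ext i j
      have e := congrFun (brillLindquist_eq p α1 α2) x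
      simp only [physMetricCoeff_two, h.zero, sigma_one_eq hp one_le_two h h1 h2, Matrix.add_apply,
        Matrix.of_apply, h₂, g, f, e, cubeExcess, poles]
      ring
    · have := Real.pi_ne_zero
      field_simp; ring
  · filter_upwards [hoff] with r hr i j n hn
    obtain ⟨h1, h2⟩ := hr n hn
    have s1 := hs2 _ h1 h2
    refine ⟨diffAt ((contDiffAt_const.mul (s1.add ((hcs _ h1 h2).mul s1))).mul
      contDiffAt_const), diffAt (ContDiffAt.congr_of_eventuallyEq
      (f := fun z => 6 * (f z * f z) * δ i j + g z * sd i j p z)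
      (((contDiffAt_const.mul ((hfs _ h1 h2).mul (hfs _ h1 h2))).mul contDiffAt_const).add
        ((hgs _ h1 h2).mul ((nice_sd i j).smooth.at ⟨hp, h1, h2⟩))) ?_)⟩
    filter_upwards [eventually_off_point h1 h2] with z hz
    simp only [h₂, Matrix.of_apply, seed_eq ⟨hp, hz.1, hz.2⟩]

lemma ExpandsTo.sphere_bound {a : E6 → E3} {f : E6 → Fn}
    {Φ : ℝ × E3 × E6 → ℝ} (hf : ExpandsTo 1 a (-3) f Φ) {K : Set (E6)}
    (hK : IsCompact K) (hK0 : ∀ p ∈ K, p.1 ≠ p.2) :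
    ∃ C, ∀ᶠ δ in N0, ∀ p ∈ K, ∃ A : ℝ, |A| ≤ C ∧ ∀ t, 0 < t → t ≤ δ →
      (∀ n, Dir n → ContinuousAt (f p) (a p + t • n)) →
      |t ^ 2 * ∫ n, f p (a p + t • n.1) ∂sph - A * t⁻¹| ≤ C := by
  obtain ⟨C, hC, d, hd, h⟩ := hf.uniform hK hK0
  refine ⟨4 * π * C, ?_⟩
  filter_upwards [Ioo_mem_nhdsGT hd] with δ hδ p hp
  refine ⟨∫ n, Φ (0, n.1, p) ∂sph, abs_sphere_integral_le fun n hn => (h p hp n hn).1,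
    fun t ht htδ hc => ?_⟩
  have c1 := (continuous_sphere_comp hc).const_mul (t ^ 2)
  have c2 : Continuous fun n : S2 => -t⁻¹ * Φ (0, n.1, p) := by
    refine continuous_const.mul (continuous_iff_continuousAt.2 fun n => ?_)
    have hn : n.1 ≠ 0 := by rw [← norm_ne_zero_iff, dir]; norm_num
    exact ContinuousAt.comp (g := Φ) (f := fun n : S2 => ((0 : ℝ), n.1, p))
      (hf.smooth n p hn (hK0 p hp)).continuousAt (by fun_prop)
  have e : t ^ 2 * ∫ n, f p (a p + t • n.1) ∂sph - (∫ n, Φ (0, n.1, p) ∂sph) * t⁻¹ =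
      ∫ n, (t ^ 2 * f p (a p + t • n.1) + -t⁻¹ * Φ (0, n.1, p)) ∂sph := by
    rw [sphere_integral_add c1 c2, integral_const_mul, integral_const_mul]; ring
  rw [e]
  refine abs_sphere_integral_le (f := fun n => t ^ 2 * f p (a p + t • n) + -t⁻¹ * Φ (0, n, p))
    fun n hn => ?_
  have h1 := ((h p hp n hn).2 t ht (htδ.trans_lt hδ.2)).2
  rw [zpow_one, show (-3 : ℤ) + 1 = -2 from rfl, zpow_neg, zpow_neg] at h1
  have e2 : t ^ 2 * f p (a p + t • n) + -t⁻¹ * Φ (0, n, p) =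
      t ^ 2 * (f p (a p + t • n) - (t ^ (3 : ℤ))⁻¹ * Φ (0, n, p)) := by
    norm_cast; field_simp; ring
  rw [e2, abs_mul, abs_of_pos (by positivity)]
  calc t ^ 2 * _ ≤ t ^ 2 * (C * (t ^ (2 : ℤ))⁻¹) := by gcongr
    _ = C := by norm_cast; field_simp

lemma abs_integral_shell_le {f : Fn} {a : E3} {C δ A ε : ℝ} (hε : 0 < ε) (hεδ : ε ≤ δ)
    (hf : ∀ x, ε ≤ dist x a → dist x a ≤ δ → SmoothAt f x)
    (hb : ∀ t, 0 < t → t ≤ δ → (∀ n, Dir n → ContinuousAt f (a + t • n)) →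
      |t ^ 2 * ∫ n, f (a + t • n.1) ∂sph - A * t⁻¹| ≤ C) :
    |(∫ x in {x | ε ≤ dist x a ∧ dist x a ≤ δ}, f x) - A * (Real.log δ - Real.log ε)| ≤ C * δ := by
  have hsh : ∀ r, ε ≤ r → r ≤ δ → ∀ n, Dir n → SmoothAt f (a + r • n) := by
    intro r h h' n hn
    have : dist (a + r • n) a = r := by simp [norm_smul, hn, abs_of_pos (hε.trans_le h)]
    exact hf _ (by rw [this]; exact h) (by rw [this]; exact h')
  have i1 : IntervalIntegrable (fun r : ℝ => r ^ 2 * ∫ n, f (a + r • n.1) ∂sph) volume ε δ := by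
    refine ContinuousOn.intervalIntegrable (shell_continuousOn fun r hr n hn => ?_)
    rw [Set.uIcc_of_le hεδ] at hr
    exact (hsh r hr.1 hr.2 n hn).continuousAt
  have i2 : IntervalIntegrable (fun r : ℝ => A * r⁻¹) volume ε δ := by
    refine ContinuousOn.intervalIntegrable fun r hr => ?_
    rw [Set.uIcc_of_le hεδ] at hr
    exact (continuousAt_const.mul (continuousAt_inv₀
      (hε.trans_le hr.1).ne')).continuousWithinAt
  have hlog : ∫ r in ε..δ, A * r⁻¹ = A * (Real.log δ - Real.log ε) := by
    rw [intervalIntegral.integral_const_mul, integral_inv_of_pos hε (hε.trans_le hεδ),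
      Real.log_div (hε.trans_le hεδ).ne' hε.ne']
  rw [(integral_shell hε.le hεδ fun x h h' => (hf x h h').continuousAt).2, ← hlog,
    ← intervalIntegral.integral_sub i1 i2, ← Real.norm_eq_abs]
  have hb' : ∀ r, ε ≤ r → r ≤ δ → |r ^ 2 * ∫ n, f (a + r • n.1) ∂sph - A * r⁻¹| ≤ C :=
    fun r h h' => hb r (hε.trans_le h) h' fun n hn => (hsh r h h' n hn).continuousAt
  refine (intervalIntegral.norm_integral_le_of_norm_le_const (C := C) fun r hr => ?_).trans ?_
  · rw [Set.uIoc_of_le hεδ] at hr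
    exact hb' r hr.1.le hr.2
  · have : 0 ≤ C := (abs_nonneg _).trans (hb' δ hεδ le_rfl)
    rw [abs_of_nonneg (by linarith)]
    gcongr; linarith

lemma Nice.integral_outside {f : E6 → Fn} (hf : Nice (-3) (-3) 4 f) {K : Set (E6)}
    (hK : IsCompact K) (hK0 : ∀ p ∈ K, p.1 ≠ p.2) :
    ∀ᶠ δ in N0, ∃ C, ∀ p ∈ K, ‖p‖ + δ < δ⁻¹ ∧
      (∀ r, δ⁻¹ ≤ r → ∀ n, Dir n → |f p (r • n)| ≤ C * (r ^ 4)⁻¹) ∧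
      ∃ A, ∀ ε, 0 < ε → ε ≤ δ → IntegrableOn (f p) (outside p ε ∩ ball 0 δ⁻¹) ∧
        |(∫ x in outside p ε ∩ ball 0 δ⁻¹, f p x) - A * Real.log ε| ≤ C := by
  obtain ⟨Φ1, hΦ1⟩ := hf.fst
  obtain ⟨Φ2, hΦ2⟩ := hf.snd
  obtain ⟨Φ3, hΦ3⟩ := hf.inf
  obtain ⟨C1, h1⟩ := hΦ1.sphere_bound hK hK0
  obtain ⟨C2, h2⟩ := hΦ2.sphere_bound hK hK0
  obtain ⟨C3, hC3, d3, hd3, h3⟩ := hΦ3.uniform hK hK0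
  obtain ⟨η, hη, hη'⟩ := hK.exists_forall_le' (f := r12) (a := 0)
    (continuous_fst.dist continuous_snd).continuousOn fun p hp => r12_pos (hK0 p hp)
  obtain ⟨B, hB⟩ := hK.isBounded.exists_norm_le
  have hinf : ∀ᶠ δ in N0, B + 1 < δ⁻¹ := tendsto_inv_nhdsGT_zero.eventually_gt_atTop _
  filter_upwards [h1, h2, hinf, Ioo_mem_nhdsGT hd3, Ioo_mem_nhdsGT (show 0 < η / 3 by positivity),
    Ioo_mem_nhdsGT one_pos] with δ h1 h2 h4 hd hδ hδ1
  have hδ0 := hδ.1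
  have c1 : Continuous fun q : (E6) × E3 => dist q.2 q.1.1 := by fun_prop
  have c2 : Continuous fun q : (E6) × E3 => dist q.2 q.1.2 := by fun_prop
  have cQ : IsCompact ({q : (E6) × E3 | δ ≤ dist q.2 q.1.1 ∧ δ ≤ dist q.2 q.1.2} ∩
      K ×ˢ closedBall (0 : E3) δ⁻¹) :=
    (hK.prod (isCompact_closedBall _ _)).inter_left
      ((isClosed_le continuous_const c1).inter (isClosed_le continuous_const c2))
  obtain ⟨C₀, hC₀⟩ := cQ.exists_bound_of_continuousOn (f := fun q => f q.1 q.2) fun q hq =>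
    (hf.smooth q.1 q.2 ⟨hK0 _ hq.2.1, dist_pos.1 (hδ0.trans_le hq.1.1),
      dist_pos.1 (hδ0.trans_le hq.1.2)⟩).continuousAt.continuousWithinAt
  set B₀ : Set E3 := closedBall 0 δ⁻¹ with hB₀
  have hC₀' : ∀ p ∈ K, ∀ S ⊆ outside p δ ∩ B₀, |∫ x in S, f p x| ≤ |C₀| * volume.real B₀ := by
    intro p hp S hS
    refine (norm_setIntegral_le_of_norm_le_const (C := |C₀|) ((measure_mono (hS.trans
      Set.inter_subset_right)).trans_lt measure_closedBall_lt_top) fun x hx =>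
      (hC₀ (p, x) ⟨(hS hx).1, hp, (hS hx).2⟩).trans (le_abs_self _)).trans ?_
    exact mul_le_mul_of_nonneg_left (measureReal_mono (hS.trans Set.inter_subset_right)
      measure_closedBall_lt_top.ne) (abs_nonneg _)
  refine ⟨max C3 ((C1 + C2) * |Real.log δ| + (C1 + C2) * δ + |C₀| * volume.real B₀),
    fun p hp => ⟨by linarith [hB p hp, hδ1.2], fun r hr n hn => ?_, ?_⟩⟩
  · have hr0 : 0 < r := (inv_pos.2 hδ0).trans_le hr
    have := ((h3 p hp n hn).2 r⁻¹ (inv_pos.2 hr0)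
      ((inv_le_of_inv_le₀ hδ0 hr).trans_lt hd.2)).1
    rw [zero_add, zpow_neg_one, inv_inv] at this
    refine this.trans ?_
    rw [show (r⁻¹ : ℝ) ^ (4 : ℤ) = (r ^ 4)⁻¹ by norm_cast; rw [inv_pow]]
    gcongr; exact le_max_left _ _
  obtain ⟨A1, a1, b1⟩ := h1 p hp
  obtain ⟨A2, a2, b2⟩ := h2 p hp
  have hR : 3 * δ < dist p.1 p.2 := by have := hη' p hp; rw [r12] at this; linarith [hδ.2]
  refine ⟨-A1 - A2, fun ε hε hεδ => ?_⟩
  set T := outside p ε ∩ ball 0 δ⁻¹ with hT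
  set S1 := {x : E3 | ε ≤ dist x p.1 ∧ dist x p.1 ≤ δ} with hS1
  set Sb := {x : E3 | ε ≤ dist x p.2 ∧ dist x p.2 ≤ δ} with hSb
  have mS : ∀ a : E3, MeasurableSet {x : E3 | ε ≤ dist x a ∧ dist x a ≤ δ} := fun a =>
    ((isClosed_le continuous_const (continuous_id.dist continuous_const)).inter
      (isClosed_le (continuous_id.dist continuous_const) continuous_const)).measurableSet
  have hsm : ∀ x ∈ outside p ε, SmoothAt (f p) x := fun x hx =>
    hf.smooth.at ⟨hK0 p hp, (outside_ne hε hx).1, (outside_ne hε hx).2⟩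
  have iT : IntegrableOn (f p) T := (ContinuousOn.integrableOn_compact
    ((isCompact_closedBall _ _).inter_left (isClosed_outside p ε)) fun x hx =>
      (hsm x hx.1).continuousAt.continuousWithinAt).mono_set
        (Set.inter_subset_inter_right _ ball_subset_closedBall)
  have o1 : S1 ⊆ outside p ε := fun x hx => ⟨hx.1, by
    linarith [dist_triangle p.1 x p.2, dist_comm p.1 x, hx.2]⟩
  have o2 : Sb ⊆ outside p ε := fun x hx => ⟨by
    linarith [dist_triangle p.1 x p.2, dist_comm p.1 x, hx.2], hx.1⟩
  have bb : ∀ x a : E3, dist x a ≤ δ → ‖a‖ ≤ ‖p‖ → x ∈ ball 0 δ⁻¹ := fun x a h h' => by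
    rw [mem_ball]
    have := dist_triangle x a 0
    rw [dist_zero_right a] at this
    linarith [hB p hp, hδ1.2]
  have e1 : T ∩ S1 = S1 := Set.inter_eq_right.2 fun x hx =>
    ⟨o1 hx, bb x p.1 hx.2 (norm_fst_le p)⟩
  have e2 : T \ S1 ∩ Sb = Sb := Set.inter_eq_right.2 fun x hx =>
    ⟨⟨o2 hx, bb x p.2 hx.2 (norm_snd_le p)⟩, fun h => by
      linarith [dist_triangle p.1 x p.2, dist_comm p.1 x, hx.2, h.2]⟩
  have k1 := integral_inter_add_sdiff (mS p.1) iT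
  have k2 := integral_inter_add_sdiff (mS p.2) (iT.mono_set (Set.sdiff_subset (t := S1)))
  rw [e1] at k1
  rw [e2] at k2
  have l1 := abs_integral_shell_le hε hεδ (fun x h h' => hsm x (o1 ⟨h, h'⟩)) b1
  have l2 := abs_integral_shell_le hε hεδ (fun x h h' => hsm x (o2 ⟨h, h'⟩)) b2
  have l3 := hC₀' p hp ((T \ S1) \ Sb) fun x hx => ⟨⟨by
    by_contra h; exact hx.1.2 ⟨hx.1.1.1.1, (not_le.1 h).le⟩, by
    by_contra h; exact hx.2 ⟨hx.1.1.1.2, (not_le.1 h).le⟩⟩, ball_subset_closedBall hx.1.1.2⟩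
  refine ⟨iT, ?_⟩
  refine le_max_of_le_right ?_
  rw [← k1, ← k2]
  have g1 : |A1 * Real.log δ| ≤ C1 * |Real.log δ| := by rw [abs_mul]; gcongr
  have g2 : |A2 * Real.log δ| ≤ C2 * |Real.log δ| := by rw [abs_mul]; gcongr
  rw [abs_le] at *
  constructor <;> linarith [l1.1, l1.2, l2.1, l2.2, l3.1, l3.2, g1.1, g1.2, g2.1, g2.2]

lemma dist_add_smul {a n : E3} {r : ℝ} (hr : 0 ≤ r) (hn : Dir n) : dist (a + r • n) a = r := by
  simp [norm_smul, hn, abs_of_nonneg hr]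

lemma integral_div_ball {V : Fin 3 → Fn} (hp : p.1 ≠ p.2)
    (hV : ∀ i x, x ≠ p.1 → x ≠ p.2 → SmoothAt (V i) x) {ε r : ℝ}
    (hε : ε ∈ Set.Ioo 0 (r12 p / 8)) (hr : ‖p‖ + ε < r) :
    ∫ x in outside p ε ∩ ball 0 r, ∑ i, pd i (V i) x =
      flux V 0 r - flux V p.1 ε - flux V p.2 ε := by
  have hr0 : 0 < r := by linarith [norm_nonneg p, hε.1]
  obtain ⟨χ, hχ, c1, c2, c3⟩ := exists_cutoff (0 : E3) hr0
  set W : Fin 3 → Fn := fun i z => χ z * V i z with hW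
  have hWs : ∀ i x, x ≠ p.1 → x ≠ p.2 → SmoothAt (W i) x := fun i x h1 h2 =>
    hχ.contDiffAt.mul (hV i x h1 h2)
  have near : ∀ a : E3, ‖a‖ ≤ ‖p‖ → ∀ x, dist x a ≤ ε → dist x 0 < r := fun a ha x hx => by
    linarith [dist_triangle x a 0, dist_zero_right a]
  have fl : ∀ a t, (∀ n, Dir n → dist (a + t • n) 0 ≤ r) → flux W a t = flux V a t :=
    fun a t h => flux_congr fun n hn i => by rw [hW]; simp only [c1 _ (h n hn), one_mul]
  have fp : ∀ a : E3, ‖a‖ ≤ ‖p‖ → flux W a ε = flux V a ε := fun a ha =>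
    fl a ε fun n hn => (near a ha _ (dist_add_smul hε.1.le hn).le).le
  have f0 : flux W 0 r = flux V 0 r := fl 0 r fun n hn => (dist_add_smul hr0.le hn).le
  have f2 : flux W 0 (2 * r) = 0 := by
    have : ∀ n : S2, χ (0 + (2 * r) • n.1) = 0 := fun n =>
      c2 _ (dist_add_smul (by positivity) (dir n)).ge
    simp only [flux, hW, this, zero_mul, Finset.sum_const_zero, mul_zero, integral_zero]
  have tot := integral_div_outside hp hWs (fun i => c3.mul_right) hε
  have hS0 : ∀ x : E3, r ≤ dist x 0 → x ∈ outside p ε := fun x hx =>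
    ⟨le_of_not_ge fun h => (near _ (norm_fst_le p) x h).not_ge hx,
      le_of_not_ge fun h => (near _ (norm_snd_le p) x h).not_ge hx⟩
  obtain ⟨-, sh⟩ := integral_div_shell (V := W) (a := 0) hr0.le (show r ≤ 2 * r by linarith)
    fun i x h _ => hWs i x (outside_ne hε.1 (hS0 x h)).1 (outside_ne hε.1 (hS0 x h)).2
  set S := {x : E3 | r ≤ dist x 0 ∧ dist x 0 ≤ 2 * r} with hS
  have mS : MeasurableSet S :=
    ((isClosed_le continuous_const (continuous_id.dist continuous_const)).inter
      (isClosed_le (continuous_id.dist continuous_const) continuous_const)).measurableSet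
  have hi : IntegrableOn (fun x => ∑ i, pd i (W i) x) (outside p ε) :=
    integrable_finsetSum _ fun i _ => integrableOn_outside hε.1 (fun x h1 h2 =>
      (contDiffAt_pd (hWs i x h1 h2)).continuousAt) (hasCompactSupport_pd c3.mul_right)
  have split := integral_inter_add_sdiff mS hi
  rw [Set.inter_eq_right.2 (show S ⊆ outside p ε from fun x hx => hS0 x hx.1), sh, tot, f0, f2,
    fp _ (norm_fst_le p), fp _ (norm_snd_le p)] at split
  have in1 : ∫ x in outside p ε \ S, ∑ i, pd i (W i) x =
      ∫ x in outside p ε ∩ ball 0 r, ∑ i, pd i (W i) x := by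
    refine setIntegral_eq_of_subset_of_forall_sdiff_eq_zero
      ((measurableSet_outside p ε).diff mS) (fun x hx => ⟨hx.1, fun h => ?_⟩) fun x hx => ?_
    · exact (mem_ball.1 hx.2).not_ge h.1
    · have h2 : 2 * r < dist x 0 := by
        by_contra h
        exact hx.1.2 ⟨le_of_not_gt fun h' => hx.2 ⟨hx.1.1, h'⟩, not_lt.1 h⟩
      refine Finset.sum_eq_zero fun i _ => ?_
      have : W i =ᶠ[𝓝 x] fun _ => 0 := by
        filter_upwards [(isOpen_lt continuous_const (continuous_id.dist continuous_const)).mem_nhds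
          h2] with z hz
        simp [hW, c2 z (le_of_lt hz)]
      rw [pd_congr this, pd_const]
  rw [in1] at split
  rw [setIntegral_congr_fun ((measurableSet_outside p ε).inter measurableSet_ball)
    (g := fun x => ∑ i, pd i (W i) x) fun x hx => sum_congr rfl fun i _ => pd_congr ?_]
  · linarith
  · filter_upwards [isOpen_ball.mem_nhds hx.2] with z hz
    simp [hW, c1 z (le_of_lt (mem_ball.1 hz))]

lemma hasFinitePart_flux_residualField (hp : p.1 ≠ p.2)
    (h : IsPerturbativeSolution p.1 p.2 α1 α2 2 σ) :
    HasFinitePart (fun ε => flux (residualField p (σ 2)) p.1 ε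
      + flux (residualField p (σ 2)) p.2 ε) 0 := by
  have hs : 0 < ‖p‖ + 1 := by positivity
  obtain ⟨φ, hφ, c1, -, hc⟩ := exists_cutoff (0 : E3) hs
  obtain ⟨A, P, hP0, hP⟩ := h.poisson 1 one_lt_two φ hφ hc
  have hT := tendsto_green hp (fun x => sigma_two_smooth h) (h.locallyIntegrable 1 one_lt_two) hφ hc
  have hlap : ∀ x, Laplacian.laplacian φ x = lap φ x := fun x => laplacian_eq_sum_pd hφ.contDiffAt
  simp_rw [hlap] at hP
  choose Φ1 hΦ1 using fun i => (nice_srcField i).fst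
  choose Φ2 hΦ2 using fun i => (nice_srcField i).snd
  have w1 := flux_tendsto_zero fun i => (hΦ1 i).ray hp
  have w2 := flux_tendsto_zero fun i => (hΦ2 i).ray hp
  have key := ((hT.sub hP).sub w1).sub w2
  rw [sub_self, sub_zero, sub_zero] at key
  refine ⟨-A, -P, by simp [hP0], key.congr' ?_⟩
  have fl : ∀ a b : E3, a ≠ b → ‖a‖ ≤ ‖p‖ → (∀ x, x ≠ a → x ≠ b → x ≠ p.1 ∧ x ≠ p.2) →
      ∀ᶠ ε in N0, flux (fun i z => φ z * pd i (σ 2) z - σ 2 z * pd i φ z) a ε =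
        flux (residualField p (σ 2)) a ε + flux (srcField p) a ε := by
    intro a b hab ha hoff
    filter_upwards [eventually_off_ray a b hab, Ioo_mem_nhdsGT one_pos] with ε h1 hε
    have ho : ∀ n, Dir n → a + ε • n ≠ p.1 ∧ a + ε • n ≠ p.2 := fun n hn =>
      hoff _ (h1 n hn).1 (h1 n hn).2
    rw [← flux_add
      (fun i n hn => (smooth_residualField hp h (ho n hn).1 (ho n hn).2 i).continuousAt)
      fun i n hn => ((nice_srcField i).smooth.at ⟨hp, (ho n hn).1, (ho n hn).2⟩).continuousAt]
    refine flux_congr fun n hn i => ?_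
    have hx : dist (a + ε • n) 0 < ‖p‖ + 1 := by
      linarith [dist_triangle (a + ε • n) a 0, dist_zero_right a, dist_add_smul (a := a) hε.1.le hn,
        hε.2]
    have h1 : φ =ᶠ[𝓝 (a + ε • n)] fun _ => 1 := by
      filter_upwards [isOpen_ball.mem_nhds (mem_ball.2 hx)] with z hz using c1 z (mem_ball.1 hz).le
    rw [pd_congr h1, pd_const, h1.eq_of_nhds, residualField]
    ring
  filter_upwards [fl p.1 p.2 hp (norm_fst_le p) fun x a b => ⟨a, b⟩,
    fl p.2 p.1 hp.symm (norm_snd_le p) fun x a b => ⟨b, a⟩, self_mem_nhdsWithin] with ε e1 e2 hε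
  have e3 : ∫ x in {x : E3 | ε ≤ dist x p.1 ∧ ε ≤ dist x p.2}, source p.1 p.2 σ 1 x * φ x =
      ∫ x in outside p ε, lap (σ 2) x * φ x :=
    setIntegral_congr_fun (measurableSet_outside p ε) fun x hx => by
      obtain ⟨h1, h2⟩ := outside_ne hε hx
      simp only [source_one hp h h1 h2, lap_sigma_two hp h h1 h2]
  rw [e1, e2, e3, Polynomial.eval_neg]
  ring

lemma exists_residual_bound {K : Set (E6)} (hK : IsCompact K) (hK0 : ∀ p ∈ K, p.1 ≠ p.2) :
    ∃ C, ∀ p ∈ K, ∀ (α1 α2 : ℝ) (σ : ℕ → Fn) (L : ℝ), 0 ≤ α1 → 0 ≤ α2 →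
      IsPerturbativeSolution p.1 p.2 α1 α2 2 σ →
      Tendsto (flux (residualField p (σ 2)) 0) atTop (𝓝 L) → |L| ≤ C * (α1 + α2) := by
  obtain ⟨δ, ⟨⟨C1, h1⟩, C2, h2⟩, hδ⟩ := (((nice_src1.integral_outside hK hK0).and
    (nice_src2.integral_outside hK hK0)).and self_mem_nhdsWithin).exists
  have hδ : 0 < δ := hδ
  set C := max C1 C2
  refine ⟨4 * π * C * δ + C, fun p hp α1 α2 σ L ha1 ha2 h hL => ?_⟩
  obtain ⟨hpn, b1, A1, i1⟩ := h1 p hp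
  obtain ⟨-, b2, A2, i2⟩ := h2 p hp
  have hp0 := hK0 p hp
  have hr : 0 < δ⁻¹ := inv_pos.2 hδ
  have off : ∀ r, δ⁻¹ ≤ r → ∀ n, Dir n → r • n ≠ p.1 ∧ r • n ≠ p.2 := by
    intro r hr' n hn
    have : ‖r • n‖ = r := by rw [norm_smul, hn, mul_one, Real.norm_of_nonneg (hr.le.trans hr')]
    exact ⟨fun e => by linarith [norm_fst_le p, congrArg norm e],
      fun e => by linarith [norm_snd_le p, congrArg norm e]⟩
  obtain ⟨L', hL', hb⟩ := exists_flux_limit (V := residualField p (σ 2)) (C := C * (α1 + α2)) hr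
    (fun i r hr' n hn => smooth_residualField hp0 h (off r hr' n hn).1 (off r hr' n hn).2 i)
    fun r hr' n hn => by
      rw [div_residualField hp0 h (off r hr' n hn).1 (off r hr' n hn).2]
      refine (abs_add_le _ _).trans ?_
      rw [abs_mul, abs_mul, abs_of_nonneg ha1, abs_of_nonneg ha2]
      have e1 := (b1 r hr' n hn).trans (mul_le_mul_of_nonneg_right (le_max_left C1 C2)
        (by positivity : 0 ≤ (r ^ 4)⁻¹))
      have e2 := (b2 r hr' n hn).trans (mul_le_mul_of_nonneg_right (le_max_right C1 C2)
        (by positivity : 0 ≤ (r ^ 4)⁻¹))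
      linarith [mul_le_mul_of_nonneg_left e1 ha1, mul_le_mul_of_nonneg_left e2 ha2]
  obtain rfl := tendsto_nhds_unique hL hL'
  have key := (hasFinitePart_flux_residualField hp0 h).abs_sub_le (L' := L)
    (A' := -(α1 * A1 + α2 * A2)) (C := (4 * π * C * δ + C) * (α1 + α2)) ?_
  · rwa [zero_sub, abs_neg] at key
  have hR := r12_pos hp0
  filter_upwards [Ioo_mem_nhdsGT (show 0 < r12 p / 8 by positivity), Ioo_mem_nhdsGT hδ] with ε hε hε'
  have k := integral_div_ball (V := residualField p (σ 2)) (r := δ⁻¹) hp0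
    (fun i x h1 h2 => smooth_residualField hp0 h h1 h2 i) hε (by linarith [hε'.2])
  obtain ⟨j1, l1⟩ := i1 ε hε.1 hε'.2.le
  obtain ⟨j2, l2⟩ := i2 ε hε.1 hε'.2.le
  rw [setIntegral_congr_fun ((measurableSet_outside p ε).inter measurableSet_ball) fun x hx =>
    div_residualField hp0 h (outside_ne hε.1 hx.1).1 (outside_ne hε.1 hx.1).2,
    integral_add (j1.const_mul α1) (j2.const_mul α2), integral_const_mul, integral_const_mul] at k
  have l3 := hb δ⁻¹ le_rfl
  rw [inv_inv] at l3
  have l1' := mul_le_mul_of_nonneg_left (l1.trans (le_max_left C1 C2)) ha1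
  have l2' := mul_le_mul_of_nonneg_left (l2.trans (le_max_right C1 C2)) ha2
  rw [← abs_of_nonneg ha1, ← abs_mul, abs_of_nonneg ha1] at l1'
  rw [← abs_of_nonneg ha2, ← abs_mul, abs_of_nonneg ha2] at l2'
  rw [abs_le] at *
  constructor <;> linarith [l1'.1, l1'.2, l2'.1, l2'.2, l3.1, l3.2]

lemma betaCoeff_zero_eq (f : ℝ → ℝ) : betaCoeff 0 f = f 0 := by simp [betaCoeff]

lemma betaCoeff_one_eq {f : ℝ → ℝ} {d : ℝ} (h : HasDerivAt f d 0) : betaCoeff 1 f = d := by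
  simp [betaCoeff, h.deriv]

/-- The inversion in the unit sphere. -/
def kelvin (ρ : E3) : E3 := (‖ρ‖ ^ 2)⁻¹ • ρ

lemma contDiffAt_kelvin {ρ : E3} (h : ρ ≠ 0) : SmoothAt kelvin ρ :=
  ((contDiffAt_id.norm_sq ℝ).inv (pow_ne_zero 2 (norm_ne_zero_iff.2 h))).smul contDiffAt_id

section Directions

variable {n : E3} {r : ℝ}

lemma kelvin_smul (hn : Dir n) (hr : 0 < r) : kelvin (r • n) = r⁻¹ • n := by
  rw [kelvin, norm_smul, hn, mul_one, Real.norm_of_nonneg hr.le, smul_smul]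
  congr 1; field_simp

lemma smul_ne (hn : Dir n) (hr : 0 < r) : r • n ≠ 0 := by
  rw [← norm_ne_zero_iff, norm_smul, hn, mul_one, Real.norm_of_nonneg hr.le]; exact hr.ne'

lemma pd_kelvin (hn : Dir n) (hr : 0 < r) (i k : Fin 3) :
    pd i (fun z => kelvin z k) (r • n) = (r ^ 2)⁻¹ * (δ i k - 2 * n i * n k) := by
  have h0 := smul_ne hn hr
  have h := (((hasPD_dist h0).pow 2).inv (by simpa using h0)).mul (HasPD.coord k)
  have e : (fun z : E3 => kelvin z k) = fun z => (dist z 0 ^ 2)⁻¹ * z k := by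
    funext z; simp [kelvin]
  have hd : dist (r • n) 0 = r := by simp [norm_smul, hn, abs_of_pos hr]
  rw [e, h.2 i, hd]
  by_cases hik : i = k
  · subst hik; simp [δ]; field_simp; ring
  · simp [δ, hik]; field_simp

lemma angular_euler {Z : Fn} (hn : Dir n) (hr : 0 < r)
    (hz : DiffAt (fun z : E3 => Z (‖z‖⁻¹ • z)) (r • n)) :
    ∑ i, n i * pd i (fun z : E3 => Z (‖z‖⁻¹ • z)) (r • n) = 0 := by
  rw [← fderiv_eq_sum_pd]
  have hl : HasDerivAt (fun s : ℝ => s • n) n r := by simpa using (hasDerivAt_id r).smul_const n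
  have h1 := hz.hasFDerivAt.comp_hasDerivAt r hl
  refine h1.unique ((hasDerivAt_const r (Z n)).congr_of_eventuallyEq ?_)
  filter_upwards [lt_mem_nhds hr] with s hs
  simp [norm_smul, hn, abs_of_pos hs, smul_smul, inv_mul_cancel₀ hs.ne']

end Directions

section Algebra

variable {A B M s : Fin 3 → Fin 3 → ℝ} {n g : Fin 3 → ℝ} {κ m τ P Q : ℝ}

/-- The components of the pullback of a metric. -/
def pullback (A B M : Fin 3 → Fin 3 → ℝ) (i j : Fin 3) : ℝ := ∑ k, ∑ l, A i k * B j l * M k l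

lemma pullback_radial : ∑ i, ∑ j, n i * n j * pullback A B M i j =
    ∑ k, ∑ l, (∑ i, n i * A i k) * (∑ j, n j * B j l) * M k l := by
  simp only [pullback, Fin.sum_univ_three]; ring

lemma pullback_trace : ∑ i, pullback A B M i i = ∑ k, ∑ l, (∑ i, A i k * B i l) * M k l := by
  simp only [pullback, Fin.sum_univ_three]; ring

lemma sum_reflection (hn : ∑ i, n i * n i = 1) (k : Fin 3) :
    ∑ i, n i * (κ * (δ i k - 2 * n i * n k)) = -κ * n k := by
  have : ∑ i, n i * (κ * (δ i k - 2 * n i * n k)) =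
      κ * ∑ i, δ k i * n i - 2 * κ * n k * ∑ i, n i * n i := by
    rw [mul_sum, mul_sum, ← sum_sub_distrib]
    refine sum_congr rfl fun i _ => ?_
    rw [show δ i k = δ k i by simp [δ, eq_comm]]; ring
  rw [this, hn, sum_δ_mul_left]; ring

lemma sum_reflection_mul (hn : ∑ i, n i * n i = 1) (k l : Fin 3) :
    ∑ i, κ * (δ i k - 2 * n i * n k) * (m * (δ i l - 2 * n i * n l)) = κ * m * δ k l := by
  have h := sum_reflection (κ := m) hn l
  have : ∑ i, κ * (δ i k - 2 * n i * n k) * (m * (δ i l - 2 * n i * n l)) =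
      κ * (∑ i, δ k i * (m * (δ i l - 2 * n i * n l)))
        - 2 * κ * n k * ∑ i, n i * (m * (δ i l - 2 * n i * n l)) := by
    rw [mul_sum, mul_sum, ← sum_sub_distrib]
    refine sum_congr rfl fun i _ => ?_
    rw [show δ i k = δ k i by simp [δ, eq_comm]]; ring
  rw [this, h, sum_δ_mul_left]; ring

lemma sum_mul_δ (f : Fin 3 → Fin 3 → ℝ) : ∑ k, ∑ l, f k l * (P * δ k l) = P * ∑ k, f k k := by
  simp [δ, mul_sum, mul_comm]

lemma pullback_inversion (hn : ∑ i, n i * n i = 1) (hg : ∑ i, n i * g i = 0)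
    (hs : ∑ k, s k k = 0) (hA : A = fun i k => κ * (δ i k - 2 * n i * n k))
    (hB : B = fun i k => g i * (τ * n k) + m * (δ i k - 2 * n i * n k)) :
    (∑ i, ∑ j, n i * n j * pullback A A (fun k l => P * δ k l) i j = κ ^ 2 * P ∧
      ∑ i, pullback A A (fun k l => P * δ k l) i i = 3 * (κ ^ 2 * P)) ∧
    (∑ i, ∑ j, n i * n j * pullback A A s i j = κ ^ 2 * ∑ i, ∑ j, s i j * n i * n j ∧
      ∑ i, pullback A A s i i = 0) ∧
    (∑ i, ∑ j, n i * n j * pullback A B (fun k l => P * δ k l) i j = κ * m * P ∧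
      ∑ i, pullback A B (fun k l => P * δ k l) i i = 3 * (κ * m * P)) := by
  have a1 : ∀ k, ∑ i, n i * A i k = -κ * n k := by subst hA; exact sum_reflection hn
  have b1 : ∀ k, ∑ i, n i * B i k = -m * n k := by
    intro k
    have := sum_reflection (κ := m) hn k
    subst hB
    simp only [mul_add, sum_add_distrib, this]
    simp only [← mul_assoc, ← sum_mul, hg]; ring
  have a2 : ∀ k l, ∑ i, A i k * A i l = κ ^ 2 * δ k l := by
    subst hA; intro k l; rw [sum_reflection_mul hn]; ring
  have ab : ∀ k, ∑ i, A i k * B i k = -κ * n k * (τ * n k) * 0 + (∑ i, A i k * g i) * (τ * n k)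
      + κ * m * δ k k := by
    intro k
    have := sum_reflection_mul (κ := κ) (m := m) hn k k
    subst hA hB
    simp only [mul_add, sum_add_distrib, this, sum_mul]
    simp only [mul_assoc, mul_zero, zero_add]
  have c1 : ∑ k, (∑ i, A i k * g i) * (τ * n k) = 0 := by
    have h : ∀ i, ∑ k, A i k * n k = -κ * n i := fun i => by
      rw [← a1 i]
      refine sum_congr rfl fun k _ => ?_
      subst hA; simp only [δ, eq_comm (a := i)]; ring
    calc _ = τ * ∑ i, g i * ∑ k, A i k * n k := by simp only [Fin.sum_univ_three]; ring
      _ = -τ * κ * ∑ i, n i * g i := by simp only [h, Fin.sum_univ_three]; ring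
      _ = 0 := by rw [hg, mul_zero]
  have n2 : ∀ c d : ℝ, ∑ k, c * n k * (d * n k) = c * d := fun c d => by
    rw [← mul_one (c * d), ← hn, mul_sum]
    exact sum_congr rfl fun k _ => by ring
  have d3 : ∑ k : Fin 3, δ k k = 3 := by simp [δ]
  refine ⟨⟨?_, ?_⟩, ⟨?_, ?_⟩, ?_, ?_⟩
  · rw [pullback_radial, sum_mul_δ]; simp only [a1, n2]; ring
  · rw [pullback_trace, sum_mul_δ]; simp only [a2, ← mul_sum, d3]; ring
  · rw [pullback_radial]; simp only [a1, mul_sum]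
    exact sum_congr rfl fun k _ => sum_congr rfl fun l _ => by ring
  · rw [pullback_trace]
    simp only [a2, mul_assoc, ← mul_sum, sum_δ_mul_left, hs, mul_zero]
  · rw [pullback_radial, sum_mul_δ]; simp only [a1, b1, n2]; ring
  · rw [pullback_trace, sum_mul_δ]
    simp only [ab, sum_add_distrib, c1, ← mul_sum, d3, mul_zero,
      Finset.sum_const_zero]; ring

lemma pullback_symm_trace (hM : ∀ k l, M k l = M l k) (i j : Fin 3) :
    pullback B A M i j = pullback A B M j i := by
  rw [pullback, sum_comm]
  exact sum_congr rfl fun k _ => sum_congr rfl fun l _ => by rw [hM l k]; ring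

end Algebra

lemma FstJet.of_smooth {F : RFn} {n : E3} (h : SmoothAt F (0, n)) :
    FstJet (fun t => F (t, n)) (F (0, n)) (dfst F (0, n)) :=
  ⟨rfl, hasDerivAt_dfst (q := (0, n)) (diffAt h)⟩

lemma FstJet.dfst_scale {F : RFn} {n : E3} {v d k : ℝ}
    (h : SmoothAt (fun q : ℝ × E3 => F (k * q.1, q.2)) (0, n))
    (hF : FstJet (fun t => F (t, n)) v d) :
    dfst (fun q : ℝ × E3 => F (k * q.1, q.2)) (0, n) = k * d := by
  have h1 : HasDerivAt (fun t : ℝ => k * t) k 0 := by simpa using (hasDerivAt_id (0 : ℝ)).const_mul k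
  have h2 : HasDerivAt (fun t => F (t, n)) d (k * 0) := by simpa using hF.deriv
  have := (hasDerivAt_dfst (q := (0, n)) (diffAt h)).unique (h2.comp 0 h1)
  rw [this, mul_comm]

section Hole

variable {α1 α2 α c G : ℝ} {y1 y2 ρ n : E3} {Z : Fn}

lemma norm_direction (hρ : ρ ≠ 0) : ‖‖ρ‖⁻¹ • ρ‖ = 1 := by
  rw [norm_smul, norm_inv, norm_norm, inv_mul_cancel₀ (norm_ne_zero_iff.2 hρ)]

lemma inversion_zero (hl : ∀ n, Dir n → leadingCoeff p.1 (σ 0) n = α) (hρ : ρ ≠ 0) (β : ℝ) :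
    inversion p.1 σ 0 β ρ = p.1 + α ^ 2 • kelvin ρ := by
  simp [inversion, partialSum, kelvin, hl _ (norm_direction hρ), smul_smul, div_eq_mul_inv]

lemma inversion_one (hl : ∀ n, Dir n → leadingCoeff p.1 (σ 0) n = α)
    (hl' : ∀ n, Dir n → leadingCoeff p.1 (σ 1) n = Z n) (hρ : ρ ≠ 0) (β : ℝ) :
    inversion p.1 σ 1 β ρ = p.1 + (α + β * Z (‖ρ‖⁻¹ • ρ)) ^ 2 • kelvin ρ := by
  simp [inversion, partialSum, sum_range_succ, kelvin, hl _ (norm_direction hρ),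
    hl' _ (norm_direction hρ), smul_smul, div_eq_mul_inv]

lemma contDiffAt_angular (hZ : ∀ n, Dir n → SmoothAt Z n) (hρ : ρ ≠ 0) :
    SmoothAt (fun z : E3 => Z (‖z‖⁻¹ • z)) ρ :=
  ContDiffAt.comp (g := Z) (f := fun z : E3 => ‖z‖⁻¹ • z) ρ (hZ _ (norm_direction hρ))
    (((contDiffAt_norm ℝ hρ).inv (norm_ne_zero_iff.2 hρ)).smul contDiffAt_id)

lemma contDiffAt_kelvin_coord (hρ : ρ ≠ 0) (k : Fin 3) :
    SmoothAt (fun z => kelvin z k) ρ :=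
  ContDiffAt.comp (g := fun z : E3 => z k) ρ (contDiff_coord k).contDiffAt (contDiffAt_kelvin hρ)

/-- The derivative of the unperturbed inversion. -/
def invJac (α : ℝ) (ρ : E3) (i k : Fin 3) : ℝ := α ^ 2 * pd i (fun z => kelvin z k) ρ

/-- The first-order perturbation of the derivative of the inversion. -/
def invJac1 (α : ℝ) (Z : Fn) (ρ : E3) (i k : Fin 3) : ℝ :=
  2 * α * pd i (fun z : E3 => Z (‖z‖⁻¹ • z)) ρ * kelvin ρ k
    + 2 * α * Z (‖ρ‖⁻¹ • ρ) * pd i (fun z => kelvin z k) ρ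

lemma pd_inversion_zero (hl : ∀ n, Dir n → leadingCoeff p.1 (σ 0) n = α) (hρ : ρ ≠ 0) (β : ℝ)
    (i k : Fin 3) : pd i (fun z => inversion p.1 σ 0 β z k) ρ = invJac α ρ i k := by
  have h : (fun z => inversion p.1 σ 0 β z k) =ᶠ[𝓝 ρ] fun z => p.1 k + α ^ 2 * kelvin z k := by
    filter_upwards [isOpen_ne.mem_nhds hρ] with z hz
    simp [inversion_zero hl hz]
  have hd := diffAt (contDiffAt_kelvin_coord hρ k)
  rw [pd_congr h, pd_add (differentiableAt_const _) (hd.const_mul _), pd_const, pd_const_mul _ hd,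
    zero_add, invJac]

lemma hasDerivAt_pd_inversion (hl : ∀ n, Dir n → leadingCoeff p.1 (σ 0) n = α)
    (hl' : ∀ n, Dir n → leadingCoeff p.1 (σ 1) n = Z n)
    (hZ : ∀ n, Dir n → SmoothAt Z n) (hρ : ρ ≠ 0) (i k : Fin 3) :
    pd i (fun z => inversion p.1 σ 1 0 z k) ρ = invJac α ρ i k ∧
    HasDerivAt (fun β => pd i (fun z => inversion p.1 σ 1 β z k) ρ) (invJac1 α Z ρ i k) 0 := by
  have hz : HasPD _ ρ _ := ⟨diffAt (contDiffAt_angular hZ hρ), fun k => rfl⟩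
  have hk : HasPD _ ρ _ := ⟨diffAt (contDiffAt_kelvin_coord hρ k), fun _ => rfl⟩
  have h : ∀ β, pd i (fun z => inversion p.1 σ 1 β z k) ρ = invJac α ρ i k + β * invJac1 α Z ρ i k
      + β ^ 2 * (2 * Z (‖ρ‖⁻¹ • ρ) * pd i (fun z : E3 => Z (‖z‖⁻¹ • z)) ρ * kelvin ρ k
        + Z (‖ρ‖⁻¹ • ρ) ^ 2 * pd i (fun z => kelvin z k) ρ) := by
    intro β
    have e := (HasPD.const (x := ρ) (p.1 k)).add ((((HasPD.const α).add (hz.const_mul β)).pow 2).mul hk)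
    rw [(e.congr (f' := fun z => inversion p.1 σ 1 β z k) (by
      filter_upwards [isOpen_ne.mem_nhds hρ] with z hz
      simp [inversion_one hl hl' hz]) fun _ => rfl).2 i, invJac, invJac1]
    ring
  refine ⟨by simpa using h 0, ?_⟩
  simp only [h]
  have := (((hasDerivAt_id (0 : ℝ)).mul_const (invJac1 α Z ρ i k)).const_add (invJac α ρ i k)).fun_add
    (((hasDerivAt_id (0 : ℝ)).pow 2).mul_const (2 * Z (‖ρ‖⁻¹ • ρ) * pd i (fun z : E3 =>
      Z (‖z‖⁻¹ • z)) ρ * kelvin ρ k + Z (‖ρ‖⁻¹ • ρ) ^ 2 * pd i (fun z => kelvin z k) ρ))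
  simpa using this

lemma invertedMetricCoeff_zero (hl : ∀ n, Dir n → leadingCoeff p.1 (σ 0) n = α) (hρ : ρ ≠ 0)
    (i j : Fin 3) : invertedMetricCoeff y1 y2 p.1 σ 0 ρ i j =
      pullback (invJac α ρ) (invJac α ρ) (fun k l => σ 0 (p.1 + α ^ 2 • kelvin ρ) ^ 4 * δ k l) i j := by
  simp only [invertedMetricCoeff, Matrix.of_apply, betaCoeff_zero_eq, invertedMetric, pullback,
    pd_inversion_zero hl hρ, physMetric_apply, inversion_zero hl hρ]
  simp [partialSum]

/-- The first-order perturbation of the fourth power of the conformal factor, along the perturbed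
inversion. -/
def invFactor1 (α : ℝ) (Z : Fn) (p : E6) (σ : ℕ → Fn) (ρ : E3) : ℝ :=
  4 * σ 0 (p.1 + α ^ 2 • kelvin ρ) ^ 3 * (σ 1 (p.1 + α ^ 2 • kelvin ρ)
    + 2 * α * Z (‖ρ‖⁻¹ • ρ) * ∑ k, kelvin ρ k * pd k (σ 0) (p.1 + α ^ 2 • kelvin ρ))

lemma invertedMetricCoeff_one (hl : ∀ n, Dir n → leadingCoeff p.1 (σ 0) n = α)
    (hl' : ∀ n, Dir n → leadingCoeff p.1 (σ 1) n = Z n)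
    (hZ : ∀ n, Dir n → SmoothAt Z n) (hρ : ρ ≠ 0)
    (h0 : DiffAt (σ 0) (p.1 + α ^ 2 • kelvin ρ))
    (h1 : DiffAt (σ 1) (p.1 + α ^ 2 • kelvin ρ))
    {s : Fin 3 → Fin 3 → Fn}
    (hs : ∀ k l, DiffAt (s k l) (p.1 + α ^ 2 • kelvin ρ))
    (hss : ∀ k l, (fun x => seed y1 y2 x k l) =ᶠ[𝓝 (p.1 + α ^ 2 • kelvin ρ)] s k l) (i j : Fin 3) :
    invertedMetricCoeff y1 y2 p.1 σ 1 ρ i j =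
      pullback (invJac1 α Z ρ) (invJac α ρ) (fun k l => σ 0 (p.1 + α ^ 2 • kelvin ρ) ^ 4 * δ k l) i j
      + pullback (invJac α ρ) (invJac1 α Z ρ)
        (fun k l => σ 0 (p.1 + α ^ 2 • kelvin ρ) ^ 4 * δ k l) i j
      + (pullback (invJac α ρ) (invJac α ρ) (fun k l => invFactor1 α Z p σ ρ * δ k l) i j
        + σ 0 (p.1 + α ^ 2 • kelvin ρ) ^ 4 * pullback (invJac α ρ) (invJac α ρ)
          (fun k l => s k l (p.1 + α ^ 2 • kelvin ρ)) i j) := by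
  set X := p.1 + α ^ 2 • kelvin ρ with hX
  let x : ℝ → E3 := fun β => p.1 + (α + β * Z (‖ρ‖⁻¹ • ρ)) ^ 2 • kelvin ρ
  have hx0 : x 0 = X := by simp [x, hX]
  have hx : HasDerivAt x ((2 * α * Z (‖ρ‖⁻¹ • ρ)) • kelvin ρ) 0 := by
    have := (((((hasDerivAt_id (0 : ℝ)).mul_const (Z (‖ρ‖⁻¹ • ρ))).const_add α).pow 2).smul_const
      (kelvin ρ)).const_add p.1
    refine this.congr_deriv ?_
    simp
  have d0 : HasDerivAt (fun β => σ 0 (x β)) (2 * α * Z (‖ρ‖⁻¹ • ρ) * ∑ k, kelvin ρ k * pd k (σ 0) X)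
      0 := by
    have := HasFDerivAt.comp_hasDerivAt (0 : ℝ) (by rw [hx0]; exact h0.hasFDerivAt) hx
    rwa [map_smul, fderiv_eq_sum_pd, smul_eq_mul] at this
  have dl : ∀ f : Fn, DiffAt f X → HasDerivAt (fun β => β * f (x β)) (f X) 0 := by
    intro f hf
    have := (hasDerivAt_id (0 : ℝ)).mul (HasFDerivAt.comp_hasDerivAt (0 : ℝ)
      (by rw [hx0]; exact hf.hasFDerivAt) hx)
    simpa [hx0, Function.comp_def, Pi.mul_def] using this
  have dm : ∀ k l, HasDerivAt (fun β => physMetric y1 y2 σ 1 β (inversion p.1 σ 1 β ρ) k l)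
      (invFactor1 α Z p σ ρ * δ k l + σ 0 X ^ 4 * s k l X) 0 := by
    intro k l
    have h := ((d0.fun_add (dl _ h1)).fun_pow 4).fun_mul ((dl _ (hs k l)).const_add (δ k l))
    have h' : HasDerivAt (fun β => (σ 0 (x β) + β * σ 1 (x β)) ^ 4 * (δ k l + β * s k l (x β)))
      (invFactor1 α Z p σ ρ * δ k l + σ 0 X ^ 4 * s k l X) 0 := by
      refine h.congr_deriv ?_
      simp only [hx0, invFactor1, ← hX, zero_mul, add_zero, Nat.cast_ofNat, Nat.reduceSub]
      ring
    refine h'.congr_of_eventuallyEq ?_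
    have hev := hx.continuousAt.eventually (by rw [hx0]; exact hss k l)
    filter_upwards [hev] with β hβ
    rw [inversion_one hl hl' hρ, physMetric_apply]
    simp only [partialSum, sum_range_succ, Finset.range_zero, Finset.sum_empty, pow_zero,
      one_mul, zero_add, pow_one]
    change _ * (_ + β * seed y1 y2 (x β) k l) = _
    rw [hβ]
  have e0 : ∀ k l, physMetric y1 y2 σ 1 0 (inversion p.1 σ 1 0 ρ) k l = σ 0 X ^ 4 * δ k l := by
    intro k l
    rw [inversion_one hl hl' hρ, physMetric_apply]
    simp [partialSum, sum_range_succ, hX]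
  have key : HasDerivAt (fun β => invertedMetric y1 y2 p.1 σ 1 β ρ i j) (∑ k, ∑ l,
      ((invJac1 α Z ρ i k * invJac α ρ j l + invJac α ρ i k * invJac1 α Z ρ j l) * (σ 0 X ^ 4 * δ k l)
        + invJac α ρ i k * invJac α ρ j l * (invFactor1 α Z p σ ρ * δ k l + σ 0 X ^ 4 * s k l X))) 0 := by
    simp only [invertedMetric, Matrix.of_apply]
    refine HasDerivAt.fun_sum fun k _ => HasDerivAt.fun_sum fun l _ => ?_
    obtain ⟨a, a'⟩ := hasDerivAt_pd_inversion hl hl' hZ hρ i k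
    obtain ⟨b, b'⟩ := hasDerivAt_pd_inversion hl hl' hZ hρ j l
    have := (a'.fun_mul b').fun_mul (dm k l)
    rwa [a, b, e0] at this
  rw [invertedMetricCoeff, Matrix.of_apply, betaCoeff_one_eq key]
  simp only [pullback, mul_sum, ← sum_add_distrib]
  exact sum_congr rfl fun k _ => sum_congr rfl fun l _ => by ring

end Hole

section HoleMass

variable {α1 α2 α c G : ℝ} {y1 y2 ρ n : E3} {h : TensorField}

attribute [local fun_prop] contDiff_coord

lemma contDiffAt_pullback {A B M : E3 → Fin 3 → Fin 3 → ℝ}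
    (hA : ∀ i k, SmoothAt (fun z => A z i k) ρ) (hB : ∀ i k, SmoothAt (fun z => B z i k) ρ)
    (hM : ∀ i k, SmoothAt (fun z => M z i k) ρ) (i j : Fin 3) :
    SmoothAt (fun z => pullback (A z) (B z) (M z) i j) ρ :=
  ContDiffAt.sum fun k _ => ContDiffAt.sum fun l _ => ((hA i k).mul (hB j l)).mul (hM k l)

lemma hasSurfaceMass_inverted {X S : RFn} (hα : 0 < α)
    (hh : ∀ᶠ r : ℝ in atTop, ∀ i j, ∀ n, Dir n →
      SmoothAt (fun z => h z i j) (r • n))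
    (hX : ∀ n, Dir n → SmoothAt X (0, n))
    (hS : ∀ n, Dir n → SmoothAt S (0, n))
    (he : ∀ᶠ r : ℝ in atTop, ∀ n, Dir n →
      ∑ i, ∑ j, n i * n j * h (r • n) i j = X (α ^ 2 * r⁻¹, n) + S (α ^ 2 * r⁻¹, n) ∧
      ∑ i, h (r • n) i i = 3 * X (α ^ 2 * r⁻¹, n))
    (h0 : ∫ n, S (0, n.1) ∂sph = 0) {f : Fn}
    (hf : ∀ n, Dir n → ∃ v, FstJet (fun t => X (t, n) + S (t, n)) v (f n)) :
    HasSurfaceMass c G h (c ^ 2 / (16 * π * G) * (2 * ∫ n, α ^ 2 * f n.1 ∂sph)) := by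
  have sc : ∀ {F : RFn}, (∀ n, Dir n → SmoothAt F (0, n)) →
      ∀ n, Dir n → SmoothAt (fun q : ℝ × E3 => F (α ^ 2 * q.1, q.2)) (0, n) :=
    fun {F} hF n hn => ContDiffAt.comp (g := F) (f := fun q : ℝ × E3 => (α ^ 2 * q.1, q.2)) (0, n)
      (by simpa using hF n hn) ((contDiffAt_const.mul contDiffAt_fst).prodMk contDiffAt_snd)
  have hXS : ∀ n, Dir n → SmoothAt (fun q => X q + S q) (0, n) := fun n hn =>
    (hX n hn).add (hS n hn)
  have he' := tendsto_inv_nhdsGT_zero.eventually he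
  have key := hasSurfaceMass_of_expansion (c := c) (G := G) hh (sc hXS)
    (sc fun n hn => contDiffAt_const.mul (hX n hn))
    (he'.mono fun t ht n hn => by simpa using (ht n hn).1)
    (he'.mono fun t ht n hn => by simpa using (ht n hn).2) ?_
  · convert key using 5 with n
    obtain ⟨v, hv⟩ := hf n (dir n)
    exact (hv.dfst_scale (F := fun q => X q + S q) (sc hXS n (dir n))).symm
  · have e : ∀ n : S2, 3 * (X (0, n.1) + S (0, n.1))
        - 3 * X (0, n.1) = 3 * S (0, n.1) := fun n => by ring
    simp only [mul_zero, e, integral_const_mul, h0]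

lemma exists_ray_brillLindquist_fst (hp : p.1 ≠ p.2) (α1 α2 : ℝ) :
    ∃ Φ, Ray 1 p.1 (-1) (brillLindquist p.1 p.2 α1 α2) Φ ∧ ∀ n, Dir n →
      Φ (0, n) = α1 ∧ dfst Φ (0, n) = 1 + α2 / r12 p := by
  obtain ⟨Φ, hΦ⟩ := (nice_brillLindquist α1 α2).fst
  have hr := hΦ.ray hp
  beta_reduce at hr
  rw [← brillLindquist_eq] at hr
  refine ⟨_, hr, fun n hn => ?_⟩
  have C := @FstJet.const
  refine hr.fstJet hn (((FstJet.id.mul ((C 1).add ((C α2).mul ((fstJet_farDist (n := n) hp).inv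
    (r12_pos hp).ne')))).add (C α1)).of_eq ?_ ?_) ?_
  · ring
  · ring
  · filter_upwards [self_mem_nhdsWithin] with t ht
    obtain ⟨e1, e2, -⟩ := ray_fst hp hn ht
    have ht' : (t : ℝ) ≠ 0 := ne_of_gt ht
    rw [brillLindquist_eq]
    simp only [zpow_one, zpow_neg, e1, e2]
    field_simp; ring

lemma tendsto_inverted_radius (hα : 0 < α) :
    Tendsto (fun r : ℝ => α ^ 2 * r⁻¹) atTop N0 := by
  refine tendsto_nhdsWithin_iff.2 ⟨by simpa using tendsto_inv_atTop_zero.const_mul (α ^ 2), ?_⟩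
  filter_upwards [eventually_gt_atTop 0] with r hr
  exact mul_pos (by positivity) (inv_pos.2 hr)

lemma invPoint_smul (hn : Dir n) {r : ℝ} (hr : 0 < r) :
    p.1 + α ^ 2 • kelvin (r • n) = p.1 + (α ^ 2 * r⁻¹) • n := by
  rw [kelvin_smul hn hr, smul_smul]

lemma contDiffAt_invPoint (hρ : ρ ≠ 0) :
    SmoothAt (fun z => p.1 + α ^ 2 • kelvin z) ρ :=
  ContDiffAt.comp (g := fun x : E3 => p.1 + α ^ 2 • x) ρ (by fun_prop) (contDiffAt_kelvin hρ)

lemma contDiffAt_comp_invPoint {f : Fn} (hρ : ρ ≠ 0)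
    (hf : SmoothAt f (p.1 + α ^ 2 • kelvin ρ)) :
    SmoothAt (fun z => f (p.1 + α ^ 2 • kelvin z)) ρ :=
  ContDiffAt.comp (g := f) (f := fun z => p.1 + α ^ 2 • kelvin z) ρ hf
    (contDiffAt_invPoint hρ)

lemma contDiffAt_invJac (hρ : ρ ≠ 0) (i k : Fin 3) : SmoothAt (fun z => invJac α z i k) ρ :=
  contDiffAt_const.mul (contDiffAt_pd (contDiffAt_kelvin_coord hρ k))

lemma eventually_regular (hp : p.1 ≠ p.2) (hα : 0 < α) : ∀ᶠ r : ℝ in atTop, ∀ n, Dir n →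
    ∀ᶠ ρ in 𝓝 (r • n), ρ ≠ 0 ∧ p.1 + α ^ 2 • kelvin ρ ≠ p.1 ∧ p.1 + α ^ 2 • kelvin ρ ≠ p.2 := by
  filter_upwards [(tendsto_inverted_radius hα).eventually (eventually_off_ray _ _ hp),
    eventually_gt_atTop 0] with r hr hr0 n hn
  have h0 := smul_ne hn hr0
  have hc : ContinuousAt (fun ρ => p.1 + α ^ 2 • kelvin ρ) (r • n) :=
    (contDiffAt_invPoint h0).continuousAt
  have := hr n hn
  rw [← invPoint_smul hn hr0] at this
  have ho : ∀ᶠ ρ in 𝓝 (r • n), ρ ≠ 0 := isOpen_ne.mem_nhds h0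
  exact ho.and ((hc.eventually_ne this.1).and (hc.eventually_ne this.2))

lemma sum_mul_self (hn : Dir n) : ∑ i, n i * n i = 1 := by
  have := EuclideanSpace.real_norm_sq_eq n
  rw [hn] at this
  simpa [sq] using this.symm

lemma invJac_smul (hn : Dir n) {r : ℝ} (hr : 0 < r) : invJac α (r • n) =
    fun i k => α ^ 2 * (r ^ 2)⁻¹ * (δ i k - 2 * n i * n k) := by
  funext i k; rw [invJac, pd_kelvin hn hr]; ring

lemma sum_quadratic_swap (n : E3) (M : Fin 3 → Fin 3 → ℝ) :
    ∑ i, ∑ j, n i * n j * M j i = ∑ i, ∑ j, n i * n j * M i j := by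
  simp only [Fin.sum_univ_three]; ring

lemma hole_mass_zero (hp : p.1 ≠ p.2) (hG : G ≠ 0) (hα : 0 < α1)
    (h0 : σ 0 = brillLindquist p.1 p.2 α1 α2)
    (hl : ∀ n, Dir n → leadingCoeff p.1 (σ 0) n = α1) :
    HasSurfaceMass c G (invertedMetricCoeff y1 y2 p.1 σ 0)
      (2 * c ^ 2 / G * (α1 * (1 + α2 / r12 p))) := by
  obtain ⟨Φ, hΦ, hd⟩ := exists_ray_brillLindquist_fst hp α1 α2
  rw [← h0] at hΦ
  have hs : ∀ x, x ≠ p.1 → x ≠ p.2 → SmoothAt (σ 0) x :=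
    fun x h1 h2 => by rw [h0, brillLindquist_eq]; exact smooth_brillLindquist h1 h2
  have key := hasSurfaceMass_inverted (c := c) (G := G) (h := invertedMetricCoeff y1 y2 p.1 σ 0)
    (X := fun q => α1⁻¹ ^ 4 * (Φ q * Φ q * (Φ q * Φ q))) (S := fun _ => 0) hα ?_
    (fun n hn => by have := hΦ.smooth n hn; fun_prop) (fun n hn => contDiffAt_const) ?_
    (by simp) (f := fun _ => 4 * α1⁻¹ * (1 + α2 / r12 p)) fun n hn => ?_
  · convert key using 1
    rw [sphere_integral_const]
    have := Real.pi_ne_zero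
    field_simp; ring
  · filter_upwards [eventually_regular hp hα] with r hr i j n hn
    obtain ⟨a, b, d⟩ := (hr n hn).self_of_nhds
    exact (contDiffAt_pullback (contDiffAt_invJac a) (contDiffAt_invJac a) (fun i k =>
      ((contDiffAt_comp_invPoint a (hs _ b d)).pow 4).mul contDiffAt_const) i j).congr_of_eventuallyEq
        ((hr n hn).mono fun ρ hρ => invertedMetricCoeff_zero hl hρ.1 i j)
  · filter_upwards [(tendsto_inverted_radius hα).eventually hΦ.eq, eventually_gt_atTop 0]
      with r hr hr0 n hn
    obtain ⟨⟨e1, e2⟩, -⟩ := pullback_inversion (n := n) (g := 0) (s := 0) (τ := 0) (m := 0)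
      (P := σ 0 (p.1 + α1 ^ 2 • kelvin (r • n)) ^ 4) (sum_mul_self hn) (by simp) (by simp)
      (invJac_smul (α := α1) hn hr0) rfl
    simp only [invertedMetricCoeff_zero hl (smul_ne hn hr0), e1, e2]
    have := hr n hn
    rw [zpow_one] at this
    rw [invPoint_smul hn hr0, this, zpow_neg_one]
    constructor <;> field_simp <;> ring
  · have j := FstJet.of_smooth (hΦ.smooth n hn)
    rw [(hd n hn).1, (hd n hn).2] at j
    refine ⟨_, (((FstJet.const _).mul ((j.mul j).mul (j.mul j))).add (FstJet.const 0)).of_eq rfl ?_⟩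
    field_simp; ring

lemma hole_mass_one (hp : p.1 ≠ p.2) (hG : G ≠ 0) (hα : 0 < α1)
    (h0 : σ 0 = brillLindquist p.1 p.2 α1 α2)
    (h1 : ∀ x, x ≠ p.1 → x ≠ p.2 → σ 1 x = firstOrder p α1 α2 x)
    (hs : ∀ x, x ≠ p.1 → x ≠ p.2 → ∀ i j, seed y1 y2 x i j = sd i j p x)
    (hl : ∀ n, Dir n → leadingCoeff p.1 (σ 0) n = α1) {U : RFn}
    (hU : Ray 1 p.1 (-1) (firstOrder p α1 α2) U)
    (hl' : ∀ n, Dir n → leadingCoeff p.1 (σ 1) n = U (0, n)) :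
    HasSurfaceMass c G (invertedMetricCoeff y1 y2 p.1 σ 1)
      (2 * c ^ 2 / G * (α1 * (1 / (48 * r12 p ^ 2) - 25 * α2 / (48 * r12 p ^ 3)))) := by
  obtain ⟨Φ, hΦ, hd⟩ := exists_ray_brillLindquist_fst hp α1 α2
  obtain ⟨Ψ, hΨ⟩ : ∃ Ψ : Fin 3 → Fin 3 → RFn, ∀ i j, Ray 1 p.1 0 (sd i j p) (Ψ i j) := by
    choose Ψ hΨ using fun i j => (nice_sd i j).fst
    exact ⟨_, fun i j => (hΨ i j).ray hp⟩
  obtain ⟨Z, hZe⟩ : ∃ Z : Fn, ∀ n, U (0, n) = Z n := ⟨_, fun _ => rfl⟩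
  simp only [hZe] at hl'
  have hZ : ∀ n, Dir n → SmoothAt Z n := fun n hn => by
    rw [← funext hZe]
    exact ContDiffAt.comp (g := U) (f := fun n : E3 => ((0 : ℝ), n)) n (hU.smooth n hn)
      (contDiffAt_const.prodMk contDiffAt_id)
  rw [← h0] at hΦ
  have s0 : ∀ x, x ≠ p.1 → x ≠ p.2 → SmoothAt (σ 0) x :=
    fun x h1 h2 => by rw [h0, brillLindquist_eq]; exact smooth_brillLindquist h1 h2
  have s1 : ∀ x, x ≠ p.1 → x ≠ p.2 → SmoothAt (σ 1) x := fun x h h' =>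
    ((nice_firstOrder α1 α2).smooth.at ⟨hp, h, h'⟩).congr_of_eventuallyEq
      ((eventually_off_point h h').mono fun z hz => h1 z hz.1 hz.2)
  have s2 : ∀ x, x ≠ p.1 → x ≠ p.2 → ∀ i j, SmoothAt (sd i j p) x := fun x h h' i j =>
    (nice_sd i j).smooth.at ⟨hp, h, h'⟩
  have coeff : ∀ ρ, ρ ≠ 0 → p.1 + α1 ^ 2 • kelvin ρ ≠ p.1 → p.1 + α1 ^ 2 • kelvin ρ ≠ p.2 →
      ∀ i j, _ := fun ρ a b d i j =>
    invertedMetricCoeff_one (y1 := y1) (y2 := y2) hl hl' hZ a (diffAt (s0 _ b d))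
      (diffAt (s1 _ b d)) (s := fun k l => sd k l p)
      (fun k l => diffAt (s2 _ b d k l))
      (fun k l => (eventually_off_point b d).mono fun z hz => hs z hz.1 hz.2 k l) i j
  have hq : ∀ i : Fin 3, ∀ q, SmoothAt (fun q : ℝ × E3 => q.2 i) q := fun i q =>
    ((contDiff_coord i).comp contDiff_snd).contDiffAt
  have hΨs : ∀ n, Dir n →
      SmoothAt (fun q => ∑ i, ∑ j, Ψ i j q * q.2 i * q.2 j) (0, n) := fun n hn => by
    have := fun i j => (hΨ i j).smooth n hn
    fun_prop
  have sX : ∀ n, Dir n → SmoothAt Φ (0, n) ∧ SmoothAt U (0, n) ∧ SmoothAt (dfst Φ) (0, n) ∧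
      SmoothAt (fun q : ℝ × E3 => Z q.2) (0, n) := fun n hn =>
    ⟨hΦ.smooth n hn, hU.smooth n hn, contDiffAt_dfst (hΦ.smooth n hn),
      ContDiffAt.comp (g := Z) (0, n) (hZ n hn) contDiffAt_snd⟩
  have hsd : ∀ n, Dir n → _ := fun n hn => sd_data_fst hp hΨ hn
  have hR := (r12_pos hp).ne'
  have key := hasSurfaceMass_inverted (c := c) (G := G) (h := invertedMetricCoeff y1 y2 p.1 σ 1)
    (X := fun q => 4 * α1⁻¹ ^ 4 * (Φ q * Φ q * Φ q) * (U q + 2 * α1⁻¹ * Z q.2 * (q.1 * dfst Φ q))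
      + -4 * α1⁻¹ * Z q.2 * (α1⁻¹ ^ 4 * (Φ q * Φ q * (Φ q * Φ q))))
    (S := fun q => α1⁻¹ ^ 4 * (Φ q * Φ q * (Φ q * Φ q)) * ∑ i, ∑ j, Ψ i j q * q.2 i * q.2 j) hα ?_
    (fun n hn => by obtain ⟨a, b, c, d⟩ := sX n hn; fun_prop)
    (fun n hn => by have := (sX n hn).1; have := hΨs n hn; fun_prop) ?_ ?_
    (f := fun n => 4 * ((1 + α2 / r12 p) * U (0, n) + α1 * dfst U (0, n)) / α1 ^ 2
      + 4 * (1 + α2 / r12 p) / α1 * (∑ i, ∑ j, Ψ i j (0, n) * n i * n j)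
      + dfst (fun q => ∑ i, ∑ j, Ψ i j q * q.2 i * q.2 j) (0, n)) fun n hn => ?_
  · convert key using 1
    have e : ∀ n : S2, α1 ^ 2 * (4 * ((1 + α2 / r12 p) * U (0, n.1)
        + α1 * dfst U (0, n.1)) / α1 ^ 2
        + 4 * (1 + α2 / r12 p) / α1 * (∑ i, ∑ j, Ψ i j (0, n.1) * n.1 i * n.1 j)
        + dfst (fun q => ∑ i, ∑ j, Ψ i j q * q.2 i * q.2 j) (0, n.1)) =
        (4 * α1 * (1 / (48 * r12 p ^ 2) - 25 * α2 / (48 * r12 p ^ 3))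
          - 2 / 3 * (1 + α2 / r12 p) * α1 / r12 p ^ 2 - α1 ^ 2 / (8 * r12 p ^ 3))
        + (-(1 + α2 / r12 p) * α1 / (2 * r12 p ^ 2) - α1 / (6 * r12 p ^ 2)
          - α1 * α2 / (6 * r12 p ^ 3)) * axisCos p n
        + (2 * (1 + α2 / r12 p) * α1 / r12 p ^ 2 + 3 * α1 ^ 2 / (8 * r12 p ^ 3)) * axisCos p n ^ 2
        + 0 * axisCos p n ^ 3 := by
      intro n
      rw [(hsd n (dir n)).1, (hsd n (dir n)).2,
        (firstOrder_data_fst hp hU (dir n)).1,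
        (firstOrder_data_fst hp hU (dir n)).2]
      field_simp; ring
    simp only [e, sphere_integral_axis hp]
    have := Real.pi_ne_zero
    field_simp; ring
  · filter_upwards [eventually_regular hp hα] with r hr i j n hn
    obtain ⟨a, b, d⟩ := (hr n hn).self_of_nhds
    have C {f} := contDiffAt_comp_invPoint (f := f) (p := p) (α := α1) a
    have hk := contDiffAt_kelvin_coord a
    have hz := contDiffAt_angular hZ a
    have K {c : ℝ} {f g : Fn} (hf : SmoothAt f (r • n)) (hg : SmoothAt g (r • n)) :
      SmoothAt (fun z => c * f z * g z) (r • n) := (contDiffAt_const.mul hf).mul hg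
    have h0 := C (s0 _ b d)
    have hM := fun k l : Fin 3 => (h0.pow 4).mul (contDiffAt_const (c := δ k l))
    have hJ : ∀ i k, SmoothAt (fun z => invJac1 α1 Z z i k) (r • n) := fun i k =>
      (K (contDiffAt_pd hz) (hk k)).add (K hz (contDiffAt_pd (hk k)))
    have hF : SmoothAt (invFactor1 α1 Z p σ) (r • n) := K (h0.pow 3) ((C (s1 _ b d)).add
      (K hz (ContDiffAt.sum fun k _ => (hk k).mul (C (contDiffAt_pd (s0 _ b d))))))
    have hI := contDiffAt_invJac (α := α1) a
    exact (((contDiffAt_pullback hJ hI hM i j).add (contDiffAt_pullback hI hJ hM i j)).add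
      ((contDiffAt_pullback hI hI (fun k l => hF.mul contDiffAt_const) i j).add ((h0.pow 4).mul
        (contDiffAt_pullback hI hI (fun k l => C (s2 _ b d k l)) i j)))).congr_of_eventuallyEq
          ((hr n hn).mono fun ρ hρ => coeff ρ hρ.1 hρ.2.1 hρ.2.2 i j)
  · have hT := tendsto_inverted_radius hα
    have hΨe : ∀ᶠ t in N0, ∀ i j, ∀ n, Dir n →
        sd i j p (p.1 + t ^ (1 : ℤ) • n) = t ^ (0 : ℤ) * Ψ i j (t, n) :=
      eventually_all.2 fun i => eventually_all.2 fun j => (hΨ i j).eq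
    have hdiff : ∀ᶠ t in N0, ∀ n, Dir n → DiffAt (σ 0) (p.1 + t • n) :=
      (eventually_off_ray _ _ hp).mono fun t ht n hn =>
        diffAt (s0 _ (ht n hn).1 (ht n hn).2)
    filter_upwards [hT.eventually hΦ.eq, hT.eventually hU.eq, hT.eventually hΨe,
      hT.eventually (hΦ.radial hdiff), eventually_regular hp hα, eventually_gt_atTop 0]
      with r e0 e1 e2 e3 hr hr0 n hn
    obtain ⟨a, b, d⟩ := (hr n hn).self_of_nhds
    have hk := h1 _ b d
    have tr := sd_trace ⟨hp, b, d⟩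
    have e0 := e0 n hn
    have e1 := e1 n hn
    have e2 := fun i j => e2 i j n hn
    have e3 := e3 n hn
    have hdir : ‖r • n‖⁻¹ • r • n = n := by
      rw [norm_smul, hn, mul_one, Real.norm_of_nonneg hr0.le, smul_smul, inv_mul_cancel₀ hr0.ne',
        one_smul]
    have hB : invJac1 α1 Z (r • n) = fun i k => 2 * α1 * pd i (fun z : E3 => Z (‖z‖⁻¹ • z)) (r • n)
        * (r⁻¹ * n k) + 2 * α1 * Z n * (r ^ 2)⁻¹ * (δ i k - 2 * n i * n k) := by
      funext i k
      rw [invJac1, pd_kelvin hn hr0, kelvin_smul hn hr0, hdir]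
      simp; ring
    have hg : ∑ i, n i * (2 * α1 * pd i (fun z : E3 => Z (‖z‖⁻¹ • z)) (r • n)) = 0 := by
      have := angular_euler hn hr0 (diffAt (contDiffAt_angular hZ a))
      calc _ = 2 * α1 * ∑ i, n i * pd i (fun z : E3 => Z (‖z‖⁻¹ • z)) (r • n) := by
            rw [mul_sum]; exact sum_congr rfl fun i _ => by ring
        _ = 0 := by rw [this, mul_zero]
    have hJ := invJac_smul (α := α1) hn hr0
    obtain ⟨-, ⟨t1, t2⟩, t3, t4⟩ := pullback_inversion
      (P := σ 0 (p.1 + α1 ^ 2 • kelvin (r • n)) ^ 4)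
      (s := fun k l => sd k l p (p.1 + α1 ^ 2 • kelvin (r • n))) (sum_mul_self hn) hg tr hJ hB
    obtain ⟨⟨t5, t6⟩, -⟩ := pullback_inversion (P := invFactor1 α1 Z p σ (r • n))
      (s := 0) (sum_mul_self hn) hg (by simp) hJ hB
    have t7 := (sum_quadratic_swap n _).trans t3
    have hsw := fun i j => pullback_symm_trace (A := invJac α1 (r • n)) (B := invJac1 α1 Z (r • n))
      (M := fun k l => σ 0 (p.1 + α1 ^ 2 • kelvin (r • n)) ^ 4 * δ k l)
      (fun k l => by simp [δ, eq_comm]) i j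
    simp only [zpow_one, zpow_neg, zpow_zero, one_mul] at e0 e1 e2
    have hF : invFactor1 α1 Z p σ (r • n) = 4 * (α1 ^ 2 * r⁻¹)⁻¹ ^ 4 * Φ (α1 ^ 2 * r⁻¹, n) ^ 3 *
        (U (α1 ^ 2 * r⁻¹, n) + 2 * α1⁻¹ * Z n * (-Φ (α1 ^ 2 * r⁻¹, n)
          + α1 ^ 2 * r⁻¹ * dfst Φ (α1 ^ 2 * r⁻¹, n))) := by
      have hgr : ∑ k, kelvin (r • n) k * pd k (σ 0) (p.1 + α1 ^ 2 • kelvin (r • n)) =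
          r⁻¹ * ∑ k, n k * pd k (σ 0) (p.1 + (α1 ^ 2 * r⁻¹) • n) := by
        rw [invPoint_smul hn hr0, kelvin_smul hn hr0, mul_sum]
        exact sum_congr rfl fun k _ => by simp; ring
      rw [invFactor1, hgr, e3, hk, hdir, invPoint_smul hn hr0, e0, e1]
      norm_num [zpow_ofNat]
      field_simp
    simp only [coeff _ a b d, hsw, mul_add, sum_add_distrib, mul_left_comm _ (σ 0 _ ^ 4), ← mul_sum,
      t1, t2, t3, t4, t5, t6, t7]
    simp only [hF, invPoint_smul hn hr0, e0, e2]
    constructor <;> field_simp <;> ring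
  · have e : ∀ n : S2, α1⁻¹ ^ 4 * (Φ (0, n.1) * Φ (0, n.1)
        * (Φ (0, n.1) * Φ (0, n.1))) * (∑ i, ∑ j, Ψ i j (0, n.1) * n.1 i * n.1 j)
        = -1 / 3 / r12 p ^ 2 + -1 / 3 / r12 p ^ 2 * axisCos p n + 1 / r12 p ^ 2 * axisCos p n ^ 2
          + 0 * axisCos p n ^ 3 := by
      intro n
      rw [(hsd n (dir n)).1, (hd n (dir n)).1]
      field_simp; ring
    simp only [e, sphere_integral_axis hp]
    ring
  · have j := FstJet.of_smooth (hΦ.smooth n hn)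
    rw [(hd n hn).1, (hd n hn).2] at j
    have ju := FstJet.of_smooth (hU.smooth n hn)
    have jd := FstJet.id.mul (FstJet.of_smooth (contDiffAt_dfst (hΦ.smooth n hn)))
    have js := FstJet.of_smooth (hΨs n hn)
    have C := @FstJet.const
    refine ⟨_, ((((((C (4 * α1⁻¹ ^ 4)).mul ((j.mul j).mul j)).mul (ju.add
      ((C (2 * α1⁻¹ * Z n)).mul jd))).add ((C (-4 * α1⁻¹ * Z n)).mul ((C (α1⁻¹ ^ 4)).mul
      ((j.mul j).mul (j.mul j))))).add (((C (α1⁻¹ ^ 4)).mul ((j.mul j).mul (j.mul j))).mul js))).of_eq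
      rfl ?_⟩
    simp only [(hd n hn).2, hZe]
    field_simp; ring

end HoleMass

section Masses

variable {α1 α2 c G β : ℝ} {y1 y2 a : E3}

lemma HasSurfaceMass.unique {h : TensorField} {m m' : ℝ} (hm : HasSurfaceMass c G h m)
    (hm' : HasSurfaceMass c G h m') : m = m' := tendsto_nhds_unique hm.2 hm'.2

lemma HasADMMass.unique {N : ℕ} {m m' : ℝ} (hm : HasADMMass c G y1 y2 σ N β m)
    (hm' : HasADMMass c G y1 y2 σ N β m') : m = m' := by
  obtain ⟨μ, h, rfl⟩ := hm
  obtain ⟨μ', h', rfl⟩ := hm'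
  exact sum_congr rfl fun k hk => by
    rw [(h k (Finset.mem_range_succ_iff.1 hk)).unique (h' k (Finset.mem_range_succ_iff.1 hk))]

lemma HasHoleMass.unique {N : ℕ} {m m' : ℝ} (hm : HasHoleMass c G y1 y2 a σ N β m)
    (hm' : HasHoleMass c G y1 y2 a σ N β m') : m = m' := by
  obtain ⟨-, μ, h, rfl⟩ := hm
  obtain ⟨-, μ', h', rfl⟩ := hm'
  exact sum_congr rfl fun k hk => by
    rw [(h k (Finset.mem_range_succ_iff.1 hk)).unique (h' k (Finset.mem_range_succ_iff.1 hk))]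

/-- The mass of the hole of parameter `α` at distance `R` from the hole of parameter `α'`. -/
def holeMass (c G R β α α' : ℝ) : ℝ :=
  2 * c ^ 2 / G * (α * (1 + α' / R + β * (1 / (48 * R ^ 2) - 25 * α' / (48 * R ^ 3))))

lemma hasHoleMass_fst (hp : p.1 ≠ p.2) (hG : G ≠ 0) (hα : 0 < α1)
    (h0 : σ 0 = brillLindquist p.1 p.2 α1 α2)
    (h1 : ∀ x, x ≠ p.1 → x ≠ p.2 → σ 1 x = firstOrder p α1 α2 x)
    (hs : ∀ x, x ≠ p.1 → x ≠ p.2 → ∀ i j, seed y1 y2 x i j = sd i j p x) :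
    HasHoleMass c G y1 y2 p.1 σ 1 β (holeMass c G (r12 p) β α1 α2) := by
  obtain ⟨Φ, hΦ, hd⟩ := exists_ray_brillLindquist_fst hp α1 α2
  obtain ⟨U, hU, -⟩ := exists_ray_firstOrder_fst hp α1 α2
  have t0 : ∀ n, Dir n → Tendsto (fun t : ℝ => t * σ 0 (p.1 + t • n)) N0 (𝓝 α1) := by
    intro n hn
    have := hΦ.tendsto hn
    rw [(hd n hn).1] at this
    simpa [h0] using this
  have t1 : ∀ n, Dir n →
      Tendsto (fun t : ℝ => t * σ 1 (p.1 + t • n)) N0 (𝓝 (U (0, n))) := by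
    intro n hn
    refine (hU.tendsto hn).congr' ?_
    filter_upwards [eventually_off_ray _ _ hp] with t ht
    simp [h1 _ (ht n hn).1 (ht n hn).2]
  have l0 := fun n hn => (t0 n hn).limUnder_eq
  have l1 := fun n hn => (t1 n hn).limUnder_eq
  refine ⟨fun k hk n hn => ?_, fun k => if k = 0 then 2 * c ^ 2 / G * (α1 * (1 + α2 / r12 p)) else
    2 * c ^ 2 / G * (α1 * (1 / (48 * r12 p ^ 2) - 25 * α2 / (48 * r12 p ^ 3))), fun k hk => ?_, ?_⟩
  rotate_left
  · interval_cases k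
    · exact hole_mass_zero hp hG hα h0 l0
    · exact hole_mass_one hp hG hα h0 h1 hs l0 hU l1
  · simp [partialSum, sum_range_succ, holeMass]; ring
  · interval_cases k
    exacts [⟨_, t0 n hn⟩, ⟨_, t1 n hn⟩]

lemma IsPerturbativeSolution.hasHoleMass (hp : p.1 ≠ p.2) (hG : G ≠ 0) (h1 : 0 < α1) (h2 : 0 < α2)
    (h : IsPerturbativeSolution p.1 p.2 α1 α2 2 σ) :
    HasHoleMass c G p.1 p.2 p.1 σ 1 β (holeMass c G (r12 p) β α1 α2) ∧
      HasHoleMass c G p.1 p.2 p.2 σ 1 β (holeMass c G (r12 p) β α2 α1) := by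
  refine ⟨hasHoleMass_fst hp hG h1 h.zero (fun x => sigma_one_eq hp one_le_two h)
    fun x a b => seed_eq ⟨hp, a, b⟩, ?_⟩
  have := hasHoleMass_fst (c := c) (G := G) (β := β) (p := p.swap) (y1 := p.1) (y2 := p.2) (σ := σ)
    (α1 := α2) (α2 := α1) hp.symm hG h2
    (by rw [h.zero]; funext x; simp only [brillLindquist, Prod.fst_swap, Prod.snd_swap]; ring)
    (fun x a b => by rw [firstOrder_swap, sigma_one_eq hp one_le_two h b a])
    fun x a b i j => by rw [sd_swap, seed_eq ⟨hp, b, a⟩]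
  rwa [show r12 p.swap = r12 p from dist_comm _ _] at this

lemma IsPerturbativeSolution.hasADMMass (hp : p.1 ≠ p.2) (hG : G ≠ 0)
    (h : IsPerturbativeSolution p.1 p.2 α1 α2 2 σ) {L : ℝ}
    (hL : Tendsto (flux (residualField p (σ 2)) 0) atTop (𝓝 L)) :
    HasADMMass c G p.1 p.2 σ 2 β (2 * c ^ 2 / G * ((α1 + α2) * (1 + β / (48 * r12 p ^ 2)))
      - β ^ 2 * (c ^ 2 / (2 * π * G)) * (L - π / (64 * r12 p ^ 3))) := by
  refine ⟨fun k => if k = 0 then 2 * c ^ 2 / G * (α1 + α2) else if k = 1 then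
    2 * c ^ 2 / G * ((α1 + α2) / (48 * r12 p ^ 2)) else
    -(c ^ 2 / (2 * π * G)) * (L - π / (64 * r12 p ^ 3)), fun k hk => ?_, ?_⟩
  · interval_cases k
    · exact adm_mass_zero hp hG h.zero
    · exact adm_mass_one hp hG h.zero fun x => sigma_one_eq hp one_le_two h
    · exact adm_mass_two hp hG h hL
  · simp [partialSum, sum_range_succ]; ring

end Masses

lemma HasFinitePartAt.eq_of_inv_sq {K1 K2 : ℝ} {a b v : E3} (hab : a ≠ b)
    (h : HasFinitePartAt (fun x => (K1 / dist x a ^ 2) • (x - a) + (K2 / dist x b ^ 2) • (x - b)) a v) :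
    v = (K2 / dist a b ^ 2) • (a - b) := by
  ext i
  refine (h i).eq_of_tendsto ?_
  set F : RFn := fun q => K2 / dist (a + q.1 • q.2) b ^ 2 * (a + q.1 • q.2 - b) i
  have hF : ∀ t, ∀ n, a + t • n ≠ b → SmoothAt F (t, n) := fun t n hn => by
    have h0 : Smooth fun q : ℝ × E3 => a + q.1 • q.2 - b := by fun_prop
    have h1 : SmoothAt (fun q => dist (a + q.1 • q.2) b ^ 2) (t, n) := by
      simp only [dist_eq_norm]; exact h0.contDiffAt.norm_sq ℝ
    exact (contDiffAt_const.div h1 (pow_ne_zero 2 (dist_ne_zero.2 hn))).mul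
      ((contDiff_coord i).comp h0).contDiffAt
  have key := (tendsto_sphere_integral fun n _ => hF 0 n (by simpa using hab)).const_mul
    (1 / (4 * π))
  have e0 : 1 / (4 * π) * ∫ n, F (0, n.1) ∂sph = ((K2 / dist a b ^ 2) • (a - b)) i := by
    simp only [F, zero_smul, add_zero, sphere_integral_const]
    have := Real.pi_ne_zero
    simp; field_simp
  rw [e0] at key
  refine key.congr' ?_
  filter_upwards [eventually_off_ray a b hab, self_mem_nhdsWithin] with t ht ht0
  have ht0 : 0 < t := ht0
  have e1 : ∫ n, K1 / t * n.1 i ∂sph = 0 :=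
    sphere_integral_odd (fun n => K1 / t * n i) fun n => by simp
  have c1 : Continuous fun n : S2 => K1 / t * n.1 i := by fun_prop
  have c2 : Continuous fun n : S2 => F (t, n) := continuous_iff_continuousAt.2 fun n =>
    ContinuousAt.comp (g := F) (f := fun n : S2 => (t, n.1))
      (hF t n (ht n (dir n)).2).continuousAt (by fun_prop)
  have := sphere_integral_add c1 c2
  rw [e1, zero_add] at this
  rw [← this]
  congr 1
  refine integral_congr_ae (.of_forall fun n => ?_)
  have hd : dist (a + t • n.1) a = t := by simp [norm_smul, abs_of_pos ht0]
  simp only [F, PiLp.add_apply, PiLp.smul_apply, smul_eq_mul, hd, add_sub_cancel_left]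
  field_simp

section Asymptotic

/-- `f` agrees with `P (c⁻²)` up to `O (c⁻²ᵏ)` as `c → ∞`. -/
def ExpandsUpTo (k : ℕ) (f P : ℝ → ℝ) : Prop :=
  Continuous P ∧ (fun c => f c - P (c ^ 2)⁻¹) =O[atTop] fun c : ℝ => (c ^ 2)⁻¹ ^ k

namespace ExpandsUpTo

variable {k l : ℕ} {f g P Q S : ℝ → ℝ}

lemma tendsto_inv_sq : Tendsto (fun c : ℝ => (c ^ 2)⁻¹) atTop (𝓝 0) :=
  tendsto_inv_atTop_zero.comp (tendsto_pow_atTop two_ne_zero)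

lemma isBigO_one (h : Continuous P) : (fun c : ℝ => P (c ^ 2)⁻¹) =O[atTop] fun _ => (1 : ℝ) :=
  ((h.tendsto 0).comp tendsto_inv_sq).isBigO_one ℝ

lemma isBigO_pow (h : l ≤ k) :
    (fun c : ℝ => (c ^ 2)⁻¹ ^ k) =O[atTop] fun c : ℝ => (c ^ 2)⁻¹ ^ l := by
  obtain ⟨j, rfl⟩ := Nat.exists_eq_add_of_le h
  simpa [pow_add] using (isBigO_refl (fun c : ℝ => (c ^ 2)⁻¹ ^ l) atTop).mul
    (isBigO_one (continuous_pow j))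

lemma const (k : ℕ) (a : ℝ) : ExpandsUpTo k (fun _ => a) fun _ => a :=
  ⟨continuous_const, by simpa using isBigO_zero _ _⟩

lemma mono (h : ExpandsUpTo k f P) (hl : l ≤ k) : ExpandsUpTo l f P :=
  ⟨h.1, h.2.trans (isBigO_pow hl)⟩

lemma add (h : ExpandsUpTo k f P) (h' : ExpandsUpTo k g Q) :
    ExpandsUpTo k (fun c => f c + g c) fun t => P t + Q t :=
  ⟨h.1.add h'.1, (h.2.add h'.2).congr_left fun c => by ring⟩

lemma bounded (h : ExpandsUpTo k f P) : f =O[atTop] fun _ => (1 : ℝ) := by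
  have := (h.mono (Nat.zero_le k)).2
  simp only [pow_zero] at this
  exact (this.add (isBigO_one h.1)).congr_left fun c => by ring

lemma mul (h : ExpandsUpTo k f P) (h' : ExpandsUpTo k g Q) :
    ExpandsUpTo k (fun c => f c * g c) fun t => P t * Q t := by
  refine ⟨h.1.mul h'.1, ?_⟩
  have h1 := h.2.mul h'.bounded
  have h2 := (isBigO_one h.1).mul h'.2
  simp only [mul_one, one_mul] at h1 h2
  exact (h1.add h2).congr_left fun c => by ring

lemma const_mul (a : ℝ) (h : ExpandsUpTo k f P) : ExpandsUpTo k (fun c => a * f c) fun t => a * P t :=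
  (const k a).mul h

lemma shift (h : ExpandsUpTo k f P) :
    ExpandsUpTo (k + 1) (fun c => (c ^ 2)⁻¹ * f c) fun t => t * P t := by
  refine ⟨continuous_id.mul h.1, ?_⟩
  have := (isBigO_refl (fun c => (c ^ 2)⁻¹) atTop).mul h.2
  exact this.congr (fun c => by ring) fun c => by ring

lemma congr (h : ExpandsUpTo k f P) (hg : ∀ᶠ c in atTop, g c = f c) : ExpandsUpTo k g P :=
  ⟨h.1, h.2.congr' (hg.mono fun c hc => by simp only [hc]) EventuallyEq.rfl⟩

lemma bounded_mul (hf : f =O[atTop] fun _ => (1 : ℝ)) (h : ExpandsUpTo k g fun _ => 0) :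
    ExpandsUpTo k (fun c => f c * g c) fun _ => 0 :=
  ⟨continuous_const, by simpa using hf.mul h.2⟩

lemma truncate (h : ExpandsUpTo k f P) (hQ : Continuous Q) (hS : Continuous S)
    (e : ∀ t, P t = Q t + t ^ k * S t) : ExpandsUpTo k f Q := by
  refine ⟨hQ, ?_⟩
  have h2 := (isBigO_refl (fun c => (c ^ 2)⁻¹ ^ k) atTop).mul (isBigO_one hS)
  simp only [mul_one] at h2
  exact (h.2.add h2).congr_left fun c => by rw [e]; ring

end ExpandsUpTo

end Asymptotic

section Energy

variable {G m m' m1 m2 R : ℝ} {r α α' α1 α2 L M : ℝ → ℝ}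

lemma expandsUpTo_inv_separation (hR : 0 < R) (hr0 : Tendsto r atTop (𝓝 R)) {κ : ℝ}
    (hr : (fun c => r c + κ / c ^ 4 / r c - R) =O[atTop] fun c : ℝ => (c ^ 6)⁻¹) :
    ExpandsUpTo 3 (fun c => (r c)⁻¹) fun t => R⁻¹ + κ * R⁻¹ ^ 3 * t ^ 2 := by
  have b : (fun c => (r c)⁻¹) =O[atTop] fun _ => (1 : ℝ) := (hr0.inv₀ hR.ne').isBigO_one ℝ
  have b0 : ExpandsUpTo 0 (fun c => (r c)⁻¹) fun _ => 0 := ⟨continuous_const, by simpa using b⟩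
  have d : ExpandsUpTo 3 (fun c => r c + κ / c ^ 4 / r c - R) fun _ => 0 :=
    ⟨continuous_const, by simpa using hr.congr_right fun c => by ring⟩
  have step : ∀ {k P}, k ≤ 1 → ExpandsUpTo k (fun c => (r c)⁻¹) P → ExpandsUpTo (k + 2)
      (fun c => (r c)⁻¹) fun t => R⁻¹ + (κ * R⁻¹ * (t * (t * (P t * P t))) + -R⁻¹ * 0) :=
    fun hk h => ((ExpandsUpTo.const _ R⁻¹).add (((h.mul h).shift.shift.const_mul (κ * R⁻¹)).add
      (((ExpandsUpTo.bounded_mul b d).mono (by lia)).const_mul (-R⁻¹)))).congr <| by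
        filter_upwards [hr0.eventually_const_lt hR, eventually_gt_atTop 0] with c hc hc0
        field_simp
        ring
  have h1 := (step zero_le_one b0).mono (show 1 ≤ 2 by norm_num)
  refine (step le_rfl h1).truncate (S := fun _ => 0) (by fun_prop) (by fun_prop) fun t => ?_
  ring

lemma isBigO_mass_parameter (hG : 0 < G) (hm : 0 < m) (hm' : 0 < m') (hR : 0 < R)
    (hr0 : Tendsto r atTop (𝓝 R)) (hα : ∀ᶠ c in atTop, 0 < α c ∧ 0 < α' c)
    (h : ∀ᶠ c in atTop, m = holeMass c G (r c) (betaParam G m m' c) (α c) (α' c)) :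
    (fun c => c ^ 2 * α c) =O[atTop] fun _ => (1 : ℝ) := by
  have ht : Tendsto (fun c => betaParam G m m' c * (1 / (48 * r c ^ 2))) atTop (𝓝 0) := by
    have h1 : Tendsto (fun c : ℝ => betaParam G m m' c) atTop (𝓝 0) :=
      tendsto_const_nhds.div_atTop (tendsto_pow_atTop four_ne_zero)
    have h2 : Tendsto (fun c => 1 / (48 * r c ^ 2)) atTop (𝓝 (1 / (48 * R ^ 2))) :=
      tendsto_const_nhds.div ((hr0.pow 2).const_mul 48) (by positivity)
    simpa using h1.mul h2
  refine .of_bound (G * m) ?_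
  filter_upwards [hα, h, ht.eventually_const_lt (show -(1 / 2 : ℝ) < 0 by norm_num),
    hr0.eventually_const_lt hR, eventually_gt_atTop 0] with c ⟨a, a'⟩ e hb hr hc
  have hβ : betaParam G m m' c ≤ 0 :=
    div_nonpos_of_nonpos_of_nonneg (neg_nonpos.2 (by positivity)) (by positivity)
  have h3 : 0 ≤ α' c / r c := by positivity
  have h4 : 0 ≤ -betaParam G m m' c * (25 * α' c / (48 * r c ^ 3)) :=
    mul_nonneg (neg_nonneg.2 hβ) (by positivity)
  have h5 : 1 / 2 ≤ 1 + α' c / r c + betaParam G m m' c *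
      (1 / (48 * r c ^ 2) - 25 * α' c / (48 * r c ^ 3)) := by linarith
  have h6 : 0 < c ^ 2 * α c := by positivity
  have h7 : G * m = 2 * (c ^ 2 * α c * (1 + α' c / r c + betaParam G m m' c *
      (1 / (48 * r c ^ 2) - 25 * α' c / (48 * r c ^ 3)))) := by
    conv_lhs => rw [e]
    rw [holeMass]; field_simp
  rw [Real.norm_of_nonneg h6.le, norm_one, mul_one, h7]
  nlinarith [mul_le_mul_of_nonneg_left h5 h6.le]

lemma ExpandsUpTo.mass_parameter_step {k l : ℕ} {A A' P B B' Q : ℝ → ℝ} (hG : 0 < G)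
    (hr : ∀ᶠ c in atTop, 0 < r c)
    (h : ∀ᶠ c in atTop, m = holeMass c G (r c) (betaParam G m m' c) (α c) (α' c)) (hl : k ≤ l + 1)
    (hA : ExpandsUpTo k (fun c => c ^ 2 * α c) A) (hA' : ExpandsUpTo k (fun c => c ^ 2 * α' c) A')
    (hP : ExpandsUpTo k (fun c => (r c)⁻¹) P) (hB : ExpandsUpTo l (fun c => c ^ 2 * α c) B)
    (hB' : ExpandsUpTo l (fun c => c ^ 2 * α' c) B') (hQ : ExpandsUpTo l (fun c => (r c)⁻¹) Q) :
    ExpandsUpTo (k + 1) (fun c => c ^ 2 * α c) fun t => G * m / 2 + (-1 * (t * (A t * A' t * P t))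
      + G ^ 2 * m * m' / 6 * (t * (t * (B t * (Q t * Q t)
        + -25 * (t * (B t * B' t * (Q t * Q t * Q t))))))) := by
  refine ((const _ (G * m / 2)).add ((((hA.mul hA').mul hP).shift.const_mul (-1)).add
    (((((hB.mul (hQ.mul hQ)).add ((((hB.mul hB').mul ((hQ.mul hQ).mul hQ)).shift.mono
      l.le_succ).const_mul (-25))).shift.shift).mono (by lia)).const_mul
        (G ^ 2 * m * m' / 6)))).congr ?_
  filter_upwards [h, hr, eventually_gt_atTop 0] with c hc hr hc0
  have : G * m / 2 = c ^ 2 * α c * (1 + α' c / r c + betaParam G m m' c *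
      (1 / (48 * r c ^ 2) - 25 * α' c / (48 * r c ^ 3))) := by
    conv_lhs => rw [hc]
    rw [holeMass]; field_simp
  rw [this, betaParam]
  field_simp
  ring

lemma expandsUpTo_mass_parameter (hG : 0 < G) (hm : 0 < m) (hm' : 0 < m') (hR : 0 < R)
    (hr0 : Tendsto r atTop (𝓝 R)) (hα : ∀ᶠ c in atTop, 0 < α c ∧ 0 < α' c)
    (e : ∀ᶠ c in atTop, m = holeMass c G (r c) (betaParam G m m' c) (α c) (α' c))
    (e' : ∀ᶠ c in atTop, m' = holeMass c G (r c) (betaParam G m' m c) (α' c) (α c))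
    {κ : ℝ} (hρ : ExpandsUpTo 3 (fun c => (r c)⁻¹) fun t => R⁻¹ + κ * t ^ 2) :
    ExpandsUpTo 3 (fun c => c ^ 2 * α c) fun t => G * m / 2 - t * (G ^ 2 * m * m' / 4 * R⁻¹)
      + t ^ 2 * (G ^ 3 * m * m' * (m + m') / 8 * R⁻¹ ^ 2 + G ^ 3 * m ^ 2 * m' / 12 * R⁻¹ ^ 2) := by
  have hr := hr0.eventually_const_lt hR
  have z : ∀ {f : ℝ → ℝ}, f =O[atTop] (fun _ => (1 : ℝ)) → ExpandsUpTo 0 f fun _ => 0 :=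
    fun hf => ⟨continuous_const, by simpa using hf⟩
  have b := z (isBigO_mass_parameter hG hm hm' hR hr0 hα e)
  have b' := z (isBigO_mass_parameter hG hm' hm hR hr0 (hα.mono fun _ h => h.symm) e')
  have b3 := z hρ.bounded
  have ρ2 : ExpandsUpTo 2 (fun c => (r c)⁻¹) fun _ => R⁻¹ :=
    (hρ.mono (by norm_num)).truncate (S := fun _ => κ) (by fun_prop) (by fun_prop) fun t => by ring
  have ρ1 := ρ2.mono one_le_two
  have c1 : ExpandsUpTo 1 (fun c => c ^ 2 * α c) fun _ => G * m / 2 :=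
    (ExpandsUpTo.mass_parameter_step hG hr e zero_le_one b b' b3 b b' b3).truncate (S := fun _ => 0)
      (by fun_prop) (by fun_prop) fun t => by ring
  have c1' : ExpandsUpTo 1 (fun c => c ^ 2 * α' c) fun _ => G * m' / 2 :=
    (ExpandsUpTo.mass_parameter_step hG hr e' zero_le_one b' b b3 b' b b3).truncate (S := fun _ => 0)
      (by fun_prop) (by fun_prop) fun t => by ring
  have c2 := ExpandsUpTo.mass_parameter_step hG hr e le_rfl c1 c1' ρ1 b b' b3
  have c2' := ExpandsUpTo.mass_parameter_step hG hr e' le_rfl c1' c1 ρ1 b' b b3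
  refine (ExpandsUpTo.mass_parameter_step hG hr e le_rfl c2 c2' ρ2 c1 c1' ρ1).truncate
    (S := fun t => -(G ^ 2 * m * m' / 4 * R⁻¹) ^ 2 * R⁻¹
      - 25 * (G ^ 2 * m * m' / 6) * (G * m / 2 * (G * m' / 2)) * R⁻¹ ^ 3)
    (by fun_prop) (by fun_prop) fun t => by ring

lemma isBigO_energy (hG : 0 < G) (h1 : 0 < m1) (h2 : 0 < m2) (hR : 0 < R)
    (hr0 : Tendsto r atTop (𝓝 R))
    (hr : (fun c => r c + G ^ 2 * (m1 ^ 2 + m2 ^ 2) / 4 / c ^ 4 / r c - R) =O[atTop]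
      fun c : ℝ => (c ^ 6)⁻¹)
    (hα : ∀ᶠ c in atTop, 0 < α1 c ∧ 0 < α2 c)
    (e1 : ∀ᶠ c in atTop, m1 = holeMass c G (r c) (betaParam G m1 m2 c) (α1 c) (α2 c))
    (e2 : ∀ᶠ c in atTop, m2 = holeMass c G (r c) (betaParam G m1 m2 c) (α2 c) (α1 c))
    {C : ℝ} (hL : ∀ᶠ c in atTop, |L c| ≤ C * (α1 c + α2 c))
    (hM : ∀ᶠ c in atTop, M c = 2 * c ^ 2 / G * ((α1 c + α2 c)
      * (1 + betaParam G m1 m2 c / (48 * r c ^ 2)))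
      - betaParam G m1 m2 c ^ 2 * (c ^ 2 / (2 * π * G)) * (L c - π / (64 * r c ^ 3))) :
    (fun c => c ^ 2 * (M c - m1 - m2) - energy2PN G m1 m2 R c) =O[atTop] fun c : ℝ => (c ^ 6)⁻¹ := by
  have e2' : ∀ᶠ c in atTop, m2 = holeMass c G (r c) (betaParam G m2 m1 c) (α2 c) (α1 c) := by
    filter_upwards [e2] with c hc
    rwa [betaParam, mul_right_comm, ← betaParam]
  have ρ := expandsUpTo_inv_separation hR hr0 hr
  have A := expandsUpTo_mass_parameter hG h1 h2 hR hr0 hα e1 e2' ρ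
  have B := expandsUpTo_mass_parameter hG h2 h1 hR hr0 (hα.mono fun _ h => h.symm) e2' e1 ρ
  have hL0 : ExpandsUpTo 1 L fun _ => 0 := by
    have h := (ExpandsUpTo.bounded_mul ((A.add B).const_mul C).bounded
      (ExpandsUpTo.const 0 (1 : ℝ) |>.truncate (Q := fun _ => 0) (S := fun _ => 1) (by fun_prop)
        (by fun_prop) fun t => by simp)).shift
    refine ⟨continuous_const, IsBigO.trans (.of_bound 1 ?_) h.2⟩
    filter_upwards [hL, eventually_gt_atTop 0] with c hc h0
    rw [sub_zero, one_mul, Real.norm_eq_abs]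
    refine hc.trans (le_of_eq_of_le ?_ (le_abs_self _))
    field_simp
    ring
  have A1 : ExpandsUpTo 1 (fun c => c ^ 2 * α1 c) fun _ => G * m1 / 2 :=
    (A.mono (by norm_num)).truncate (S := fun t => -(G ^ 2 * m1 * m2 / 4 * R⁻¹)
      + t * (G ^ 3 * m1 * m2 * (m1 + m2) / 8 * R⁻¹ ^ 2 + G ^ 3 * m1 ^ 2 * m2 / 12 * R⁻¹ ^ 2))
      (by fun_prop) (by fun_prop) fun t => by ring
  have B1 : ExpandsUpTo 1 (fun c => c ^ 2 * α2 c) fun _ => G * m2 / 2 :=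
    (B.mono (by norm_num)).truncate (S := fun t => -(G ^ 2 * m2 * m1 / 4 * R⁻¹)
      + t * (G ^ 3 * m2 * m1 * (m2 + m1) / 8 * R⁻¹ ^ 2 + G ^ 3 * m2 ^ 2 * m1 / 12 * R⁻¹ ^ 2))
      (by fun_prop) (by fun_prop) fun t => by ring
  have ρ1 : ExpandsUpTo 1 (fun c => (r c)⁻¹) fun _ => R⁻¹ := (ρ.mono (by norm_num)).truncate
    (S := fun t => G ^ 2 * (m1 ^ 2 + m2 ^ 2) / 4 * R⁻¹ ^ 3 * t) (by fun_prop) (by fun_prop)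
    fun t => by ring
  have ρ3 := (ρ1.mul ρ1).mul ρ1
  have AB := (A.mul B).truncate
    (Q := fun t => G ^ 2 * m1 * m2 / 4 - t * (G ^ 3 * m1 * m2 * (m1 + m2) / 8 * R⁻¹)
      + t ^ 2 * (G ^ 4 * m1 * m2 * ((m1 ^ 2 + m2 ^ 2) / 16 + 13 * m1 * m2 / 48) * R⁻¹ ^ 2))
    (S := fun t => -(G ^ 2 * m1 * m2 / 4 * R⁻¹)
      * (G ^ 3 * m1 * m2 * (m1 + m2) / 3 * R⁻¹ ^ 2)
      + t * ((G ^ 3 * m1 * m2 * (m1 + m2) / 8 * R⁻¹ ^ 2 + G ^ 3 * m1 ^ 2 * m2 / 12 * R⁻¹ ^ 2)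
      * (G ^ 3 * m2 * m1 * (m2 + m1) / 8 * R⁻¹ ^ 2 + G ^ 3 * m2 ^ 2 * m1 / 12 * R⁻¹ ^ 2)))
    (by fun_prop) (by fun_prop) fun t => by ring
  have ABρ := (AB.mul ρ).truncate
    (Q := fun t => G ^ 2 * m1 * m2 / 4 * R⁻¹ - t * (G ^ 3 * m1 * m2 * (m1 + m2) / 8 * R⁻¹ ^ 2)
      + t ^ 2 * (G ^ 4 * m1 * m2 * ((m1 ^ 2 + m2 ^ 2) / 8 + 13 * m1 * m2 / 48) * R⁻¹ ^ 3))
    (S := fun t => (-(G ^ 3 * m1 * m2 * (m1 + m2) / 8 * R⁻¹)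
      + t * (G ^ 4 * m1 * m2 * ((m1 ^ 2 + m2 ^ 2) / 16 + 13 * m1 * m2 / 48) * R⁻¹ ^ 2))
      * (G ^ 2 * (m1 ^ 2 + m2 ^ 2) / 4 * R⁻¹ ^ 3))
    (by fun_prop) (by fun_prop) fun t => by ring
  have key := ((ABρ.const_mul (-4 / G)).add
    ((((A1.mul B1).mul ρ3).shift.shift).const_mul (-(50 / 3) * G * m1 * m2))).add
    ((ρ3.shift.shift.const_mul (G ^ 3 * m1 ^ 2 * m2 ^ 2 / 2)).add
      (hL0.shift.shift.const_mul (-(32 * G ^ 3 * m1 ^ 2 * m2 ^ 2 / π))))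
  refine key.2.congr' ?_ (.of_forall fun c => by ring)
  filter_upwards [e1, e2, hM, hr0.eventually_const_lt hR, eventually_gt_atTop 0]
    with c e1 e2 hM hr hc
  have hE : c ^ 2 * (M c - m1 - m2) = c ^ 2 * (M c - holeMass c G (r c) (betaParam G m1 m2 c) (α1 c)
    (α2 c) - holeMass c G (r c) (betaParam G m1 m2 c) (α2 c) (α1 c)) := by rw [← e1, ← e2]
  have := Real.pi_ne_zero
  rw [hE, hM, energy2PN, holeMass, holeMass, betaParam]
  field_simp
  ring

end Energy

end Geometrostatics

end

theorem theorem3 (G : ℝ) (hG : 0 < G) :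
    -- the masses are finite, at the orders in `β` that are needed
    (∀ (c β α₁ α₂ : ℝ) (y₁ y₂ : Geometrostatics.E3) (σ : ℕ → Geometrostatics.E3 → ℝ),
      0 < c → 0 < α₁ → 0 < α₂ → y₁ ≠ y₂ →
      Geometrostatics.IsPerturbativeSolution y₁ y₂ α₁ α₂ 2 σ →
      (∃ M, Geometrostatics.HasADMMass c G y₁ y₂ σ 2 β M) ∧
      (∃ m, Geometrostatics.HasHoleMass c G y₁ y₂ y₁ σ 1 β m) ∧
      (∃ m, Geometrostatics.HasHoleMass c G y₁ y₂ y₂ σ 1 β m)) ∧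
    -- the energy, as `c → ∞` with fixed masses and fixed positions in harmonic coordinates
    (∀ (m₁ m₂ : ℝ) (Y₁ Y₂ : Geometrostatics.E3) (y₁ y₂ ξ₁ ξ₂ : ℝ → Geometrostatics.E3)
      (α₁ α₂ M : ℝ → ℝ) (σ : ℝ → ℕ → Geometrostatics.E3 → ℝ),
      0 < m₁ → 0 < m₂ → Y₁ ≠ Y₂ →
      -- the coordinate change from the present to the harmonic coordinates
      Tendsto y₁ atTop (𝓝 Y₁) → Tendsto y₂ atTop (𝓝 Y₂) →
      (∀ᶠ c in atTop, Geometrostatics.HasFinitePartAt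
        (Geometrostatics.gaugeVector G m₁ m₂ c (y₁ c) (y₂ c)) (y₁ c) (ξ₁ c)) →
      (∀ᶠ c in atTop, Geometrostatics.HasFinitePartAt
        (Geometrostatics.gaugeVector G m₁ m₂ c (y₁ c) (y₂ c)) (y₂ c) (ξ₂ c)) →
      (fun c => y₁ c + ξ₁ c - Y₁) =O[atTop] (fun c : ℝ => (c ^ 6)⁻¹) →
      (fun c => y₂ c + ξ₂ c - Y₂) =O[atTop] (fun c : ℝ => (c ^ 6)⁻¹) →
      -- the solution of the constraint equation
      (∀ᶠ c in atTop, 0 < α₁ c ∧ 0 < α₂ c) →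
      (∀ᶠ c in atTop,
        Geometrostatics.IsPerturbativeSolution (y₁ c) (y₂ c) (α₁ c) (α₂ c) 2 (σ c)) →
      -- its masses
      (∀ᶠ c in atTop, Geometrostatics.HasADMMass c G (y₁ c) (y₂ c) (σ c) 2
        (Geometrostatics.betaParam G m₁ m₂ c) (M c)) →
      (∀ᶠ c in atTop, Geometrostatics.HasHoleMass c G (y₁ c) (y₂ c) (y₁ c) (σ c) 1
        (Geometrostatics.betaParam G m₁ m₂ c) m₁) →
      (∀ᶠ c in atTop, Geometrostatics.HasHoleMass c G (y₁ c) (y₂ c) (y₂ c) (σ c) 1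
        (Geometrostatics.betaParam G m₁ m₂ c) m₂) →
      (fun c => c ^ 2 * (M c - m₁ - m₂) - Geometrostatics.energy2PN G m₁ m₂ (dist Y₁ Y₂) c)
        =O[atTop] (fun c : ℝ => (c ^ 6)⁻¹)) := by
  refine ⟨fun c β α1 α2 y1 y2 σ _ h1 h2 hy h => ?_, ?_⟩
  · obtain ⟨L, hL⟩ := Geometrostatics.exists_flux_residualField (p := (y1, y2)) hy h
    exact ⟨⟨_, h.hasADMMass (p := (y1, y2)) hy hG.ne' hL⟩,
      ⟨_, (h.hasHoleMass (p := (y1, y2)) hy hG.ne' h1 h2).1⟩,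
      ⟨_, (h.hasHoleMass (p := (y1, y2)) hy hG.ne' h1 h2).2⟩⟩
  · intro m1 m2 Y1 Y2 y1 y2 ξ1 ξ2 α1 α2 M σ hm1 hm2 hY t1 t2 g1 g2 o1 o2 hα h hM hh1 hh2
    have hR : 0 < dist Y1 Y2 := dist_pos.2 hY
    have hr0 : Tendsto (fun c => dist (y1 c) (y2 c)) atTop (𝓝 (dist Y1 Y2)) := t1.dist t2
    have hne : ∀ᶠ c in atTop, y1 c ≠ y2 c :=
      (hr0.eventually_const_lt hR).mono fun c hc => dist_pos.1 hc
    obtain ⟨δ, hδ, hδY⟩ : ∃ δ > 0, ∀ p ∈ closedBall (Y1, Y2) δ, p.1 ≠ p.2 := by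
      have : {p : Geometrostatics.E3 × Geometrostatics.E3 | p.1 ≠ p.2} ∈ 𝓝 (Y1, Y2) :=
        (isOpen_ne_fun continuous_fst continuous_snd).mem_nhds hY
      exact Metric.nhds_basis_closedBall.mem_iff.1 this
    obtain ⟨C, hC⟩ := Geometrostatics.exists_residual_bound
      (isCompact_closedBall (Y1, Y2) δ) hδY
    have hnear : ∀ᶠ c in atTop, (y1 c, y2 c) ∈ closedBall (Y1, Y2) δ :=
      (t1.prodMk_nhds t2).eventually (closedBall_mem_nhds _ hδ)
    have hex : ∀ᶠ c in atTop, ∃ L, Tendsto (Geometrostatics.flux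
        (Geometrostatics.residualField (y1 c, y2 c) (σ c 2)) 0) atTop (𝓝 L) := by
      filter_upwards [hne, h] with c hc h
      exact Geometrostatics.exists_flux_residualField (p := (y1 c, y2 c)) hc h
    have hL : ∀ᶠ c in atTop, Tendsto (Geometrostatics.flux (Geometrostatics.residualField
        (y1 c, y2 c) (σ c 2)) 0) atTop (𝓝 (limUnder atTop (Geometrostatics.flux
        (Geometrostatics.residualField (y1 c, y2 c) (σ c 2)) 0))) :=
      hex.mono fun c hc => tendsto_nhds_limUnder hc
    refine Geometrostatics.isBigO_energy (r := fun c => dist (y1 c) (y2 c)) (α1 := α1) (α2 := α2)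
      (C := C) (L := fun c => limUnder atTop (Geometrostatics.flux
        (Geometrostatics.residualField (y1 c, y2 c) (σ c 2)) 0))
      hG hm1 hm2 hR hr0 ?_ hα ?_ ?_ ?_ ?_
    · refine IsBigO.trans (.of_bound 1 ?_) (o1.sub o2)
      filter_upwards [hne, g1, g2, eventually_gt_atTop 0] with c hc g1 g2 hc0
      have hr := dist_pos.2 hc
      have x1 := Geometrostatics.HasFinitePartAt.eq_of_inv_sq hc g1
      have x2 := Geometrostatics.HasFinitePartAt.eq_of_inv_sq (K1 := G ^ 2 * m2 ^ 2 / (4 * c ^ 4))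
        (K2 := G ^ 2 * m1 ^ 2 / (4 * c ^ 4)) hc.symm ((funext fun x => add_comm _ _ :
        Geometrostatics.gaugeVector G m1 m2 c (y1 c) (y2 c) = _) ▸ g2)
      have e : y1 c + ξ1 c - Y1 - (y2 c + ξ2 c - Y2) = (1 + G ^ 2 * (m1 ^ 2 + m2 ^ 2) / 4 / c ^ 4
          / dist (y1 c) (y2 c) ^ 2) • (y1 c - y2 c) - (Y1 - Y2) := by
        rw [x1, x2, dist_comm (y2 c)]
        module
      rw [e, one_mul, Real.norm_eq_abs]
      refine le_trans (le_of_eq ?_) (abs_norm_sub_norm_le _ _)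
      rw [norm_smul, Real.norm_of_nonneg (by positivity), ← dist_eq_norm, ← dist_eq_norm]
      congr 1
      field_simp
    · filter_upwards [hne, h, hα, hh1] with c hc h hα hm
      exact hm.unique (h.hasHoleMass (p := (y1 c, y2 c)) hc hG.ne' hα.1 hα.2).1
    · filter_upwards [hne, h, hα, hh2] with c hc h hα hm
      exact hm.unique (h.hasHoleMass (p := (y1 c, y2 c)) hc hG.ne' hα.1 hα.2).2
    · filter_upwards [h, hα, hnear, hL] with c h hα hn hL
      exact hC _ hn _ _ _ _ hα.1.le hα.2.le h hL
    · filter_upwards [hne, h, hM, hL] with c hc h hM hL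
      exact hM.unique (h.hasADMMass (p := (y1 c, y2 c)) hc hG.ne' hL)
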